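/- Let $(M_0,g_0)$ be a connected (Hausdorff, second countable, smooth) pseudo-Riemannian manifold of signature $(k,l)$, let $\Delta$ be a finite-dimensional real module of the Clifford algebra of signature $(k,l)$ with $v^2=-\langle v,v\rangle$ (in particular the spinor module), and let $Spin$ be the connected group generated by the exponentials of ${\mathfrak{spin}}(k,l)$ acting on $\mathbb{R}^{k,l}\oplus\Delta$. Let $M_0$ carry a $Spin$-structure with spinor bundle $S$ (fibre $\Delta$), Clifford multiplication $\rho$, and the connection $\nabla$ on $S$ induced by the Levi-Civita connection. Let $g_1$ be a smooth non-degenerate parallel bilinear form on $S$ which is suitable: $g_1$ is symmetric or skew-symmetric ($\sigma=\pm1$), Clifford multiplication by tangent vectors is $g_1$-symmetric or $g_1$-skew ($\tau=\pm1$), and $\sigma\tau=1$. Let $M=M(S)=(M_0,\mathcal{A})$, $\mathcal{A}(U)=\Gamma(U,\wedge S)$, be the associated supermanifold, whose vector fields are the sums of even and odd superderivations of $\mathcal{A}$. For a section $\theta$ of $S^*$ let $\iota(\theta)$ be interior multiplication; for a covector field $\xi$ let $\iota(\xi)=\nabla_X$ on $\wedge S$, where $\xi=g_0(X,\cdot)$.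 For $V_p=T_pM_0+S_p$ let $\mathfrak{p}(V_p)=\mathfrak{spin}(T_pM_0)+T_pM_0+S_p$ be the Poincaré super Lie algebra with $[T_pM_0,V_p]=0$ and, for $s,t\in S_p$, $[s,t]=\pi(s,t)\in T_pM_0$, where $g_0(\pi(s,t),v)=g_1(\rho(v)s,t)$. Let $\alpha:\mathfrak{p}(V_p)\to\mathfrak{gl}(V_p^*)$ be induced by the coadjoint representation, and let $\mathfrak{g}\subset\mathfrak{gl}_{m|n}(\mathbb{R})$ ($m=k+l$, $n=\dim\Delta$) be the matrix form of $\alpha(\mathfrak{p}(V_p))$ with respect to the basis of $V_p^*$ dual to a spin frame of $V_p$ at some point $p$. Let $G=\exp\mathfrak{g}$, i.e. $G(\mathcal{A}(U))$ is the group generated by the exponentials of the even elements of $\mathfrak{g}\otimes\mathcal{A}(U)$, and let $\mathcal{F}_G$ be the sheaf of frame fields of $M$ which locally have the form $\iota(b)u$, where $b=(e^i,\theta_j)$ is dual to a local spin frame and $u\in G(\mathcal{A}(U))$. An open set $U$ is small if the group of sections over $U$ of the sheaf of groups associated with $U\mapsto G(\mathcal{A}(U))$ acts simply transitively on $\mathcal{F}_G(U)$.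 A vector field $X$ on $M$ is a Killing vector field on $(M,g_0+g_1)$ if it is an infinitesimal automorphism of $\mathcal{F}_G$: for all small open $U$ and all $Y=(Y_1,\dots,Y_{m+n})\in\mathcal{F}_G(U)$, $$([X,Y_1],\dots,[X,Y_{m+n}])\in Y\,(\mathfrak{g}\otimes\mathcal{A}(U)),$$ where $[\cdot,\cdot]$ is the supercommutator. Then, for every smooth section $s$ of $S$, the odd vector field $X_s=\iota(g_1(s,\cdot))$ is a Killing vector field on $(M,g_0+g_1)$ if and only if $s$ is a twistor spinor, i.e. there is a smooth section $\tilde s$ of $S$ with $\nabla_Xs=\rho(X)\tilde s$ for all vector fields $X$ on $M_0$. In particular, if $s$ is a Killing spinor, i.e. $\nabla_Xs=\lambda\rho(X)s$ for all $X$, with a constant $\lambda\in\mathbb{R}$, then $X_s$ is a Killing vector field. -/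

import Mathlib

open Bundle TopologicalSpace
open scoped Manifold ContDiff

noncomputable section

namespace SpinSuper

/-! ### Linear algebra: spin Lie algebra, Poincaré super Lie algebra, coadjoint representation -/

section LinearAlgebra

variable {V₀ V₁ : Type*} [AddCommGroup V₀] [Module ℝ V₀] [AddCommGroup V₁] [Module ℝ V₁]

/-- The infinitesimal rotation `u ↦ ⟨v, u⟩ w - ⟨w, u⟩ v`. -/
def wedge (B : LinearMap.BilinForm ℝ V₀) (v w : V₀) : Module.End ℝ V₀ :=
  (B v).smulRight w - (B w).smulRight v

/-- The Clifford relation `ρ(v)² = -⟨v, v⟩`. -/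
def IsClifford (B : LinearMap.BilinForm ℝ V₀) (ρ : V₀ →ₗ[ℝ] Module.End ℝ V₁) : Prop :=
  ∀ v, ρ v * ρ v = -(B v v) • (1 : Module.End ℝ V₁)

/-- `spin(V₀)`, acting on `V₀ + V₁`: it is spanned by the elements `¼ [v, w]` of the Clifford
algebra, which act on `V₀` by `[¼ [v, w], u] = ⟨v, u⟩ w - ⟨w, u⟩ v` and on `V₁` by Clifford
multiplication. -/
def spinLie (B : LinearMap.BilinForm ℝ V₀) (ρ : V₀ →ₗ[ℝ] Module.End ℝ V₁) :
    Submodule ℝ (Module.End ℝ V₀ × Module.End ℝ V₁) :=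
  Submodule.span ℝ
    {X | ∃ v w, X = (wedge B v w, (4⁻¹ : ℝ) • (ρ v * ρ w - ρ w * ρ v))}

/-- A bilinear form on the spinor module is suitable: it is symmetric or skew (symmetry `σ`),
Clifford multiplication is symmetric or skew with respect to it (type `τ`), and `σ τ = 1`. -/
def IsSuitable (ρ : V₀ →ₗ[ℝ] Module.End ℝ V₁) (β : LinearMap.BilinForm ℝ V₁) : Prop :=
  ∃ σ τ : ℝ, (σ = 1 ∨ σ = -1) ∧ (τ = 1 ∨ τ = -1) ∧
    (∀ s t, β s t = σ * β t s) ∧ (∀ v s t, β (ρ v s) t = τ * β s (ρ v t)) ∧ σ * τ = 1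

variable [FiniteDimensional ℝ V₀]

/-- The map `π : V₁ × V₁ → V₀` with `⟨π(s, t), v⟩ = β(ρ(v) s, t)`. -/
def piMap (B : LinearMap.BilinForm ℝ V₀) (hB : B.Nondegenerate)
    (ρ : V₀ →ₗ[ℝ] Module.End ℝ V₁) (β : LinearMap.BilinForm ℝ V₁) (s t : V₁) : V₀ :=
  (B.toDual hB).symm ((β.flip t) ∘ₗ (ρ.flip s))

/-- The vector space `(gl(V₀) + gl(V₁)) + (V₀ + V₁)`, which contains `p(V) = spin(V₀) + V`. -/
abbrev PoincareAmbient (V₀ V₁ : Type*) [AddCommGroup V₀] [Module ℝ V₀]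
    [AddCommGroup V₁] [Module ℝ V₁] : Type _ :=
  (Module.End ℝ V₀ × Module.End ℝ V₁) × (V₀ × V₁)

/-- The Poincaré super Lie algebra `p(V) = spin(V₀) + V₀ + V₁` as a vector space;
its odd part is `V₁`. -/
def poincare (B : LinearMap.BilinForm ℝ V₀) (ρ : V₀ →ₗ[ℝ] Module.End ℝ V₁) :
    Submodule ℝ (PoincareAmbient V₀ V₁) :=
  (spinLie B ρ).comap (LinearMap.fst ℝ _ _)

/-- The super Lie bracket of `p(V)`: commutator on `spin(V₀)`, the natural action of `spin(V₀)`
on `V`, `[V₀, V] = 0`, and `[s, t] = π(s, t)` for `s, t` in `V₁`. -/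
def poincareBracket (B : LinearMap.BilinForm ℝ V₀) (hB : B.Nondegenerate)
    (ρ : V₀ →ₗ[ℝ] Module.End ℝ V₁) (β : LinearMap.BilinForm ℝ V₁)
    (x y : PoincareAmbient V₀ V₁) : PoincareAmbient V₀ V₁ :=
  ((x.1.1 * y.1.1 - y.1.1 * x.1.1, x.1.2 * y.1.2 - y.1.2 * x.1.2),
    (x.1.1 y.2.1 - y.1.1 x.2.1 + piMap B hB ρ β x.2.2 y.2.2, x.1.2 y.2.2 - y.1.2 x.2.2))

/-- The even component of an element of `p(V)`. -/
def poincareEven (x : PoincareAmbient V₀ V₁) : PoincareAmbient V₀ V₁ := (x.1, (x.2.1, 0))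

/-- The odd component of an element of `p(V)`. -/
def poincareOdd (x : PoincareAmbient V₀ V₁) : PoincareAmbient V₀ V₁ := (0, (0, x.2.2))

/-- `ad_x`, restricted to the ideal `V = V₀ + V₁` of `p(V)`. -/
def adV (B : LinearMap.BilinForm ℝ V₀) (hB : B.Nondegenerate)
    (ρ : V₀ →ₗ[ℝ] Module.End ℝ V₁) (β : LinearMap.BilinForm ℝ V₁)
    (x : PoincareAmbient V₀ V₁) : (V₀ × V₁) →ₗ[ℝ] (V₀ × V₁) where
  toFun z := (poincareBracket B hB ρ β x (0, z)).2
  map_add' z w := by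
    simp only [poincareBracket, piMap]
    ext <;> simp [LinearMap.add_comp, add_add_add_comm]
  map_smul' a z := by
    simp only [poincareBracket, piMap]
    ext <;> simp [LinearMap.smul_comp]

/-- `ad_x` preserves `V`, so `adV` is `ad_x` on `V`. -/
theorem poincareBracket_mem (B : LinearMap.BilinForm ℝ V₀) (hB : B.Nondegenerate)
    (ρ : V₀ →ₗ[ℝ] Module.End ℝ V₁) (β : LinearMap.BilinForm ℝ V₁)
    (x : PoincareAmbient V₀ V₁) (z : V₀ × V₁) :
    poincareBracket B hB ρ β x (0, z) = (0, adV B hB ρ β x z) := by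
  simp only [poincareBracket, adV]
  ext <;> simp

/-- The representation `α` of `p(V)` on `V* = p(V)* / V^⊥` that is induced by the coadjoint
representation `ad*_x(y) = -(-1)^(|x| |y|) y ∘ ad_x`. -/
def coadjoint (B : LinearMap.BilinForm ℝ V₀) (hB : B.Nondegenerate)
    (ρ : V₀ →ₗ[ℝ] Module.End ℝ V₁) (β : LinearMap.BilinForm ℝ V₁)
    (x : PoincareAmbient V₀ V₁) :
    Module.Dual ℝ (V₀ × V₁) →ₗ[ℝ] Module.Dual ℝ (V₀ × V₁) :=
  -(adV B hB ρ β (poincareEven x)).dualMap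
    - (adV B hB ρ β (poincareOdd x)).dualMap ∘ₗ
        (LinearMap.inl ℝ V₀ V₁ ∘ₗ LinearMap.fst ℝ V₀ V₁).dualMap
    + (adV B hB ρ β (poincareOdd x)).dualMap ∘ₗ
        (LinearMap.inr ℝ V₀ V₁ ∘ₗ LinearMap.snd ℝ V₀ V₁).dualMap

/-- `α(p(V))^b ⊆ gl(m|n)`: the matrices of the `α(x)`, `x ∈ p(V)`, with respect to the basis `b`
of `V*` that is dual to the basis `c` of `V`. -/
def coadjointMatrices {J : Type*} [Fintype J] [DecidableEq J]
    (B : LinearMap.BilinForm ℝ V₀) (hB : B.Nondegenerate)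
    (ρ : V₀ →ₗ[ℝ] Module.End ℝ V₁) (β : LinearMap.BilinForm ℝ V₁)
    (c : Module.Basis J ℝ (V₀ × V₁)) : Submodule ℝ (Matrix J J ℝ) :=
  Submodule.span ℝ {N | ∃ x ∈ poincare B ρ,
    N = LinearMap.toMatrix c.dualBasis c.dualBasis (coadjoint B hB ρ β x)}

end LinearAlgebra

/-! ### The model: pseudo-Euclidean space, Clifford module, spin group -/

section Model

/-- Index set of an orthonormal basis of a pseudo-Euclidean space of signature `(k, l)`. -/
abbrev EvenIdx (k l : ℕ) : Type := Fin k ⊕ Fin l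

/-- Index set of a homogeneous basis of the super vector space `V₀ + V₁`. -/
abbrev Idx (k l n : ℕ) : Type := EvenIdx k l ⊕ Fin n

/-- `ε_i = ⟨e_i, e_i⟩`. -/
def sgn (k l : ℕ) : EvenIdx k l → ℝ := Sum.elim (fun _ => 1) (fun _ => -1)

/-- The standard scalar product of signature `(k, l)`. -/
def modelForm (k l : ℕ) : LinearMap.BilinForm ℝ (EvenIdx k l → ℝ) :=
  Matrix.toBilin' (Matrix.diagonal (sgn k l))

/-- A real module `ℝⁿ` of the Clifford algebra of signature `(k, l)`, for instance the spinor
module (an irreducible such module, or a complex one considered as a real one). -/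
structure CliffordModule (k l n : ℕ) where
  ρ : (EvenIdx k l → ℝ) →ₗ[ℝ] Module.End ℝ (Fin n → ℝ)
  clifford : IsClifford (modelForm k l) ρ

/-- The Lie algebra `spin(k, l)` as an algebra of block matrices acting on `ℝ^(k+l) + ℝⁿ`. -/
def modelSpin {k l n : ℕ} (Δ : CliffordModule k l n) :
    Set (Matrix (Idx k l n) (Idx k l n) ℝ) :=
  {Y | ∃ X ∈ spinLie (modelForm k l) Δ.ρ,
    Y = Matrix.fromBlocks (LinearMap.toMatrix' X.1) 0 0 (LinearMap.toMatrix' X.2)}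

end Model

/-! ### Bundles, metrics, spin structures, connections -/

section Geometry

variable (E : Type*) [NormedAddCommGroup E] [NormedSpace ℝ E]
  {M : Type*} [TopologicalSpace M] [ChartedSpace E M]

/-- Smooth sections, over an open set `U`, of a bundle `S` with model fibre `F`. -/
def SmoothOn (F : Type*) [NormedAddCommGroup F] [NormedSpace ℝ F] {S : M → Type*}
    [TopologicalSpace (TotalSpace F S)] [∀ x, TopologicalSpace (S x)] [FiberBundle F S]
    (s : Π x, S x) (U : Opens M) : Prop :=
  ContMDiffOn 𝓘(ℝ, E) (𝓘(ℝ, E).prod 𝓘(ℝ, F)) ∞ (fun x => TotalSpace.mk' F x (s x)) U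

/-- A smooth field of bilinear forms on the fibres of a bundle. -/
structure FormField (F : Type*) [NormedAddCommGroup F] [NormedSpace ℝ F] (S : M → Type*)
    [TopologicalSpace (TotalSpace F S)] [∀ x, TopologicalSpace (S x)] [FiberBundle F S]
    [∀ x, AddCommGroup (S x)] [∀ x, Module ℝ (S x)] where
  form : ∀ x, LinearMap.BilinForm ℝ (S x)
  smooth : ∀ (U : Opens M) (s t : Π x, S x), SmoothOn E F s U → SmoothOn E F t U →
    ContMDiffOn 𝓘(ℝ, E) 𝓘(ℝ, ℝ) ∞ (fun x => form x (s x) (t x)) U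

variable (M) in
/-- A pseudo-Riemannian metric on `M`. -/
structure PseudoMetric [IsManifold 𝓘(ℝ, E) ∞ M] extends
    FormField E E (TangentSpace 𝓘(ℝ, E) : M → Type _) where
  symm : ∀ x v w, form x v w = form x w v
  nondeg : ∀ x, (form x).Nondegenerate

variable {E}

instance tangentFiniteDimensional [FiniteDimensional ℝ E] (x : M) :
    FiniteDimensional ℝ (TangentSpace 𝓘(ℝ, E) x) :=
  inferInstanceAs (FiniteDimensional ℝ E)

section LeviCivita

variable [IsManifold 𝓘(ℝ, E) ∞ M]

/-- The right-hand side of the Koszul formula for `2 g(∇_X Y, Z)`. -/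
def koszul (g : PseudoMetric E M) (X Y Z : Π x : M, TangentSpace 𝓘(ℝ, E) x) (x : M) : ℝ :=
  mvfderiv 𝓘(ℝ, E) (fun y => g.form y (Y y) (Z y)) x (X x)
    + mvfderiv 𝓘(ℝ, E) (fun y => g.form y (Z y) (X y)) x (Y x)
    - mvfderiv 𝓘(ℝ, E) (fun y => g.form y (X y) (Y y)) x (Z x)
    + g.form x (VectorField.mlieBracket 𝓘(ℝ, E) X Y x) (Z x)
    - g.form x (VectorField.mlieBracket 𝓘(ℝ, E) Y Z x) (X x)
    + g.form x (VectorField.mlieBracket 𝓘(ℝ, E) Z X x) (Y x)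

/-- The Levi-Civita connection `∇_v Y` at `x`: the unique tangent vector `w` such that
`2 g(w, Z) = koszul(X, Y, Z)` at `x` for all vector fields `X`, `Z` near `x` with `X(x) = v`. -/
def leviCivita (g : PseudoMetric E M) (Y : Π x : M, TangentSpace 𝓘(ℝ, E) x) (x : M)
    (v : TangentSpace 𝓘(ℝ, E) x) : TangentSpace 𝓘(ℝ, E) x :=
  Classical.epsilon fun w => ∀ (W : Opens M) (X Z : Π x : M, TangentSpace 𝓘(ℝ, E) x), x ∈ W →
    SmoothOn E E X W → SmoothOn E E Z W → X x = v → 2 * g.form x w (Z x) = koszul g X Y Z x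

end LeviCivita

variable (E) in
/-- A tuple `(e_i, θ^j)` of tangent vector fields and sections of `S` on an open set; the values
outside of this open set are irrelevant. -/
structure LocalTuple (k l n : ℕ) (S : M → Type*) where
  dom : Opens M
  e : EvenIdx k l → Π x : M, TangentSpace 𝓘(ℝ, E) x
  θ : Fin n → Π x : M, S x

/-- Smooth maps from `U` to the connected Lie group `Spin` generated by `spin(k, l)`, which acts
on `ℝ^(k+l) + ℝⁿ`: locally, products of exponentials of smooth `spin(k, l)`-valued maps. -/
def IsSpinMap (E : Type*) [NormedAddCommGroup E] [NormedSpace ℝ E]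
    {M : Type*} [TopologicalSpace M] [ChartedSpace E M] {k l n : ℕ} (Δ : CliffordModule k l n)
    (U : Opens M) (h : M → Matrix (Idx k l n) (Idx k l n) ℝ) : Prop :=
  ∀ x ∈ U, ∃ W : Opens M, x ∈ W ∧ W ≤ U ∧
    ∃ L : List (M → Matrix (Idx k l n) (Idx k l n) ℝ),
      (∀ Y ∈ L, (∀ i j, ContMDiffOn 𝓘(ℝ, E) 𝓘(ℝ, ℝ) ∞ (fun y => Y y i j) W) ∧
        ∀ y ∈ W, Y y ∈ modelSpin Δ) ∧
      ∀ y ∈ W, h y = (L.map fun Y => NormedSpace.exp (Y y)).prod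

/-- `c = b h` on `U`. -/
def LocalTuple.RelatedBy {k l n : ℕ} {S : M → Type*} [∀ x, AddCommGroup (S x)]
    [∀ x, Module ℝ (S x)] (b c : LocalTuple E k l n S)
    (h : M → Matrix (Idx k l n) (Idx k l n) ℝ) (U : Opens M) : Prop :=
  ∀ x ∈ U, (∀ i, c.e i x = ∑ j, h x (Sum.inl j) (Sum.inl i) • b.e j x) ∧
    (∀ i, c.θ i x = ∑ j, h x (Sum.inr j) (Sum.inr i) • b.θ j x)

section Spin

variable [IsManifold 𝓘(ℝ, E) ∞ M] (F : Type*) [NormedAddCommGroup F] [NormedSpace ℝ F]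
  {S : M → Type*} [TopologicalSpace (TotalSpace F S)] [∀ x, AddCommGroup (S x)]
  [∀ x, Module ℝ (S x)] [∀ x, TopologicalSpace (S x)] [FiberBundle F S]

/-- `(e_i, θ^j)` is a smooth local frame of `TM + S`, the `e_i` are orthonormal, and Clifford
multiplication by the `e_i` has constant coefficients in the frame `θ^j`, the same as in the
model. -/
structure LocalTuple.IsAdapted {k l n : ℕ} (g : PseudoMetric E M) (Δ : CliffordModule k l n)
    (ρ : ∀ x : M, TangentSpace 𝓘(ℝ, E) x →ₗ[ℝ] Module.End ℝ (S x))
    (b : LocalTuple E k l n S) : Prop where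
  frame_e : IsLocalFrameOn 𝓘(ℝ, E) E ∞ b.e b.dom
  frame_θ : IsLocalFrameOn 𝓘(ℝ, E) F ∞ b.θ b.dom
  orthonormal : ∀ x ∈ b.dom, ∀ i j, g.form x (b.e i x) (b.e j x) = if i = j then sgn k l i else 0
  clifford : ∀ x ∈ b.dom, ∀ i j, ρ x (b.e i x) (b.θ j x)
    = ∑ r, LinearMap.toMatrix' (Δ.ρ (Pi.single i 1)) r j • b.θ r x

/-- A spin structure on `(M, g)` with spinor bundle `S`: `S` carries a Clifford multiplication by
tangent vectors, and `TM + S` has an atlas of local frames in which the metric and the Clifford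
multiplication are those of the model and whose transition functions are maps to the spin group.
(Equivalently: a principal bundle of spin frames that covers the one of orthonormal frames, and
`S` is the associated bundle with fibre `Δ`.) -/
structure SpinStructure {k l n : ℕ} (g : PseudoMetric E M) (Δ : CliffordModule k l n)
    (S : M → Type*) [TopologicalSpace (TotalSpace F S)] [∀ x, AddCommGroup (S x)]
    [∀ x, Module ℝ (S x)] [∀ x, TopologicalSpace (S x)] [FiberBundle F S] where
  ρ : ∀ x : M, TangentSpace 𝓘(ℝ, E) x →ₗ[ℝ] Module.End ℝ (S x)
  atlas : Set (LocalTuple E k l n S)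
  adapted : ∀ b ∈ atlas, b.IsAdapted F g Δ ρ
  cover : ∀ x : M, ∃ b ∈ atlas, x ∈ b.dom
  transition : ∀ b ∈ atlas, ∀ c ∈ atlas, ∃ h,
    IsSpinMap E Δ (b.dom ⊓ c.dom) h ∧ b.RelatedBy c h (b.dom ⊓ c.dom)

variable {F} {k l n : ℕ} {g : PseudoMetric E M} {Δ : CliffordModule k l n}

namespace SpinStructure

variable (P : SpinStructure F g Δ S)

/-- The local sections of the bundle of spin frames. -/
def spinFrames : Set (LocalTuple E k l n S) :=
  {c | c.IsAdapted F g Δ P.ρ ∧ ∀ x ∈ c.dom, ∃ b ∈ P.atlas, ∃ W : Opens M,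
    x ∈ W ∧ W ≤ b.dom ⊓ c.dom ∧ ∃ h, IsSpinMap E Δ W h ∧ b.RelatedBy c h W}

/-- A spin frame near `x`. -/
def frameAt (x : M) : LocalTuple E k l n S := (P.cover x).choose

theorem frameAt_mem (x : M) : P.frameAt x ∈ P.atlas := (P.cover x).choose_spec.1

/-- The coefficient functions `t^j` of a section `t = ∑ t^j θ^j` in the spin frame near `x`. -/
def coeffAt (x : M) (t : Π y, S y) (j : Fin n) (y : M) : ℝ :=
  (P.adapted _ (P.frameAt_mem x)).frame_θ.coeff j y (t y)

/-- The connection on the spinor bundle that is induced by the Levi-Civita connection: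
`∇_v t = ∑ v(t^j) θ^j + ¼ ∑ ε_i ρ(e_i) ρ(∇_v e_i) t` in a spin frame `(e_i, θ^j)`. -/
def nabla (t : Π y, S y) (x : M) (v : TangentSpace 𝓘(ℝ, E) x) : S x :=
  (∑ j, mvfderiv 𝓘(ℝ, E) (P.coeffAt x t j) x v • (P.frameAt x).θ j x)
    + (4⁻¹ : ℝ) • ∑ i, sgn k l i •
        P.ρ x ((P.frameAt x).e i x) (P.ρ x (leviCivita g ((P.frameAt x).e i) x v) (t x))

/-- `g₁` is parallel. -/
def IsParallel (g₁ : FormField E F S) : Prop :=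
  ∀ (W : Opens M) (s t : Π y, S y), SmoothOn E F s W → SmoothOn E F t W →
    ∀ x ∈ W, ∀ v : TangentSpace 𝓘(ℝ, E) x,
      mvfderiv 𝓘(ℝ, E) (fun y => g₁.form y (s y) (t y)) x v
        = g₁.form x (P.nabla s x v) (t x) + g₁.form x (s x) (P.nabla t x v)

/-- Twistor spinors. -/
def IsTwistorSpinor (s : Π y, S y) : Prop :=
  ∃ s' : Π y, S y, SmoothOn E F s' ⊤ ∧
    ∀ x (v : TangentSpace 𝓘(ℝ, E) x), P.nabla s x v = P.ρ x v (s' x)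

/-- Killing spinors. -/
def IsKillingSpinor (s : Π y, S y) : Prop :=
  ∃ r : ℝ, ∀ x (v : TangentSpace 𝓘(ℝ, E) x), P.nabla s x v = P.ρ x v (r • s x)

end SpinStructure

end Spin

/-! ### The supermanifold `M(S) = (M, Γ(∧S))` -/

section Supermanifold

variable (E) (F : Type*) [NormedAddCommGroup F] [NormedSpace ℝ F]
  (S : M → Type*) [TopologicalSpace (TotalSpace F S)] [∀ x, AddCommGroup (S x)]
  [∀ x, Module ℝ (S x)] [∀ x, TopologicalSpace (S x)] [FiberBundle F S]

/-- All (not necessarily smooth) sections of the bundle of algebras `∧S` over `U`. -/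
abbrev ExtSec (U : Opens M) : Type _ := Π x : U, ExteriorAlgebra ℝ (S x)

/-- Restriction of sections of `∧S`. -/
def restrictExt {U W : Opens M} (h : W ≤ U) : ExtSec S U →ₐ[ℝ] ExtSec S W where
  toFun f := fun x => f ⟨x, h x.2⟩
  map_one' := rfl
  map_mul' _ _ := rfl
  map_zero' := rfl
  map_add' _ _ := rfl
  commutes' _ := rfl

/-- The smooth functions and the smooth sections of `S` on `U`, as sections of `∧S`. -/
def generators (U : Opens M) : Set (ExtSec S U) :=
  {f | ∃ φ : M → ℝ, ContMDiffOn 𝓘(ℝ, E) 𝓘(ℝ, ℝ) ∞ φ U ∧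
      f = fun x : U => algebraMap ℝ (ExteriorAlgebra ℝ (S x)) (φ x)} ∪
  {f | ∃ t : Π x, S x, SmoothOn E F t U ∧ f = fun x : U => ExteriorAlgebra.ι ℝ (t x)}

theorem restrictExt_mem {U W : Opens M} (h : W ≤ U) {f : ExtSec S U}
    (hf : f ∈ Algebra.adjoin ℝ (generators E F S U)) :
    restrictExt S h f ∈ Algebra.adjoin ℝ (generators E F S W) := by
  have h1 : restrictExt S h f ∈ (Algebra.adjoin ℝ (generators E F S U)).map (restrictExt S h) :=
    ⟨f, hf, rfl⟩
  rw [AlgHom.map_adjoin] at h1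
  refine Algebra.adjoin_mono ?_ h1
  rintro _ ⟨_, ⟨φ, hφ, rfl⟩ | ⟨t, ht, rfl⟩, rfl⟩
  · exact Or.inl ⟨φ, hφ.mono h, rfl⟩
  · exact Or.inr ⟨t, ContMDiffOn.mono ht h, rfl⟩

/-- The algebra `𝒜(U) = Γ(U, ∧S)` of functions on the supermanifold `M(S)` over `U`: the sections of `∧S` over `U` that are locally polynomials
in smooth functions and smooth sections of `S`. -/
def superFunctions (U : Opens M) : Subalgebra ℝ (ExtSec S U) where
  carrier := {f | ∀ x ∈ U, ∃ (W : Opens M) (h : W ≤ U), x ∈ W ∧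
    restrictExt S h f ∈ Algebra.adjoin ℝ (generators E F S W)}
  mul_mem' := by
    intro a b ha hb x hx
    obtain ⟨W, h, hxW, hW⟩ := ha x hx
    obtain ⟨W', h', hxW', hW'⟩ := hb x hx
    refine ⟨W ⊓ W', inf_le_left.trans h, ⟨hxW, hxW'⟩, ?_⟩
    rw [map_mul]
    exact mul_mem (restrictExt_mem E F S (inf_le_left : W ⊓ W' ≤ W) hW)
      (restrictExt_mem E F S (inf_le_right : W ⊓ W' ≤ W') hW')
  add_mem' := by
    intro a b ha hb x hx
    obtain ⟨W, h, hxW, hW⟩ := ha x hx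
    obtain ⟨W', h', hxW', hW'⟩ := hb x hx
    refine ⟨W ⊓ W', inf_le_left.trans h, ⟨hxW, hxW'⟩, ?_⟩
    rw [map_add]
    exact add_mem (restrictExt_mem E F S (inf_le_left : W ⊓ W' ≤ W) hW)
      (restrictExt_mem E F S (inf_le_right : W ⊓ W' ≤ W') hW')
  algebraMap_mem' := by
    intro r x hx
    refine ⟨U, le_rfl, hx, ?_⟩
    rw [AlgHom.commutes]
    exact Subalgebra.algebraMap_mem _ r

/-- Pointwise maps that preserve polynomials in the generators preserve smoothness. -/
theorem superFunctions_map (T : ∀ x : M, ExteriorAlgebra ℝ (S x) → ExteriorAlgebra ℝ (S x))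
    (hT : ∀ (W : Opens M) (f : ExtSec S W), f ∈ Algebra.adjoin ℝ (generators E F S W) →
      (fun x : W => T x (f x)) ∈ Algebra.adjoin ℝ (generators E F S W))
    {U : Opens M} {f : ExtSec S U} (hf : f ∈ superFunctions E F S U) :
    (fun x : U => T x (f x)) ∈ superFunctions E F S U := by
  intro x hx
  obtain ⟨W, h, hxW, hW⟩ := hf x hx
  exact ⟨W, h, hxW, hT W _ hW⟩

/-- Restriction `𝒜(U) → 𝒜(W)`. -/
def res {U W : Opens M} (h : W ≤ U) : superFunctions E F S U →ₐ[ℝ] superFunctions E F S W :=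
  ((restrictExt S h).comp (superFunctions E F S U).val).codRestrict _ <| by
    rintro ⟨f, hf⟩ x hx
    obtain ⟨W', h', hxW', hW'⟩ := hf x (h hx)
    exact ⟨W ⊓ W', inf_le_left, ⟨hx, hxW'⟩,
      restrictExt_mem E F S (inf_le_right : W ⊓ W' ≤ W') hW'⟩

theorem involute_mem (W : Opens M) (f : ExtSec S W)
    (hf : f ∈ Algebra.adjoin ℝ (generators E F S W)) :
    (fun x : W => CliffordAlgebra.involute (f x)) ∈ Algebra.adjoin ℝ (generators E F S W) := by
  induction hf using Algebra.adjoin_induction with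
  | mem f hf =>
    obtain ⟨φ, hφ, rfl⟩ | ⟨t, ht, rfl⟩ := hf
    · refine Algebra.subset_adjoin (Or.inl ⟨φ, hφ, ?_⟩)
      funext x
      exact AlgHom.commutes _ _
    · have : (fun x : W => CliffordAlgebra.involute (ExteriorAlgebra.ι ℝ (t x)))
          = -(fun x : W => ExteriorAlgebra.ι ℝ (t x)) := by
        funext x
        exact CliffordAlgebra.involute_ι _
      rw [this]
      exact neg_mem (Algebra.subset_adjoin (Or.inr ⟨t, ht, rfl⟩))
  | algebraMap r =>
    have : (fun x : W => CliffordAlgebra.involute (algebraMap ℝ (ExtSec S W) r x))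
        = algebraMap ℝ (ExtSec S W) r := by
      funext x
      exact AlgHom.commutes _ _
    rw [this]
    exact Subalgebra.algebraMap_mem _ r
  | add f f' _ _ ha hb =>
    have : (fun x : W => CliffordAlgebra.involute ((f + f') x))
        = (fun x : W => CliffordAlgebra.involute (f x))
          + fun x : W => CliffordAlgebra.involute (f' x) := by
      funext x
      simp
    rw [this]
    exact add_mem ha hb
  | mul f f' _ _ ha hb =>
    have : (fun x : W => CliffordAlgebra.involute ((f * f') x))
        = (fun x : W => CliffordAlgebra.involute (f x))
          * fun x : W => CliffordAlgebra.involute (f' x) := by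
      funext x
      simp
    rw [this]
    exact mul_mem ha hb

instance superFunctionsRing (U : Opens M) : Ring (superFunctions E F S U) :=
  (superFunctions E F S U).toRing

/-- The parity operator `a ↦ (-1)^|a| a` of `𝒜(U)`. -/
def parity (U : Opens M) : superFunctions E F S U →ₗ[ℝ] superFunctions E F S U where
  toFun f := ⟨fun x : U => CliffordAlgebra.involute (f.1 x),
    superFunctions_map E F S (fun _ a => CliffordAlgebra.involute a)
      (involute_mem E F S) f.2⟩
  map_add' f f' := by
    ext x
    simp
  map_smul' r f := by
    ext x
    simp

/-- The endomorphisms of the sheaf of vector spaces `𝒜` over `U`, i.e. the families of linear maps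
`𝒜(W) → 𝒜(W)`, `W ⊆ U` open, that are compatible with restrictions. -/
def SheafEnd (U : Opens M) :
    Subalgebra ℝ (Π W : {W : Opens M // W ≤ U}, Module.End ℝ (superFunctions E F S W.1)) where
  carrier := {X | ∀ (W W' : {W : Opens M // W ≤ U}) (h : W'.1 ≤ W.1)
    (f : superFunctions E F S W.1), res E F S h (X W f) = X W' (res E F S h f)}
  mul_mem' := by
    intro X Y hX hY W W' h f
    simp only [Pi.mul_apply, Module.End.mul_apply]
    rw [hX W W' h, hY W W' h]
  add_mem' := by
    intro X Y hX hY W W' h f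
    simp only [Pi.add_apply, LinearMap.add_apply, map_add]
    rw [hX W W' h, hY W W' h]
  algebraMap_mem' := by
    intro r W W' h f
    simp [Pi.algebraMap_apply, Module.algebraMap_end_apply]

instance sheafEndRing (U : Opens M) : Ring (SheafEnd E F S U) := (SheafEnd E F S U).toRing

instance sheafEndAddCommGroup (U : Opens M) : AddCommGroup (SheafEnd E F S U) := Ring.toAddCommGroup

variable {E F S}

/-- Restriction of sheaf endomorphisms to a smaller open set. -/
def restrictEnd {U U' : Opens M} (h : U' ≤ U) (X : SheafEnd E F S U) :
    SheafEnd E F S U' :=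
  ⟨fun W => X.1 ⟨W.1, W.2.trans h⟩, fun W W' hW f =>
    X.2 ⟨W.1, W.2.trans h⟩ ⟨W'.1, W'.2.trans h⟩ hW f⟩

/-- Multiplication from the left by `a ∈ 𝒜(U)`. -/
def leftMul {U : Opens M} (a : superFunctions E F S U) : SheafEnd E F S U :=
  ⟨fun W => LinearMap.mulLeft ℝ (res E F S W.2 a), by
    intro W W' h f
    simp only [LinearMap.mulLeft_apply, map_mul]
    rfl⟩

variable (E F S) in
/-- The parity operator as an endomorphism of the sheaf. -/
def parityEnd (U : Opens M) : SheafEnd E F S U :=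
  ⟨fun W => parity E F S W.1, fun _ _ _ _ => rfl⟩

/-- Even superderivations: they preserve the degree and satisfy `X(ab) = X(a) b + a X(b)`. -/
def IsEvenDer {U : Opens M} (X : SheafEnd E F S U) : Prop :=
  X * parityEnd E F S U = parityEnd E F S U * X ∧
  ∀ W a b, X.1 W (a * b) = X.1 W a * b + a * X.1 W b

/-- Odd superderivations: they reverse the degree and satisfy
`X(ab) = X(a) b + (-1)^|a| a X(b)`. -/
def IsOddDer {U : Opens M} (X : SheafEnd E F S U) : Prop :=
  X * parityEnd E F S U = -(parityEnd E F S U * X) ∧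
  ∀ W a b, X.1 W (a * b) = X.1 W a * b + parity E F S W.1 a * X.1 W b

/-- Vector fields on the supermanifold `M(S)` over `U`: sections of the tangent sheaf
`Der 𝒜 = (Der 𝒜)_0 + (Der 𝒜)_1`. -/
def IsVectorField {U : Opens M} (X : SheafEnd E F S U) : Prop :=
  ∃ X₀ X₁, IsEvenDer X₀ ∧ IsOddDer X₁ ∧ X = X₀ + X₁

/-- The even component of a sheaf endomorphism. -/
def evenPart {U : Opens M} (X : SheafEnd E F S U) : SheafEnd E F S U :=
  (2⁻¹ : ℝ) • (X + parityEnd E F S U * X * parityEnd E F S U)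

/-- The odd component of a sheaf endomorphism. -/
def oddPart {U : Opens M} (X : SheafEnd E F S U) : SheafEnd E F S U :=
  (2⁻¹ : ℝ) • (X - parityEnd E F S U * X * parityEnd E F S U)

/-- The supercommutator: `[X, Y] = X Y - (-1)^(|X| |Y|) Y X` for homogeneous `X`, `Y`. -/
def superBracket {U : Opens M} (X Y : SheafEnd E F S U) : SheafEnd E F S U :=
  X * Y - evenPart Y * evenPart X - evenPart Y * oddPart X - oddPart Y * evenPart X
    + oddPart Y * oddPart X

/-- The right module structure on vector fields: `X · a = (-1)^(|X| |a|) a X` for homogeneous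
`X` and `a`. -/
def rightMul {U : Opens M} (X : SheafEnd E F S U) (a : superFunctions E F S U) :
    SheafEnd E F S U :=
  leftMul a * evenPart X + leftMul (parity E F S U a) * oddPart X

/-- The right action of matrices on tuples of vector fields: `(E · Z)_j = ∑_i E_i · Z_ij`. -/
def tupleMul {J : Type*} [Fintype J] {U : Opens M} (X : J → SheafEnd E F S U)
    (Z : Matrix J J (superFunctions E F S U)) : J → SheafEnd E F S U :=
  fun j => ∑ i, rightMul (X i) (Z i j)

/-- Interior multiplication by a section `η` of `S*`, as a relation. -/
def IsInterior {U : Opens M} (η : Π x : M, Module.Dual ℝ (S x)) (D : SheafEnd E F S U) : Prop :=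
  ∀ (W : {W : Opens M // W ≤ U}) (f : superFunctions E F S W.1) (x : W.1),
    (D.1 W f).1 x = CliffordAlgebra.contractLeft (η x) (f.1 x)

theorem contractLeft_mul {N : Type*} [AddCommGroup N] [Module ℝ N] (d : Module.Dual ℝ N)
    (a b : ExteriorAlgebra ℝ N) :
    CliffordAlgebra.contractLeft d (a * b)
      = CliffordAlgebra.contractLeft d a * b
        + CliffordAlgebra.involute a * CliffordAlgebra.contractLeft d b := by
  induction a using CliffordAlgebra.left_induction with
  | algebraMap r =>
    rw [CliffordAlgebra.contractLeft_algebraMap_mul, CliffordAlgebra.contractLeft_algebraMap,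
      AlgHom.commutes, zero_mul, zero_add]
  | add a a' ha ha' =>
    simp only [add_mul, map_add, ha, ha']
    abel
  | ι_mul a m ha =>
    rw [mul_assoc, CliffordAlgebra.contractLeft_ι_mul, CliffordAlgebra.contractLeft_ι_mul, ha,
      map_mul, CliffordAlgebra.involute_ι]
    simp only [sub_mul, mul_add, neg_mul, smul_mul_assoc, mul_assoc]
    abel

theorem contractLeft_involute {N : Type*} [AddCommGroup N] [Module ℝ N]
    (d : Module.Dual ℝ N) (a : ExteriorAlgebra ℝ N) :
    CliffordAlgebra.contractLeft d (CliffordAlgebra.involute a)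
      = -CliffordAlgebra.involute (CliffordAlgebra.contractLeft d a) := by
  induction a using CliffordAlgebra.left_induction with
  | algebraMap r => simp
  | add a a' ha ha' =>
    simp only [map_add, ha, ha']
    abel
  | ι_mul a m ha =>
    rw [map_mul, CliffordAlgebra.involute_ι, neg_mul, map_neg, CliffordAlgebra.contractLeft_ι_mul,
      CliffordAlgebra.contractLeft_ι_mul, ha, map_sub, map_mul, CliffordAlgebra.involute_ι,
      map_smul]
    simp

theorem contractLeft_mem (η : Π x : M, Module.Dual ℝ (S x))
    (hη : ∀ (W : Opens M) (t : Π x, S x), SmoothOn E F t W →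
      ContMDiffOn 𝓘(ℝ, E) 𝓘(ℝ, ℝ) ∞ (fun x => η x (t x)) W)
    (W : Opens M) (f : ExtSec S W) (hf : f ∈ Algebra.adjoin ℝ (generators E F S W)) :
    (fun x : W => CliffordAlgebra.contractLeft (η x) (f x))
      ∈ Algebra.adjoin ℝ (generators E F S W) := by
  induction hf using Algebra.adjoin_induction with
  | mem f hf =>
    obtain ⟨φ, hφ, rfl⟩ | ⟨t, ht, rfl⟩ := hf
    · have : (fun x : W => (CliffordAlgebra.contractLeft (η x) :
          ExteriorAlgebra ℝ (S x) →ₗ[ℝ] ExteriorAlgebra ℝ (S x)) (algebraMap ℝ _ (φ x))) = 0 := by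
        funext x
        exact CliffordAlgebra.contractLeft_algebraMap (0 : QuadraticForm ℝ (S x)) (η x) _
      rw [this]
      exact zero_mem _
    · refine Algebra.subset_adjoin (Or.inl ⟨fun x => η x (t x), hη W t ht, ?_⟩)
      funext x
      exact CliffordAlgebra.contractLeft_ι (0 : QuadraticForm ℝ (S x)) (η x) (t x)
  | algebraMap r =>
    have : (fun x : W => CliffordAlgebra.contractLeft (η x) (algebraMap ℝ (ExtSec S W) r x))
        = 0 := by
      funext x
      exact CliffordAlgebra.contractLeft_algebraMap (0 : QuadraticForm ℝ (S x)) (η x) _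
    rw [this]
    exact zero_mem _
  | add f f' _ _ ha hb =>
    have : (fun x : W => CliffordAlgebra.contractLeft (η x) ((f + f') x))
        = (fun x : W => CliffordAlgebra.contractLeft (η x) (f x))
          + fun x : W => CliffordAlgebra.contractLeft (η x) (f' x) := by
      funext x
      simp
    rw [this]
    exact add_mem ha hb
  | mul f f' hf _ ha hb =>
    have : (fun x : W => CliffordAlgebra.contractLeft (η x) ((f * f') x))
        = (fun x : W => CliffordAlgebra.contractLeft (η x) (f x)) * f'
          + (fun x : W => CliffordAlgebra.involute (f x))
            * fun x : W => CliffordAlgebra.contractLeft (η x) (f' x) := by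
      funext x
      exact contractLeft_mul _ _ _
    rw [this]
    exact add_mem (mul_mem ha (by assumption)) (mul_mem (involute_mem E F S W f hf) hb)

/-- Interior multiplication by a smooth section `η` of `S*`. -/
def interiorMul (η : Π x : M, Module.Dual ℝ (S x))
    (hη : ∀ (W : Opens M) (t : Π x, S x), SmoothOn E F t W →
      ContMDiffOn 𝓘(ℝ, E) 𝓘(ℝ, ℝ) ∞ (fun x => η x (t x)) W) : SheafEnd E F S (⊤ : Opens M) :=
  ⟨fun W =>
    { toFun := fun f => ⟨fun x : W.1 => CliffordAlgebra.contractLeft (η x) (f.1 x),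
        superFunctions_map E F S (fun x a => CliffordAlgebra.contractLeft (η x) a)
          (contractLeft_mem η hη) f.2⟩
      map_add' := fun f f' => by
        ext x
        simp
      map_smul' := fun r f => by
        ext x
        simp }, fun _ _ _ _ => rfl⟩

/-- The odd vector field `X_s = ι(g₁(s, ·))` on `M(S)`. -/
def spinorField (g₁ : FormField E F S) (s : Π x, S x) (hs : SmoothOn E F s ⊤) :
    SheafEnd E F S (⊤ : Opens M) :=
  interiorMul (fun x => g₁.form x (s x)) fun W t ht =>
    g₁.smooth W s t (ContMDiffOn.mono hs (Set.subset_univ _)) ht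

theorem spinorField_isOddDer (g₁ : FormField E F S) (s : Π x, S x) (hs : SmoothOn E F s ⊤) :
    IsOddDer (spinorField g₁ s hs) := by
  constructor
  · ext W f x
    exact contractLeft_involute (g₁.form x (s x)) (f.1 x)
  · intro W a b
    ext x
    exact contractLeft_mul _ _ _

/-! ### The supergroup `G = exp 𝔤` -/

section Supergroup

variable {J₀ J₁ : Type*} [Fintype J₀] [Fintype J₁] [DecidableEq J₀] [DecidableEq J₁]

/-- `𝔤 ⊗ 𝒜(U) ⊆ gl(m|n)(𝒜(U))`: the `𝒜(U)`-module spanned by `𝔤`, where `𝒜(U)` acts on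
supermatrices by `(a x)_ij = (-1)^(|a| |i|) a x_ij`. (With this sign, `𝔤 ⊗ 𝒜(U)` is a super Lie
subalgebra of `gl(m|n)(𝒜(U))`.) -/
def tensorSub (𝔤 : Submodule ℝ (Matrix (J₀ ⊕ J₁) (J₀ ⊕ J₁) ℝ)) (U : Opens M) :
    Submodule ℝ (Matrix (J₀ ⊕ J₁) (J₀ ⊕ J₁) (superFunctions E F S U)) :=
  Submodule.span ℝ {Z | ∃ x ∈ 𝔤, ∃ a : superFunctions E F S U,
    (∀ i j, Z (Sum.inl i) j = x (Sum.inl i) j • a) ∧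
    (∀ i j, Z (Sum.inr i) j = x (Sum.inr i) j • parity E F S U a)}

/-- Even supermatrices: the diagonal blocks have even entries, the off-diagonal ones odd entries. -/
def IsEvenMatrix {U : Opens M}
    (Z : Matrix (J₀ ⊕ J₁) (J₀ ⊕ J₁) (superFunctions E F S U)) : Prop :=
  (∀ i j, parity E F S U (Z (Sum.inl i) (Sum.inl j)) = Z (Sum.inl i) (Sum.inl j)) ∧
  (∀ i j, parity E F S U (Z (Sum.inr i) (Sum.inr j)) = Z (Sum.inr i) (Sum.inr j)) ∧
  (∀ i j, parity E F S U (Z (Sum.inl i) (Sum.inr j)) = -Z (Sum.inl i) (Sum.inr j)) ∧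
  (∀ i j, parity E F S U (Z (Sum.inr i) (Sum.inl j)) = -Z (Sum.inr i) (Sum.inl j))

/-- `H = exp Y = ∑ Y^r / r!`. The series converges at each point `x`, in the finite-dimensional
vector space `∧S_x`, which is expressed by means of the linear functionals on `∧S_x`. -/
def IsExp {J : Type*} [Fintype J] [DecidableEq J] {U : Opens M}
    (Y H : Matrix J J (superFunctions E F S U)) : Prop :=
  ∀ (x : U) (i j : J) (φ : Module.Dual ℝ (ExteriorAlgebra ℝ (S x))),
    HasSum (fun r : ℕ => ((r.factorial : ℝ)⁻¹) * φ (((Y ^ r) i j).1 x)) (φ ((H i j).1 x))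

/-- The group `G(𝒜(U))` generated by the exponentials of the elements of `(𝔤 ⊗ 𝒜(U))_0`. -/
def expGroup (𝔤 : Submodule ℝ (Matrix (J₀ ⊕ J₁) (J₀ ⊕ J₁) ℝ)) (U : Opens M) :
    Subgroup (Matrix (J₀ ⊕ J₁) (J₀ ⊕ J₁) (superFunctions E F S U))ˣ :=
  Subgroup.closure {u | ∃ Y ∈ tensorSub 𝔤 U, IsEvenMatrix Y ∧ IsExp Y u.1}

/-- Restriction of invertible supermatrices. -/
def resUnits {J : Type*} [Fintype J] [DecidableEq J] {U W : Opens M} (h : W ≤ U) :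
    (Matrix J J (superFunctions E F S U))ˣ →* (Matrix J J (superFunctions E F S W))ˣ :=
  Units.map ((res E F S h).mapMatrix : _ →ₐ[ℝ] Matrix J J (superFunctions E F S W)).toMonoidHom

/-- The sheaf of groups defined by `G`, i.e. the sheaf associated with `U ↦ G(𝒜(U))`: invertible
supermatrices over `𝒜(U)` that lie locally in `G(𝒜(W))`. -/
def sheafG (𝔤 : Submodule ℝ (Matrix (J₀ ⊕ J₁) (J₀ ⊕ J₁) ℝ)) (U : Opens M) :
    Set (Matrix (J₀ ⊕ J₁) (J₀ ⊕ J₁) (superFunctions E F S U))ˣ :=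
  {u | ∀ x ∈ U, ∃ (W : Opens M) (h : W ≤ U), x ∈ W ∧ resUnits h u ∈ expGroup 𝔤 W}

/-- An open set `U` is small for a sheaf `ℱ` of tuples of vector fields if the group of sections
over `U` of the sheaf defined by `G` acts simply transitively on `ℱ(U)`. -/
def IsSmall (𝔤 : Submodule ℝ (Matrix (J₀ ⊕ J₁) (J₀ ⊕ J₁) ℝ))
    (ℱ : ∀ U : Opens M, Set (J₀ ⊕ J₁ → SheafEnd E F S U)) (U : Opens M) : Prop :=
  ∀ X ∈ ℱ U, ∀ Y ∈ ℱ U, ∃! u, u ∈ sheafG 𝔤 U ∧ tupleMul X u.1 = Y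

/-- Infinitesimal automorphisms of a `G`-structure `ℱ`, `G = exp 𝔤`: vector fields `X` on `M(S)`
with `L_X Y = ([X, Y_1], …, [X, Y_(m+n)]) ∈ Y (𝔤 ⊗ 𝒜(U))` for all small `U` and `Y ∈ ℱ(U)`. -/
def IsInfinitesimalAutomorphism (𝔤 : Submodule ℝ (Matrix (J₀ ⊕ J₁) (J₀ ⊕ J₁) ℝ))
    (ℱ : ∀ U : Opens M, Set (J₀ ⊕ J₁ → SheafEnd E F S U)) (X : SheafEnd E F S (⊤ : Opens M)) :
    Prop :=
  IsVectorField X ∧ ∀ U : Opens M, IsSmall 𝔤 ℱ U → ∀ Y ∈ ℱ U,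
    ∃ Z ∈ tensorSub 𝔤 U, (fun j => superBracket (restrictEnd le_top X) (Y j)) = tupleMul Y Z

end Supergroup

end Supermanifold

/-! ### The `G`-structure of `M(S)` -/

section Structure

variable [IsManifold 𝓘(ℝ, E) ∞ M] {F : Type*} [NormedAddCommGroup F] [NormedSpace ℝ F]
  {S : M → Type*} [TopologicalSpace (TotalSpace F S)] [∀ x, AddCommGroup (S x)]
  [∀ x, Module ℝ (S x)] [∀ x, TopologicalSpace (S x)] [FiberBundle F S]
  {k l n : ℕ} {g : PseudoMetric E M} {Δ : CliffordModule k l n} (P : SpinStructure F g Δ S)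

namespace SpinStructure

/-- `D = r ∇_X` on `∧S`: the even derivation with `f ↦ r X(f)` on functions and
`t ↦ r ∇_X t` on sections of `S`. -/
def IsCovariantDerivative {U : Opens M} (r : ℝ) (X : Π x : M, TangentSpace 𝓘(ℝ, E) x)
    (D : SheafEnd E F S U) : Prop :=
  IsEvenDer D ∧ ∀ (W : {W : Opens M // W ≤ U}) (f : superFunctions E F S W.1),
    (∀ φ : M → ℝ, ContMDiffOn 𝓘(ℝ, E) 𝓘(ℝ, ℝ) ∞ φ W.1 →
      (∀ x : W.1, f.1 x = algebraMap ℝ _ (φ x)) →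
      ∀ x : W.1, (D.1 W f).1 x = algebraMap ℝ _ (r * mvfderiv 𝓘(ℝ, E) φ x (X x))) ∧
    (∀ t : Π x, S x, SmoothOn E F t W.1 →
      (∀ x : W.1, f.1 x = ExteriorAlgebra.ι ℝ (t x)) →
      ∀ x : W.1, (D.1 W f).1 x = ExteriorAlgebra.ι ℝ (r • P.nabla t x (X x)))

/-- The frame field `ι(b) = (ι(e^i), ι(θ_j))` of `M(S)` that corresponds to the coframe
`b = (e^i, θ_j)` dual to a spin frame `c = (e_i, θ^j)`: `ι(θ_j)` is interior multiplication, and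
`ι(e^i) = ε_i ∇_(e_i)`, because `e^i` corresponds to `ε_i e_i` under `T*M ≅ TM`. -/
def IsFrameField (c : LocalTuple E k l n S) (hc : c.IsAdapted F g Δ P.ρ)
    (X : Idx k l n → SheafEnd E F S c.dom) : Prop :=
  (∀ i, P.IsCovariantDerivative (sgn k l i) (c.e i) (X (Sum.inl i))) ∧
  (∀ j, IsInterior (hc.frame_θ.coeff j) (X (Sum.inr j)))

/-- The `G`-structure `ℱ_G` on `M(S)`: the sheaf of frame fields that are locally of the form
`ι(b) u`, where `b` is dual to a spin frame and `u` belongs to `G(𝒜(W))`. (The factor from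
`exp spin(k, l)` is contained in `G(𝒜(W))`.) -/
def sheafF (𝔤 : Submodule ℝ (Matrix (Idx k l n) (Idx k l n) ℝ)) (U : Opens M) :
    Set (Idx k l n → SheafEnd E F S U) :=
  {Y | ∀ x ∈ U, ∃ c, ∃ hc : c ∈ P.spinFrames, ∃ h : c.dom ≤ U, x ∈ c.dom ∧
    ∃ X, P.IsFrameField c hc.1 X ∧ ∃ u ∈ expGroup 𝔤 c.dom,
      (fun j => restrictEnd h (Y j)) = tupleMul X u.1}

variable [FiniteDimensional ℝ E]

/-- The super Lie algebra `𝔤 = α(p(V_p))^b ⊆ gl(m|n)`, where `V_p = T_pM + S_p`, and `b` is the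
basis of `V_p*` dual to the value at `p` of a spin frame `c`. -/
def lieAlg (g₁ : FormField E F S) (c : LocalTuple E k l n S) (hc : c ∈ P.spinFrames)
    (p : M) (hp : p ∈ c.dom) : Submodule ℝ (Matrix (Idx k l n) (Idx k l n) ℝ) :=
  coadjointMatrices (g.form p) (g.nondeg p) (P.ρ p) (g₁.form p)
    ((hc.1.frame_e.toBasisAt hp).prod (hc.1.frame_θ.toBasisAt hp))

/-- Killing vector fields on `(M(S), g₀ + g₁)`: the infinitesimal automorphisms of `ℱ_G`. -/
def IsKillingVectorField (𝔤 : Submodule ℝ (Matrix (Idx k l n) (Idx k l n) ℝ))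
    (X : SheafEnd E F S (⊤ : Opens M)) : Prop :=
  IsInfinitesimalAutomorphism 𝔤 (P.sheafF 𝔤) X

end SpinStructure

end Structure

end Geometry

end SpinSuper

end

/-!
# Killing vector fields on `(M, g₀ + g₁)` and twistor spinors

Let `c = (e_i, θ^j)` be a spin frame, `ε_i = g₀(e_i, e_i)`, and let `ι(c)` be the corresponding
frame field of the supermanifold, so that `ι(e^i) = ε_i ∇_{e_i}` and `ι(θ_j)` is interior
multiplication. The theorem rests on the brackets (`superBracket_spinorField`)

  `[X_s, ι(e^i)] = -ε_i ι(g₁(∇_{e_i} s, ·))`, `[X_s, ι(θ_j)] = 0`.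

The first one holds because `g₁` is parallel, the second one because interior multiplications
anticommute. Both sides are superderivations, which are determined by their values on functions and
on sections of `S`. Hence `[X_s, ι(c)] = ι(c) N` with a matrix `N` of smooth functions, whose only
block is the lower left one, with the entries `-ε_i g₁(∇_{e_i} s, θ^r)`.

On the other hand, the computation of the coadjoint representation (`coadjointMatrices_eq`) shows
that `𝔤` consists of the sums of a block diagonal matrix from `spin(k, l)` and a matrix with the
lower left block `-ε_i g₁(ρ(e_i) q, θ^r)`, where `q` is a spinor. As `g₁` is non-degenerate, `N(x)`
belongs to `𝔤` if and only if there is `q ∈ S_x` with `∇_v s = ρ(v) q` for all `v ∈ T_xM₀`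
(`nablaMatrix_mem_iff`). The spinor `q` depends smoothly on `x`: it is `-ε_i ρ(e_i) ∇_{e_i} s` for
any `i`.

This argument presupposes a number of facts.

* `𝔤` is one and the same space of matrices for all spin frames and all points. The matrix of `g₁`
  is locally constant in a spin frame, because the matrix of `∇` in this frame belongs to
  `spin(k, l)`, under which a suitable form is invariant; it does not change with the spin frame
  for the same reason; and `M₀` is connected (`formInBasis_eq`).
* The equation `[X_s, Y] ∈ Y (𝔤 ⊗ 𝒜)` has to be checked for all `Y = ι(c) u` with `u ∈ G`. We have
  `[X_s, Y] = Y (u⁻¹ N u + u⁻¹ X_s(u))`, and `Ad(u⁻¹)` preserves `𝔤 ⊗ 𝒜`, which also contains the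
  logarithmic derivative `u⁻¹ X_s(u)` (`isGauge_of_mem_expGroup`). For `u = exp Z` both statements
  follow from linear differential equations in a finite-dimensional algebra, the fibre
  `gl(m|n)(∧S_x)`. They hold because `𝔤 ⊗ 𝒜` is preserved by commutators with its even elements, as
  `𝔤` is a super Lie algebra with `[𝔤₁, 𝔤₁] = 0`.
* The frame fields `ι(c)` exist and are linearly independent over `𝒜` (`exists_isFrameField`,
  `IsFrameField.isIndependent`). If `c = b h` with a spin transformation `h`, then `ι(c) = ι(b) v`,
  where `v` is the inverse transpose of `h`, and `v` belongs to `G` locally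
  (`IsFrameField.eq_tupleMul`). It follows that every open set is small (`isSmall`), so that the
  condition on Killing vector fields is not vacuous and can be evaluated on the frame fields `ι(c)`
  themselves.
-/

noncomputable section

namespace SpinSuper

/-! ### Exponentials and Lie subalgebras of finite-dimensional algebras -/

section Exponential

open NormedSpace

variable {A : Type*} [NormedRing A] [NormedAlgebra ℝ A] [FiniteDimensional ℝ A]

theorem mem_of_hasDerivAt_mem {V : Type*} [NormedAddCommGroup V] [NormedSpace ℝ V]
    [FiniteDimensional ℝ V] (𝔥 : Submodule ℝ V) (K K' : ℝ → V)
    (hK : ∀ s, HasDerivAt K (K' s) s) (hK' : ∀ s, K' s ∈ 𝔥) (h0 : K 0 ∈ 𝔥) (s : ℝ) :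
    K s ∈ 𝔥 := by
  rw [← Subspace.dualAnnihilator_dualCoannihilator_eq (W := 𝔥), Submodule.mem_dualCoannihilator]
  intro ℓ hℓ
  rw [Submodule.mem_dualAnnihilator] at hℓ
  have hd : ∀ r, HasDerivAt (fun r => ℓ (K r)) 0 r := fun r => by
    have := (LinearMap.toContinuousLinearMap ℓ).hasFDerivAt.comp_hasDerivAt r (hK r)
    have h2 : LinearMap.toContinuousLinearMap ℓ (K' r) = 0 := hℓ _ (hK' r)
    rw [h2] at this
    exact this
  have hc := is_const_of_deriv_eq_zero (fun r => (hd r).differentiableAt)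
    (fun r => (hd r).deriv) s 0
  rw [hc]
  exact hℓ _ h0

theorem hasDerivAt_exp_smul (Y : A) (s : ℝ) :
    HasDerivAt (fun s : ℝ => exp (s • Y)) (Y * exp (s • Y)) s := by
  have : CompleteSpace A := FiniteDimensional.complete ℝ A
  exact hasDerivAt_exp_smul_const' (𝕂 := ℝ) Y s

theorem hasDerivAt_exp_smul' (Y : A) (s : ℝ) :
    HasDerivAt (fun s : ℝ => exp (s • Y)) (exp (s • Y) * Y) s := by
  have : CompleteSpace A := FiniteDimensional.complete ℝ A
  exact hasDerivAt_exp_smul_const (𝕂 := ℝ) Y s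

theorem exp_neg_mul_exp (Y : A) : exp (-Y) * exp Y = 1 := by
  have : CompleteSpace A := FiniteDimensional.complete ℝ A
  let _ : NormedAlgebra ℚ A := NormedAlgebra.restrictScalars ℚ ℝ A
  rw [← exp_add_of_commute (Commute.neg_left (Commute.refl Y)), neg_add_cancel, exp_zero]

theorem exp_mul_exp_neg (Y : A) : exp Y * exp (-Y) = 1 := by
  have := exp_neg_mul_exp (-Y)
  rwa [neg_neg] at this

/-- Linear differential equations with constant coefficients are solved by the exponential. -/
theorem eq_exp_apply_of_hasDerivAt {V : Type*} [NormedAddCommGroup V] [NormedSpace ℝ V]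
    [CompleteSpace V] (T : V →L[ℝ] V) (f : ℝ → V) (hf : ∀ s, HasDerivAt f (T (f s)) s) :
    f 1 = exp T (f 0) := by
  have hg : ∀ s, HasDerivAt (fun s : ℝ => exp (s • (-T)) (f s)) 0 s := by
    intro s
    have h := (hasDerivAt_exp_smul_const (𝕂 := ℝ) (-T) s).clm_apply (hf s)
    refine h.congr_deriv ?_
    change exp (s • (-T)) (-(T (f s))) + _ = 0
    rw [map_neg, neg_add_cancel]
  have hc := is_const_of_deriv_eq_zero (fun r => (hg r).differentiableAt)
    (fun r => (hg r).deriv) 1 0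
  simp only [one_smul, zero_smul, exp_zero, one_apply_eq_self] at hc
  rw [← hc]
  have e1 : exp T * exp (-T) = 1 := by
    let _ : NormedAlgebra ℚ (V →L[ℝ] V) := NormedAlgebra.restrictScalars ℚ ℝ _
    rw [← exp_add_of_commute (Commute.neg_right (Commute.refl T)), add_neg_cancel, exp_zero]
  exact (congrArg (fun L : V →L[ℝ] V => L (f 1)) e1).symm

theorem exp_apply_mem {V : Type*} [NormedAddCommGroup V] [NormedSpace ℝ V]
    [FiniteDimensional ℝ V] (𝔥 : Submodule ℝ V) (T : V →L[ℝ] V) (hT : ∀ v ∈ 𝔥, T v ∈ 𝔥)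
    {v : V} (hv : v ∈ 𝔥) : exp T v ∈ 𝔥 := by
  have : CompleteSpace V := FiniteDimensional.complete ℝ V
  have hpow : ∀ r : ℕ, (T ^ r) v ∈ 𝔥 := by
    intro r
    induction r with
    | zero => simpa using hv
    | succ r ih =>
      rw [pow_succ']
      exact hT ((T ^ r) v) ih
  have hs := (ContinuousLinearMap.apply ℝ V v).hasSum (exp_series_hasSum_exp' (𝕂 := ℝ) T)
  have hc : IsClosed (𝔥 : Set V) := Submodule.closed_of_finiteDimensional 𝔥
  exact hc.mem_of_tendsto hs (Filter.Eventually.of_forall fun I =>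
    𝔥.sum_mem fun r _ => 𝔥.smul_mem _ (hpow r))

/-- `Ad(exp(-Y))` preserves every subspace that is preserved by `ad Y`: the curve
`f(s) = exp(-sY) Z exp(sY)` solves the linear equation `f' = [f, Y]`. -/
theorem exp_conj_mem (𝔥 : Submodule ℝ A) (Y : A) (hY : ∀ Z ∈ 𝔥, Z * Y - Y * Z ∈ 𝔥)
    {Z : A} (hZ : Z ∈ 𝔥) : exp (-Y) * Z * exp Y ∈ 𝔥 := by
  have : CompleteSpace A := FiniteDimensional.complete ℝ A
  have h1 := eq_exp_apply_of_hasDerivAt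
    ((ContinuousLinearMap.mul ℝ A).flip Y - ContinuousLinearMap.mul ℝ A Y)
    (fun s => exp (s • (-Y)) * Z * exp (s • Y)) fun s => by
      refine (((hasDerivAt_exp_smul (-Y) s).mul_const Z).mul
        (hasDerivAt_exp_smul' Y s)).congr_deriv ?_
      change _ = exp (s • (-Y)) * Z * exp (s • Y) * Y - Y * (exp (s • (-Y)) * Z * exp (s • Y))
      simp only [neg_mul, mul_assoc]
      abel
  simp only [one_smul, zero_smul, exp_zero, one_mul, mul_one] at h1
  rw [h1]
  exact exp_apply_mem 𝔥 _ hY hZ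

theorem exp_conj_mem' (𝔥 : Submodule ℝ A) (Y : A) (hY : ∀ Z ∈ 𝔥, Z * Y - Y * Z ∈ 𝔥)
    {Z : A} (hZ : Z ∈ 𝔥) : exp Y * Z * exp (-Y) ∈ 𝔥 := by
  have := exp_conj_mem 𝔥 (-Y) (fun Z hZ => by
    have := 𝔥.neg_mem (hY Z hZ)
    convert this using 1
    simp only [mul_neg, neg_mul]
    abel) hZ
  rwa [neg_neg] at this

/-- The logarithmic derivative of `exp Y` along a derivation `δ` lies in every subspace that
contains `δ Y` and is preserved by `ad Y`: the curve `K(s) = exp(-sY) δ(exp(sY))` has the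
derivative `exp(-sY) δ(Y) exp(sY)`. -/
theorem exp_neg_mul_derivation_exp_mem (𝔥 : Submodule ℝ A) (Y : A)
    (hY : ∀ Z ∈ 𝔥, Z * Y - Y * Z ∈ 𝔥) (δ : A →ₗ[ℝ] A)
    (hδ : ∀ a, δ (Y * a) = δ Y * a + Y * δ a) (hδ1 : δ 1 = 0) (hδY : δ Y ∈ 𝔥) :
    exp (-Y) * δ (exp Y) ∈ 𝔥 := by
  have : CompleteSpace A := FiniteDimensional.complete ℝ A
  have hY' : ∀ s : ℝ, ∀ Z ∈ 𝔥, Z * (s • Y) - (s • Y) * Z ∈ 𝔥 := fun s Z hZ => by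
    have := 𝔥.smul_mem s (hY Z hZ)
    rwa [smul_sub, ← mul_smul_comm, ← smul_mul_assoc] at this
  have h := mem_of_hasDerivAt_mem 𝔥 (fun s : ℝ => exp (s • (-Y)) * δ (exp (s • Y)))
    (fun s => exp (s • (-Y)) * δ Y * exp (s • Y)) ?_ ?_ ?_ 1
  · simpa using h
  · intro s
    have h1 : HasDerivAt (fun s : ℝ => δ (exp (s • Y))) (δ (Y * exp (s • Y))) s :=
      (LinearMap.toContinuousLinearMap δ).hasFDerivAt.comp_hasDerivAt s (hasDerivAt_exp_smul Y s)
    have h2 := (hasDerivAt_exp_smul' (-Y) s).mul h1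
    refine h2.congr_deriv ?_
    rw [hδ]
    simp only [mul_neg, neg_mul, mul_add, mul_assoc]
    abel
  · intro s
    rw [smul_neg]
    exact exp_conj_mem 𝔥 (s • Y) (hY' s) hδY
  · simp [hδ1]

/-- The logarithmic derivative of `exp` at `Y` in the direction `Z` lies in every subspace that
contains `Z` and is preserved by `ad Y`. -/
theorem exp_neg_mul_fderiv_exp_mem (𝔥 : Submodule ℝ A) (Y Z : A)
    (hY : ∀ Z ∈ 𝔥, Z * Y - Y * Z ∈ 𝔥) (hZ : Z ∈ 𝔥) :
    exp (-Y) * fderiv ℝ exp Y Z ∈ 𝔥 := by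
  have : CompleteSpace A := FiniteDimensional.complete ℝ A
  let _ : NormedAlgebra ℚ A := NormedAlgebra.restrictScalars ℚ ℝ A
  have hY' : ∀ s : ℝ, ∀ Z ∈ 𝔥, Z * (s • Y) - (s • Y) * Z ∈ 𝔥 := fun s Z hZ => by
    have := 𝔥.smul_mem s (hY Z hZ)
    rwa [smul_sub, ← mul_smul_comm, ← smul_mul_assoc] at this
  have hdiff : ∀ W : A, HasFDerivAt exp (fderiv ℝ exp W) W := fun W =>
    (exp_analytic (𝕂 := ℝ) W).differentiableAt.hasFDerivAt
  -- `ψ(s)` is the derivative of `exp(s(Y + tZ))` with respect to `t` at `t = 0`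
  let ψ : ℝ → A := fun s => fderiv ℝ exp (s • Y) (s • Z)
  have hψ : ∀ s : ℝ, HasDerivAt (fun t : ℝ => exp (s • (Y + t • Z))) (ψ s) 0 := by
    intro s
    have h1 : HasDerivAt (fun t : ℝ => s • (Y + t • Z)) (s • Z) 0 := by
      have := (((hasDerivAt_id (0 : ℝ)).smul_const Z).const_add Y).const_smul s
      exact this.congr_deriv (by rw [one_smul])
    have h2 : HasFDerivAt exp (fderiv ℝ exp (s • Y)) (s • (Y + (0 : ℝ) • Z)) := by
      simpa using hdiff (s • Y)
    exact h2.comp_hasDerivAt (0 : ℝ) h1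
  have hcoc : ∀ s r : ℝ, ψ (s + r) = ψ s * exp (r • Y) + exp (s • Y) * ψ r := by
    intro s r
    have h1 := (hψ s).mul (hψ r)
    have h2 : (fun t : ℝ => exp (s • (Y + t • Z))) * (fun t : ℝ => exp (r • (Y + t • Z)))
        = fun t : ℝ => exp ((s + r) • (Y + t • Z)) := by
      funext t
      simp only [Pi.mul_apply]
      rw [add_smul, exp_add_of_commute]
      exact ((Commute.refl _).smul_left s).smul_right r
    have h3 := h1.unique (h2 ▸ hψ (s + r))
    rw [← h3]
    simp
  have hψ0 : HasDerivAt ψ Z 0 := by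
    have hcont : Continuous (fun r : ℝ => fderiv ℝ exp (r • Y) Z) := by
      have : ContDiff ℝ 1 (exp : A → A) :=
        contDiff_iff_contDiffAt.2 fun W => (exp_analytic (𝕂 := ℝ) W).contDiffAt
      exact ((this.continuous_fderiv one_ne_zero).comp
        (continuous_id.smul continuous_const)).clm_apply continuous_const
    rw [hasDerivAt_iff_tendsto_slope]
    have h1 : Filter.Tendsto (fun r : ℝ => fderiv ℝ exp (r • Y) Z) (nhdsWithin 0 {0}ᶜ)
        (nhds Z) := by
      have h2 := (hcont.tendsto 0).mono_left (nhdsWithin_le_nhds (s := ({0}ᶜ : Set ℝ)))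
      simpa [(hasFDerivAt_exp_zero (𝕂 := ℝ) (𝔸 := A)).fderiv] using h2
    refine h1.congr' ?_
    filter_upwards [self_mem_nhdsWithin] with r hr
    have hr' : r ≠ 0 := hr
    simp [slope_def_module, ψ, smul_smul, hr']
  have hψs : ∀ s, HasDerivAt ψ (ψ s * Y + exp (s • Y) * Z) s := by
    intro s
    have h1 : HasDerivAt (fun r : ℝ => ψ s * exp (r • Y) + exp (s • Y) * ψ r)
        (ψ s * Y + exp (s • Y) * Z) 0 := by
      have h2 := ((hasDerivAt_exp_smul Y 0).const_mul (ψ s)).add (hψ0.const_mul (exp (s • Y)))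
      exact h2.congr_deriv (by simp)
    have h2 : HasDerivAt (fun r : ℝ => ψ (s + r)) (ψ s * Y + exp (s • Y) * Z) 0 := by
      simpa only [hcoc] using h1
    have h3 := HasDerivAt.comp_sub_const (f := fun r : ℝ => ψ (s + r)) s s (by simpa using h2)
    simpa using h3
  have h := mem_of_hasDerivAt_mem 𝔥 (fun s : ℝ => ψ s * exp (s • (-Y)))
    (fun s => exp (s • Y) * Z * exp (s • (-Y))) ?_ ?_ ?_ 1
  · have h2 := exp_conj_mem 𝔥 Y hY h
    have h3 : exp (-Y) * (ψ 1 * exp ((1 : ℝ) • -Y)) * exp Y = exp (-Y) * fderiv ℝ exp Y Z := by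
      simp only [ψ, one_smul]
      rw [mul_assoc, mul_assoc, exp_neg_mul_exp, mul_one]
    rwa [h3] at h2
  · intro s
    have h2 := (hψs s).mul (hasDerivAt_exp_smul (-Y) s)
    refine h2.congr_deriv ?_
    simp only [neg_mul, mul_neg, add_mul, mul_assoc]
    abel
  · intro s
    rw [smul_neg]
    exact exp_conj_mem' 𝔥 (s • Y) (hY' s) hZ
  · simp [ψ]

end Exponential

/-! ### The spin Lie algebra and its invariant forms -/

section SpinAlgebra

variable {V₀ V₁ : Type*} [AddCommGroup V₀] [Module ℝ V₀] [AddCommGroup V₁] [Module ℝ V₁]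
  {B : LinearMap.BilinForm ℝ V₀} {ρ : V₀ →ₗ[ℝ] Module.End ℝ V₁}

theorem wedge_apply (v w u : V₀) : wedge B v w u = B v u • w - B w u • v := by
  simp [wedge]

theorem IsClifford.mul_add_mul (h : IsClifford B ρ) (hB : ∀ v w, B v w = B w v) (v w : V₀) :
    ρ v * ρ w + ρ w * ρ v = -(2 * B v w) • (1 : Module.End ℝ V₁) := by
  have h1 := h (v + w)
  have h2 := h v
  have h3 := h w
  simp only [map_add, add_mul, mul_add, LinearMap.add_apply, hB w v] at h1
  rw [h2, h3] at h1
  have h4 : ρ v * ρ w + ρ w * ρ v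
      = -(B v v + B v w + (B v w + B w w)) • (1 : Module.End ℝ V₁)
        - (-(B v v) • (1 : Module.End ℝ V₁) + -(B w w) • (1 : Module.End ℝ V₁)) := by
    rw [← h1]
    abel
  rw [h4]
  module

/-- Commutators with elements of `spin(V₀)` rotate Clifford multiplication. -/
theorem spinLie_commutator (h : IsClifford B ρ) (hB : ∀ v w, B v w = B w v)
    {X : Module.End ℝ V₀ × Module.End ℝ V₁} (hX : X ∈ spinLie B ρ) (u : V₀) :
    X.2 * ρ u - ρ u * X.2 = ρ (X.1 u) := by
  induction hX using Submodule.span_induction with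
  | mem X hX =>
    obtain ⟨v, w, rfl⟩ := hX
    have h1 := h.mul_add_mul hB v w
    have h2 := h.mul_add_mul hB v u
    have h3 := h.mul_add_mul hB w u
    have e1 : ρ w * ρ v = -(2 * B v w) • (1 : Module.End ℝ V₁) - ρ v * ρ w := by rw [← h1]; abel
    have e2 : ρ u * ρ v = -(2 * B v u) • (1 : Module.End ℝ V₁) - ρ v * ρ u := by rw [← h2]; abel
    have e3 : ρ w * ρ u = -(2 * B w u) • (1 : Module.End ℝ V₁) - ρ u * ρ w := by rw [← h3]; abel
    have e4 : ρ v * ρ w * ρ u - ρ u * (ρ v * ρ w) = (2 * B v u) • ρ w - (2 * B w u) • ρ v := by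
      rw [mul_assoc, e3, ← mul_assoc (ρ u), e2, mul_sub, sub_mul, mul_smul_comm, mul_one,
        smul_mul_assoc, one_mul, mul_assoc]
      module
    dsimp only
    rw [wedge_apply, e1, map_sub, map_smul, map_smul]
    have e5 : (4⁻¹ : ℝ) • (ρ v * ρ w - (-(2 * B v w) • (1 : Module.End ℝ V₁) - ρ v * ρ w)) * ρ u
        - ρ u * (4⁻¹ : ℝ) • (ρ v * ρ w - (-(2 * B v w) • (1 : Module.End ℝ V₁) - ρ v * ρ w))
        = (2⁻¹ : ℝ) • (ρ v * ρ w * ρ u - ρ u * (ρ v * ρ w)) := by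
      simp only [smul_mul_assoc, mul_smul_comm, sub_mul, mul_sub, one_mul, mul_one]
      module
    rw [e5, e4]
    module
  | zero => simp
  | add X Y _ _ hX hY =>
    simp only [Prod.snd_add, Prod.fst_add, add_mul, mul_add, LinearMap.add_apply, map_add, ← hX,
      ← hY]
    abel
  | smul r X _ hX =>
    simp only [Prod.smul_snd, Prod.smul_fst, smul_mul_assoc, mul_smul_comm, LinearMap.smul_apply,
      map_smul, ← hX, smul_sub]

theorem spinLie_skew (hB : ∀ v w, B v w = B w v)
    {X : Module.End ℝ V₀ × Module.End ℝ V₁} (hX : X ∈ spinLie B ρ) (u w : V₀) :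
    B (X.1 u) w = -B u (X.1 w) := by
  induction hX using Submodule.span_induction with
  | mem X hX =>
    obtain ⟨a, b, rfl⟩ := hX
    simp only [wedge_apply, map_sub, map_smul, LinearMap.sub_apply, LinearMap.smul_apply,
      smul_eq_mul, hB u a, hB u b]
    ring
  | zero => simp
  | add X Y _ _ hX hY =>
    simp only [Prod.fst_add, LinearMap.add_apply, map_add, hX, hY]
    ring
  | smul r X _ hX =>
    simp only [Prod.smul_fst, LinearMap.smul_apply, map_smul, hX, smul_eq_mul]
    ring

theorem spinLie_bracket_mem (h : IsClifford B ρ) (hB : ∀ v w, B v w = B w v)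
    {X Y : Module.End ℝ V₀ × Module.End ℝ V₁} (hX : X ∈ spinLie B ρ) (hY : Y ∈ spinLie B ρ) :
    X * Y - Y * X ∈ spinLie B ρ := by
  have hX2 := spinLie_commutator h hB hX
  have hX1 := spinLie_skew hB hX
  induction hY using Submodule.span_induction with
  | mem Y hY =>
    obtain ⟨a, b, rfl⟩ := hY
    have key : X * (wedge B a b, (4⁻¹ : ℝ) • (ρ a * ρ b - ρ b * ρ a))
        - (wedge B a b, (4⁻¹ : ℝ) • (ρ a * ρ b - ρ b * ρ a)) * X
        = (wedge B (X.1 a) b, (4⁻¹ : ℝ) • (ρ (X.1 a) * ρ b - ρ b * ρ (X.1 a)))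
          + (wedge B a (X.1 b), (4⁻¹ : ℝ) • (ρ a * ρ (X.1 b) - ρ (X.1 b) * ρ a)) := by
      refine Prod.ext ?_ ?_
      · refine LinearMap.ext fun u => ?_
        simp only [Prod.fst_sub, Prod.fst_mul, Prod.fst_add, LinearMap.sub_apply,
          Module.End.mul_apply, LinearMap.add_apply, wedge_apply, map_sub, map_smul, hX1]
        module
      · simp only [Prod.snd_sub, Prod.snd_mul, Prod.snd_add, ← hX2, sub_mul, mul_sub,
          mul_smul_comm, smul_mul_assoc, mul_assoc]
        module
    rw [key]
    exact add_mem (Submodule.subset_span ⟨_, _, rfl⟩) (Submodule.subset_span ⟨_, _, rfl⟩)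
  | zero => simp
  | add Y Z _ _ hY hZ =>
    have : X * (Y + Z) - (Y + Z) * X = (X * Y - Y * X) + (X * Z - Z * X) := by
      rw [mul_add, add_mul]; abel
    rw [this]
    exact add_mem hY hZ
  | smul r Y _ hY =>
    have : X * (r • Y) - (r • Y) * X = r • (X * Y - Y * X) := by
      rw [mul_smul_comm, smul_mul_assoc, smul_sub]
    rw [this]
    exact Submodule.smul_mem _ r hY

theorem IsSuitable.mul_apply {β : LinearMap.BilinForm ℝ V₁} (hβ : IsSuitable ρ β) (v w : V₀)
    (s t : V₁) : β (ρ v (ρ w s)) t = β s (ρ w (ρ v t)) := by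
  obtain ⟨σ, τ, -, hτ, -, h, -⟩ := hβ
  rw [h, h, ← mul_assoc]
  obtain rfl | rfl := hτ <;> norm_num

/-- Suitable bilinear forms are invariant under `spin(V₀)`. -/
theorem IsSuitable.spinLie_skew {β : LinearMap.BilinForm ℝ V₁} (hβ : IsSuitable ρ β)
    {X : Module.End ℝ V₀ × Module.End ℝ V₁} (hX : X ∈ spinLie B ρ) (s t : V₁) :
    β (X.2 s) t = -β s (X.2 t) := by
  induction hX using Submodule.span_induction with
  | mem X hX =>
    obtain ⟨v, w, rfl⟩ := hX
    simp only [LinearMap.smul_apply, LinearMap.sub_apply, Module.End.mul_apply, map_smul, map_sub,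
      hβ.mul_apply, smul_eq_mul]
    ring
  | zero => simp
  | add X Y _ _ hX hY =>
    simp only [Prod.snd_add, LinearMap.add_apply, map_add, hX, hY]
    ring
  | smul r X _ hX =>
    simp only [Prod.smul_snd, LinearMap.smul_apply, map_smul, hX, smul_eq_mul]
    ring

/-- An element of `spin(V₀)` is determined by the rotation that it induces on `V₀`. -/
theorem spinLie_snd_eq {ι : Type*} [Fintype ι] (e : ι → V₀) (ε : ι → ℝ)
    (he : ∀ v, v = ∑ i, ε i • B v (e i) • e i)
    {X : Module.End ℝ V₀ × Module.End ℝ V₁} (hX : X ∈ spinLie B ρ) :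
    X.2 = (4⁻¹ : ℝ) • ∑ i, ε i • (ρ (e i) * ρ (X.1 (e i))) := by
  induction hX using Submodule.span_induction with
  | mem X hX =>
    obtain ⟨v, w, rfl⟩ := hX
    dsimp only
    congr 1
    have hv : ρ v = ∑ i, ε i • B v (e i) • ρ (e i) := by
      conv_lhs => rw [he v]
      simp
    have hw : ρ w = ∑ i, ε i • B w (e i) • ρ (e i) := by
      conv_lhs => rw [he w]
      simp
    calc ρ v * ρ w - ρ w * ρ v
        = (∑ i, ε i • B v (e i) • ρ (e i)) * ρ w - (∑ i, ε i • B w (e i) • ρ (e i)) * ρ v := by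
          rw [← hv, ← hw]
      _ = _ := by
          rw [Finset.sum_mul, Finset.sum_mul, ← Finset.sum_sub_distrib]
          refine Finset.sum_congr rfl fun i _ => ?_
          rw [wedge_apply, map_sub, map_smul, map_smul, mul_sub]
          simp only [smul_mul_assoc, mul_smul_comm, smul_sub]
  | zero => simp
  | add X Y _ _ hX hY =>
    simp only [Prod.snd_add, Prod.fst_add, LinearMap.add_apply, map_add, mul_add, smul_add,
      Finset.sum_add_distrib, ← hX, ← hY]
  | smul r X _ hX =>
    rw [Prod.smul_snd, hX, smul_comm, Finset.smul_sum]
    congr 1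
    refine Finset.sum_congr rfl fun i _ => ?_
    rw [Prod.smul_fst, LinearMap.smul_apply, map_smul, mul_smul_comm, smul_comm]

end SpinAlgebra

/-! ### The super Lie algebra in a spin frame -/

section ModelAlgebra

variable {k l n : ℕ} (Δ : CliffordModule k l n)

theorem sgn_mul_self (i : EvenIdx k l) : sgn k l i * sgn k l i = 1 := by
  cases i <;> simp [sgn]

theorem sgn_ne_zero (i : EvenIdx k l) : sgn k l i ≠ 0 := by
  cases i <;> simp [sgn]

theorem toMatrix'_single {p r : Type*} [Fintype r] [DecidableEq r] (f : (r → ℝ) →ₗ[ℝ] (p → ℝ))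
    (i : p) (j : r) : LinearMap.toMatrix' f i j = f (Pi.single j 1) i := by
  rw [LinearMap.toMatrix'_apply]

theorem modelForm_apply (u v : EvenIdx k l → ℝ) :
    modelForm k l u v = ∑ i, sgn k l i * u i * v i := by
  rw [modelForm, Matrix.toBilin'_apply']
  simp only [dotProduct, Matrix.mulVec_diagonal]
  exact Finset.sum_congr rfl fun i _ => by ring

theorem modelForm_comm (u v : EvenIdx k l → ℝ) : modelForm k l u v = modelForm k l v u := by
  rw [modelForm_apply, modelForm_apply]
  exact Finset.sum_congr rfl fun i _ => by ring

theorem modelForm_single (u : EvenIdx k l → ℝ) (i : EvenIdx k l) :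
    modelForm k l u (Pi.single i 1) = sgn k l i * u i := by
  rw [modelForm_apply, Finset.sum_eq_single i] <;> simp +contextual

/-- The matrix in `gl(m|n)` of `α(A)`, `A ∈ spin(k, l)`. -/
def rotationMatrix (A : Module.End ℝ (EvenIdx k l → ℝ) × Module.End ℝ (Fin n → ℝ)) :
    Matrix (Idx k l n) (Idx k l n) ℝ :=
  Matrix.fromBlocks (-(LinearMap.toMatrix' A.1).transpose) 0 0
    (-(LinearMap.toMatrix' A.2).transpose)

/-- The matrix in `gl(m|n)` of `α(q)` for a spinor `q`, where `G` is the form `g₁` in a spin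
frame. -/
def spinorMatrix (G : LinearMap.BilinForm ℝ (Fin n → ℝ)) (q : Fin n → ℝ) :
    Matrix (Idx k l n) (Idx k l n) ℝ :=
  Matrix.fromBlocks 0 0
    (Matrix.of fun r i => -(sgn k l i * G (Δ.ρ (Pi.single i 1) q) (Pi.single r 1))) 0

/-- The super Lie algebra `𝔤` as a space of matrices that depends on a bilinear form `G` on the
spinor module. -/
def modelLie (G : LinearMap.BilinForm ℝ (Fin n → ℝ)) :
    Submodule ℝ (Matrix (Idx k l n) (Idx k l n) ℝ) where
  carrier := {N | ∃ A ∈ spinLie (modelForm k l) Δ.ρ, ∃ q,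
    N = rotationMatrix A + spinorMatrix Δ G q}
  zero_mem' := ⟨0, zero_mem _, 0, by ext (i | i) (j | j) <;> simp [rotationMatrix, spinorMatrix]⟩
  add_mem' := by
    rintro _ _ ⟨A, hA, q, rfl⟩ ⟨A', hA', q', rfl⟩
    refine ⟨A + A', add_mem hA hA', q + q', ?_⟩
    ext (i | i) (j | j) <;> simp [rotationMatrix, spinorMatrix] <;> ring
  smul_mem' := by
    rintro r _ ⟨A, hA, q, rfl⟩
    refine ⟨r • A, Submodule.smul_mem _ r hA, r • q, ?_⟩
    ext (i | i) (j | j) <;> simp [rotationMatrix, spinorMatrix]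
    ring

variable {Δ} {G : LinearMap.BilinForm ℝ (Fin n → ℝ)}

theorem rotationMatrix_mem {A : Module.End ℝ (EvenIdx k l → ℝ) × Module.End ℝ (Fin n → ℝ)}
    (hA : A ∈ spinLie (modelForm k l) Δ.ρ) : rotationMatrix A ∈ modelLie Δ G :=
  ⟨A, hA, 0, by ext (i | i) (j | j) <;> simp [rotationMatrix, spinorMatrix]⟩

theorem spinorMatrix_mem (q : Fin n → ℝ) : spinorMatrix Δ G q ∈ modelLie Δ G :=
  ⟨0, zero_mem _, q, by ext (i | i) (j | j) <;> simp [rotationMatrix, spinorMatrix]⟩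

theorem rotationMatrix_commutator
    (A A' : Module.End ℝ (EvenIdx k l → ℝ) × Module.End ℝ (Fin n → ℝ)) :
    rotationMatrix A * rotationMatrix A' - rotationMatrix A' * rotationMatrix A
      = rotationMatrix (A * A' - A' * A) := by
  simp only [rotationMatrix, Matrix.fromBlocks_multiply, Matrix.mul_zero, Matrix.zero_mul,
    add_zero, zero_add, Prod.fst_sub, Prod.snd_sub, Prod.fst_mul, Prod.snd_mul, map_sub,
    LinearMap.toMatrix'_mul, Matrix.transpose_sub, Matrix.transpose_mul]
  ext (i | i) (j | j) <;> simp

theorem rotationMatrix_spinorMatrix_commutator (hG : IsSuitable Δ.ρ G)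
    {A : Module.End ℝ (EvenIdx k l → ℝ) × Module.End ℝ (Fin n → ℝ)}
    (hA : A ∈ spinLie (modelForm k l) Δ.ρ) (q : Fin n → ℝ) :
    rotationMatrix A * spinorMatrix Δ G q - spinorMatrix Δ G q * rotationMatrix A
      = spinorMatrix Δ G (A.2 q) := by
  have hcomm := spinLie_commutator Δ.clifford modelForm_comm hA
  have hskew : ∀ i j, sgn k l j * LinearMap.toMatrix' A.1 i j
      = -(sgn k l i * LinearMap.toMatrix' A.1 j i) := by
    intro i j
    have h := spinLie_skew modelForm_comm hA (Pi.single i 1) (Pi.single j 1)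
    rw [modelForm_comm (Pi.single i 1), modelForm_single, modelForm_single] at h
    simp only [toMatrix'_single]
    have h1 := sgn_mul_self i
    have h2 := sgn_mul_self j
    linear_combination (sgn k l i * sgn k l j) * h
      + (-(sgn k l i) * A.1 (Pi.single i 1) j) * h2
      + (-(sgn k l j) * A.1 (Pi.single j 1) i) * h1
  simp only [rotationMatrix, spinorMatrix, Matrix.fromBlocks_multiply, Matrix.mul_zero,
    Matrix.zero_mul, add_zero, zero_add]
  ext (i | r) (j | j)
  · simp
  · simp
  · simp only [Matrix.sub_apply, Matrix.fromBlocks_apply₂₁, Matrix.mul_apply, Matrix.neg_apply,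
      Matrix.transpose_apply, Matrix.of_apply]
    have e1 : ∑ x, -LinearMap.toMatrix' A.2 x r
          * -(sgn k l j * G (Δ.ρ (Pi.single j 1) q) (Pi.single x 1))
        = -(sgn k l j * G (A.2 (Δ.ρ (Pi.single j 1) q)) (Pi.single r 1)) := by
      rw [hG.spinLie_skew hA]
      have : A.2 (Pi.single r 1) = ∑ x, LinearMap.toMatrix' A.2 x r • Pi.single x (1 : ℝ) := by
        conv_lhs => rw [pi_eq_sum_univ' (A.2 (Pi.single r 1))]
        simp
      rw [this, map_sum, mul_neg, neg_neg, Finset.mul_sum]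
      refine Finset.sum_congr rfl fun x _ => ?_
      rw [map_smul, smul_eq_mul]
      ring
    have e2 : ∑ x, -(sgn k l x * G (Δ.ρ (Pi.single x 1) q) (Pi.single r 1))
          * -LinearMap.toMatrix' A.1 j x
        = -(sgn k l j * G (Δ.ρ (A.1 (Pi.single j 1)) q) (Pi.single r 1)) := by
      have : A.1 (Pi.single j 1) = ∑ x, LinearMap.toMatrix' A.1 x j • Pi.single x (1 : ℝ) := by
        conv_lhs => rw [pi_eq_sum_univ' (A.1 (Pi.single j 1))]
        simp
      rw [this]
      simp only [map_sum, map_smul, LinearMap.sum_apply, LinearMap.smul_apply, smul_eq_mul,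
        Finset.mul_sum, ← Finset.sum_neg_distrib]
      refine Finset.sum_congr rfl fun x _ => ?_
      linear_combination G (Δ.ρ (Pi.single x 1) q) (Pi.single r 1) * hskew j x
    rw [e1, e2, ← hcomm]
    simp only [LinearMap.sub_apply, Module.End.mul_apply, map_sub]
    ring
  · simp

variable {V₀ V₁ : Type*} [AddCommGroup V₀] [Module ℝ V₀] [AddCommGroup V₁] [Module ℝ V₁]
  {B : LinearMap.BilinForm ℝ V₀} {ρ : V₀ →ₗ[ℝ] Module.End ℝ V₁}

theorem form_piMap [FiniteDimensional ℝ V₀] (hB : B.Nondegenerate)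
    (β : LinearMap.BilinForm ℝ V₁) (s t : V₁) (v : V₀) :
    B (piMap B hB ρ β s t) v = β (ρ v s) t := by
  have := LinearMap.congr_fun ((B.toDual hB).apply_symm_apply ((β.flip t) ∘ₗ (ρ.flip s))) v
  rw [LinearMap.BilinForm.toDual_def] at this
  exact this

/-- A bilinear form in the coordinates given by a basis. -/
def formInBasis (β : LinearMap.BilinForm ℝ V₁) (b₁ : Module.Basis (Fin n) ℝ V₁) :
    LinearMap.BilinForm ℝ (Fin n → ℝ) :=
  β.compl₁₂ (b₁.equivFun.symm : (Fin n → ℝ) →ₗ[ℝ] V₁) (b₁.equivFun.symm : (Fin n → ℝ) →ₗ[ℝ] V₁)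

theorem formInBasis_apply (β : LinearMap.BilinForm ℝ V₁) (b₁ : Module.Basis (Fin n) ℝ V₁)
    (u v : Fin n → ℝ) :
    formInBasis β b₁ u v = β (b₁.equivFun.symm u) (b₁.equivFun.symm v) := rfl

/-- The bases `b₀` of `V₀` and `b₁` of `V₁` identify the metric and the Clifford multiplication
with those of the model. -/
structure IsAdaptedBasis (Δ : CliffordModule k l n) (B : LinearMap.BilinForm ℝ V₀)
    (ρ : V₀ →ₗ[ℝ] Module.End ℝ V₁) (b₀ : Module.Basis (EvenIdx k l) ℝ V₀)
    (b₁ : Module.Basis (Fin n) ℝ V₁) : Prop where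
  orthonormal : ∀ i j, B (b₀ i) (b₀ j) = if i = j then sgn k l i else 0
  clifford : ∀ i j, ρ (b₀ i) (b₁ j) = ∑ r, LinearMap.toMatrix' (Δ.ρ (Pi.single i 1)) r j • b₁ r

namespace IsAdaptedBasis

variable {b₀ : Module.Basis (EvenIdx k l) ℝ V₀} {b₁ : Module.Basis (Fin n) ℝ V₁}
  (h : IsAdaptedBasis Δ B ρ b₀ b₁)

include h

theorem form_eq (u v : EvenIdx k l → ℝ) :
    B (b₀.equivFun.symm u) (b₀.equivFun.symm v) = modelForm k l u v := by
  simp only [Module.Basis.equivFun_symm_apply, map_sum, map_smul, LinearMap.sum_apply,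
    LinearMap.smul_apply, h.orthonormal, smul_eq_mul, modelForm_apply]
  refine Finset.sum_congr rfl fun i _ => ?_
  rw [Finset.mul_sum, Finset.sum_eq_single i]
  · simp; ring
  · intro j _ hj
    simp [hj]
  · simp

theorem clifford_eq (u : EvenIdx k l → ℝ) (t : Fin n → ℝ) :
    ρ (b₀.equivFun.symm u) (b₁.equivFun.symm t) = b₁.equivFun.symm (Δ.ρ u t) := by
  have e : ∀ i j, ρ (b₀ i) (b₁ j) = b₁.equivFun.symm (Δ.ρ (Pi.single i 1) (Pi.single j 1)) := by
    intro i j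
    rw [h.clifford, Module.Basis.equivFun_symm_apply]
    simp
  have hu : Δ.ρ u = ∑ i, u i • Δ.ρ (Pi.single i 1) := by
    conv_lhs => rw [pi_eq_sum_univ' u]
    simp
  have ht : t = ∑ j, t j • (Pi.single j 1 : Fin n → ℝ) := pi_eq_sum_univ' t
  rw [hu]
  conv_rhs => rw [ht]
  rw [Module.Basis.equivFun_symm_apply, Module.Basis.equivFun_symm_apply]
  simp only [map_sum, map_smul, LinearMap.sum_apply, LinearMap.smul_apply, e]

theorem isClifford : IsClifford B ρ := by
  intro v
  refine LinearMap.ext fun s => ?_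
  have h0 := congrArg (fun L => L (b₁.equivFun s)) (Δ.clifford (b₀.equivFun v))
  have h1 := h.clifford_eq (b₀.equivFun v) (b₁.equivFun s)
  have h2 := h.clifford_eq (b₀.equivFun v) (Δ.ρ (b₀.equivFun v) (b₁.equivFun s))
  have h3 := h.form_eq (b₀.equivFun v) (b₀.equivFun v)
  simp only [LinearEquiv.symm_apply_apply, Module.End.mul_apply, LinearMap.smul_apply,
    Module.End.one_apply] at h0 h1 h2 h3
  rw [Module.End.mul_apply, h1, h2, h0, map_smul, LinearEquiv.symm_apply_apply, ← h3]
  simp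

theorem eq_sum (v : V₀) : v = ∑ i, sgn k l i • B v (b₀ i) • b₀ i := by
  have e : ∀ i, B v (b₀ i) = sgn k l i * b₀.repr v i := by
    intro i
    conv_lhs => rw [← b₀.sum_repr v]
    simp only [map_sum, map_smul, LinearMap.sum_apply, LinearMap.smul_apply, h.orthonormal,
      smul_eq_mul]
    rw [Finset.sum_eq_single i] <;> simp +contextual [mul_comm]
  simp only [e, smul_smul, ← mul_assoc, sgn_mul_self, one_mul]
  exact (b₀.sum_repr v).symm

theorem isSuitable_formInBasis {β : LinearMap.BilinForm ℝ V₁} (hβ : IsSuitable ρ β) :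
    IsSuitable Δ.ρ (formInBasis β b₁) := by
  obtain ⟨σ, τ, hσ, hτ, h1, h2, h3⟩ := hβ
  refine ⟨σ, τ, hσ, hτ, fun s t => h1 _ _, fun v s t => ?_, h3⟩
  rw [formInBasis_apply, formInBasis_apply, ← h.clifford_eq, ← h.clifford_eq, h2]

theorem map_spinLie :
    (spinLie (modelForm k l) Δ.ρ).map (LinearMap.prodMap
      (b₀.equivFun.symm.conj : Module.End ℝ (EvenIdx k l → ℝ) →ₗ[ℝ] Module.End ℝ V₀)
      (b₁.equivFun.symm.conj : Module.End ℝ (Fin n → ℝ) →ₗ[ℝ] Module.End ℝ V₁))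
      = spinLie B ρ := by
  rw [spinLie, spinLie, Submodule.map_span]
  congr 1
  have key : ∀ v w, LinearMap.prodMap
      (b₀.equivFun.symm.conj : Module.End ℝ (EvenIdx k l → ℝ) →ₗ[ℝ] Module.End ℝ V₀)
      (b₁.equivFun.symm.conj : Module.End ℝ (Fin n → ℝ) →ₗ[ℝ] Module.End ℝ V₁)
      (wedge (modelForm k l) v w, (4⁻¹ : ℝ) • (Δ.ρ v * Δ.ρ w - Δ.ρ w * Δ.ρ v))
      = (wedge B (b₀.equivFun.symm v) (b₀.equivFun.symm w), (4⁻¹ : ℝ) •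
        (ρ (b₀.equivFun.symm v) * ρ (b₀.equivFun.symm w)
          - ρ (b₀.equivFun.symm w) * ρ (b₀.equivFun.symm v))) := by
    intro v w
    refine Prod.ext (LinearMap.ext fun u => ?_) (LinearMap.ext fun s => ?_)
    · have h1 := h.form_eq v (b₀.equivFun u)
      have h2 := h.form_eq w (b₀.equivFun u)
      rw [LinearEquiv.symm_apply_apply] at h1 h2
      simp only [LinearMap.prodMap_apply, LinearEquiv.coe_coe, LinearEquiv.conj_apply_apply,
        LinearEquiv.symm_symm, wedge_apply, map_sub, map_smul, h1, h2]
    · have h1 := h.clifford_eq v (Δ.ρ w (b₁.equivFun s))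
      have h2 := h.clifford_eq w (Δ.ρ v (b₁.equivFun s))
      rw [← h.clifford_eq, LinearEquiv.symm_apply_apply] at h1 h2
      simp only [LinearMap.prodMap_apply, LinearEquiv.coe_coe, LinearEquiv.conj_apply_apply,
        LinearEquiv.symm_symm, map_sub, map_smul, LinearMap.smul_apply, LinearMap.sub_apply,
        Module.End.mul_apply, h1, h2]
  ext X
  constructor
  · rintro ⟨_, ⟨v, w, rfl⟩, rfl⟩
    exact ⟨_, _, key v w⟩
  · rintro ⟨v, w, rfl⟩
    refine ⟨_, ⟨b₀.equivFun v, b₀.equivFun w, rfl⟩, ?_⟩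
    rw [key]
    simp

theorem coord_eq (v : V₀) (i : EvenIdx k l) : b₀.coord i v = sgn k l i * B v (b₀ i) := by
  conv_lhs => rw [h.eq_sum v]
  simp only [map_sum, map_smul, Module.Basis.coord_apply, Module.Basis.repr_self, smul_eq_mul]
  rw [Finset.sum_eq_single i] <;> simp +contextual

theorem toMatrix_coadjoint [FiniteDimensional ℝ V₀] (hB : B.Nondegenerate)
    (β : LinearMap.BilinForm ℝ V₁)
    (A : Module.End ℝ (EvenIdx k l → ℝ) × Module.End ℝ (Fin n → ℝ)) (v : V₀) (q : Fin n → ℝ) :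
    LinearMap.toMatrix (b₀.prod b₁).dualBasis (b₀.prod b₁).dualBasis
      (coadjoint B hB ρ β ((b₀.equivFun.symm.conj A.1, b₁.equivFun.symm.conj A.2),
        (v, b₁.equivFun.symm q)))
      = rotationMatrix A + spinorMatrix Δ (formInBasis β b₁) q := by
  ext i j
  rw [LinearMap.toMatrix_apply, Module.Basis.dualBasis_repr, Module.Basis.coe_dualBasis]
  have e0 : ∀ a i, b₀.coord i (b₀.equivFun.symm a) = a i := fun a i => by
    rw [Module.Basis.coord_apply, ← Module.Basis.equivFun_apply, LinearEquiv.apply_symm_apply]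
  have e1 : ∀ a i, b₁.coord i (b₁.equivFun.symm a) = a i := fun a i => by
    rw [Module.Basis.coord_apply, ← Module.Basis.equivFun_apply, LinearEquiv.apply_symm_apply]
  have c0 : ∀ i, b₀.equivFun (b₀ i) = Pi.single i 1 := fun i => by
    ext j; simp [Pi.single_apply, eq_comm]
  have c1 : ∀ i, b₁.equivFun (b₁ i) = Pi.single i 1 := fun i => by
    ext j; simp [Pi.single_apply, eq_comm]
  have p0 : ∀ i (z : V₀ × V₁), (b₀.prod b₁).coord (Sum.inl i) z = b₀.coord i z.1 := fun i z => rfl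
  have p1 : ∀ i (z : V₀ × V₁), (b₀.prod b₁).coord (Sum.inr i) z = b₁.coord i z.2 := fun i z => rfl
  have c1s : ∀ r, b₁.equivFun.symm (Pi.single r 1) = b₁ r := fun r => by
    rw [← c1, LinearEquiv.symm_apply_apply]
  have c0s : ∀ r, b₀.equivFun.symm (Pi.single r 1) = b₀ r := fun r => by
    rw [← c0, LinearEquiv.symm_apply_apply]
  have hz1 : ∀ t, piMap B hB ρ β 0 t = 0 := by simp [piMap]
  have hz2 : ∀ t, piMap B hB ρ β t 0 = 0 := by simp [piMap]
  have hpi : ∀ i r, b₀.coord i (piMap B hB ρ β (b₁.equivFun.symm q) (b₁ r))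
      = sgn k l i * formInBasis β b₁ (Δ.ρ (Pi.single i 1) q) (Pi.single r 1) := by
    intro i r
    rw [h.coord_eq, form_piMap, formInBasis_apply, ← h.clifford_eq, c1s, c0s]
  obtain j | j := j <;> obtain i | i := i <;>
  · simp [coadjoint, adV, poincareBracket, poincareEven, poincareOdd, p0, p1, rotationMatrix,
      spinorMatrix, hz1, hz2, LinearEquiv.conj_apply_apply, e0, e1,
      hpi, Finsupp.single_eq_pi_single,
      -Module.Basis.coord_apply, -Module.Basis.equivFun_symm_apply]

/-- In an adapted basis, `α(p(V))` becomes a space of matrices that depends on `g₁` only. -/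
theorem coadjointMatrices_eq [FiniteDimensional ℝ V₀] (hB : B.Nondegenerate)
    (β : LinearMap.BilinForm ℝ V₁) :
    coadjointMatrices B hB ρ β (b₀.prod b₁) = modelLie Δ (formInBasis β b₁) := by
  refine le_antisymm (Submodule.span_le.2 ?_) ?_
  · rintro _ ⟨⟨⟨X₀, X₁⟩, v, q⟩, hx, rfl⟩
    have hx' : (X₀, X₁) ∈ spinLie B ρ := hx
    rw [← h.map_spinLie] at hx'
    obtain ⟨A, hA, hAX⟩ := hx'
    refine ⟨A, hA, b₁.equivFun q, ?_⟩
    rw [← h.toMatrix_coadjoint hB β A v, LinearEquiv.symm_apply_apply]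
    have h1 : X₀ = b₀.equivFun.symm.conj A.1 := (congrArg Prod.fst hAX).symm
    have h2 : X₁ = b₁.equivFun.symm.conj A.2 := (congrArg Prod.snd hAX).symm
    rw [h1, h2]
  · rintro _ ⟨A, hA, q, rfl⟩
    refine Submodule.subset_span ⟨_, ?_, (h.toMatrix_coadjoint hB β A 0 q).symm⟩
    change _ ∈ spinLie B ρ
    rw [← h.map_spinLie]
    exact ⟨A, hA, rfl⟩

end IsAdaptedBasis

end ModelAlgebra

/-! ### Supermatrices over an exterior algebra -/

section Supermatrices

variable {V : Type*} [AddCommGroup V] [Module ℝ V]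

theorem ι_mul_eq_involute_mul (v : V) (b : ExteriorAlgebra ℝ V) :
    ExteriorAlgebra.ι ℝ v * b = CliffordAlgebra.involute b * ExteriorAlgebra.ι ℝ v := by
  induction b using CliffordAlgebra.left_induction with
  | algebraMap r => rw [AlgHom.commutes, Algebra.commutes]
  | add a b ha hb => rw [mul_add, ha, hb, map_add, add_mul]
  | ι_mul b w hb =>
    have h := ExteriorAlgebra.ι_add_mul_swap (R := ℝ) v w
    have h2 : ExteriorAlgebra.ι ℝ v * CliffordAlgebra.ι 0 w
        = -(CliffordAlgebra.ι 0 w * ExteriorAlgebra.ι ℝ v) := eq_neg_of_add_eq_zero_left h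
    rw [← mul_assoc, h2, neg_mul, mul_assoc, hb, map_mul, CliffordAlgebra.involute_ι, neg_mul,
      neg_mul, mul_assoc]

/-- Supercommutativity of the exterior algebra: moving `b = b₀ + b₁` past `a` applies the parity
operator to `a` in the term with the odd part `b₁`. -/
theorem two_smul_mul_eq (a b : ExteriorAlgebra ℝ V) :
    (2 : ℝ) • (a * b) = (b + CliffordAlgebra.involute b) * a
      + (b - CliffordAlgebra.involute b) * CliffordAlgebra.involute a := by
  induction a using CliffordAlgebra.left_induction generalizing b with
  | algebraMap r =>
    rw [AlgHom.commutes, ← add_mul, add_add_sub_cancel, Algebra.commutes, two_smul, add_mul]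
  | add a a' ha ha' =>
    rw [add_mul, smul_add, ha, ha', map_add, mul_add, mul_add]
    abel
  | ι_mul a m ha =>
    have h := fun c => ι_mul_eq_involute_mul m (c : ExteriorAlgebra ℝ V)
    change ∀ c, CliffordAlgebra.ι 0 m * c = CliffordAlgebra.involute c * CliffordAlgebra.ι 0 m at h
    rw [mul_assoc, ← mul_smul_comm, ha, mul_add, ← mul_assoc, ← mul_assoc, h, h, map_add, map_sub,
      CliffordAlgebra.involute_involute, map_mul, CliffordAlgebra.involute_ι, mul_assoc, mul_assoc,
      neg_mul, mul_neg, ← neg_mul, neg_sub, add_comm (CliffordAlgebra.involute b)]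

theorem mul_comm_of_even {a : ExteriorAlgebra ℝ V} (ha : CliffordAlgebra.involute a = a)
    (b : ExteriorAlgebra ℝ V) : a * b = b * a := by
  have h := two_smul_mul_eq a b
  rw [ha, ← add_mul, add_add_sub_cancel, add_mul, ← two_smul ℝ (b * a)] at h
  exact smul_right_injective _ (two_ne_zero' ℝ) h

theorem mul_comm_of_odd {a : ExteriorAlgebra ℝ V} (ha : CliffordAlgebra.involute a = -a)
    (b : ExteriorAlgebra ℝ V) : a * b = CliffordAlgebra.involute b * a := by
  have h := two_smul_mul_eq a b
  have h2 : (b + CliffordAlgebra.involute b) * a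
      + (b - CliffordAlgebra.involute b) * CliffordAlgebra.involute a
      = (2 : ℝ) • (CliffordAlgebra.involute b * a) := by
    rw [ha, two_smul]
    noncomm_ring
  rw [h2] at h
  exact smul_right_injective _ (two_ne_zero' ℝ) h

variable {J₀ J₁ : Type*}

section Scale

variable {R : Type*} [Ring R] [Algebra ℝ R] (p : R →ₗ[ℝ] R)

/-- The supermatrix `a x` for a real matrix `x`: `(a x)_ij = (-1)^(|a| |i|) a x_ij`. -/
def superScale : R →ₗ[ℝ] Matrix (J₀ ⊕ J₁) (J₀ ⊕ J₁) ℝ →ₗ[ℝ] Matrix (J₀ ⊕ J₁) (J₀ ⊕ J₁) R :=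
  LinearMap.mk₂ ℝ (fun a x => Matrix.of fun i j => x i j • Sum.elim (fun _ => a) (fun _ => p a) i)
    (by intro a b x; ext (i | i) j <;> simp)
    (by intro r a x; ext (i | i) j <;> simp [smul_comm r])
    (by intro a x y; ext (i | i) j <;> simp [add_smul])
    (by intro r a x; ext (i | i) j <;> simp [mul_smul])

theorem superScale_inl (a : R) (x : Matrix (J₀ ⊕ J₁) (J₀ ⊕ J₁) ℝ) (i : J₀) (j : J₀ ⊕ J₁) :
    superScale p a x (Sum.inl i) j = x (Sum.inl i) j • a := rfl

theorem superScale_inr (a : R) (x : Matrix (J₀ ⊕ J₁) (J₀ ⊕ J₁) ℝ) (i : J₁) (j : J₀ ⊕ J₁) :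
    superScale p a x (Sum.inr i) j = x (Sum.inr i) j • p a := rfl

variable [Fintype J₀] [Fintype J₁] [DecidableEq J₀] [DecidableEq J₁]

/-- The extension of a linear map of real matrices to supermatrices. -/
def superExtend (P : Matrix (J₀ ⊕ J₁) (J₀ ⊕ J₁) ℝ →ₗ[ℝ] Matrix (J₀ ⊕ J₁) (J₀ ⊕ J₁) ℝ)
    (Z : Matrix (J₀ ⊕ J₁) (J₀ ⊕ J₁) R) : Matrix (J₀ ⊕ J₁) (J₀ ⊕ J₁) R :=
  ∑ i, ∑ j, superScale p (Sum.elim (fun _ => Z i j) (fun _ => p (Z i j)) i)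
    (P (Matrix.single i j 1))

theorem superExtend_superScale (hp : ∀ a, p (p a) = a)
    (P : Matrix (J₀ ⊕ J₁) (J₀ ⊕ J₁) ℝ →ₗ[ℝ] Matrix (J₀ ⊕ J₁) (J₀ ⊕ J₁) ℝ) (a : R)
    (x : Matrix (J₀ ⊕ J₁) (J₀ ⊕ J₁) ℝ) :
    superExtend p P (superScale p a x) = superScale p a (P x) := by
  have h : ∀ i j, Sum.elim (fun _ => superScale p a x i j) (fun _ => p (superScale p a x i j)) i
      = x i j • a := by
    rintro (i | i) j
    · rfl
    · simp [superScale_inr, hp]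
  conv_rhs => rw [Matrix.matrix_eq_sum_single x]
  simp only [superExtend, h, map_sum, map_smul, LinearMap.smul_apply]
  refine Finset.sum_congr rfl fun i _ => Finset.sum_congr rfl fun j _ => ?_
  rw [← map_smul, ← map_smul, Matrix.smul_single, smul_eq_mul, mul_one]

theorem superExtend_add (P : Matrix (J₀ ⊕ J₁) (J₀ ⊕ J₁) ℝ →ₗ[ℝ] Matrix (J₀ ⊕ J₁) (J₀ ⊕ J₁) ℝ)
    (Z Z' : Matrix (J₀ ⊕ J₁) (J₀ ⊕ J₁) R) :
    superExtend p P (Z + Z') = superExtend p P Z + superExtend p P Z' := by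
  simp only [superExtend, ← Finset.sum_add_distrib]
  refine Finset.sum_congr rfl fun i _ => Finset.sum_congr rfl fun j _ => ?_
  rw [← LinearMap.add_apply, ← map_add]
  cases i <;> simp

theorem superExtend_smul (P : Matrix (J₀ ⊕ J₁) (J₀ ⊕ J₁) ℝ →ₗ[ℝ] Matrix (J₀ ⊕ J₁) (J₀ ⊕ J₁) ℝ)
    (r : ℝ) (Z : Matrix (J₀ ⊕ J₁) (J₀ ⊕ J₁) R) :
    superExtend p P (r • Z) = r • superExtend p P Z := by
  simp only [superExtend, Finset.smul_sum]
  refine Finset.sum_congr rfl fun i _ => Finset.sum_congr rfl fun j _ => ?_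
  rw [← LinearMap.smul_apply, ← map_smul]
  cases i <;> simp

end Scale

/-- `𝔤 ⊗ Λ ⊆ gl(m|n)(Λ)`. -/
def tensorSpace {R : Type*} [Ring R] [Algebra ℝ R] (p : R →ₗ[ℝ] R)
    (𝔤 : Submodule ℝ (Matrix (J₀ ⊕ J₁) (J₀ ⊕ J₁) ℝ)) :
    Submodule ℝ (Matrix (J₀ ⊕ J₁) (J₀ ⊕ J₁) R) :=
  Submodule.span ℝ {Z | ∃ x ∈ 𝔤, ∃ a, Z = superScale p a x}

theorem superScale_mem {R : Type*} [Ring R] [Algebra ℝ R] (p : R →ₗ[ℝ] R)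
    {𝔤 : Submodule ℝ (Matrix (J₀ ⊕ J₁) (J₀ ⊕ J₁) ℝ)} (a : R)
    {x : Matrix (J₀ ⊕ J₁) (J₀ ⊕ J₁) ℝ} (hx : x ∈ 𝔤) :
    superScale p a x ∈ tensorSpace p 𝔤 :=
  Submodule.subset_span ⟨x, hx, a, rfl⟩

variable [Fintype J₀] [Fintype J₁] [DecidableEq J₀] [DecidableEq J₁]

/-- Membership in `𝔤 ⊗ Λ` is a system of linear equations with coefficients in `Λ`. -/
theorem mem_tensorSpace_iff {R : Type*} [Ring R] [Algebra ℝ R] (p : R →ₗ[ℝ] R)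
    (hp : ∀ a, p (p a) = a) {𝔤 : Submodule ℝ (Matrix (J₀ ⊕ J₁) (J₀ ⊕ J₁) ℝ)}
    {P : Matrix (J₀ ⊕ J₁) (J₀ ⊕ J₁) ℝ →ₗ[ℝ] Matrix (J₀ ⊕ J₁) (J₀ ⊕ J₁) ℝ}
    (hP : ∀ x, P x ∈ 𝔤) (hP' : ∀ x ∈ 𝔤, P x = x) (Z : Matrix (J₀ ⊕ J₁) (J₀ ⊕ J₁) R) :
    Z ∈ tensorSpace p 𝔤 ↔ superExtend p P Z = Z := by
  constructor
  · intro hZ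
    induction hZ using Submodule.span_induction with
    | mem Z hZ =>
      obtain ⟨x, hx, a, rfl⟩ := hZ
      rw [superExtend_superScale p hp, hP' x hx]
    | zero =>
      have := superExtend_smul p P 0 (0 : Matrix (J₀ ⊕ J₁) (J₀ ⊕ J₁) R)
      simpa using this
    | add Z Z' _ _ h h' => rw [superExtend_add, h, h']
    | smul r Z _ h => rw [superExtend_smul, h]
  · intro h
    rw [← h]
    exact sum_mem fun i _ => sum_mem fun j _ => superScale_mem p _ (hP _)

theorem exists_projection (𝔤 : Submodule ℝ (Matrix (J₀ ⊕ J₁) (J₀ ⊕ J₁) ℝ)) :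
    ∃ P : Matrix (J₀ ⊕ J₁) (J₀ ⊕ J₁) ℝ →ₗ[ℝ] Matrix (J₀ ⊕ J₁) (J₀ ⊕ J₁) ℝ,
      (∀ x, P x ∈ 𝔤) ∧ ∀ x ∈ 𝔤, P x = x := by
  obtain ⟨f, hf⟩ := 𝔤.subtype.exists_leftInverse_of_injective (Submodule.ker_subtype 𝔤)
  refine ⟨𝔤.subtype ∘ₗ f, fun x => (f x).2, fun x hx => ?_⟩
  have := LinearMap.congr_fun hf ⟨x, hx⟩
  exact congrArg Subtype.val this

/-- The parity operator of an exterior algebra. -/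
abbrev extParity (V : Type*) [AddCommGroup V] [Module ℝ V] :
    ExteriorAlgebra ℝ V →ₗ[ℝ] ExteriorAlgebra ℝ V :=
  (CliffordAlgebra.involute : ExteriorAlgebra ℝ V →ₐ[ℝ] ExteriorAlgebra ℝ V).toLinearMap

theorem extParity_extParity (a : ExteriorAlgebra ℝ V) : extParity V (extParity V a) = a :=
  CliffordAlgebra.involute_involute a

/-- The diagonal supermatrix `a 1`. -/
def superDiag (a : ExteriorAlgebra ℝ V) :
    Matrix (J₀ ⊕ J₁) (J₀ ⊕ J₁) (ExteriorAlgebra ℝ V) :=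
  Matrix.diagonal (Sum.elim (fun _ => a) fun _ => CliffordAlgebra.involute a)

/-- A real matrix as a supermatrix over an exterior algebra. -/
def realMatrix : Matrix (J₀ ⊕ J₁) (J₀ ⊕ J₁) ℝ →ₐ[ℝ]
    Matrix (J₀ ⊕ J₁) (J₀ ⊕ J₁) (ExteriorAlgebra ℝ V) :=
  (Algebra.ofId ℝ (ExteriorAlgebra ℝ V)).mapMatrix

theorem superScale_eq (a : ExteriorAlgebra ℝ V) (x : Matrix (J₀ ⊕ J₁) (J₀ ⊕ J₁) ℝ) :
    superScale (extParity V) a x = superDiag a * realMatrix x := by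
  ext (i | i) j <;>
  simp [superScale_inl, superScale_inr, superDiag, realMatrix, Algebra.ofId_apply,
    Algebra.smul_def, Algebra.commutes]

theorem superDiag_mul (a b : ExteriorAlgebra ℝ V) :
    (superDiag a * superDiag b : Matrix (J₀ ⊕ J₁) (J₀ ⊕ J₁) _) = superDiag (a * b) := by
  rw [superDiag, superDiag, superDiag, Matrix.diagonal_mul_diagonal]
  congr 1
  funext i
  cases i <;> simp

/-- Block diagonal real matrices. -/
def IsBlockDiagonal (x : Matrix (J₀ ⊕ J₁) (J₀ ⊕ J₁) ℝ) : Prop :=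
  (∀ i j, x (Sum.inl i) (Sum.inr j) = 0) ∧ ∀ i j, x (Sum.inr i) (Sum.inl j) = 0

/-- Real matrices whose only nonzero block is the lower left one. -/
def IsLowerBlock (x : Matrix (J₀ ⊕ J₁) (J₀ ⊕ J₁) ℝ) : Prop :=
  (∀ i j, x (Sum.inl i) j = 0) ∧ ∀ i j, x (Sum.inr i) (Sum.inr j) = 0

theorem IsBlockDiagonal.mul_superDiag {x : Matrix (J₀ ⊕ J₁) (J₀ ⊕ J₁) ℝ} (hx : IsBlockDiagonal x)
    (b : ExteriorAlgebra ℝ V) : realMatrix x * superDiag b = superDiag b * realMatrix x := by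
  ext (i | i) (j | j) <;>
  simp [superDiag, realMatrix, Algebra.ofId_apply, Algebra.commutes, hx.1, hx.2]

theorem IsLowerBlock.mul_superDiag {x : Matrix (J₀ ⊕ J₁) (J₀ ⊕ J₁) ℝ} (hx : IsLowerBlock x)
    (b : ExteriorAlgebra ℝ V) :
    realMatrix x * superDiag b = superDiag (CliffordAlgebra.involute b) * realMatrix x := by
  ext (i | i) (j | j) <;>
  simp [superDiag, realMatrix, Algebra.ofId_apply, Algebra.commutes, hx.1, hx.2]

/-- The grading operator of `gl(m|n)`. -/
def gradingMatrix (V : Type*) [AddCommGroup V] [Module ℝ V] :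
    Matrix (J₀ ⊕ J₁) (J₀ ⊕ J₁) (ExteriorAlgebra ℝ V) :=
  Matrix.diagonal (Sum.elim (fun _ => 1) fun _ => -1)

theorem gradingMatrix_mul_self :
    (gradingMatrix V * gradingMatrix V : Matrix (J₀ ⊕ J₁) (J₀ ⊕ J₁) _) = 1 := by
  rw [gradingMatrix, Matrix.diagonal_mul_diagonal, ← Matrix.diagonal_one]
  congr 1
  funext i
  cases i <;> simp

/-- The parity automorphism of `gl(m|n)(Λ)`. -/
def matrixParity : Matrix (J₀ ⊕ J₁) (J₀ ⊕ J₁) (ExteriorAlgebra ℝ V) →ₐ[ℝ]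
    Matrix (J₀ ⊕ J₁) (J₀ ⊕ J₁) (ExteriorAlgebra ℝ V) :=
  AlgHom.ofLinearMap
    (LinearMap.mulLeftRight ℝ (gradingMatrix V, gradingMatrix V) ∘ₗ
      (CliffordAlgebra.involute : ExteriorAlgebra ℝ V →ₐ[ℝ] _).mapMatrix.toLinearMap)
    (by simp [gradingMatrix_mul_self])
    (by
      intro Z Z'
      simp only [LinearMap.comp_apply, AlgHom.toLinearMap_apply, map_mul,
        LinearMap.mulLeftRight_apply]
      rw [mul_assoc _ (gradingMatrix V), ← mul_assoc (gradingMatrix V) (gradingMatrix V * _),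
        ← mul_assoc (gradingMatrix V) (gradingMatrix V), gradingMatrix_mul_self, one_mul]
      simp only [mul_assoc])

theorem matrixParity_apply (Z : Matrix (J₀ ⊕ J₁) (J₀ ⊕ J₁) (ExteriorAlgebra ℝ V)) (i j) :
    matrixParity Z i j = Sum.elim (fun _ => 1) (fun _ => -1) i * CliffordAlgebra.involute (Z i j)
      * Sum.elim (fun _ => 1) (fun _ => -1) j := by
  change (gradingMatrix V * (CliffordAlgebra.involute : ExteriorAlgebra ℝ V →ₐ[ℝ] _).mapMatrix Z
    * gradingMatrix V : Matrix (J₀ ⊕ J₁) (J₀ ⊕ J₁) (ExteriorAlgebra ℝ V)) i j = _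
  rw [gradingMatrix, Matrix.mul_diagonal, Matrix.diagonal_mul]
  rfl

theorem matrixParity_superScale_of_blockDiagonal {x : Matrix (J₀ ⊕ J₁) (J₀ ⊕ J₁) ℝ}
    (hx : IsBlockDiagonal x) (a : ExteriorAlgebra ℝ V) :
    matrixParity (superScale (extParity V) a x)
      = superScale (extParity V) (CliffordAlgebra.involute a) x := by
  ext (i | i) (j | j) <;> simp [matrixParity_apply, superScale_inl, superScale_inr, hx.1, hx.2]

theorem matrixParity_superScale_of_lowerBlock {x : Matrix (J₀ ⊕ J₁) (J₀ ⊕ J₁) ℝ}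
    (hx : IsLowerBlock x) (a : ExteriorAlgebra ℝ V) :
    matrixParity (superScale (extParity V) a x)
      = -superScale (extParity V) (CliffordAlgebra.involute a) x := by
  ext (i | i) (j | j) <;> simp [matrixParity_apply, superScale_inl, superScale_inr, hx.1, hx.2]

/-- A super Lie algebra of real matrices `𝔤 = 𝔤₀ + 𝔤₁` with `[𝔤₁, 𝔤₁] = 0`, where `𝔤₀` consists of
block diagonal matrices and `𝔤₁` of matrices with only a lower left block. -/
structure IsTriangularSuperLie (𝔤 : Submodule ℝ (Matrix (J₀ ⊕ J₁) (J₀ ⊕ J₁) ℝ)) : Prop where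
  split : ∀ x ∈ 𝔤, ∃ y ∈ 𝔤, ∃ z ∈ 𝔤, IsBlockDiagonal y ∧ IsLowerBlock z ∧ x = y + z
  bracket : ∀ x ∈ 𝔤, ∀ y ∈ 𝔤, IsBlockDiagonal x → x * y - y * x ∈ 𝔤

theorem IsLowerBlock.mul_eq_zero {x y : Matrix (J₀ ⊕ J₁) (J₀ ⊕ J₁) ℝ} (hx : IsLowerBlock x)
    (hy : IsLowerBlock y) : x * y = 0 := by
  ext (i | i) (j | j) <;> simp [Matrix.mul_apply, hx.1, hx.2, hy.1]

variable {𝔤 : Submodule ℝ (Matrix (J₀ ⊕ J₁) (J₀ ⊕ J₁) ℝ)}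

/-- The even part of `𝔤 ⊗ Λ` is `𝔤₀ ⊗ Λ₀ + 𝔤₁ ⊗ Λ₁`. -/
theorem IsTriangularSuperLie.even_mem_span (h𝔤 : IsTriangularSuperLie 𝔤)
    {Y : Matrix (J₀ ⊕ J₁) (J₀ ⊕ J₁) (ExteriorAlgebra ℝ V)}
    (hY : Y ∈ tensorSpace (extParity V) 𝔤) (hev : matrixParity Y = Y) :
    Y ∈ Submodule.span ℝ {Z | ∃ x ∈ 𝔤, ∃ a : ExteriorAlgebra ℝ V,
      Z = superScale (extParity V) a x ∧ (IsBlockDiagonal x ∧ CliffordAlgebra.involute a = a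
        ∨ IsLowerBlock x ∧ CliffordAlgebra.involute a = -a)} := by
  have h1 : Y = (2⁻¹ : ℝ) • (Y + matrixParity Y) := by
    rw [hev, ← two_smul ℝ Y, smul_smul]
    norm_num
  rw [h1]
  clear h1 hev
  refine Submodule.smul_mem _ _ ?_
  induction hY using Submodule.span_induction with
  | mem Y hY =>
    obtain ⟨x, hx, a, rfl⟩ := hY
    obtain ⟨y, hy, z, hz, hy', hz', rfl⟩ := h𝔤.split x hx
    have : superScale (extParity V) a (y + z) + matrixParity (superScale (extParity V) a (y + z))
        = superScale (extParity V) (a + CliffordAlgebra.involute a) y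
          + superScale (extParity V) (a - CliffordAlgebra.involute a) z := by
      rw [map_add, map_add, matrixParity_superScale_of_blockDiagonal hy',
        matrixParity_superScale_of_lowerBlock hz']
      simp only [map_add, map_sub, LinearMap.add_apply, LinearMap.sub_apply]
      abel
    rw [this]
    refine add_mem (Submodule.subset_span ⟨y, hy, _, rfl, Or.inl ⟨hy', ?_⟩⟩)
      (Submodule.subset_span ⟨z, hz, _, rfl, Or.inr ⟨hz', ?_⟩⟩)
    · rw [map_add, CliffordAlgebra.involute_involute, add_comm]
    · rw [map_sub, CliffordAlgebra.involute_involute, neg_sub]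
  | zero => simp
  | add Y Y' _ _ h h' =>
    rw [map_add, add_add_add_comm]
    exact add_mem h h'
  | smul r Y _ h =>
    rw [map_smul, ← smul_add]
    exact Submodule.smul_mem _ r h

/-- `𝔤 ⊗ Λ` is preserved by commutators with its even elements. -/
theorem IsTriangularSuperLie.commutator_mem (h𝔤 : IsTriangularSuperLie 𝔤)
    {Y : Matrix (J₀ ⊕ J₁) (J₀ ⊕ J₁) (ExteriorAlgebra ℝ V)}
    (hY : Y ∈ tensorSpace (extParity V) 𝔤) (hev : matrixParity Y = Y)
    {Z : Matrix (J₀ ⊕ J₁) (J₀ ⊕ J₁) (ExteriorAlgebra ℝ V)}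
    (hZ : Z ∈ tensorSpace (extParity V) 𝔤) :
    Z * Y - Y * Z ∈ tensorSpace (extParity V) 𝔤 := by
  have hY' := h𝔤.even_mem_span hY hev
  clear hY hev
  induction hZ using Submodule.span_induction with
  | zero => simp
  | add Z Z' _ _ h h' =>
    have : (Z + Z') * Y - Y * (Z + Z') = (Z * Y - Y * Z) + (Z' * Y - Y * Z') := by
      rw [add_mul, mul_add]; abel
    rw [this]
    exact add_mem h h'
  | smul r Z _ h =>
    have : (r • Z) * Y - Y * (r • Z) = r • (Z * Y - Y * Z) := by
      rw [smul_mul_assoc, mul_smul_comm, smul_sub]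
    rw [this]
    exact Submodule.smul_mem _ r h
  | mem Z hZ =>
    obtain ⟨y, hy, b, rfl⟩ := hZ
    induction hY' using Submodule.span_induction with
    | zero => simp
    | add Y Y' _ _ h h' =>
      rw [mul_add, add_mul, add_sub_add_comm]
      exact add_mem h h'
    | smul r Y _ h =>
      rw [smul_mul_assoc, mul_smul_comm, ← smul_sub]
      exact Submodule.smul_mem _ r h
    | mem Y hY =>
      obtain ⟨x, hx, a, rfl, ⟨hx', ha⟩ | ⟨hx', ha⟩⟩ := hY
      · have e : (superDiag a : Matrix (J₀ ⊕ J₁) (J₀ ⊕ J₁) (ExteriorAlgebra ℝ V))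
            = Matrix.diagonal fun _ => a := by
          rw [superDiag]
          congr 1
          funext i
          cases i <;> simp [ha]
        have h1 : realMatrix y * superDiag a = superDiag a * realMatrix y := by
          rw [e]
          ext i j
          simp [mul_comm_of_even ha]
        have h2 : superScale (extParity V) b y * superScale (extParity V) a x
            - superScale (extParity V) a x * superScale (extParity V) b y
            = -superScale (extParity V) (a * b) (x * y - y * x) := by
          simp only [superScale_eq, map_sub, map_mul]
          rw [← mul_assoc, mul_assoc (superDiag b), h1, ← mul_assoc (superDiag b), superDiag_mul,
            ← mul_assoc (superDiag a * _), mul_assoc (superDiag a), hx'.mul_superDiag,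
            ← mul_assoc (superDiag a), superDiag_mul, mul_comm_of_even ha b]
          noncomm_ring
        rw [h2]
        exact neg_mem (superScale_mem _ _ (h𝔤.bracket x hx y hy hx'))
      · obtain ⟨y₀, hy₀, y₁, hy₁, hy₀', hy₁', rfl⟩ := h𝔤.split y hy
        have h2 : superScale (extParity V) b (y₀ + y₁) * superScale (extParity V) a x
            - superScale (extParity V) a x * superScale (extParity V) b (y₀ + y₁)
            = superScale (extParity V) (b * a) (y₀ * x - x * y₀) := by
          have z1 : (realMatrix y₁ * realMatrix x :
              Matrix (J₀ ⊕ J₁) (J₀ ⊕ J₁) (ExteriorAlgebra ℝ V)) = 0 := by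
            rw [← map_mul, hy₁'.mul_eq_zero hx', map_zero]
          have z2 : (realMatrix x * realMatrix y₁ :
              Matrix (J₀ ⊕ J₁) (J₀ ⊕ J₁) (ExteriorAlgebra ℝ V)) = 0 := by
            rw [← map_mul, hx'.mul_eq_zero hy₁', map_zero]
          have e1 : superDiag b * realMatrix y₀ * (superDiag a * realMatrix x)
              = superDiag (b * a) * (realMatrix y₀ * realMatrix x) := by
            rw [← superDiag_mul, mul_assoc, ← mul_assoc (realMatrix y₀), hy₀'.mul_superDiag]
            simp only [mul_assoc]
          have e2 : superDiag b * realMatrix y₁ * (superDiag a * realMatrix x) = 0 := by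
            rw [mul_assoc, ← mul_assoc (realMatrix y₁), hy₁'.mul_superDiag, mul_assoc, z1,
              mul_zero, mul_zero]
          have e3 : superDiag a * realMatrix x * (superDiag b * realMatrix y₀)
              = superDiag (b * a) * (realMatrix x * realMatrix y₀) := by
            have : b * a = a * CliffordAlgebra.involute b := by
              rw [mul_comm_of_odd ha, CliffordAlgebra.involute_involute]
            rw [this, ← superDiag_mul, mul_assoc, ← mul_assoc (realMatrix x), hx'.mul_superDiag]
            simp only [mul_assoc]
          have e4 : superDiag a * realMatrix x * (superDiag b * realMatrix y₁) = 0 := by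
            rw [mul_assoc, ← mul_assoc (realMatrix x), hx'.mul_superDiag, mul_assoc, z2,
              mul_zero, mul_zero]
          simp only [map_add, superScale_eq, map_sub, map_mul, add_mul, mul_add, e1, e2, e3, e4,
            add_zero]
        rw [h2]
        have h3 := neg_mem (h𝔤.bracket y₀ hy₀ x hx hy₀')
        rw [neg_sub] at h3
        rw [← neg_sub, map_neg]
        exact neg_mem (superScale_mem _ _ h3)

/-- The action of an odd operator `X` of `Λ` on supermatrices: `(X Z)_ij = (-1)^|i| X(Z_ij)`. -/
def matrixDerivation {R : Type*} [Ring R] [Algebra ℝ R] (X : R →ₗ[ℝ] R) :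
    Matrix (J₀ ⊕ J₁) (J₀ ⊕ J₁) R →ₗ[ℝ] Matrix (J₀ ⊕ J₁) (J₀ ⊕ J₁) R where
  toFun Z := Matrix.of fun i j => Sum.elim (fun _ => X (Z i j)) (fun _ => -X (Z i j)) i
  map_add' _ _ := by ext (i | i) j <;> simp [add_comm]
  map_smul' _ _ := by ext (i | i) j <;> simp

variable {X : ExteriorAlgebra ℝ V →ₗ[ℝ] ExteriorAlgebra ℝ V}

theorem matrixDerivation_mul (hX : ∀ a b, X (a * b) = X a * b + CliffordAlgebra.involute a * X b)
    {Y : Matrix (J₀ ⊕ J₁) (J₀ ⊕ J₁) (ExteriorAlgebra ℝ V)} (hY : matrixParity Y = Y)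
    (Z : Matrix (J₀ ⊕ J₁) (J₀ ⊕ J₁) (ExteriorAlgebra ℝ V)) :
    matrixDerivation X (Y * Z) = matrixDerivation X Y * Z + Y * matrixDerivation X Z := by
  have h := fun i j => congrFun (congrFun hY i) j
  have h00 : ∀ i j, CliffordAlgebra.involute (Y (Sum.inl i) (Sum.inl j))
      = Y (Sum.inl i) (Sum.inl j) := fun i j => by
    simpa [matrixParity_apply] using h (Sum.inl i) (Sum.inl j)
  have h01 : ∀ i j, CliffordAlgebra.involute (Y (Sum.inl i) (Sum.inr j))
      = -Y (Sum.inl i) (Sum.inr j) := fun i j => by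
    rw [← neg_eq_iff_eq_neg]
    simpa [matrixParity_apply] using h (Sum.inl i) (Sum.inr j)
  have h10 : ∀ i j, CliffordAlgebra.involute (Y (Sum.inr i) (Sum.inl j))
      = -Y (Sum.inr i) (Sum.inl j) := fun i j => by
    rw [← neg_eq_iff_eq_neg]
    simpa [matrixParity_apply] using h (Sum.inr i) (Sum.inl j)
  have h11 : ∀ i j, CliffordAlgebra.involute (Y (Sum.inr i) (Sum.inr j))
      = Y (Sum.inr i) (Sum.inr j) := fun i j => by
    simpa [matrixParity_apply] using h (Sum.inr i) (Sum.inr j)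
  ext (i | i) (j | j) <;>
  · simp only [matrixDerivation, LinearMap.coe_mk, AddHom.coe_mk, Matrix.of_apply, Sum.elim_inl,
      Sum.elim_inr, Matrix.mul_apply, Matrix.add_apply, Fintype.sum_sum_type, map_add, map_sum, hX,
      h00, h01, h10, h11, Finset.sum_add_distrib, neg_mul, mul_neg, Finset.sum_neg_distrib]
    abel

theorem matrixDerivation_mem (hX : ∀ a, X (CliffordAlgebra.involute a)
      = -CliffordAlgebra.involute (X a))
    {Z : Matrix (J₀ ⊕ J₁) (J₀ ⊕ J₁) (ExteriorAlgebra ℝ V)}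
    (hZ : Z ∈ tensorSpace (extParity V) 𝔤) :
    matrixDerivation X Z ∈ tensorSpace (extParity V) 𝔤 := by
  induction hZ using Submodule.span_induction with
  | zero => simp
  | add Z Z' _ _ h h' =>
    rw [map_add]
    exact add_mem h h'
  | smul r Z _ h =>
    rw [map_smul]
    exact Submodule.smul_mem _ r h
  | mem Z hZ =>
    obtain ⟨x, hx, a, rfl⟩ := hZ
    have : matrixDerivation X (superScale (extParity V) a x)
        = superScale (extParity V) (X a) x := by
      ext (i | i) j <;> simp [matrixDerivation, superScale_inl, superScale_inr, hX]
    rw [this]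
    exact superScale_mem _ _ hx

end Supermatrices

/-! ### The group `G = exp 𝔤` at a point -/

section Gauge

section Abstract

variable {A : Type*} [Ring A] [Algebra ℝ A]

/-- `H = exp Y` in an algebra, where the convergence is tested by means of linear functionals. -/
def IsWeakExp (Y H : A) : Prop :=
  ∀ φ : Module.Dual ℝ A, HasSum (fun r : ℕ => ((r.factorial : ℝ)⁻¹) * φ (Y ^ r)) (φ H)

theorem IsWeakExp.map_eq {Y H : A} (h : IsWeakExp Y H) (f : A →ₐ[ℝ] A) (hf : f Y = Y) :
    f H = H := by
  rw [← sub_eq_zero, ← Module.forall_dual_apply_eq_zero_iff ℝ]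
  intro φ
  rw [map_sub, sub_eq_zero]
  have h1 := h (φ ∘ₗ f.toLinearMap)
  simp only [LinearMap.comp_apply, AlgHom.toLinearMap_apply, map_pow, hf] at h1
  exact h1.unique (h φ)

variable [FiniteDimensional ℝ A]

attribute [local instance] Matrix.linftyOpNormedRing Matrix.linftyOpNormedAlgebra

theorem IsWeakExp.conj_mem {Y : A} {H : Aˣ} (h : IsWeakExp Y H.1) (𝔥 : Submodule ℝ A)
    (hY : ∀ Z ∈ 𝔥, Z * Y - Y * Z ∈ 𝔥) :
    (∀ Z ∈ 𝔥, H⁻¹.1 * Z * H.1 ∈ 𝔥 ∧ H.1 * Z * H⁻¹.1 ∈ 𝔥) ∧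
    ∀ δ : A →ₗ[ℝ] A, (∀ a, δ (Y * a) = δ Y * a + Y * δ a) → δ 1 = 0 → δ Y ∈ 𝔥 →
      H⁻¹.1 * δ H.1 ∈ 𝔥 := by
  let b := Module.finBasis ℝ A
  let f := Algebra.leftMulMatrix b
  -- the norm of the left regular representation
  let _ : NormedRing A := NormedRing.induced A _ f (Algebra.leftMulMatrix_injective b)
  let _ : NormedAlgebra ℝ A := NormedAlgebra.induced ℝ A _ f
  have hc : CompleteSpace A := FiniteDimensional.complete ℝ A
  have hH : H.1 = NormedSpace.exp Y := by
    rw [← sub_eq_zero, ← Module.forall_dual_apply_eq_zero_iff ℝ]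
    intro φ
    rw [map_sub, sub_eq_zero]
    refine (h φ).unique ?_
    have := (LinearMap.toContinuousLinearMap φ).hasSum
      (NormedSpace.exp_series_hasSum_exp' (𝕂 := ℝ) Y)
    simp only [map_smul, smul_eq_mul] at this
    exact this
  have hH' : H⁻¹.1 = NormedSpace.exp (-Y) := by
    rw [Units.inv_eq_of_mul_eq_one_right]
    rw [hH, exp_mul_exp_neg]
  rw [hH, hH']
  exact ⟨fun Z hZ => ⟨exp_conj_mem 𝔥 Y hY hZ, exp_conj_mem' 𝔥 Y hY hZ⟩,
    fun δ h1 h2 h3 => exp_neg_mul_derivation_exp_mem 𝔥 Y hY δ h1 h2 h3⟩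

end Abstract

variable {V : Type*} [AddCommGroup V] [Module ℝ V] [FiniteDimensional ℝ V]

instance exteriorAlgebraFiniteDimensional : FiniteDimensional ℝ (ExteriorAlgebra ℝ V) :=
  Module.Finite.of_basis (Module.finBasis ℝ V).ExteriorAlgebra

variable {J₀ J₁ : Type*} [Fintype J₀] [Fintype J₁] [DecidableEq J₀] [DecidableEq J₁]

/-- The properties of the elements `u` of `exp((𝔤 ⊗ Λ)₀)` that are used: `u` is even, `Ad(u)`
preserves `𝔤 ⊗ Λ`, and the logarithmic derivative of `u` along the odd derivation `X` of `Λ` lies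
in `𝔤 ⊗ Λ`. -/
structure IsGauge (𝔤 : Submodule ℝ (Matrix (J₀ ⊕ J₁) (J₀ ⊕ J₁) ℝ))
    (X : ExteriorAlgebra ℝ V →ₗ[ℝ] ExteriorAlgebra ℝ V)
    (u : (Matrix (J₀ ⊕ J₁) (J₀ ⊕ J₁) (ExteriorAlgebra ℝ V))ˣ) : Prop where
  even : matrixParity u.1 = u.1
  conj : ∀ Z ∈ tensorSpace (extParity V) 𝔤, u⁻¹.1 * Z * u.1 ∈ tensorSpace (extParity V) 𝔤
  conj_inv : ∀ Z ∈ tensorSpace (extParity V) 𝔤, u.1 * Z * u⁻¹.1 ∈ tensorSpace (extParity V) 𝔤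
  deriv : u⁻¹.1 * matrixDerivation X u.1 ∈ tensorSpace (extParity V) 𝔤

variable {𝔤 : Submodule ℝ (Matrix (J₀ ⊕ J₁) (J₀ ⊕ J₁) ℝ)}
  {X : ExteriorAlgebra ℝ V →ₗ[ℝ] ExteriorAlgebra ℝ V}

theorem matrixDerivation_one
    (hX : ∀ a b, X (a * b) = X a * b + CliffordAlgebra.involute a * X b) :
    matrixDerivation X (1 : Matrix (J₀ ⊕ J₁) (J₀ ⊕ J₁) (ExteriorAlgebra ℝ V)) = 0 := by
  have h := matrixDerivation_mul (J₀ := J₀) (J₁ := J₁) hX (map_one matrixParity) 1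
  rw [mul_one, mul_one, one_mul] at h
  exact left_eq_add.1 h

theorem IsGauge.one (hX : ∀ a b, X (a * b) = X a * b + CliffordAlgebra.involute a * X b) :
    IsGauge 𝔤 X 1 where
  even := map_one _
  conj Z hZ := by simpa using hZ
  conj_inv Z hZ := by simpa using hZ
  deriv := by simp [matrixDerivation_one hX]

theorem IsGauge.mul (hX : ∀ a b, X (a * b) = X a * b + CliffordAlgebra.involute a * X b)
    {u v : (Matrix (J₀ ⊕ J₁) (J₀ ⊕ J₁) (ExteriorAlgebra ℝ V))ˣ}
    (hu : IsGauge 𝔤 X u) (hv : IsGauge 𝔤 X v) : IsGauge 𝔤 X (u * v) where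
  even := by rw [Units.val_mul, map_mul, hu.even, hv.even]
  conj Z hZ := by
    have := hv.conj _ (hu.conj Z hZ)
    rw [mul_inv_rev, Units.val_mul, Units.val_mul]
    simpa only [mul_assoc] using this
  conj_inv Z hZ := by
    have := hu.conj_inv _ (hv.conj_inv Z hZ)
    rw [mul_inv_rev, Units.val_mul, Units.val_mul]
    simpa only [mul_assoc] using this
  deriv := by
    have h : (u * v)⁻¹.1 * matrixDerivation X (u * v).1
        = v⁻¹.1 * (u⁻¹.1 * matrixDerivation X u.1) * v.1 + v⁻¹.1 * matrixDerivation X v.1 := by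
      rw [mul_inv_rev, Units.val_mul, Units.val_mul, matrixDerivation_mul hX hu.even, mul_add]
      simp only [mul_assoc, Units.inv_mul_cancel_left]
    rw [h]
    exact add_mem (hv.conj _ hu.deriv) hv.deriv

theorem IsGauge.inv (hX : ∀ a b, X (a * b) = X a * b + CliffordAlgebra.involute a * X b)
    {u : (Matrix (J₀ ⊕ J₁) (J₀ ⊕ J₁) (ExteriorAlgebra ℝ V))ˣ}
    (hu : IsGauge 𝔤 X u) : IsGauge 𝔤 X u⁻¹ where
  even := by
    have h1 : u.1 * matrixParity u⁻¹.1 = 1 := by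
      nth_rw 1 [← hu.even]
      rw [← map_mul, Units.mul_inv, map_one]
    exact (Units.eq_inv_of_mul_eq_one_left h1)
  conj Z hZ := by simpa using hu.conj_inv Z hZ
  conj_inv Z hZ := by simpa using hu.conj Z hZ
  deriv := by
    have h1 : matrixDerivation X u.1 * u⁻¹.1 + u.1 * matrixDerivation X u⁻¹.1 = 0 := by
      rw [← matrixDerivation_mul hX hu.even, Units.mul_inv, matrixDerivation_one hX]
    have h2 : (u⁻¹)⁻¹.1 * matrixDerivation X u⁻¹.1
        = -(u.1 * (u⁻¹.1 * matrixDerivation X u.1) * u⁻¹.1) := by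
      rw [inv_inv, Units.mul_inv_cancel_left]
      exact eq_neg_of_add_eq_zero_right h1
    rw [h2]
    exact neg_mem (hu.conj_inv _ hu.deriv)

theorem IsGauge.of_isWeakExp (h𝔤 : IsTriangularSuperLie 𝔤)
    (hX : ∀ a b, X (a * b) = X a * b + CliffordAlgebra.involute a * X b)
    (hX' : ∀ a, X (CliffordAlgebra.involute a) = -CliffordAlgebra.involute (X a))
    {Y : Matrix (J₀ ⊕ J₁) (J₀ ⊕ J₁) (ExteriorAlgebra ℝ V)}
    (hY : Y ∈ tensorSpace (extParity V) 𝔤) (hev : matrixParity Y = Y)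
    {u : (Matrix (J₀ ⊕ J₁) (J₀ ⊕ J₁) (ExteriorAlgebra ℝ V))ˣ} (hu : IsWeakExp Y u.1) :
    IsGauge 𝔤 X u := by
  obtain ⟨h1, h2⟩ := hu.conj_mem (tensorSpace (extParity V) 𝔤)
    fun Z hZ => h𝔤.commutator_mem hY hev hZ
  exact ⟨hu.map_eq _ hev, fun Z hZ => (h1 Z hZ).1, fun Z hZ => (h1 Z hZ).2,
    h2 _ (fun a => matrixDerivation_mul hX hev a) (matrixDerivation_one hX)
      (matrixDerivation_mem hX' hY)⟩

end Gauge

section SectionMatrices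

variable {E : Type*} [NormedAddCommGroup E] [NormedSpace ℝ E]
  {M : Type*} [TopologicalSpace M] [ChartedSpace E M]
  {F : Type*} [NormedAddCommGroup F] [NormedSpace ℝ F]
  {S : M → Type*} [TopologicalSpace (TotalSpace F S)] [∀ x, AddCommGroup (S x)]
  [∀ x, Module ℝ (S x)] [∀ x, TopologicalSpace (S x)] [FiberBundle F S] {U : Opens M}

/-- The value of a section of `∧S` at a point. -/
def evalAt (x : U) : superFunctions E F S U →ₐ[ℝ] ExteriorAlgebra ℝ (S x) :=
  (Pi.evalAlgHom ℝ _ x).comp (superFunctions E F S U).val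

theorem superFunctions_ext {f f' : superFunctions E F S U} (h : ∀ x : U, f.1 x = f'.1 x) :
    f = f' :=
  Subtype.ext (funext h)

theorem parity_parity (f : superFunctions E F S U) :
    parity E F S U (parity E F S U f) = f :=
  superFunctions_ext fun _ => CliffordAlgebra.involute_involute _

theorem parity_mul (f f' : superFunctions E F S U) :
    parity E F S U (f * f') = parity E F S U f * parity E F S U f' :=
  superFunctions_ext fun _ => map_mul _ _ _

variable {J₀ J₁ : Type*} [Fintype J₀] [Fintype J₁] [DecidableEq J₀] [DecidableEq J₁]

/-- The value of a supermatrix at a point. -/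
def evalMatrix {J : Type*} [Fintype J] [DecidableEq J] (x : U) :
    Matrix J J (superFunctions E F S U) →ₐ[ℝ] Matrix J J (ExteriorAlgebra ℝ (S x)) :=
  (evalAt x).mapMatrix

theorem evalMatrix_apply {J : Type*} [Fintype J] [DecidableEq J] (x : U)
    (Z : Matrix J J (superFunctions E F S U)) (i j : J) : evalMatrix x Z i j = (Z i j).1 x := rfl

theorem evalMatrix_superScale (x : U) (a : superFunctions E F S U)
    (y : Matrix (J₀ ⊕ J₁) (J₀ ⊕ J₁) ℝ) :
    evalMatrix x (superScale (parity E F S U) a y) = superScale (extParity (S x)) (a.1 x) y := by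
  ext (i | i) j <;> rfl

theorem evalMatrix_superExtend
    (P : Matrix (J₀ ⊕ J₁) (J₀ ⊕ J₁) ℝ →ₗ[ℝ] Matrix (J₀ ⊕ J₁) (J₀ ⊕ J₁) ℝ) (x : U)
    (Z : Matrix (J₀ ⊕ J₁) (J₀ ⊕ J₁) (superFunctions E F S U)) :
    evalMatrix x (superExtend (parity E F S U) P Z)
      = superExtend (extParity (S x)) P (evalMatrix x Z) := by
  simp only [superExtend, map_sum, evalMatrix_superScale]
  refine Finset.sum_congr rfl fun i _ => Finset.sum_congr rfl fun j _ => ?_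
  cases i <;> rfl

theorem tensorSub_eq (𝔤 : Submodule ℝ (Matrix (J₀ ⊕ J₁) (J₀ ⊕ J₁) ℝ)) (U : Opens M) :
    tensorSub (E := E) (F := F) (S := S) 𝔤 U = tensorSpace (parity E F S U) 𝔤 := by
  rw [tensorSub, tensorSpace]
  congr 1
  ext Z
  constructor
  · rintro ⟨x, hx, a, h1, h2⟩
    refine ⟨x, hx, a, ?_⟩
    ext (i | i) j : 1
    · exact h1 i j
    · exact h2 i j
  · rintro ⟨x, hx, a, rfl⟩
    exact ⟨x, hx, a, fun i j => rfl, fun i j => rfl⟩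

theorem matrix_ext {J : Type*} [Fintype J] [DecidableEq J]
    {Z Z' : Matrix J J (superFunctions E F S U)}
    (h : ∀ x : U, evalMatrix x Z = evalMatrix x Z') : Z = Z' := by
  refine Matrix.ext fun i j => ?_
  exact superFunctions_ext fun x => congrFun (congrFun (h x) i) j

/-- `𝔤 ⊗ 𝒜(U)` is defined by pointwise conditions. -/
theorem mem_tensorSub_iff {𝔤 : Submodule ℝ (Matrix (J₀ ⊕ J₁) (J₀ ⊕ J₁) ℝ)}
    {Z : Matrix (J₀ ⊕ J₁) (J₀ ⊕ J₁) (superFunctions E F S U)} :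
    Z ∈ tensorSub 𝔤 U ↔ ∀ x : U, evalMatrix x Z ∈ tensorSpace (extParity (S x)) 𝔤 := by
  obtain ⟨P, hP, hP'⟩ := exists_projection 𝔤
  rw [tensorSub_eq, mem_tensorSpace_iff (parity E F S U) (fun f => parity_parity f) hP hP']
  simp only [mem_tensorSpace_iff _ extParity_extParity hP hP', ← evalMatrix_superExtend]
  exact ⟨fun h x => by rw [h], fun h => matrix_ext h⟩

theorem evalMatrix_isEvenMatrix {Z : Matrix (J₀ ⊕ J₁) (J₀ ⊕ J₁) (superFunctions E F S U)}
    (hZ : IsEvenMatrix Z) (x : U) : matrixParity (evalMatrix x Z) = evalMatrix x Z := by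
  obtain ⟨h1, h2, h3, h4⟩ := hZ
  ext (i | i) (j | j) <;> rw [matrixParity_apply] <;>
  simp only [evalMatrix_apply, Sum.elim_inl, Sum.elim_inr, one_mul, mul_one, mul_neg, neg_mul,
    neg_neg]
  · exact congrArg (fun f => f.1 x) (h1 i j)
  · exact neg_eq_iff_eq_neg.2 (congrArg (fun f => f.1 x) (h3 i j))
  · exact neg_eq_iff_eq_neg.2 (congrArg (fun f => f.1 x) (h4 i j))
  · exact congrArg (fun f => f.1 x) (h2 i j)

theorem IsExp.isWeakExp {J : Type*} [Fintype J] [DecidableEq J]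
    {Y H : Matrix J J (superFunctions E F S U)} (h : IsExp Y H) (x : U) :
    IsWeakExp (evalMatrix x Y) (evalMatrix x H) := by
  intro φ
  have key : ∀ Z : Matrix J J (ExteriorAlgebra ℝ (S x)),
      φ Z = ∑ i, ∑ j, (φ ∘ₗ Matrix.singleLinearMap ℝ i j) (Z i j) := by
    intro Z
    conv_lhs => rw [Matrix.matrix_eq_sum_single Z]
    simp
  simp only [key, Finset.mul_sum]
  refine hasSum_sum fun i _ => hasSum_sum fun j _ => ?_
  simp only [← map_pow]
  exact h x i j (φ ∘ₗ Matrix.singleLinearMap ℝ i j)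

/-- The values of the elements of `G(𝒜(U))` are gauge transformations. -/
theorem isGauge_of_mem_expGroup [∀ x, FiniteDimensional ℝ (S x)]
    {𝔤 : Submodule ℝ (Matrix (J₀ ⊕ J₁) (J₀ ⊕ J₁) ℝ)} (h𝔤 : IsTriangularSuperLie 𝔤) (x : U)
    {X : ExteriorAlgebra ℝ (S x) →ₗ[ℝ] ExteriorAlgebra ℝ (S x)}
    (hX : ∀ a b, X (a * b) = X a * b + CliffordAlgebra.involute a * X b)
    (hX' : ∀ a, X (CliffordAlgebra.involute a) = -CliffordAlgebra.involute (X a))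
    {u : (Matrix (J₀ ⊕ J₁) (J₀ ⊕ J₁) (superFunctions E F S U))ˣ} (hu : u ∈ expGroup 𝔤 U) :
    IsGauge 𝔤 X (Units.map (evalMatrix x : _ →ₐ[ℝ] _).toMonoidHom u) := by
  induction hu using Subgroup.closure_induction with
  | mem u hu =>
    obtain ⟨Y, hY, hev, hexp⟩ := hu
    exact IsGauge.of_isWeakExp h𝔤 hX hX' (mem_tensorSub_iff.1 hY x)
      (evalMatrix_isEvenMatrix hev x) (hexp.isWeakExp x)
  | one =>
    rw [map_one]
    exact IsGauge.one hX
  | mul u v _ _ hu hv =>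
    rw [map_mul]
    exact IsGauge.mul hX hu hv
  | inv u _ hu =>
    rw [map_inv]
    exact IsGauge.inv hX hu

end SectionMatrices

/-! ### Supercommutators and right modules in an algebra with a grading operator -/

/-- A supercommutative algebra `Λ` with parity operator `p` that acts by left multiplications
`l a` in an algebra `R` of operators, where `P` is the grading operator. -/
structure SuperAction (R Λ : Type*) [Ring R] [Algebra ℝ R] [Ring Λ] [Algebra ℝ Λ] where
  P : R
  p : Λ →ₗ[ℝ] Λ
  l : Λ →ₗ[ℝ] R
  P_mul_P : P * P = 1
  p_p : ∀ a, p (p a) = a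
  p_mul : ∀ a b, p (a * b) = p a * p b
  p_one : p 1 = 1
  l_mul : ∀ a b, l (a * b) = l a * l b
  l_one : l 1 = 1
  P_mul_l : ∀ a, P * l a = l (p a) * P
  supercomm : ∀ a b, (2 : ℝ) • (a * b) = (b + p b) * a + (b - p b) * p a

namespace SuperAction

variable {R Λ : Type*} [Ring R] [Algebra ℝ R] [Ring Λ] [Algebra ℝ Λ] (A : SuperAction R Λ)

/-- The even component of an operator. -/
def even (X : R) : R := (2⁻¹ : ℝ) • (X + A.P * X * A.P)

/-- The odd component of an operator. -/
def odd (X : R) : R := (2⁻¹ : ℝ) • (X - A.P * X * A.P)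

/-- The supercommutator of operators. -/
def bracket (X Y : R) : R :=
  X * Y - A.even Y * A.even X - A.even Y * A.odd X - A.odd Y * A.even X + A.odd Y * A.odd X

/-- The right multiplication of operators by elements of `Λ`. -/
def smulRight (X : R) (a : Λ) : R := A.l a * A.even X + A.l (A.p a) * A.odd X

/-- Operators that preserve the degree. -/
def IsEven (X : R) : Prop := X * A.P = A.P * X

/-- Operators that reverse the degree. -/
def IsOdd (X : R) : Prop := X * A.P = -(A.P * X)

variable {A} {X Y : R}

theorem IsEven.conj (h : A.IsEven X) : A.P * X * A.P = X := by
  rw [mul_assoc, h, ← mul_assoc, A.P_mul_P, one_mul]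

theorem IsOdd.conj (h : A.IsOdd X) : A.P * X * A.P = -X := by
  rw [mul_assoc, h, mul_neg, ← mul_assoc, A.P_mul_P, one_mul]

theorem isEven_even (X : R) : A.IsEven (A.even X) := by
  rw [IsEven, even, smul_mul_assoc, mul_smul_comm, add_mul, mul_add, mul_assoc _ _ A.P,
    A.P_mul_P, mul_one, ← mul_assoc, ← mul_assoc, A.P_mul_P, one_mul, add_comm]

theorem isOdd_odd (X : R) : A.IsOdd (A.odd X) := by
  rw [IsOdd, odd, smul_mul_assoc, mul_smul_comm, sub_mul, mul_sub, mul_assoc _ _ A.P,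
    A.P_mul_P, mul_one, ← mul_assoc, ← mul_assoc, A.P_mul_P, one_mul, ← smul_neg, neg_sub]

theorem even_add_odd (X : R) : A.even X + A.odd X = X := by
  rw [even, odd, ← smul_add, add_add_sub_cancel, ← two_smul ℝ X, smul_smul]
  norm_num

theorem even_of_add {X₀ X₁ : R} (h₀ : A.IsEven X₀) (h₁ : A.IsOdd X₁) (h : X = X₀ + X₁) :
    A.even X = X₀ := by
  rw [even, h, mul_add, add_mul, h₀.conj, h₁.conj, add_add_add_comm, add_neg_cancel, add_zero,
    ← two_smul ℝ X₀, smul_smul]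
  norm_num

theorem odd_of_add {X₀ X₁ : R} (h₀ : A.IsEven X₀) (h₁ : A.IsOdd X₁) (h : X = X₀ + X₁) :
    A.odd X = X₁ := by
  have h2 := A.even_add_odd X
  rw [even_of_add h₀ h₁ h] at h2
  exact add_left_cancel (h2.trans h)

theorem isEven_zero : A.IsEven 0 := by rw [IsEven, zero_mul, mul_zero]

theorem isOdd_zero : A.IsOdd 0 := by rw [IsOdd, zero_mul, mul_zero, neg_zero]

theorem IsEven.even_eq (h : A.IsEven X) : A.even X = X :=
  even_of_add h isOdd_zero (add_zero X).symm

theorem IsEven.odd_eq (h : A.IsEven X) : A.odd X = 0 :=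
  odd_of_add h isOdd_zero (add_zero X).symm

theorem IsOdd.even_eq (h : A.IsOdd X) : A.even X = 0 :=
  even_of_add isEven_zero h (zero_add X).symm

theorem IsOdd.odd_eq (h : A.IsOdd X) : A.odd X = X :=
  odd_of_add isEven_zero h (zero_add X).symm

theorem IsEven.add (hX : A.IsEven X) (hY : A.IsEven Y) : A.IsEven (X + Y) := by
  rw [IsEven, add_mul, mul_add, hX, hY]

theorem IsOdd.add (hX : A.IsOdd X) (hY : A.IsOdd Y) : A.IsOdd (X + Y) := by
  rw [IsOdd, add_mul, mul_add, hX, hY, neg_add]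

theorem IsEven.neg (hX : A.IsEven X) : A.IsEven (-X) := by rw [IsEven, neg_mul, mul_neg, hX]

theorem IsOdd.neg (hX : A.IsOdd X) : A.IsOdd (-X) := by rw [IsOdd, neg_mul, mul_neg, hX]

theorem IsEven.mul_odd (hX : A.IsEven X) (hY : A.IsOdd Y) : A.IsOdd (X * Y) := by
  rw [IsOdd, mul_assoc, hY, mul_neg, ← mul_assoc, hX, mul_assoc]

theorem IsOdd.mul_even (hX : A.IsOdd X) (hY : A.IsEven Y) : A.IsOdd (X * Y) := by
  rw [IsOdd, mul_assoc, hY, ← mul_assoc, hX, neg_mul, mul_assoc]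

theorem IsEven.mul_even (hX : A.IsEven X) (hY : A.IsEven Y) : A.IsEven (X * Y) := by
  rw [IsEven, mul_assoc, hY, ← mul_assoc, hX, mul_assoc]

theorem IsOdd.mul_odd (hX : A.IsOdd X) (hY : A.IsOdd Y) : A.IsEven (X * Y) := by
  rw [IsEven, mul_assoc, hY, mul_neg, ← mul_assoc, hX, neg_mul, neg_neg, mul_assoc]

theorem isEven_l {a : Λ} (ha : A.p a = a) : A.IsEven (A.l a) := by
  rw [IsEven, A.P_mul_l, ha]

theorem isOdd_l {a : Λ} (ha : A.p a = -a) : A.IsOdd (A.l a) := by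
  rw [IsOdd, A.P_mul_l, ha, map_neg, neg_mul, neg_neg]

/-- Every element of `Λ` is the sum of an even and an odd one. -/
theorem exists_even_odd (A : SuperAction R Λ) (a : Λ) :
    ∃ a₀ a₁, A.p a₀ = a₀ ∧ A.p a₁ = -a₁ ∧ a = a₀ + a₁ ∧ A.p a = a₀ - a₁ ∧
      ∀ b, b * a₀ = a₀ * b ∧ b * a₁ = a₁ * A.p b := by
  have h0 : a = (2⁻¹ : ℝ) • (a + A.p a) + (2⁻¹ : ℝ) • (a - A.p a) := by
    rw [← smul_add, add_add_sub_cancel, ← two_smul ℝ a, smul_smul]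
    norm_num
  have e0 : A.p ((2⁻¹ : ℝ) • (a + A.p a)) = (2⁻¹ : ℝ) • (a + A.p a) := by
    rw [map_smul, map_add, A.p_p, add_comm]
  have e1 : A.p ((2⁻¹ : ℝ) • (a - A.p a)) = -((2⁻¹ : ℝ) • (a - A.p a)) := by
    rw [map_smul, map_sub, A.p_p, ← smul_neg, neg_sub]
  refine ⟨(2⁻¹ : ℝ) • (a + A.p a), (2⁻¹ : ℝ) • (a - A.p a), e0, e1, h0, ?_, ?_⟩
  · conv_lhs => rw [h0]
    rw [map_add, e0, e1]
    exact (sub_eq_add_neg _ _).symm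
  · have h2 : Function.Injective fun a : Λ => (2 : ℝ) • a :=
      smul_right_injective _ (two_ne_zero' ℝ)
    refine fun b => ⟨h2 ?_, h2 ?_⟩
    · change (2 : ℝ) • (b * _) = _
      rw [A.supercomm, e0, sub_self, zero_mul, add_zero, ← two_smul ℝ, smul_mul_assoc]
    · change (2 : ℝ) • (b * _) = _
      rw [A.supercomm, e1, add_neg_cancel, zero_mul, zero_add, sub_neg_eq_add, ← two_smul ℝ,
        smul_mul_assoc]

section SmulRight

variable {a a₀ a₁ : Λ}

theorem even_smulRight (X : R) (h₀ : A.p a₀ = a₀) (h₁ : A.p a₁ = -a₁) :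
    A.even (A.smulRight X (a₀ + a₁)) = A.l a₀ * A.even X - A.l a₁ * A.odd X := by
  refine even_of_add (X₁ := A.l a₁ * A.even X + A.l a₀ * A.odd X) ?_ ?_ ?_
  · rw [sub_eq_add_neg]
    exact ((isEven_l h₀).mul_even (isEven_even X)).add ((isOdd_l h₁).mul_odd (isOdd_odd X)).neg
  · exact ((isOdd_l h₁).mul_even (isEven_even X)).add ((isEven_l h₀).mul_odd (isOdd_odd X))
  · rw [smulRight, map_add A.p, h₀, h₁, map_add, map_add, map_neg]
    noncomm_ring

theorem odd_smulRight (X : R) (h₀ : A.p a₀ = a₀) (h₁ : A.p a₁ = -a₁) :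
    A.odd (A.smulRight X (a₀ + a₁)) = A.l a₁ * A.even X + A.l a₀ * A.odd X := by
  refine odd_of_add (X₀ := A.l a₀ * A.even X - A.l a₁ * A.odd X) ?_ ?_ ?_
  · rw [sub_eq_add_neg]
    exact ((isEven_l h₀).mul_even (isEven_even X)).add ((isOdd_l h₁).mul_odd (isOdd_odd X)).neg
  · exact ((isOdd_l h₁).mul_even (isEven_even X)).add ((isEven_l h₀).mul_odd (isOdd_odd X))
  · rw [smulRight, map_add A.p, h₀, h₁, map_add, map_add, map_neg]
    noncomm_ring

theorem smulRight_smulRight (X : R) (a b : Λ) :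
    A.smulRight (A.smulRight X a) b = A.smulRight X (a * b) := by
  obtain ⟨a₀, a₁, h₀, h₁, rfl, hp, hc⟩ := A.exists_even_odd a
  rw [smulRight, even_smulRight X h₀ h₁, odd_smulRight X h₀ h₁, smulRight, A.p_mul, hp]
  have e1 : (a₀ + a₁) * b = b * a₀ + A.p b * a₁ := by
    rw [add_mul, (hc b).1, (hc (A.p b)).2, A.p_p]
  have e2 : (a₀ - a₁) * A.p b = A.p b * a₀ - b * a₁ := by
    rw [sub_mul, (hc (A.p b)).1, (hc b).2]
  rw [e1, e2, map_add, map_sub, A.l_mul, A.l_mul, A.l_mul, A.l_mul]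
  noncomm_ring

theorem smulRight_add (X : R) (a b : Λ) :
    A.smulRight X (a + b) = A.smulRight X a + A.smulRight X b := by
  simp only [smulRight, map_add, add_mul]
  abel

theorem smulRight_zero (X : R) : A.smulRight X 0 = 0 := by simp [smulRight]

theorem smulRight_one (X : R) : A.smulRight X 1 = X := by
  rw [smulRight, A.p_one, A.l_one, one_mul, one_mul, even_add_odd]

theorem even_add (X Y : R) : A.even (X + Y) = A.even X + A.even Y := by
  rw [even, even, even, ← smul_add, mul_add, add_mul, add_add_add_comm]

theorem odd_add (X Y : R) : A.odd (X + Y) = A.odd X + A.odd Y := by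
  rw [odd, odd, odd, ← smul_add, mul_add, add_mul, add_sub_add_comm]

theorem add_smulRight (X Y : R) (a : Λ) :
    A.smulRight (X + Y) a = A.smulRight X a + A.smulRight Y a := by
  simp only [smulRight, even_add, odd_add, mul_add]
  abel

theorem zero_smulRight (a : Λ) : A.smulRight 0 a = 0 := by simp [smulRight, even, odd]

theorem smulRight_sum {ι : Type*} (s : Finset ι) (X : R) (a : ι → Λ) :
    A.smulRight X (∑ i ∈ s, a i) = ∑ i ∈ s, A.smulRight X (a i) :=
  map_sum (⟨⟨A.smulRight X, smulRight_zero X⟩, smulRight_add X⟩ : Λ →+ R) a s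

theorem sum_smulRight {ι : Type*} (s : Finset ι) (X : ι → R) (a : Λ) :
    A.smulRight (∑ i ∈ s, X i) a = ∑ i ∈ s, A.smulRight (X i) a :=
  map_sum (⟨⟨fun X => A.smulRight X a, zero_smulRight a⟩, fun X Y => add_smulRight X Y a⟩ :
    R →+ R) X s

variable {J : Type*} [Fintype J] [DecidableEq J]

theorem tuple_mul_mul (X : J → R) (Z Z' : Matrix J J Λ) (j : J) :
    ∑ i, A.smulRight (∑ r, A.smulRight (X r) (Z r i)) (Z' i j)
      = ∑ r, A.smulRight (X r) ((Z * Z') r j) := by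
  simp only [sum_smulRight, smulRight_smulRight, Matrix.mul_apply, smulRight_sum]
  exact Finset.sum_comm

theorem tuple_mul_one (X : J → R) (j : J) :
    ∑ i, A.smulRight (X i) ((1 : Matrix J J Λ) i j) = X j := by
  rw [Finset.sum_eq_single j]
  · rw [Matrix.one_apply_eq, smulRight_one]
  · intro i _ hij
    rw [Matrix.one_apply_ne hij, smulRight_zero]
  · simp

theorem tuple_mul_add (X : J → R) (Z Z' : Matrix J J Λ) (j : J) :
    ∑ i, A.smulRight (X i) ((Z + Z') i j)
      = (∑ i, A.smulRight (X i) (Z i j)) + ∑ i, A.smulRight (X i) (Z' i j) := by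
  simp only [Matrix.add_apply, smulRight_add, Finset.sum_add_distrib]

end SmulRight

theorem IsOdd.bracket_eq (hX : A.IsOdd X) (Y : R) :
    A.bracket X Y = (X * A.odd Y + A.odd Y * X) + (X * A.even Y - A.even Y * X) := by
  rw [bracket, hX.even_eq, hX.odd_eq, mul_zero, mul_zero, sub_zero, sub_zero]
  nth_rw 1 [← A.even_add_odd Y]
  noncomm_ring

theorem bracket_add (X Y Z : R) : A.bracket X (Y + Z) = A.bracket X Y + A.bracket X Z := by
  simp only [bracket, even_add, odd_add]
  noncomm_ring

theorem bracket_zero (X : R) : A.bracket X 0 = 0 := by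
  have h := A.bracket_add X 0 0
  rw [add_zero] at h
  exact left_eq_add.1 h

theorem bracket_sum {ι : Type*} (s : Finset ι) (X : R) (Y : ι → R) :
    A.bracket X (∑ i ∈ s, Y i) = ∑ i ∈ s, A.bracket X (Y i) :=
  map_sum (⟨⟨A.bracket X, bracket_zero X⟩, bracket_add X⟩ : R →+ R) Y s

variable {D : Λ →ₗ[ℝ] Λ}

/-- The Leibniz rule `[X, Y a] = [X, Y] a + (-1)^|Y| Y X(a)` for odd superderivations `X`. -/
theorem IsOdd.bracket_smulRight (hX : A.IsOdd X)
    (hD : ∀ a, X * A.l a = A.l (D a) + A.l (A.p a) * X) (hDp : ∀ a, D (A.p a) = -A.p (D a))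
    (Y : R) (a : Λ) :
    A.bracket X (A.smulRight Y a) = A.smulRight (A.bracket X Y) a
      + (A.l (D a) * A.even Y - A.l (A.p (D a)) * A.odd Y) := by
  have h0 := isEven_even (A := A) Y
  have h1 := isOdd_odd (A := A) Y
  have b0 := (hX.mul_odd h1).add (h1.mul_odd hX)
  have b1 : A.IsOdd (X * A.even Y - A.even Y * X) := by
    rw [sub_eq_add_neg]
    exact (hX.mul_even h0).add (h0.mul_odd hX).neg
  have e1 := even_of_add b0 b1 (hX.bracket_eq Y)
  have e2 := odd_of_add b0 b1 (hX.bracket_eq Y)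
  have e4 : A.bracket X (A.smulRight Y a) = X * A.smulRight Y a
      - A.even (A.smulRight Y a) * X + A.odd (A.smulRight Y a) * X := by
    rw [bracket, hX.even_eq, hX.odd_eq, mul_zero, mul_zero, sub_zero, sub_zero]
  have e3 : X * A.smulRight Y a = (A.l (D a) + A.l (A.p a) * X) * A.even Y
      + (-A.l (A.p (D a)) + A.l a * X) * A.odd Y := by
    rw [smulRight, mul_add, ← mul_assoc, ← mul_assoc, hD, hD, hDp, A.p_p, map_neg]
  obtain ⟨a₀, a₁, h₀, h₁, ha, hp, -⟩ := A.exists_even_odd a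
  have e5 : A.l a = A.l a₀ + A.l a₁ := by rw [ha, map_add]
  have e6 : A.smulRight (A.bracket X Y) a = A.l a * (X * A.odd Y + A.odd Y * X)
      + A.l (A.p a) * (X * A.even Y - A.even Y * X) := by rw [smulRight, e1, e2]
  have e7 : A.even (A.smulRight Y a) = A.l a₀ * A.even Y - A.l a₁ * A.odd Y := by
    rw [ha, even_smulRight Y h₀ h₁]
  have e8 : A.odd (A.smulRight Y a) = A.l a₁ * A.even Y + A.l a₀ * A.odd Y := by
    rw [ha, odd_smulRight Y h₀ h₁]
  rw [e4, e3, e6, e7, e8, hp, e5, map_sub]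
  noncomm_ring

variable {J₀ J₁ : Type*} [Fintype J₀] [Fintype J₁] [DecidableEq J₀] [DecidableEq J₁]

/-- The Leibniz rule for the Lie derivative of a tuple `Y u` of vector fields. -/
theorem IsOdd.bracket_tuple (hX : A.IsOdd X)
    (hD : ∀ a, X * A.l a = A.l (D a) + A.l (A.p a) * X) (hDp : ∀ a, D (A.p a) = -A.p (D a))
    {Y : J₀ ⊕ J₁ → R} (hY₀ : ∀ i, A.IsEven (Y (Sum.inl i))) (hY₁ : ∀ i, A.IsOdd (Y (Sum.inr i)))
    (u : Matrix (J₀ ⊕ J₁) (J₀ ⊕ J₁) Λ) (j : J₀ ⊕ J₁) :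
    A.bracket X (∑ i, A.smulRight (Y i) (u i j))
      = (∑ i, A.smulRight (A.bracket X (Y i)) (u i j))
        + ∑ i, A.smulRight (Y i) (matrixDerivation D u i j) := by
  simp only [bracket_sum, hX.bracket_smulRight hD hDp, Finset.sum_add_distrib]
  congr 1
  refine Finset.sum_congr rfl fun i _ => ?_
  obtain i | i := i
  · rw [smulRight, (hY₀ i).even_eq, (hY₀ i).odd_eq, mul_zero, mul_zero, sub_zero, add_zero]
    rfl
  · have h : matrixDerivation D u (Sum.inr i) j = -D (u (Sum.inr i) j) := rfl
    rw [smulRight, (hY₁ i).even_eq, (hY₁ i).odd_eq, mul_zero, mul_zero, zero_sub, zero_add, h,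
      map_neg, map_neg, neg_mul]

end SuperAction

/-! ### Endomorphisms of the structure sheaf -/

section SheafEndomorphisms

variable {E : Type*} [NormedAddCommGroup E] [NormedSpace ℝ E]
  {M : Type*} [TopologicalSpace M] [ChartedSpace E M]
  {F : Type*} [NormedAddCommGroup F] [NormedSpace ℝ F]
  {S : M → Type*} [TopologicalSpace (TotalSpace F S)] [∀ x, AddCommGroup (S x)]
  [∀ x, Module ℝ (S x)] [∀ x, TopologicalSpace (S x)] [FiberBundle F S]
  {U U' : Opens M}

theorem sheafEnd_ext {X Y : SheafEnd E F S U}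
    (h : ∀ (W : {W : Opens M // W ≤ U}) (f : superFunctions E F S W.1) (x : W.1),
      (X.1 W f).1 x = (Y.1 W f).1 x) : X = Y :=
  Subtype.ext (funext fun W => LinearMap.ext fun f => superFunctions_ext fun x => h W f x)

theorem sheafEnd_res (X : SheafEnd E F S U) (W W' : {W : Opens M // W ≤ U}) (h : W'.1 ≤ W.1)
    (f : superFunctions E F S W.1) : res E F S h (X.1 W f) = X.1 W' (res E F S h f) :=
  X.2 W W' h f

theorem sheafEnd_apply_eq (X : SheafEnd E F S U) (W W' : {W : Opens M // W ≤ U}) (h : W'.1 ≤ W.1)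
    (f : superFunctions E F S W.1) (x : W'.1) :
    (X.1 W f).1 ⟨x, h x.2⟩ = (X.1 W' (res E F S h f)).1 x :=
  congrArg (fun f => f.1 x) (sheafEnd_res X W W' h f)

/-- Restriction of sheaf endomorphisms as a homomorphism. -/
def restrictHom (h : U' ≤ U) : SheafEnd E F S U →+ SheafEnd E F S U' where
  toFun := restrictEnd h
  map_zero' := rfl
  map_add' _ _ := rfl

theorem restrictHom_apply (h : U' ≤ U) (X : SheafEnd E F S U) :
    restrictHom h X = restrictEnd h X := rfl

/-- Equality of sheaf endomorphisms is local. -/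
theorem sheafEnd_ext_local {X Y : SheafEnd E F S U}
    (h : ∀ x ∈ U, ∃ (W : Opens M) (hW : W ≤ U), x ∈ W ∧ restrictEnd hW X = restrictEnd hW Y) :
    X = Y := by
  refine sheafEnd_ext fun W f x => ?_
  obtain ⟨W', hW', hx, he⟩ := h x (W.2 x.2)
  have h1 : W' ⊓ W.1 ≤ U := inf_le_right.trans W.2
  have h2 := sheafEnd_apply_eq X W ⟨W' ⊓ W.1, h1⟩ inf_le_right f ⟨x, hx, x.2⟩
  have h3 := sheafEnd_apply_eq Y W ⟨W' ⊓ W.1, h1⟩ inf_le_right f ⟨x, hx, x.2⟩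
  have h4 := congrArg (fun X => X.1 ⟨W' ⊓ W.1, inf_le_left⟩) he
  have h5 : X.1 ⟨W' ⊓ W.1, h1⟩ = Y.1 ⟨W' ⊓ W.1, h1⟩ := h4
  exact h2.trans ((by rw [h5] : _ = _).trans h3.symm)

/-- The action of `𝒜(U)` on the endomorphisms of the sheaf `𝒜` over `U`. -/
def sheafAction (E : Type*) [NormedAddCommGroup E] [NormedSpace ℝ E]
    {M : Type*} [TopologicalSpace M] [ChartedSpace E M]
    (F : Type*) [NormedAddCommGroup F] [NormedSpace ℝ F]
    (S : M → Type*) [TopologicalSpace (TotalSpace F S)] [∀ x, AddCommGroup (S x)]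
    [∀ x, Module ℝ (S x)] [∀ x, TopologicalSpace (S x)] [FiberBundle F S] (U : Opens M) :
    SuperAction (SheafEnd E F S U) (superFunctions E F S U) where
  P := parityEnd E F S U
  p := parity E F S U
  l :=
    { toFun := leftMul
      map_add' := fun a _ => sheafEnd_ext fun W f x => add_mul (a.1 ⟨x, W.2 x.2⟩) _ (f.1 x)
      map_smul' := fun r a => sheafEnd_ext fun W f x =>
        smul_mul_assoc r (a.1 ⟨x, W.2 x.2⟩) (f.1 x) }
  P_mul_P := sheafEnd_ext fun _ f x => CliffordAlgebra.involute_involute (f.1 x)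
  p_p := parity_parity
  p_mul := parity_mul
  p_one := superFunctions_ext fun _ => map_one _
  l_mul a _ := sheafEnd_ext fun W f x => mul_assoc (a.1 ⟨x, W.2 x.2⟩) _ (f.1 x)
  l_one := sheafEnd_ext fun _ f x => one_mul (f.1 x)
  P_mul_l _ := sheafEnd_ext fun _ _ _ => map_mul CliffordAlgebra.involute _ _
  supercomm a b := superFunctions_ext fun x => two_smul_mul_eq (a.1 x) (b.1 x)

section Tuples

variable {J : Type*} [Fintype J] [DecidableEq J]

theorem tupleMul_tupleMul (X : J → SheafEnd E F S U) (Z Z' : Matrix J J (superFunctions E F S U)) :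
    tupleMul (tupleMul X Z) Z' = tupleMul X (Z * Z') :=
  funext fun j => SuperAction.tuple_mul_mul (A := sheafAction E F S U) X Z Z' j

theorem tupleMul_one (X : J → SheafEnd E F S U) : tupleMul X 1 = X :=
  funext fun j => SuperAction.tuple_mul_one (A := sheafAction E F S U) X j

theorem tupleMul_add (X : J → SheafEnd E F S U) (Z Z' : Matrix J J (superFunctions E F S U)) :
    tupleMul X (Z + Z') = tupleMul X Z + tupleMul X Z' :=
  funext fun j => SuperAction.tuple_mul_add (A := sheafAction E F S U) X Z Z' j

/-- Restriction of supermatrices. -/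
def resMatrix (h : U' ≤ U) : Matrix J J (superFunctions E F S U) →ₐ[ℝ]
    Matrix J J (superFunctions E F S U') :=
  (res E F S h).mapMatrix

theorem evalMatrix_resMatrix (h : U' ≤ U) (Z : Matrix J J (superFunctions E F S U)) (x : U') :
    evalMatrix x (resMatrix h Z) = evalMatrix (⟨x, h x.2⟩ : U) Z := rfl

theorem restrictEnd_tupleMul (h : U' ≤ U) (X : J → SheafEnd E F S U)
    (Z : Matrix J J (superFunctions E F S U)) :
    (fun j => restrictEnd h (tupleMul X Z j))
      = tupleMul (fun j => restrictEnd h (X j)) (resMatrix h Z) := by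
  funext j
  simp only [tupleMul, ← restrictHom_apply, map_sum]
  rfl

/-- Tuples of vector fields that are linearly independent over `𝒜`, on all open subsets. -/
def IsIndependent (X : J → SheafEnd E F S U) : Prop :=
  ∀ (W : Opens M) (h : W ≤ U) (Z Z' : Matrix J J (superFunctions E F S W)),
    tupleMul (fun j => restrictEnd h (X j)) Z = tupleMul (fun j => restrictEnd h (X j)) Z' → Z = Z'

theorem IsIndependent.of_local {X : J → SheafEnd E F S U}
    (hX : ∀ x ∈ U, ∃ (W : Opens M) (h : W ≤ U), x ∈ W ∧
      IsIndependent fun j => restrictEnd h (X j)) : IsIndependent X := by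
  intro W h Z Z' hZ
  refine matrix_ext fun x => ?_
  obtain ⟨W', h', hx, hind⟩ := hX x (h x.2)
  have h1 := congrArg (fun Y : J → SheafEnd E F S W => fun j =>
    restrictEnd (inf_le_right : W' ⊓ W ≤ W) (Y j)) hZ
  simp only [restrictEnd_tupleMul] at h1
  have h2 := hind (W' ⊓ W) inf_le_left _ _ h1
  exact congrArg (evalMatrix (⟨x, hx, x.2⟩ : (W' ⊓ W : Opens M))) h2

theorem IsIndependent.tupleMul_units {X : J → SheafEnd E F S U} (hX : IsIndependent X)
    (u : (Matrix J J (superFunctions E F S U))ˣ) : IsIndependent (tupleMul X u.1) := by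
  intro W h Z Z' hZ
  rw [restrictEnd_tupleMul, tupleMul_tupleMul, tupleMul_tupleMul] at hZ
  have h1 := congrArg (resMatrix h u⁻¹.1 * ·) (hX W h _ _ hZ)
  simp only [← mul_assoc, ← map_mul, Units.inv_mul, map_one, one_mul] at h1
  exact h1

/-- Matrices that express one tuple of vector fields in terms of an independent one can be glued. -/
theorem IsIndependent.glue {X : J → SheafEnd E F S U} (hX : IsIndependent X)
    (Y : J → SheafEnd E F S U)
    (h : ∀ x ∈ U, ∃ (W : Opens M) (hW : W ≤ U), x ∈ W ∧ ∃ Z,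
      (fun j => restrictEnd hW (Y j)) = tupleMul (fun j => restrictEnd hW (X j)) Z) :
    ∃ Z, Y = tupleMul X Z ∧ ∀ (W : Opens M) (hW : W ≤ U) (Z' : Matrix J J (superFunctions E F S W)),
      (fun j => restrictEnd hW (Y j)) = tupleMul (fun j => restrictEnd hW (X j)) Z' →
      resMatrix hW Z = Z' := by
  choose W hW hxW Z hZ using h
  have key : ∀ (W' : Opens M) (hW' : W' ≤ U) (Z' : Matrix J J (superFunctions E F S W'))
      (_ : (fun j => restrictEnd hW' (Y j)) = tupleMul (fun j => restrictEnd hW' (X j)) Z')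
      (x : M) (hx : x ∈ U) (y : M) (hy : y ∈ W') (hy' : y ∈ W x hx),
      evalMatrix ⟨y, hy⟩ Z' = evalMatrix ⟨y, hy'⟩ (Z x hx) := by
    intro W' hW' Z' hZ' x hx y hy hy'
    have h1 := congrArg (fun Y : J → SheafEnd E F S W' => fun j =>
      restrictEnd (inf_le_left : W' ⊓ W x hx ≤ W') (Y j)) hZ'
    have h2 := congrArg (fun Y : J → SheafEnd E F S (W x hx) => fun j =>
      restrictEnd (inf_le_right : W' ⊓ W x hx ≤ W x hx) (Y j)) (hZ x hx)
    simp only [restrictEnd_tupleMul] at h1 h2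
    have h3 := hX (W' ⊓ W x hx) (inf_le_left.trans hW') _ _ (h1.symm.trans h2)
    exact congrArg (evalMatrix (⟨y, hy, hy'⟩ : (W' ⊓ W x hx : Opens M))) h3
  let Z₀ : Matrix J J (superFunctions E F S U) := Matrix.of fun i j =>
    ⟨fun x : U => (Z x x.2 i j).1 ⟨x, hxW x x.2⟩, by
      intro x hx
      obtain ⟨W', hW', hx', hf⟩ := (Z x hx i j).2 x (hxW x hx)
      refine ⟨W', hW'.trans (hW x hx), hx', ?_⟩
      convert hf using 1
      funext y
      exact congrFun (congrFun (key (W y (hW x hx (hW' y.2))) (hW y _) _ (hZ y _) x hx y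
        (hxW y _) (hW' y.2)) i) j⟩
  have hres : ∀ (W' : Opens M) (hW' : W' ≤ U) (Z' : Matrix J J (superFunctions E F S W')),
      (fun j => restrictEnd hW' (Y j)) = tupleMul (fun j => restrictEnd hW' (X j)) Z' →
      resMatrix hW' Z₀ = Z' := by
    intro W' hW' Z' hZ'
    refine matrix_ext fun y => ?_
    exact (key W' hW' Z' hZ' y (hW' y.2) y y.2 (hxW y _)).symm
  refine ⟨Z₀, funext fun j => sheafEnd_ext_local fun x hx => ⟨W x hx, hW x hx, hxW x hx, ?_⟩, hres⟩
  have h1 := hZ x hx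
  rw [← hres _ _ _ h1, ← restrictEnd_tupleMul] at h1
  exact congrFun h1 j

end Tuples

/-! ### Superderivations -/

theorem IsOddDer.mul_leftMul {X : SheafEnd E F S U} (hX : IsOddDer X) (a : superFunctions E F S U) :
    X * leftMul a = leftMul (X.1 ⟨U, le_rfl⟩ a) + leftMul (parity E F S U a) * X :=
  sheafEnd_ext fun W f x => by
    have h := hX.2 W (res E F S W.2 a) f
    have h2 := sheafEnd_res X ⟨U, le_rfl⟩ W W.2 a
    rw [← h2] at h
    exact congrArg (fun f => f.1 x) h

theorem IsOddDer.map_parity {X : SheafEnd E F S U} (hX : IsOddDer X) (a : superFunctions E F S U) :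
    X.1 ⟨U, le_rfl⟩ (parity E F S U a) = -parity E F S U (X.1 ⟨U, le_rfl⟩ a) :=
  congrArg (fun Y : SheafEnd E F S U => Y.1 ⟨U, le_rfl⟩ a) hX.1

variable {J₀ J₁ : Type*} [Fintype J₀] [Fintype J₁] [DecidableEq J₀] [DecidableEq J₁]

/-- The Leibniz rule for the Lie derivative of a tuple `Y u` of vector fields. -/
theorem IsOddDer.superBracket_tupleMul {X : SheafEnd E F S U} (hX : IsOddDer X)
    {Y : J₀ ⊕ J₁ → SheafEnd E F S U} (hY₀ : ∀ i, (sheafAction E F S U).IsEven (Y (Sum.inl i)))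
    (hY₁ : ∀ i, (sheafAction E F S U).IsOdd (Y (Sum.inr i)))
    (u : Matrix (J₀ ⊕ J₁) (J₀ ⊕ J₁) (superFunctions E F S U)) :
    (fun j => superBracket X (tupleMul Y u j))
      = tupleMul (fun i => superBracket X (Y i)) u
        + tupleMul Y (matrixDerivation (X.1 ⟨U, le_rfl⟩) u) :=
  funext fun j => SuperAction.IsOdd.bracket_tuple (A := sheafAction E F S U) hX.1
    hX.mul_leftMul hX.map_parity hY₀ hY₁ u j

/-- Operators that satisfy a Leibniz rule are determined by their values on smooth functions and
smooth sections of `S`. -/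
theorem eq_of_eq_on_generators {D D' : SheafEnd E F S U}
    (τ : ∀ W : {W : Opens M // W ≤ U}, superFunctions E F S W.1 → superFunctions E F S W.1)
    (hD : ∀ W a b, D.1 W (a * b) = D.1 W a * b + τ W a * D.1 W b)
    (hD' : ∀ W a b, D'.1 W (a * b) = D'.1 W a * b + τ W a * D'.1 W b)
    (h₀ : ∀ (W : {W : Opens M // W ≤ U}) (f : superFunctions E F S W.1) (φ : M → ℝ),
      ContMDiffOn 𝓘(ℝ, E) 𝓘(ℝ, ℝ) ∞ φ W.1 → (∀ x : W.1, f.1 x = algebraMap ℝ _ (φ x)) →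
      ∀ x : W.1, (D.1 W f).1 x = (D'.1 W f).1 x)
    (h₁ : ∀ (W : {W : Opens M // W ≤ U}) (f : superFunctions E F S W.1) (t : Π x, S x),
      SmoothOn E F t W.1 → (∀ x : W.1, f.1 x = ExteriorAlgebra.ι ℝ (t x)) →
      ∀ x : W.1, (D.1 W f).1 x = (D'.1 W f).1 x) : D = D' := by
  have key : ∀ (W : {W : Opens M // W ≤ U}) (f : ExtSec S W.1),
      f ∈ Algebra.adjoin ℝ (generators E F S W.1) → ∀ hf : f ∈ superFunctions E F S W.1,
      D.1 W ⟨f, hf⟩ = D'.1 W ⟨f, hf⟩ := by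
    intro W f hf
    have hsub : ∀ f ∈ Algebra.adjoin ℝ (generators E F S W.1), f ∈ superFunctions E F S W.1 :=
      fun f hf x hx => ⟨W.1, le_rfl, hx, hf⟩
    induction hf using Algebra.adjoin_induction with
    | mem f hf =>
      intro hf'
      obtain ⟨φ, hφ, rfl⟩ | ⟨t, ht, rfl⟩ := hf
      · exact superFunctions_ext fun x => h₀ W _ φ hφ (fun _ => rfl) x
      · exact superFunctions_ext fun x => h₁ W _ t ht (fun _ => rfl) x
    | algebraMap r =>
      intro hf'
      exact superFunctions_ext fun x => h₀ W _ (fun _ => r) contMDiffOn_const (fun _ => rfl) x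
    | add f f' h1 h2 ha hb =>
      intro hf'
      have e : (⟨f + f', hf'⟩ : superFunctions E F S W.1) = ⟨f, hsub f h1⟩ + ⟨f', hsub f' h2⟩ := rfl
      rw [e, map_add, map_add, ha, hb]
    | mul f f' h1 h2 ha hb =>
      intro hf'
      have e : (⟨f * f', hf'⟩ : superFunctions E F S W.1) = ⟨f, hsub f h1⟩ * ⟨f', hsub f' h2⟩ := rfl
      rw [e, hD, hD', ha, hb]
  refine sheafEnd_ext fun W f x => ?_
  obtain ⟨W', h', hx, hf⟩ := f.2 x x.2
  have e1 := sheafEnd_apply_eq D W ⟨W', h'.trans W.2⟩ h' f ⟨x, hx⟩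
  have e2 := sheafEnd_apply_eq D' W ⟨W', h'.trans W.2⟩ h' f ⟨x, hx⟩
  have e3 := key ⟨W', h'.trans W.2⟩ _ hf (res E F S h' f).2
  exact e1.trans ((congrArg (fun f => f.1 ⟨x, hx⟩) e3).trans e2.symm)

end SheafEndomorphisms

theorem isTriangularSuperLie_modelLie {k l n : ℕ} {Δ : CliffordModule k l n}
    {G : LinearMap.BilinForm ℝ (Fin n → ℝ)} (hG : IsSuitable Δ.ρ G) :
    IsTriangularSuperLie (modelLie Δ G) where
  split := by
    rintro _ ⟨A, hA, q, rfl⟩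
    exact ⟨_, rotationMatrix_mem hA, _, spinorMatrix_mem q,
      ⟨fun _ _ => rfl, fun _ _ => rfl⟩, ⟨fun i j => by cases j <;> rfl, fun _ _ => rfl⟩, rfl⟩
  bracket := by
    rintro _ ⟨A, hA, q, rfl⟩ _ ⟨A', hA', q', rfl⟩ h
    have hq : spinorMatrix Δ G q = 0 := by
      ext (i | i) (j | j)
      · rfl
      · rfl
      · simpa [rotationMatrix] using h.2 i j
      · rfl
    refine ⟨A * A' - A' * A, spinLie_bracket_mem Δ.clifford modelForm_comm hA hA', A.2 q', ?_⟩
    rw [hq, add_zero, ← rotationMatrix_commutator, ← rotationMatrix_spinorMatrix_commutator hG hA,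
      mul_add, add_mul]
    abel

/-! ### Local frames of vector bundles -/

section Frames

variable {E : Type*} [NormedAddCommGroup E] [NormedSpace ℝ E]
  {M : Type*} [TopologicalSpace M] [ChartedSpace E M]
  {F : Type*} [NormedAddCommGroup F] [NormedSpace ℝ F]
  {S : M → Type*} [TopologicalSpace (TotalSpace F S)] [∀ x, AddCommGroup (S x)]
  [∀ x, Module ℝ (S x)] [∀ x, TopologicalSpace (S x)] [FiberBundle F S]

theorem mdifferentiableAt_sum {ι : Type*} [Fintype ι] {f : ι → M → ℝ} {x : M}
    (hf : ∀ i, MDifferentiableAt 𝓘(ℝ, E) 𝓘(ℝ, ℝ) (f i) x) :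
    MDifferentiableAt 𝓘(ℝ, E) 𝓘(ℝ, ℝ) (fun y => ∑ i, f i y) x := by
  classical
  have key : ∀ s : Finset ι, MDifferentiableAt 𝓘(ℝ, E) 𝓘(ℝ, ℝ) (fun y => ∑ i ∈ s, f i y) x := by
    intro s
    induction s using Finset.induction_on with
    | empty => simpa using mdifferentiableAt_const
    | insert i s hi h =>
      simp only [Finset.sum_insert hi]
      exact (hf i).add h
  exact key _

theorem mvfderiv_sum {ι : Type*} [Fintype ι] {f : ι → M → ℝ} {x : M}
    (hf : ∀ i, MDifferentiableAt 𝓘(ℝ, E) 𝓘(ℝ, ℝ) (f i) x) :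
    mvfderiv 𝓘(ℝ, E) (fun y => ∑ i, f i y) x = ∑ i, mvfderiv 𝓘(ℝ, E) (f i) x := by
  classical
  have key : ∀ s : Finset ι, MDifferentiableAt 𝓘(ℝ, E) 𝓘(ℝ, ℝ) (fun y => ∑ i ∈ s, f i y) x ∧
      mvfderiv 𝓘(ℝ, E) (fun y => ∑ i ∈ s, f i y) x = ∑ i ∈ s, mvfderiv 𝓘(ℝ, E) (f i) x := by
    intro s
    induction s using Finset.induction_on with
    | empty => exact ⟨by simpa using mdifferentiableAt_const, by simpa using mvfderiv_const 0⟩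
    | insert i s hi h =>
      simp only [Finset.sum_insert hi]
      exact ⟨(hf i).add h.1, by rw [mvfderiv_fun_add (hf i) h.1, h.2]⟩
  exact (key _).2

theorem mvfderiv_congr {f f' : M → ℝ} {x : M} (h : f =ᶠ[nhds x] f') :
    mvfderiv 𝓘(ℝ, E) f x = mvfderiv 𝓘(ℝ, E) f' x := by
  have h1 := h.mfderiv_eq (I := 𝓘(ℝ, E)) (I' := 𝓘(ℝ, ℝ))
  have h2 : f x = f' x := h.eq_of_nhds
  ext v
  exact congrArg (fun L : TangentSpace 𝓘(ℝ, E) x →L[ℝ] ℝ => L v) h1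

theorem contMDiffAt_det {ι : Type*} [Fintype ι] [DecidableEq ι] {A : M → Matrix ι ι ℝ} {x : M}
    (hA : ∀ i j, ContMDiffAt 𝓘(ℝ, E) 𝓘(ℝ, ℝ) ∞ (fun y => A y i j) x) :
    ContMDiffAt 𝓘(ℝ, E) 𝓘(ℝ, ℝ) ∞ (fun y => (A y).det) x := by
  simp only [Matrix.det_apply, zsmul_eq_mul, Units.smul_def]
  exact contMDiffAt_finsetSum fun σ _ =>
    contMDiffAt_const.mul (contMDiffAt_finsetProd fun i _ => hA _ _)

variable [VectorBundle ℝ F S] {ι : Type*} {e : ι → Π x, S x} {U : Set M}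

theorem _root_.IsLocalFrameOn.finiteDimensional [Finite ι] (he : IsLocalFrameOn 𝓘(ℝ, E) F ∞ e U)
    {x : M} (hx : x ∈ U) : FiniteDimensional ℝ F := by
  have h1 : FiniteDimensional ℝ (S x) := Module.Finite.of_basis (he.toBasisAt hx)
  exact Module.Finite.equiv ((trivializationAt F S x).linearEquivAt ℝ x
    (FiberBundle.mem_baseSet_trivializationAt' x))

/-- The coefficients of a smooth section in a smooth local frame are smooth. -/
theorem _root_.IsLocalFrameOn.contMDiffAt_coeff [ContMDiffVectorBundle ∞ F S 𝓘(ℝ, E)] [Fintype ι]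
    [DecidableEq ι] (he : IsLocalFrameOn 𝓘(ℝ, E) F ∞ e U) (hU : IsOpen U) {x : M} (hx : x ∈ U)
    {t : Π x, S x}
    (ht : ContMDiffAt 𝓘(ℝ, E) (𝓘(ℝ, E).prod 𝓘(ℝ, F)) ∞ (fun x => TotalSpace.mk' F x (t x)) x)
    (j : ι) : ContMDiffAt 𝓘(ℝ, E) 𝓘(ℝ, ℝ) ∞ (fun y => he.coeff j y (t y)) x := by
  have hfin := he.finiteDimensional hx
  have h1 : ContMDiffVectorBundle 1 F S 𝓘(ℝ, E) := ContMDiffVectorBundle.of_le (n := ∞) (by simp)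
  let T := trivializationAt F S x
  have hxT : x ∈ T.baseSet := FiberBundle.mem_baseSet_trivializationAt' x
  let b : Module.Basis ι ℝ F := (he.toBasisAt hx).map (T.linearEquivAt ℝ x hxT)
  let A : M → Matrix ι ι ℝ := fun y => Matrix.of fun i r => T.localFrameCoeff 𝓘(ℝ, E) b i y (e r y)
  let τ : M → ι → ℝ := fun y i => T.localFrameCoeff 𝓘(ℝ, E) b i y (t y)
  have hA : ∀ i r, ContMDiffAt 𝓘(ℝ, E) 𝓘(ℝ, ℝ) ∞ (fun y => A y i r) x := fun i r =>
    contMDiffAt_localFrameCoeff b hxT (he.contMDiffAt hU hx r) i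
  have hτ : ∀ i, ContMDiffAt 𝓘(ℝ, E) 𝓘(ℝ, ℝ) ∞ (fun y => τ y i) x := fun i =>
    contMDiffAt_localFrameCoeff b hxT ht i
  have hcr : ∀ y ∈ T.baseSet ∩ U, (A y).det ≠ 0 ∧
      he.coeff j y (t y) = ((A y).updateCol j (τ y)).det * ((A y).det)⁻¹ := by
    intro y hy
    have h2 : A y = (T.basisAt b hy.1).toMatrix (he.toBasisAt hy.2) := by
      ext i r
      rw [Module.Basis.toMatrix_apply, he.toBasisAt_coe hy.2]
      exact T.localFrameCoeff_apply_of_mem_baseSet b hy.1 (e r) i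
    have hdet : (A y).det ≠ 0 := by
      rw [h2]
      have := congrArg Matrix.det
        ((he.toBasisAt hy.2).toMatrix_mul_toMatrix_flip (T.basisAt b hy.1))
      rw [Matrix.det_mul, Matrix.det_one] at this
      exact right_ne_zero_of_mul_eq_one this
    refine ⟨hdet, ?_⟩
    have h3 : τ y = (A y).mulVec fun r => he.coeff r y (t y) := by
      funext i
      simp only [τ, A, Matrix.mulVec, dotProduct, Matrix.of_apply]
      conv_lhs => rw [he.coeff_sum_eq t hy.2]
      simp only [map_sum, map_smul, smul_eq_mul]
      exact Finset.sum_congr rfl fun r _ => mul_comm _ _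
    rw [← Matrix.cramer_apply, h3, Matrix.cramer_eq_adjugate_mulVec, Matrix.mulVec_mulVec,
      Matrix.adjugate_mul, Matrix.smul_mulVec, Matrix.one_mulVec, Pi.smul_apply, smul_eq_mul]
    field_simp
  have hnhds : T.baseSet ∩ U ∈ nhds x := (T.open_baseSet.inter hU).mem_nhds ⟨hxT, hx⟩
  refine ContMDiffAt.congr_of_eventuallyEq ?_
    (Filter.eventually_of_mem hnhds fun y hy => (hcr y hy).2)
  refine (contMDiffAt_det fun i r => ?_).mul
    ((contMDiffAt_det hA).inv₀ (hcr x ⟨hxT, hx⟩).1)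
  by_cases hr : r = j
  · simpa [Matrix.updateCol_apply, hr] using hτ i
  · simpa [Matrix.updateCol_apply, hr] using hA i r

theorem FormField.mdifferentiableAt [FiniteDimensional ℝ F] [ContMDiffVectorBundle ∞ F S 𝓘(ℝ, E)]
    (β : FormField E F S) {s t : Π x, S x} {x : M}
    (hs : MDifferentiableAt 𝓘(ℝ, E) (𝓘(ℝ, E).prod 𝓘(ℝ, F)) (fun x => TotalSpace.mk' F x (s x)) x)
    (ht : MDifferentiableAt 𝓘(ℝ, E) (𝓘(ℝ, E).prod 𝓘(ℝ, F)) (fun x => TotalSpace.mk' F x (t x)) x) :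
    MDifferentiableAt 𝓘(ℝ, E) 𝓘(ℝ, ℝ) (fun y => β.form y (s y) (t y)) x := by
  have h1 : ContMDiffVectorBundle 1 F S 𝓘(ℝ, E) := ContMDiffVectorBundle.of_le (n := ∞) (by simp)
  let T := trivializationAt F S x
  have hxT : x ∈ T.baseSet := FiberBundle.mem_baseSet_trivializationAt' x
  let b := Module.finBasis ℝ F
  have key : ∀ y ∈ T.baseSet, β.form y (s y) (t y)
      = ∑ i, ∑ j, (T.localFrameCoeff 𝓘(ℝ, E) b i y (s y) * T.localFrameCoeff 𝓘(ℝ, E) b j y (t y))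
        * β.form y (T.localFrame b i y) (T.localFrame b j y) := by
    intro y hy
    conv_lhs => rw [T.eq_sum_localFrameCoeff_smul (I := 𝓘(ℝ, E)) (b := b) (s := s) hy,
      T.eq_sum_localFrameCoeff_smul (I := 𝓘(ℝ, E)) (b := b) (s := t) hy]
    simp only [map_sum, map_smul, LinearMap.sum_apply, LinearMap.smul_apply, smul_eq_mul,
      Finset.mul_sum, mul_assoc]
    rw [Finset.sum_comm]
    refine Finset.sum_congr rfl fun i _ => Finset.sum_congr rfl fun j _ => by ring
  refine MDifferentiableAt.congr_of_eventuallyEq ?_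
    (Filter.eventually_of_mem (T.open_baseSet.mem_nhds hxT) key)
  have hg : ∀ i j, MDifferentiableAt 𝓘(ℝ, E) 𝓘(ℝ, ℝ)
      (fun y => β.form y (T.localFrame b i y) (T.localFrame b j y)) x := fun i j =>
    ((β.smooth ⟨T.baseSet, T.open_baseSet⟩ _ _ (T.contMDiffOn_localFrame_baseSet ∞ b i)
      (T.contMDiffOn_localFrame_baseSet ∞ b j)).contMDiffAt
        (T.open_baseSet.mem_nhds hxT)).mdifferentiableAt (by simp)
  refine mdifferentiableAt_sum fun i => mdifferentiableAt_sum fun j => ?_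
  exact ((mdifferentiableAt_localFrameCoeff b hxT hs i).mul
    (mdifferentiableAt_localFrameCoeff b hxT ht j)).mul (hg i j)

end Frames

/-! ### The Levi-Civita connection -/

section LeviCivita

variable {E : Type*} [NormedAddCommGroup E] [NormedSpace ℝ E] [FiniteDimensional ℝ E]
  {M : Type*} [TopologicalSpace M] [ChartedSpace E M] [IsManifold 𝓘(ℝ, E) ∞ M]
  (g : PseudoMetric E M)

/-- Differentiability of a vector field at a point. -/
abbrev MDiffVec (X : Π x : M, TangentSpace 𝓘(ℝ, E) x) (x : M) : Prop :=
  MDifferentiableAt 𝓘(ℝ, E) (𝓘(ℝ, E).prod 𝓘(ℝ, E)) (fun x => TotalSpace.mk' E x (X x)) x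

variable {X Y Z : Π x : M, TangentSpace 𝓘(ℝ, E) x} {x : M}

theorem PseudoMetric.mdifferentiableAt (hX : MDiffVec X x) (hY : MDiffVec Y x) :
    MDifferentiableAt 𝓘(ℝ, E) 𝓘(ℝ, ℝ) (fun y => g.form y (X y) (Y y)) x :=
  FormField.mdifferentiableAt g.toFormField hX hY

/-- The Leibniz rule in the second argument of the Koszul expression. -/
theorem koszul_smul_mid {f : M → ℝ} (hf : MDifferentiableAt 𝓘(ℝ, E) 𝓘(ℝ, ℝ) f x)
    (hX : MDiffVec X x) (hY : MDiffVec Y x) (hZ : MDiffVec Z x) :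
    koszul g X (f • Y) Z x
      = f x * koszul g X Y Z x + 2 * (mvfderiv 𝓘(ℝ, E) f x (X x) * g.form x (Y x) (Z x)) := by
  have h1 : mvfderiv 𝓘(ℝ, E) (fun y => g.form y ((f • Y) y) (Z y)) x
      = f x • mvfderiv 𝓘(ℝ, E) (fun y => g.form y (Y y) (Z y)) x
        + g.form x (Y x) (Z x) • mvfderiv 𝓘(ℝ, E) f x := by
    rw [← mvfderiv_fun_mul hf (g.mdifferentiableAt hY hZ)]
    congr 1
    funext y
    simp
  have h2 : mvfderiv 𝓘(ℝ, E) (fun y => g.form y (X y) ((f • Y) y)) x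
      = f x • mvfderiv 𝓘(ℝ, E) (fun y => g.form y (X y) (Y y)) x
        + g.form x (X x) (Y x) • mvfderiv 𝓘(ℝ, E) f x := by
    rw [← mvfderiv_fun_mul hf (g.mdifferentiableAt hX hY)]
    congr 1
    funext y
    simp
  rw [koszul, koszul, h1, h2, VectorField.mlieBracket_smul_right hf hY,
    VectorField.mlieBracket_smul_left hf hY]
  have e1 := g.symm x (Y x) (Z x)
  have e2 := g.symm x (Y x) (X x)
  simp only [Pi.smul_apply', map_smul, map_add, map_neg, LinearMap.add_apply, LinearMap.smul_apply,
    add_apply, smul_apply, smul_eq_mul, neg_smul,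
    LinearMap.neg_apply]
  rw [e2]
  ring

theorem koszul_add_mid {Y' : Π x : M, TangentSpace 𝓘(ℝ, E) x}
    (hX : MDiffVec X x) (hY : MDiffVec Y x) (hY' : MDiffVec Y' x) (hZ : MDiffVec Z x) :
    koszul g X (Y + Y') Z x = koszul g X Y Z x + koszul g X Y' Z x := by
  have h1 : mvfderiv 𝓘(ℝ, E) (fun y => g.form y ((Y + Y') y) (Z y)) x
      = mvfderiv 𝓘(ℝ, E) (fun y => g.form y (Y y) (Z y)) x
        + mvfderiv 𝓘(ℝ, E) (fun y => g.form y (Y' y) (Z y)) x := by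
    rw [← mvfderiv_fun_add (g.mdifferentiableAt hY hZ) (g.mdifferentiableAt hY' hZ)]
    congr 1
    funext y
    simp
  have h2 : mvfderiv 𝓘(ℝ, E) (fun y => g.form y (X y) ((Y + Y') y)) x
      = mvfderiv 𝓘(ℝ, E) (fun y => g.form y (X y) (Y y)) x
        + mvfderiv 𝓘(ℝ, E) (fun y => g.form y (X y) (Y' y)) x := by
    rw [← mvfderiv_fun_add (g.mdifferentiableAt hX hY) (g.mdifferentiableAt hX hY')]
    congr 1
    funext y
    simp
  rw [koszul, koszul, koszul, h1, h2, VectorField.mlieBracket_add_right hY hY',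
    VectorField.mlieBracket_add_left hY hY']
  simp only [Pi.add_apply, map_add, LinearMap.add_apply, add_apply]
  ring

/-- The Koszul expression is symmetric in its outer arguments up to a tensorial term. -/
theorem koszul_add_koszul : koszul g X Y Z x + koszul g X Z Y x
    = 2 * mvfderiv 𝓘(ℝ, E) (fun y => g.form y (Y y) (Z y)) x (X x) := by
  have e1 : (fun y => g.form y (Z y) (X y)) = fun y => g.form y (X y) (Z y) :=
    funext fun y => g.symm y _ _
  have e2 : (fun y => g.form y (Z y) (Y y)) = fun y => g.form y (Y y) (Z y) :=
    funext fun y => g.symm y _ _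
  have e3 : (fun y => g.form y (Y y) (X y)) = fun y => g.form y (X y) (Y y) :=
    funext fun y => g.symm y _ _
  rw [koszul, koszul, e1, e2, e3, VectorField.mlieBracket_swap_apply (V := X) (W := Z),
    VectorField.mlieBracket_swap_apply (V := Z) (W := Y),
    VectorField.mlieBracket_swap_apply (V := Y) (W := X)]
  simp only [map_neg, LinearMap.neg_apply]
  ring

theorem koszul_tensorialAt_left (hY : MDiffVec Y x) (hZ : MDiffVec Z x) :
    TensorialAt 𝓘(ℝ, E) E (fun X => koszul g X Y Z x) x where
  smul {f X} hf hX := by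
    have h1 : mvfderiv 𝓘(ℝ, E) (fun y => g.form y (Z y) ((f • X) y)) x
        = f x • mvfderiv 𝓘(ℝ, E) (fun y => g.form y (Z y) (X y)) x
          + g.form x (Z x) (X x) • mvfderiv 𝓘(ℝ, E) f x := by
      rw [← mvfderiv_fun_mul hf (g.mdifferentiableAt hZ hX)]
      congr 1
      funext y
      simp
    have h2 : mvfderiv 𝓘(ℝ, E) (fun y => g.form y ((f • X) y) (Y y)) x
        = f x • mvfderiv 𝓘(ℝ, E) (fun y => g.form y (X y) (Y y)) x
          + g.form x (X x) (Y x) • mvfderiv 𝓘(ℝ, E) f x := by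
      rw [← mvfderiv_fun_mul hf (g.mdifferentiableAt hX hY)]
      congr 1
      funext y
      simp
    have e1 := g.symm x (Z x) (X x)
    rw [koszul, koszul, h1, h2, VectorField.mlieBracket_smul_right hf hX,
      VectorField.mlieBracket_smul_left hf hX]
    simp only [Pi.smul_apply', map_smul, map_add, map_neg, LinearMap.add_apply,
      LinearMap.smul_apply, add_apply, smul_apply,
      smul_eq_mul, neg_smul, LinearMap.neg_apply]
    rw [e1]
    ring
  add {X X'} hX hX' := by
    have h1 : mvfderiv 𝓘(ℝ, E) (fun y => g.form y (Z y) ((X + X') y)) x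
        = mvfderiv 𝓘(ℝ, E) (fun y => g.form y (Z y) (X y)) x
          + mvfderiv 𝓘(ℝ, E) (fun y => g.form y (Z y) (X' y)) x := by
      rw [← mvfderiv_fun_add (g.mdifferentiableAt hZ hX) (g.mdifferentiableAt hZ hX')]
      congr 1
      funext y
      simp
    have h2 : mvfderiv 𝓘(ℝ, E) (fun y => g.form y ((X + X') y) (Y y)) x
        = mvfderiv 𝓘(ℝ, E) (fun y => g.form y (X y) (Y y)) x
          + mvfderiv 𝓘(ℝ, E) (fun y => g.form y (X' y) (Y y)) x := by
      rw [← mvfderiv_fun_add (g.mdifferentiableAt hX hY) (g.mdifferentiableAt hX' hY)]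
      congr 1
      funext y
      simp
    rw [koszul, koszul, koszul, h1, h2, VectorField.mlieBracket_add_right hX hX',
      VectorField.mlieBracket_add_left hX hX']
    simp only [Pi.add_apply, map_add, LinearMap.add_apply, add_apply]
    ring

theorem koszul_tensorialAt_right (hX : MDiffVec X x) (hY : MDiffVec Y x) :
    TensorialAt 𝓘(ℝ, E) E (fun Z => koszul g X Y Z x) x where
  smul {f Z} hf hZ := by
    have h1 := koszul_add_koszul g (X := X) (Y := Y) (Z := f • Z) (x := x)
    have h2 := koszul_add_koszul g (X := X) (Y := Y) (Z := Z) (x := x)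
    have h3 : mvfderiv 𝓘(ℝ, E) (fun y => g.form y (Y y) ((f • Z) y)) x
        = f x • mvfderiv 𝓘(ℝ, E) (fun y => g.form y (Y y) (Z y)) x
          + g.form x (Y x) (Z x) • mvfderiv 𝓘(ℝ, E) f x := by
      rw [← mvfderiv_fun_mul hf (g.mdifferentiableAt hY hZ)]
      congr 1
      funext y
      simp
    rw [koszul_smul_mid g hf hX hZ hY, h3, g.symm x (Z x) (Y x)] at h1
    simp only [add_apply, smul_apply, smul_eq_mul] at h1 ⊢
    linear_combination h1 - f x * h2
  add {Z Z'} hZ hZ' := by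
    have h1 := koszul_add_koszul g (X := X) (Y := Y) (Z := Z + Z') (x := x)
    have h2 := koszul_add_koszul g (X := X) (Y := Y) (Z := Z) (x := x)
    have h2' := koszul_add_koszul g (X := X) (Y := Y) (Z := Z') (x := x)
    have h3 : mvfderiv 𝓘(ℝ, E) (fun y => g.form y (Y y) ((Z + Z') y)) x
        = mvfderiv 𝓘(ℝ, E) (fun y => g.form y (Y y) (Z y)) x
          + mvfderiv 𝓘(ℝ, E) (fun y => g.form y (Y y) (Z' y)) x := by
      rw [← mvfderiv_fun_add (g.mdifferentiableAt hY hZ) (g.mdifferentiableAt hY hZ')]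
      congr 1
      funext y
      simp
    rw [koszul_add_mid g hX hZ hZ' hY, h3] at h1
    simp only [add_apply] at h1 ⊢
    linear_combination h1 - h2 - h2'

/-- There is a linear map `v ↦ ∇_v Y` that satisfies the Koszul formula. -/
theorem exists_koszul (hY : MDiffVec Y x) :
    ∃ N : TangentSpace 𝓘(ℝ, E) x →ₗ[ℝ] TangentSpace 𝓘(ℝ, E) x,
      ∀ X Z, MDiffVec X x → MDiffVec Z x →
        2 * g.form x (N (X x)) (Z x) = koszul g X Y Z x := by
  have h1 : ContMDiffVectorBundle 1 E (TangentSpace 𝓘(ℝ, E) : M → Type _) 𝓘(ℝ, E) :=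
    ContMDiffVectorBundle.of_le (n := ∞) (by simp)
  let K := TensorialAt.mkHom₂ (I := 𝓘(ℝ, E)) (F := E) (F' := E)
    (V := (TangentSpace 𝓘(ℝ, E) : M → Type _)) (V' := (TangentSpace 𝓘(ℝ, E) : M → Type _))
    (fun X Z => koszul g X Y Z x) x
    (fun Z hZ => koszul_tensorialAt_left g hY hZ) fun X hX => koszul_tensorialAt_right g hX hY
  let K' : TangentSpace 𝓘(ℝ, E) x →ₗ[ℝ] Module.Dual ℝ (TangentSpace 𝓘(ℝ, E) x) :=
    { toFun := fun v => (2⁻¹ : ℝ) • (K v : TangentSpace 𝓘(ℝ, E) x →ₗ[ℝ] ℝ)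
      map_add' := fun v w => by ext z; simp
      map_smul' := fun r v => by ext z; simp; ring }
  refine ⟨(LinearMap.BilinForm.toDual _ (g.nondeg x)).symm ∘ₗ K', fun X Z hX hZ => ?_⟩
  have h2 := LinearMap.congr_fun
    ((LinearMap.BilinForm.toDual _ (g.nondeg x)).apply_symm_apply (K' (X x))) (Z x)
  rw [LinearMap.BilinForm.toDual_def] at h2
  have h3 : K (X x) (Z x) = koszul g X Y Z x := TensorialAt.mkHom₂_apply _ _ hX hZ
  have h4 : K' (X x) (Z x) = 2⁻¹ * K (X x) (Z x) := rfl
  rw [LinearMap.comp_apply, LinearEquiv.coe_coe, h2, h4, h3]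
  ring

theorem exists_smooth_extension (v : TangentSpace 𝓘(ℝ, E) x) :
    ∃ (W : Opens M) (X : Π x : M, TangentSpace 𝓘(ℝ, E) x), x ∈ W ∧ SmoothOn E E X W ∧ X x = v := by
  let T := trivializationAt E (TangentSpace 𝓘(ℝ, E) : M → Type _) x
  have hxT : x ∈ T.baseSet := FiberBundle.mem_baseSet_trivializationAt' x
  let b := Module.finBasis ℝ E
  let B := T.basisAt b hxT
  refine ⟨⟨T.baseSet, T.open_baseSet⟩, fun y => ∑ i, B.repr v i • T.localFrame b i y, hxT, ?_, ?_⟩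
  · exact ContMDiffOn.sum_section fun i _ =>
      contMDiffOn_const.smul_section (T.contMDiffOn_localFrame_baseSet ∞ b i)
  · simp only [T.localFrame_apply_of_mem_baseSet b hxT]
    exact B.sum_repr v

theorem SmoothOn.mdiffVec {W : Opens M} (hX : SmoothOn E E X W) (hx : x ∈ W) : MDiffVec X x :=
  (ContMDiffOn.contMDiffAt hX (W.2.mem_nhds hx)).mdifferentiableAt (by simp)

/-- The Koszul formula. -/
theorem two_mul_leviCivita {W : Opens M} (hx : x ∈ W) (hX : SmoothOn E E X W)
    (hY : MDiffVec Y x) (hZ : SmoothOn E E Z W) :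
    2 * g.form x (leviCivita g Y x (X x)) (Z x) = koszul g X Y Z x := by
  obtain ⟨N, hN⟩ := exists_koszul g hY
  have h := Classical.epsilon_spec (p := fun w => ∀ (W : Opens M)
    (X' Z : Π x : M, TangentSpace 𝓘(ℝ, E) x), x ∈ W → SmoothOn E E X' W → SmoothOn E E Z W →
      X' x = X x → 2 * g.form x w (Z x) = koszul g X' Y Z x)
    ⟨N (X x), fun W X' Z hx hX hZ hv => by
      rw [← hv]
      exact hN X' Z (hX.mdiffVec hx) (hZ.mdiffVec hx)⟩
  exact h W X Z hx hX hZ rfl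

/-- `v ↦ ∇_v Y` is linear. -/
theorem exists_leviCivita_eq (hY : MDiffVec Y x) :
    ∃ N : TangentSpace 𝓘(ℝ, E) x →ₗ[ℝ] TangentSpace 𝓘(ℝ, E) x,
      (∀ v, leviCivita g Y x v = N v) ∧ ∀ X Z, MDiffVec X x → MDiffVec Z x →
        2 * g.form x (N (X x)) (Z x) = koszul g X Y Z x := by
  obtain ⟨N, hN⟩ := exists_koszul g hY
  refine ⟨N, fun v => ?_, hN⟩
  obtain ⟨W, X, hx, hX, rfl⟩ := exists_smooth_extension v
  rw [← sub_eq_zero]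
  refine (g.nondeg x).1 _ fun z => ?_
  obtain ⟨W', Z, hx', hZ, rfl⟩ := exists_smooth_extension z
  have h1 := two_mul_leviCivita g (W := W ⊓ W') ⟨hx, hx'⟩
    (ContMDiffOn.mono hX inf_le_left : SmoothOn E E X (W ⊓ W')) hY
    (ContMDiffOn.mono hZ inf_le_right : SmoothOn E E Z (W ⊓ W'))
  have h2 := hN X Z (hX.mdiffVec hx) (hZ.mdiffVec hx')
  rw [map_sub, LinearMap.sub_apply]
  linarith

/-- The Levi-Civita connection is metric. -/
theorem leviCivita_metric (hY : MDiffVec Y x) (hZ : MDiffVec Z x) (v : TangentSpace 𝓘(ℝ, E) x) :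
    g.form x (leviCivita g Y x v) (Z x) + g.form x (Y x) (leviCivita g Z x v)
      = mvfderiv 𝓘(ℝ, E) (fun y => g.form y (Y y) (Z y)) x v := by
  obtain ⟨W, X, hx, hX, rfl⟩ := exists_smooth_extension v
  obtain ⟨N, h1, h2⟩ := exists_leviCivita_eq g hY
  obtain ⟨N', h1', h2'⟩ := exists_leviCivita_eq g hZ
  have e1 := h2 X Z (hX.mdiffVec hx) hZ
  have e2 := h2' X Y (hX.mdiffVec hx) hY
  have e3 := koszul_add_koszul g (X := X) (Y := Y) (Z := Z) (x := x)
  rw [h1, h1', g.symm x (Y x)]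
  linarith

/-- The Leibniz rule for the Levi-Civita connection. -/
theorem leviCivita_sum {ι : Type*} [Fintype ι] {f : ι → M → ℝ}
    {e : ι → Π x : M, TangentSpace 𝓘(ℝ, E) x} (hY : MDiffVec Y x)
    (hf : ∀ i, MDifferentiableAt 𝓘(ℝ, E) 𝓘(ℝ, ℝ) (f i) x) (he : ∀ i, MDiffVec (e i) x)
    (h : ∀ᶠ y in nhds x, Y y = ∑ i, f i y • e i y) (v : TangentSpace 𝓘(ℝ, E) x) :
    leviCivita g Y x v
      = ∑ i, (mvfderiv 𝓘(ℝ, E) (f i) x v • e i x + f i x • leviCivita g (e i) x v) := by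
  rw [← sub_eq_zero]
  refine (g.nondeg x).1 _ fun z => ?_
  obtain ⟨W, X, hx, hX, rfl⟩ := exists_smooth_extension v
  obtain ⟨W', Z, hx', hZ, rfl⟩ := exists_smooth_extension z
  have hX' := hX.mdiffVec hx
  have hZ' := hZ.mdiffVec hx'
  -- by metricity it suffices to differentiate `g(Y, Z)`
  have e1 := leviCivita_metric g hY hZ' (X x)
  have e2 := fun i => leviCivita_metric g (he i) hZ' (X x)
  have e3 : mvfderiv 𝓘(ℝ, E) (fun y => g.form y (Y y) (Z y)) x
      = ∑ i, (f i x • mvfderiv 𝓘(ℝ, E) (fun y => g.form y (e i y) (Z y)) x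
        + g.form x (e i x) (Z x) • mvfderiv 𝓘(ℝ, E) (f i) x) := by
    have h4 : (fun y => g.form y (Y y) (Z y))
        =ᶠ[nhds x] fun y => ∑ i, f i y * g.form y (e i y) (Z y) := by
      filter_upwards [h] with y hy
      simp [hy]
    have h5 := mvfderiv_sum (f := fun i y => f i y * g.form y (e i y) (Z y))
      fun i => (hf i).mul (g.mdifferentiableAt (he i) hZ')
    rw [mvfderiv_congr h4, h5]
    exact Finset.sum_congr rfl fun i _ => mvfderiv_fun_mul (hf i) (g.mdifferentiableAt (he i) hZ')
  have e4 : Y x = ∑ i, f i x • e i x := h.self_of_nhds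
  rw [e3] at e1
  simp only [sum_apply, add_apply,
    smul_apply, smul_eq_mul, ← e2] at e1
  rw [e4] at e1
  simp only [map_sub, map_sum, map_add, map_smul, LinearMap.sub_apply, LinearMap.sum_apply,
    LinearMap.add_apply, LinearMap.smul_apply, smul_eq_mul, mul_add, Finset.sum_add_distrib] at e1 ⊢
  have e5 : ∑ i, g.form x (e i x) (Z x) * mvfderiv 𝓘(ℝ, E) (f i) x (X x)
      = ∑ i, mvfderiv 𝓘(ℝ, E) (f i) x (X x) * g.form x (e i x) (Z x) :=
    Finset.sum_congr rfl fun i _ => mul_comm _ _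
  linarith

theorem contMDiffOn_mvfderiv {W : Opens M} {f : M → ℝ} (hf : ContMDiffOn 𝓘(ℝ, E) 𝓘(ℝ, ℝ) ∞ f W)
    (hX : SmoothOn E E X W) :
    ContMDiffOn 𝓘(ℝ, E) 𝓘(ℝ, ℝ) ∞ (fun y => mvfderiv 𝓘(ℝ, E) f y (X y)) W := by
  have h1 : IsManifold 𝓘(ℝ, E) 1 M := IsManifold.of_le (n := ∞) (by simp)
  have h2 := (hf.contMDiffOn_tangentMapWithin (m := ∞) (by simp) W.2.uniqueMDiffOn).comp
    (t := (TotalSpace.proj : TangentBundle 𝓘(ℝ, E) M → M) ⁻¹' W) hX fun x hx => hx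
  refine ((contMDiff_snd_tangentBundle_modelSpace ℝ 𝓘(ℝ, ℝ)).comp_contMDiffOn h2).congr
    fun y hy => ?_
  change mfderiv 𝓘(ℝ, E) 𝓘(ℝ, ℝ) f y (X y) = mfderivWithin 𝓘(ℝ, E) 𝓘(ℝ, ℝ) f W y (X y)
  have h3 : mfderivWithin 𝓘(ℝ, E) 𝓘(ℝ, ℝ) f (W : Set M) y = mfderiv 𝓘(ℝ, E) 𝓘(ℝ, ℝ) f y :=
    mfderivWithin_of_isOpen W.2 hy
  rw [h3]

theorem contMDiffOn_koszul {W : Opens M} (hX : SmoothOn E E X W) (hY : SmoothOn E E Y W)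
    (hZ : SmoothOn E E Z W) :
    ContMDiffOn 𝓘(ℝ, E) 𝓘(ℝ, ℝ) ∞ (fun y => koszul g X Y Z y) W := by
  have h0 : IsManifold 𝓘(ℝ, E) (minSmoothness ℝ 2) M := by
    rw [minSmoothness_of_isRCLikeNormedField]
    infer_instance
  have h1 : IsManifold 𝓘(ℝ, E) ((⊤ : ℕ∞) + 1) M := IsManifold.of_le (n := ∞) (by simp)
  have hbr : ∀ {X Y}, SmoothOn E E X W → SmoothOn E E Y W →
      SmoothOn E E (VectorField.mlieBracket 𝓘(ℝ, E) X Y) W := fun hX hY x hx =>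
    (ContMDiffAt.mlieBracket_vectorField (m := ⊤) (n := ⊤)
      (ContMDiffOn.contMDiffAt hX (W.2.mem_nhds hx))
      (ContMDiffOn.contMDiffAt hY (W.2.mem_nhds hx)) (by simp)).contMDiffWithinAt
  exact (((((contMDiffOn_mvfderiv (g.smooth W _ _ hY hZ) hX).add
    (contMDiffOn_mvfderiv (g.smooth W _ _ hZ hX) hY)).sub
    (contMDiffOn_mvfderiv (g.smooth W _ _ hX hY) hZ)).add
    (g.smooth W _ _ (hbr hX hY) hZ)).sub
    (g.smooth W _ _ (hbr hY hZ) hX)).add (g.smooth W _ _ (hbr hZ hX) hY)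

end LeviCivita

/-! ### Smooth maps to the spin group -/

section SpinMaps

variable {E : Type*} [NormedAddCommGroup E] [NormedSpace ℝ E]
  {M : Type*} [TopologicalSpace M] [ChartedSpace E M]

theorem mvfderiv_comp_fderiv {V V' : Type*} [NormedAddCommGroup V] [NormedSpace ℝ V]
    [NormedAddCommGroup V'] [NormedSpace ℝ V'] {f : M → V} {φ : V → V'} {x : M}
    (hφ : DifferentiableAt ℝ φ (f x)) (hf : MDifferentiableAt 𝓘(ℝ, E) 𝓘(ℝ, V) f x)
    (v : TangentSpace 𝓘(ℝ, E) x) :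
    mvfderiv 𝓘(ℝ, E) (fun y => φ (f y)) x v = fderiv ℝ φ (f x) (mvfderiv 𝓘(ℝ, E) f x v) := by
  have h1 := mfderiv_comp_apply (I := 𝓘(ℝ, E)) (I' := 𝓘(ℝ, V)) (I'' := 𝓘(ℝ, V')) x
    hφ.mdifferentiableAt hf v
  rw [mfderiv_eq_fderiv] at h1
  exact h1

section Normed

variable {A : Type*} [NormedRing A] [NormedAlgebra ℝ A] [FiniteDimensional ℝ A]

theorem contMDiffAt_exp {Y : M → A} {x : M} (hY : ContMDiffAt 𝓘(ℝ, E) 𝓘(ℝ, A) ∞ Y x) :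
    ContMDiffAt 𝓘(ℝ, E) 𝓘(ℝ, A) ∞ (fun y => NormedSpace.exp (Y y)) x := by
  have : CompleteSpace A := FiniteDimensional.complete ℝ A
  exact (NormedSpace.exp_analytic (𝕂 := ℝ) (Y x)).contDiffAt.contMDiffAt.comp x hY

/-- The derivative of a map to a subspace takes values in this subspace. -/
theorem mvfderiv_mem {V : Type*} [NormedAddCommGroup V] [NormedSpace ℝ V] [FiniteDimensional ℝ V]
    (𝔥 : Submodule ℝ V) {Y : M → V} {x : M} (hY : MDifferentiableAt 𝓘(ℝ, E) 𝓘(ℝ, V) Y x)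
    (hmem : ∀ᶠ y in nhds x, Y y ∈ 𝔥) (v : TangentSpace 𝓘(ℝ, E) x) :
    mvfderiv 𝓘(ℝ, E) Y x v ∈ 𝔥 := by
  rw [← Subspace.dualAnnihilator_dualCoannihilator_eq (W := 𝔥), Submodule.mem_dualCoannihilator]
  intro ℓ hℓ
  rw [Submodule.mem_dualAnnihilator] at hℓ
  let L := LinearMap.toContinuousLinearMap ℓ
  have h1 := mvfderiv_comp_fderiv (φ := L) (L.differentiableAt) hY v
  rw [L.fderiv] at h1
  have h2 : (fun y => L (Y y)) =ᶠ[nhds x] fun _ => 0 := by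
    filter_upwards [hmem] with y hy using hℓ _ hy
  rw [mvfderiv_congr h2, mvfderiv_const] at h1
  exact h1.symm

/-- `d(exp Y) = exp(Y) Z`, where `Z` belongs to the Lie algebra of the values of `Y`. -/
theorem exists_mvfderiv_exp (𝔥 : Submodule ℝ A) (h𝔥 : ∀ Y ∈ 𝔥, ∀ Z ∈ 𝔥, Z * Y - Y * Z ∈ 𝔥)
    {Y : M → A} {x : M} (hY : MDifferentiableAt 𝓘(ℝ, E) 𝓘(ℝ, A) Y x)
    (hmem : ∀ᶠ y in nhds x, Y y ∈ 𝔥) (v : TangentSpace 𝓘(ℝ, E) x) :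
    ∃ Z ∈ 𝔥, mvfderiv 𝓘(ℝ, E) (fun y => NormedSpace.exp (Y y)) x v
      = NormedSpace.exp (Y x) * Z := by
  have : CompleteSpace A := FiniteDimensional.complete ℝ A
  refine ⟨_, exp_neg_mul_fderiv_exp_mem 𝔥 (Y x) (mvfderiv 𝓘(ℝ, E) Y x v)
    (h𝔥 _ hmem.self_of_nhds) (mvfderiv_mem 𝔥 hY hmem v), ?_⟩
  rw [← mul_assoc, exp_mul_exp_neg, one_mul]
  exact mvfderiv_comp_fderiv (NormedSpace.exp_analytic (𝕂 := ℝ) (Y x)).differentiableAt hY v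

end Normed

variable {ι : Type*} [Fintype ι] [DecidableEq ι]

/-- The properties at `x` of a product of exponentials of smooth maps to a matrix Lie algebra `𝔥`
that are needed in the sequel: `h` is smooth, `h⁻¹ dh` takes values in `𝔥`, and `𝔥` is stable
under conjugation by `h(x)`. -/
structure IsGroupMap (𝔥 : Submodule ℝ (Matrix ι ι ℝ)) (h : M → Matrix ι ι ℝ) (x : M) : Prop where
  smooth : ∀ i j, ContMDiffAt 𝓘(ℝ, E) 𝓘(ℝ, ℝ) ∞ (fun y => h y i j) x
  deriv : ∀ v, ∃ Z ∈ 𝔥, ∀ i j, mvfderiv 𝓘(ℝ, E) (fun y => h y i j) x v = (h x * Z) i j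
  conj : ∀ Z ∈ 𝔥, ∃ Z' ∈ 𝔥, Z * h x = h x * Z'

variable {𝔥 : Submodule ℝ (Matrix ι ι ℝ)} {x : M}

theorem IsGroupMap.one : IsGroupMap (E := E) 𝔥 (fun _ : M => 1) x where
  smooth _ _ := contMDiffAt_const
  deriv v := ⟨0, 𝔥.zero_mem, fun i j => by simp [mvfderiv_const]⟩
  conj Z hZ := ⟨Z, hZ, by simp⟩

theorem IsGroupMap.mul {h h' : M → Matrix ι ι ℝ} (H : IsGroupMap (E := E) 𝔥 h x)
    (H' : IsGroupMap (E := E) 𝔥 h' x) : IsGroupMap (E := E) 𝔥 (fun y => h y * h' y) x where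
  smooth i j := by
    simp only [Matrix.mul_apply]
    exact contMDiffAt_finsetSum fun r _ => (H.smooth i r).mul (H'.smooth r j)
  deriv v := by
    obtain ⟨Z, hZ, e⟩ := H.deriv v
    obtain ⟨Z', hZ', e'⟩ := H'.deriv v
    obtain ⟨Z₁, hZ₁, e₁⟩ := H'.conj Z hZ
    refine ⟨Z₁ + Z', 𝔥.add_mem hZ₁ hZ', fun i j => ?_⟩
    have d : ∀ i j, MDifferentiableAt 𝓘(ℝ, E) 𝓘(ℝ, ℝ) (fun y => h y i j) x := fun i j =>
      (H.smooth i j).mdifferentiableAt (by simp)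
    have d' : ∀ i j, MDifferentiableAt 𝓘(ℝ, E) 𝓘(ℝ, ℝ) (fun y => h' y i j) x := fun i j =>
      (H'.smooth i j).mdifferentiableAt (by simp)
    have h1 : mvfderiv 𝓘(ℝ, E) (fun y => (h y * h' y) i j) x v
        = ∑ r, (h x i r * (h' x * Z') r j + h' x r j * (h x * Z) i r) := by
      have h0 : (fun y => (h y * h' y) i j) = fun y => ∑ r, h y i r * h' y r j :=
        funext fun y => Matrix.mul_apply
      have h3 := mvfderiv_sum (f := fun r y => h y i r * h' y r j)
        fun r => (d i r).mul (d' r j)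
      rw [h0, h3, sum_apply]
      refine Finset.sum_congr rfl fun r _ => ?_
      rw [mvfderiv_fun_mul (d i r) (d' r j)]
      simp [e, e', Matrix.mul_apply]
    have h2 : h x * h' x * (Z₁ + Z') = h x * (h' x * Z') + h x * Z * h' x := by
      rw [mul_add, mul_assoc (h x) _ Z₁, ← e₁, mul_assoc, mul_assoc, add_comm]
    rw [h1, h2, Matrix.add_apply, Matrix.mul_apply, Matrix.mul_apply, ← Finset.sum_add_distrib]
    exact Finset.sum_congr rfl fun r _ => by ring
  conj Z hZ := by
    obtain ⟨Z₁, hZ₁, e₁⟩ := H.conj Z hZ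
    obtain ⟨Z₂, hZ₂, e₂⟩ := H'.conj Z₁ hZ₁
    exact ⟨Z₂, hZ₂, by rw [← mul_assoc, e₁, mul_assoc, e₂, mul_assoc]⟩

theorem IsGroupMap.congr {h h' : M → Matrix ι ι ℝ} (H : IsGroupMap (E := E) 𝔥 h x)
    (e : ∀ᶠ y in nhds x, h' y = h y) : IsGroupMap (E := E) 𝔥 h' x where
  smooth i j := (H.smooth i j).congr_of_eventuallyEq (e.mono fun y hy => by simp only [hy])
  deriv v := by
    obtain ⟨Z, hZ, e₁⟩ := H.deriv v
    refine ⟨Z, hZ, fun i j => ?_⟩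
    have h1 : (fun y => h' y i j) =ᶠ[nhds x] fun y => h y i j :=
      e.mono fun y hy => by simp only [hy]
    rw [e.self_of_nhds, ← e₁, mvfderiv_congr h1]
  conj := by
    rw [e.self_of_nhds]
    exact H.conj

/-- Matrices as endomorphisms of `ℝ^ι` with the operator norm; this normed algebra is used in
order to differentiate matrix exponentials. -/
def endEquivMatrix (ι : Type*) [Fintype ι] [DecidableEq ι] :
    ((ι → ℝ) →L[ℝ] (ι → ℝ)) ≃ₐ[ℝ] Matrix ι ι ℝ :=
  (Module.End.toContinuousLinearMap (ι → ℝ)).symm.trans LinearMap.toMatrixAlgEquiv'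

theorem exp_endEquivMatrix_symm (Y : Matrix ι ι ℝ) :
    NormedSpace.exp ((endEquivMatrix ι).symm Y) = (endEquivMatrix ι).symm (NormedSpace.exp Y) := by
  have h1 : Continuous (endEquivMatrix ι) :=
    LinearMap.continuous_of_finiteDimensional (endEquivMatrix ι).toLinearMap
  rw [← (endEquivMatrix ι).injective.eq_iff, AlgEquiv.apply_symm_apply]
  have h2 := (NormedSpace.exp_series_hasSum_exp' (𝕂 := ℝ) ((endEquivMatrix ι).symm Y)).map
    (endEquivMatrix ι) h1
  rw [NormedSpace.exp_eq_tsum (𝔸 := Matrix ι ι ℝ) ℝ]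
  refine h2.tsum_eq.symm.trans (tsum_congr fun r => ?_)
  simp

/-- Matrix entries as continuous linear functionals. -/
def entryCLM (i j : ι) : ((ι → ℝ) →L[ℝ] (ι → ℝ)) →L[ℝ] ℝ :=
  LinearMap.toContinuousLinearMap
    (Matrix.entryLinearMap ℝ ℝ i j ∘ₗ (endEquivMatrix ι).toLinearMap)

theorem entryCLM_symm (i j : ι) (Y : Matrix ι ι ℝ) :
    entryCLM i j ((endEquivMatrix ι).symm Y) = Y i j := by
  change endEquivMatrix ι ((endEquivMatrix ι).symm Y) i j = _
  rw [AlgEquiv.apply_symm_apply]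

theorem contMDiffAt_matrix {Y : M → Matrix ι ι ℝ}
    (hY : ∀ i j, ContMDiffAt 𝓘(ℝ, E) 𝓘(ℝ, ℝ) ∞ (fun y => Y y i j) x) :
    ContMDiffAt 𝓘(ℝ, E) 𝓘(ℝ, (ι → ℝ) →L[ℝ] (ι → ℝ)) ∞
      (fun y => (endEquivMatrix ι).symm (Y y)) x := by
  have h1 : (fun y => (endEquivMatrix ι).symm (Y y))
      = fun y => ∑ i, ∑ j, Y y i j • (endEquivMatrix ι).symm (Matrix.single i j 1) := by
    funext y
    conv_lhs => rw [Matrix.matrix_eq_sum_single (Y y)]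
    simp only [map_sum, ← map_smul, Matrix.smul_single, smul_eq_mul, mul_one]
  rw [h1]
  exact contMDiffAt_finsetSum fun i _ => contMDiffAt_finsetSum fun j _ =>
    (hY i j).smul contMDiffAt_const

theorem contMDiffAt_exp_entry {Y : M → Matrix ι ι ℝ}
    (hY : ∀ i j, ContMDiffAt 𝓘(ℝ, E) 𝓘(ℝ, ℝ) ∞ (fun y => Y y i j) x) (i j : ι) :
    ContMDiffAt 𝓘(ℝ, E) 𝓘(ℝ, ℝ) ∞ (fun y => NormedSpace.exp (Y y) i j) x := by
  have h1 := (entryCLM i j).contDiff.contDiffAt.contMDiffAt.comp x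
    (contMDiffAt_exp (contMDiffAt_matrix hY))
  refine h1.congr_of_eventuallyEq (Filter.Eventually.of_forall fun y => ?_)
  simp only [Function.comp_apply, exp_endEquivMatrix_symm, entryCLM_symm]

theorem IsGroupMap.exp (h𝔥 : ∀ Y ∈ 𝔥, ∀ Z ∈ 𝔥, Z * Y - Y * Z ∈ 𝔥) {Y : M → Matrix ι ι ℝ}
    (hY : ∀ i j, ContMDiffAt 𝓘(ℝ, E) 𝓘(ℝ, ℝ) ∞ (fun y => Y y i j) x)
    (hmem : ∀ᶠ y in nhds x, Y y ∈ 𝔥) :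
    IsGroupMap (E := E) 𝔥 (fun y => NormedSpace.exp (Y y)) x := by
  let φ := (endEquivMatrix ι).symm
  have hmem' : ∀ Z, Z ∈ 𝔥.comap (endEquivMatrix ι).toLinearMap ↔ endEquivMatrix ι Z ∈ 𝔥 :=
    fun Z => Iff.rfl
  have hφ' : ∀ a, endEquivMatrix ι (φ a) = a := (endEquivMatrix ι).apply_symm_apply
  have h𝔥' : ∀ Y ∈ 𝔥.comap (endEquivMatrix ι).toLinearMap,
      ∀ Z ∈ 𝔥.comap (endEquivMatrix ι).toLinearMap,
      Z * Y - Y * Z ∈ 𝔥.comap (endEquivMatrix ι).toLinearMap := fun Y hY Z hZ => by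
    rw [hmem', map_sub, map_mul, map_mul]
    exact h𝔥 _ hY _ hZ
  have hY' := contMDiffAt_matrix hY
  have hm : ∀ᶠ y in nhds x, φ (Y y) ∈ 𝔥.comap (endEquivMatrix ι).toLinearMap := by
    filter_upwards [hmem] with y hy
    rwa [hmem', hφ']
  refine ⟨contMDiffAt_exp_entry hY, fun v => ?_, fun Z hZ => ?_⟩
  · obtain ⟨Z, hZ, e⟩ := exists_mvfderiv_exp _ h𝔥' (hY'.mdifferentiableAt (by simp)) hm v
    refine ⟨endEquivMatrix ι Z, hZ, fun i j => ?_⟩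
    have h1 := mvfderiv_comp_fderiv (φ := entryCLM i j) (entryCLM i j).differentiableAt
      ((contMDiffAt_exp hY').mdifferentiableAt (by simp)) v
    have h2 : (fun y => entryCLM i j (NormedSpace.exp ((endEquivMatrix ι).symm (Y y))))
        = fun y => NormedSpace.exp (Y y) i j := by
      funext y
      rw [exp_endEquivMatrix_symm, entryCLM_symm]
    rw [h2, e, ContinuousLinearMap.fderiv] at h1
    have h3 : endEquivMatrix ι (NormedSpace.exp ((endEquivMatrix ι).symm (Y x)) * Z)
        = NormedSpace.exp (Y x) * endEquivMatrix ι Z := by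
      rw [exp_endEquivMatrix_symm, map_mul, AlgEquiv.apply_symm_apply]
    exact h1.trans (congrArg (fun N : Matrix ι ι ℝ => N i j) h3)
  · have h1 := exp_conj_mem _ (φ (Y x)) (h𝔥' _ hm.self_of_nhds)
      (Z := φ Z) (by rwa [hmem', hφ'])
    refine ⟨_, h1, ?_⟩
    change _ = _ * endEquivMatrix ι _
    rw [map_mul, map_mul, ← map_neg φ, exp_endEquivMatrix_symm, exp_endEquivMatrix_symm, hφ']
    have h2 : NormedSpace.exp (Y x) * NormedSpace.exp (-Y x) = 1 := by
      rw [Matrix.exp_neg]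
      exact Matrix.mul_nonsing_inv _ ((Matrix.isUnit_iff_isUnit_det _).1 (Matrix.isUnit_exp _))
    have h3 : ∀ Y : Matrix ι ι ℝ, endEquivMatrix ι ((endEquivMatrix ι).symm Y) = Y :=
      (endEquivMatrix ι).apply_symm_apply
    rw [h3, h3, mul_assoc, ← mul_assoc, h2, one_mul]

/-- Exponentials preserve bilinear forms that their logarithms leave infinitesimally invariant. -/
theorem exp_transpose_mul_mul_exp {Y K : Matrix ι ι ℝ} (h : Y.transpose * K + K * Y = 0)
    (hK : IsUnit K) : (NormedSpace.exp Y).transpose * K * NormedSpace.exp Y = K := by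
  have hK' := (Matrix.isUnit_iff_isUnit_det _).1 hK
  have h1 : Y.transpose = K * (-Y) * K⁻¹ := by
    rw [mul_neg, ← eq_neg_of_add_eq_zero_left h, mul_assoc, Matrix.mul_nonsing_inv _ hK', mul_one]
  have h2 : NormedSpace.exp (-Y) * NormedSpace.exp Y = 1 := by
    rw [Matrix.exp_neg]
    exact Matrix.nonsing_inv_mul _ ((Matrix.isUnit_iff_isUnit_det _).1 (Matrix.isUnit_exp _))
  have h3 : (NormedSpace.exp Y).transpose = K * NormedSpace.exp (-Y) * K⁻¹ := by
    rw [← Matrix.exp_transpose, h1]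
    exact Matrix.exp_conj _ _ hK
  have h4 : K⁻¹ * K = 1 := Matrix.nonsing_inv_mul _ hK'
  calc (NormedSpace.exp Y).transpose * K * NormedSpace.exp Y
      = K * NormedSpace.exp (-Y) * (K⁻¹ * K) * NormedSpace.exp Y := by
        rw [h3]; simp only [mul_assoc]
    _ = K := by rw [h4, mul_one, mul_assoc, h2, mul_one]

end SpinMaps

/-! ### The connection on the spinor bundle in a spin frame -/

theorem basis_equivFun_self {ι V : Type*} [Fintype ι] [DecidableEq ι] [AddCommGroup V] [Module ℝ V]
    (b : Module.Basis ι ℝ V) (i : ι) : b.equivFun (b i) = Pi.single i 1 := by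
  ext j
  simp [Pi.single_apply, eq_comm]

section SpinMatrices

variable {k l n : ℕ} (Δ : CliffordModule k l n)

/-- The Lie algebra `spin(k, l)` as a subspace of the block matrices. -/
def spinMatrices : Submodule ℝ (Matrix (Idx k l n) (Idx k l n) ℝ) where
  carrier := modelSpin Δ
  zero_mem' := ⟨0, zero_mem _, by ext (i | i) (j | j) <;> simp⟩
  add_mem' := by
    rintro _ _ ⟨A, hA, rfl⟩ ⟨A', hA', rfl⟩
    refine ⟨A + A', add_mem hA hA', ?_⟩
    ext (i | i) (j | j) <;> simp
  smul_mem' := by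
    rintro r _ ⟨A, hA, rfl⟩
    refine ⟨r • A, Submodule.smul_mem _ r hA, ?_⟩
    ext (i | i) (j | j) <;> simp

variable {Δ}

theorem spinMatrices_bracket_mem : ∀ Y ∈ spinMatrices Δ, ∀ Z ∈ spinMatrices Δ,
    Z * Y - Y * Z ∈ spinMatrices Δ := by
  rintro _ ⟨A, hA, rfl⟩ _ ⟨B, hB, rfl⟩
  refine ⟨B * A - A * B, spinLie_bracket_mem Δ.clifford modelForm_comm hB hA, ?_⟩
  rw [Matrix.fromBlocks_multiply, Matrix.fromBlocks_multiply]
  ext (i | i) (j | j) <;> simp [LinearMap.toMatrix'_mul]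

variable {E : Type*} [NormedAddCommGroup E] [NormedSpace ℝ E]
  {M : Type*} [TopologicalSpace M] [ChartedSpace E M]

theorem IsSpinMap.isGroupMap {U : Opens M} {h : M → Matrix (Idx k l n) (Idx k l n) ℝ}
    (hh : IsSpinMap E Δ U h) {x : M} (hx : x ∈ U) : IsGroupMap (E := E) (spinMatrices Δ) h x := by
  obtain ⟨W, hxW, -, L, hL, e⟩ := hh x hx
  have hW : (W : Set M) ∈ nhds x := W.2.mem_nhds hxW
  refine IsGroupMap.congr (h := fun y => (L.map fun Y => NormedSpace.exp (Y y)).prod) ?_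
    (Filter.eventually_of_mem hW e)
  clear e
  induction L with
  | nil => exact IsGroupMap.one
  | cons Y L ih =>
    simp only [List.map_cons, List.prod_cons]
    refine IsGroupMap.mul ?_ (ih fun Y' hY' => hL Y' (List.mem_cons_of_mem _ hY'))
    obtain ⟨h1, h2⟩ := hL Y List.mem_cons_self
    exact IsGroupMap.exp spinMatrices_bracket_mem (fun i j => (h1 i j).contMDiffAt hW)
      (Filter.eventually_of_mem hW h2)

end SpinMatrices

section Connection

variable {E : Type*} [NormedAddCommGroup E] [NormedSpace ℝ E] [FiniteDimensional ℝ E]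
  {M : Type*} [TopologicalSpace M] [ChartedSpace E M] [IsManifold 𝓘(ℝ, E) ∞ M]
  {F : Type*} [NormedAddCommGroup F] [NormedSpace ℝ F]
  {S : M → Type*} [TopologicalSpace (TotalSpace F S)] [∀ x, AddCommGroup (S x)]
  [∀ x, Module ℝ (S x)] [∀ x, TopologicalSpace (S x)] [FiberBundle F S]

/-- Smoothness of a section at a point. -/
abbrev SmoothAt (E : Type*) [NormedAddCommGroup E] [NormedSpace ℝ E]
    {M : Type*} [TopologicalSpace M] [ChartedSpace E M]
    (F : Type*) [NormedAddCommGroup F] [NormedSpace ℝ F]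
    {S : M → Type*} [TopologicalSpace (TotalSpace F S)] [∀ x, TopologicalSpace (S x)]
    [FiberBundle F S] (t : Π x, S x) (x : M) : Prop :=
  ContMDiffAt 𝓘(ℝ, E) (𝓘(ℝ, E).prod 𝓘(ℝ, F)) ∞ (fun x => TotalSpace.mk' F x (t x)) x

theorem SmoothOn.smoothAt {t : Π x, S x} {W : Opens M} (ht : SmoothOn E F t W) {x : M}
    (hx : x ∈ W) : SmoothAt E F t x :=
  ContMDiffOn.contMDiffAt ht (W.2.mem_nhds hx)

variable {k l n : ℕ} {g : PseudoMetric E M} {Δ : CliffordModule k l n}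
  {ρ : ∀ x : M, TangentSpace 𝓘(ℝ, E) x →ₗ[ℝ] Module.End ℝ (S x)}

namespace LocalTuple.IsAdapted

variable {b c : LocalTuple E k l n S}

theorem isAdaptedBasis (hc : c.IsAdapted F g Δ ρ) {x : M} (hx : x ∈ c.dom) :
    IsAdaptedBasis Δ (g.form x) (ρ x) (hc.frame_e.toBasisAt hx) (hc.frame_θ.toBasisAt hx) where
  orthonormal i j := by
    simpa only [IsLocalFrameOn.toBasisAt_coe] using hc.orthonormal x hx i j
  clifford i j := by
    simpa only [IsLocalFrameOn.toBasisAt_coe] using hc.clifford x hx i j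

theorem mdiffVec (hc : c.IsAdapted F g Δ ρ) {x : M} (hx : x ∈ c.dom) (i : EvenIdx k l) :
    MDiffVec (c.e i) x :=
  (hc.frame_e.contMDiffAt c.dom.2 hx i).mdifferentiableAt (by simp)

theorem coeff_θ (hc : c.IsAdapted F g Δ ρ) {x : M} (hx : x ∈ c.dom) (i j : Fin n) :
    hc.frame_θ.coeff j x (c.θ i x) = if i = j then 1 else 0 := by
  rw [IsLocalFrameOn.coeff_apply_of_mem _ hx]
  conv_lhs => rw [← hc.frame_θ.toBasisAt_coe hx i, Module.Basis.repr_self]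
  simp [Finsupp.single_apply]

/-- The connection on the spinor bundle, computed in the spin frame `c = (e_i, θ^j)`:
`∑ v(t^j) θ^j + ¼ ∑ ε_i ρ(e_i) ρ(∇_v e_i) t`. -/
def nabla (hc : c.IsAdapted F g Δ ρ) (t : Π y, S y) (x : M) (v : TangentSpace 𝓘(ℝ, E) x) : S x :=
  (∑ j, mvfderiv 𝓘(ℝ, E) (fun y => hc.frame_θ.coeff j y (t y)) x v • c.θ j x)
    + (4⁻¹ : ℝ) • ∑ i, sgn k l i • ρ x (c.e i x) (ρ x (leviCivita g (c.e i) x v) (t x))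

variable [VectorBundle ℝ F S] [ContMDiffVectorBundle ∞ F S 𝓘(ℝ, E)]

theorem mdifferentiableAt_coeff (hc : c.IsAdapted F g Δ ρ) {x : M} (hx : x ∈ c.dom)
    {t : Π y, S y} (ht : SmoothAt E F t x) (j : Fin n) :
    MDifferentiableAt 𝓘(ℝ, E) 𝓘(ℝ, ℝ) (fun y => hc.frame_θ.coeff j y (t y)) x :=
  (hc.frame_θ.contMDiffAt_coeff c.dom.2 hx ht j).mdifferentiableAt (by simp)

/-- The connection on the spinor bundle does not depend on the spin frame. -/
theorem nabla_eq_of_relatedBy (hb : b.IsAdapted F g Δ ρ) (hc : c.IsAdapted F g Δ ρ)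
    {W : Opens M} (hW : W ≤ b.dom ⊓ c.dom) {h : M → Matrix (Idx k l n) (Idx k l n) ℝ}
    (hh : IsSpinMap E Δ W h) (hbc : b.RelatedBy c h W) {x : M} (hx : x ∈ W) {t : Π y, S y}
    (ht : SmoothAt E F t x) (v : TangentSpace 𝓘(ℝ, E) x) :
    hb.nabla t x v = hc.nabla t x v := by
  have hxb : x ∈ b.dom := (hW hx).1
  have hxc : x ∈ c.dom := (hW hx).2
  have hnhds : (W : Set M) ∈ nhds x := W.2.mem_nhds hx
  have H := hh.isGroupMap hx
  obtain ⟨_, ⟨A, hA, rfl⟩, hder⟩ := H.deriv v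
  have hd : ∀ i j, MDifferentiableAt 𝓘(ℝ, E) 𝓘(ℝ, ℝ) (fun y => h y i j) x := fun i j =>
    (H.smooth i j).mdifferentiableAt (by simp)
  have Bb := hb.isAdaptedBasis hxb
  have Bc := hc.isAdaptedBasis hxc
  have hsum : ∀ u : TangentSpace 𝓘(ℝ, E) x, u = ∑ i, sgn k l i • g.form x u (c.e i x) • c.e i x :=
    fun u => by simpa only [IsLocalFrameOn.toBasisAt_coe] using Bc.eq_sum u
  have hsumb : ∀ u : TangentSpace 𝓘(ℝ, E) x,
      u = ∑ i, sgn k l i • g.form x u (b.e i x) • b.e i x :=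
    fun u => by simpa only [IsLocalFrameOn.toBasisAt_coe] using Bb.eq_sum u
  -- the rotation `A` in the frame `c`
  let X : Module.End ℝ (TangentSpace 𝓘(ℝ, E) x) × Module.End ℝ (S x) :=
    ((hc.frame_e.toBasisAt hxc).equivFun.symm.conj A.1,
      (hc.frame_θ.toBasisAt hxc).equivFun.symm.conj A.2)
  have hX : X ∈ spinLie (g.form x) (ρ x) := by
    rw [← Bc.map_spinLie]
    exact ⟨A, hA, rfl⟩
  have hX1 : ∀ i, X.1 (c.e i x) = ∑ m, LinearMap.toMatrix' A.1 m i • c.e m x := by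
    intro i
    have h1 : (hc.frame_e.toBasisAt hxc).equivFun (c.e i x) = Pi.single i 1 := by
      rw [← hc.frame_e.toBasisAt_coe hxc i]
      exact basis_equivFun_self _ i
    simp only [X, LinearEquiv.conj_apply_apply, LinearEquiv.symm_symm, h1,
      Module.Basis.equivFun_symm_apply, IsLocalFrameOn.toBasisAt_coe, toMatrix'_single]
  have hX2 : ∀ i, X.2 (c.θ i x) = ∑ m, LinearMap.toMatrix' A.2 m i • c.θ m x := by
    intro i
    have h1 : (hc.frame_θ.toBasisAt hxc).equivFun (c.θ i x) = Pi.single i 1 := by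
      rw [← hc.frame_θ.toBasisAt_coe hxc i]
      exact basis_equivFun_self _ i
    simp only [X, LinearEquiv.conj_apply_apply, LinearEquiv.symm_symm, h1,
      Module.Basis.equivFun_symm_apply, IsLocalFrameOn.toBasisAt_coe, toMatrix'_single]
  -- `T` is the linear map that agrees with `∇_v` on the frame `b`
  let T : TangentSpace 𝓘(ℝ, E) x →ₗ[ℝ] TangentSpace 𝓘(ℝ, E) x :=
    (hb.frame_e.toBasisAt hxb).constr ℝ fun i => leviCivita g (b.e i) x v
  have hT : ∀ i, T (b.e i x) = leviCivita g (b.e i) x v := fun i => by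
    conv_lhs => rw [← hb.frame_e.toBasisAt_coe hxb i, Module.Basis.constr_basis]
  have hLC : ∀ i, leviCivita g (c.e i) x v = X.1 (c.e i x) + T (c.e i x) := by
    intro i
    rw [leviCivita_sum g (hc.mdiffVec hxc i) (fun j => hd (Sum.inl j) (Sum.inl i))
      (fun j => hb.mdiffVec hxb j)
      (Filter.eventually_of_mem hnhds fun y hy => (hbc y hy).1 i) v, hX1,
      Finset.sum_add_distrib]
    congr 1
    · simp only [(hbc x hx).1, Finset.smul_sum, smul_smul]
      rw [Finset.sum_comm]
      refine Finset.sum_congr rfl fun j _ => ?_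
      rw [← Finset.sum_smul, hder]
      congr 1
      simp [Matrix.mul_apply, mul_comm]
    · rw [(hbc x hx).1 i, map_sum]
      exact Finset.sum_congr rfl fun j _ => by rw [map_smul, hT]
  have hTind : ∑ i, sgn k l i • ρ x (b.e i x) (ρ x (T (b.e i x)) (t x))
      = ∑ i, sgn k l i • ρ x (c.e i x) (ρ x (T (c.e i x)) (t x)) := by
    have h1 : ∀ i, ρ x (c.e i x) (ρ x (T (c.e i x)) (t x)) = ∑ j, (sgn k l j
        * g.form x (c.e i x) (b.e j x)) • ρ x (b.e j x) (ρ x (T (c.e i x)) (t x)) := fun i => by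
      conv_lhs => rw [show ρ x (c.e i x) = ∑ j, (sgn k l j * g.form x (c.e i x) (b.e j x))
        • ρ x (b.e j x) by
          conv_lhs => rw [hsumb (c.e i x)]
          simp only [map_sum, map_smul, smul_smul]]
      simp only [LinearMap.sum_apply, LinearMap.smul_apply]
    have h2 : ∀ j, ρ x (T (b.e j x)) (t x) = ∑ i, (sgn k l i
        * g.form x (c.e i x) (b.e j x)) • ρ x (T (c.e i x)) (t x) := fun j => by
      conv_lhs => rw [hsum (b.e j x)]
      simp only [map_sum, map_smul, smul_smul, LinearMap.sum_apply, LinearMap.smul_apply,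
        g.symm x (b.e j x)]
    simp only [h1, h2, map_sum, map_smul, Finset.smul_sum, smul_smul]
    rw [Finset.sum_comm]
    exact Finset.sum_congr rfl fun i _ => Finset.sum_congr rfl fun j _ => by
      congr 1
      ring
  have hX2' : X.2 (t x)
      = (4⁻¹ : ℝ) • ∑ i, sgn k l i • ρ x (c.e i x) (ρ x (X.1 (c.e i x)) (t x)) := by
    rw [spinLie_snd_eq (fun i => c.e i x) (sgn k l) hsum hX]
    simp
  -- the coefficients of `t` in the frames `b` and `c`
  have hcoef : ∀ y ∈ W, ∀ j, hb.frame_θ.coeff j y (t y)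
      = ∑ i, h y (Sum.inr j) (Sum.inr i) * hc.frame_θ.coeff i y (t y) := by
    intro y hy j
    conv_lhs => rw [hc.frame_θ.coeff_sum_eq t (hW hy).2]
    simp only [(hbc y hy).2, map_sum, map_smul, hb.coeff_θ (hW hy).1, smul_eq_mul]
    simp [mul_comm]
  have hdt := fun j => hc.mdifferentiableAt_coeff hxc ht j
  have hdcoef : ∀ j, mvfderiv 𝓘(ℝ, E) (fun y => hb.frame_θ.coeff j y (t y)) x v
      = ∑ i, (h x (Sum.inr j) (Sum.inr i)
          * mvfderiv 𝓘(ℝ, E) (fun y => hc.frame_θ.coeff i y (t y)) x v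
        + hc.frame_θ.coeff i x (t x) * ∑ m, h x (Sum.inr j) (Sum.inr m)
          * LinearMap.toMatrix' A.2 m i) := by
    intro j
    have h1 : (fun y => hb.frame_θ.coeff j y (t y))
        =ᶠ[nhds x] fun y => ∑ i, h y (Sum.inr j) (Sum.inr i) * hc.frame_θ.coeff i y (t y) :=
      Filter.eventually_of_mem hnhds fun y hy => hcoef y hy j
    have h2 := mvfderiv_sum (f := fun i y => h y (Sum.inr j) (Sum.inr i)
      * hc.frame_θ.coeff i y (t y)) fun i => (hd (Sum.inr j) (Sum.inr i)).mul (hdt i)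
    rw [mvfderiv_congr h1, h2, sum_apply]
    refine Finset.sum_congr rfl fun i _ => ?_
    rw [mvfderiv_fun_mul (hd (Sum.inr j) (Sum.inr i)) (hdt i)]
    simp [hder, Matrix.mul_apply]
  have hflat : ∑ j, mvfderiv 𝓘(ℝ, E) (fun y => hb.frame_θ.coeff j y (t y)) x v • b.θ j x
      = (∑ j, mvfderiv 𝓘(ℝ, E) (fun y => hc.frame_θ.coeff j y (t y)) x v • c.θ j x)
        + X.2 (t x) := by
    have h1 : X.2 (t x) = ∑ i, hc.frame_θ.coeff i x (t x) • X.2 (c.θ i x) := by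
      conv_lhs => rw [hc.frame_θ.coeff_sum_eq t hxc]
      simp only [map_sum, map_smul]
    rw [h1]
    simp only [hX2, hdcoef]
    simp only [(hbc x hx).2, Finset.smul_sum, smul_smul, Finset.sum_smul, add_smul,
      Finset.mul_sum, Finset.sum_add_distrib]
    congr 1
    · rw [Finset.sum_comm]
      exact Finset.sum_congr rfl fun i _ => Finset.sum_congr rfl fun j _ => by rw [mul_comm]
    · rw [Finset.sum_comm]
      refine Finset.sum_congr rfl fun i _ => ?_
      rw [Finset.sum_comm]
      exact Finset.sum_congr rfl fun m _ => Finset.sum_congr rfl fun j _ => by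
        congr 1
        ring
  rw [nabla, nabla, hflat, hX2']
  simp only [← hT, hTind, hLC, map_add, LinearMap.add_apply, smul_add, Finset.sum_add_distrib]
  abel

end LocalTuple.IsAdapted

end Connection

/-! ### The form `g₁` in spin frames -/

section LocallyConstant

variable {E : Type*} [NormedAddCommGroup E] [NormedSpace ℝ E]
  {M : Type*} [TopologicalSpace M] [ChartedSpace E M] [IsManifold 𝓘(ℝ, E) ∞ M]

theorem eventually_eq_of_mvfderiv_eq_zero {f : M → ℝ} {W : Opens M}
    (hf : ContMDiffOn 𝓘(ℝ, E) 𝓘(ℝ, ℝ) ∞ f W) (h : ∀ y ∈ W, mvfderiv 𝓘(ℝ, E) f y = 0) {x : M}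
    (hx : x ∈ W) : ∀ᶠ y in nhds x, f y = f x := by
  let φ := extChartAt 𝓘(ℝ, E) x
  let s : Set E := φ.target ∩ φ.symm ⁻¹' W
  have hs : IsOpen s :=
    (continuousOn_extChartAt_symm x).isOpen_inter_preimage (isOpen_extChartAt_target x) W.2
  have hφ : ∀ z ∈ s, MDifferentiableAt 𝓘(ℝ, E) 𝓘(ℝ, E) φ.symm z := fun z hz =>
    ((contMDiffOn_extChartAt_symm (n := ∞) x).contMDiffAt
      ((isOpen_extChartAt_target x).mem_nhds hz.1)).mdifferentiableAt (by simp)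
  have hf' : ∀ y ∈ W, MDifferentiableAt 𝓘(ℝ, E) 𝓘(ℝ, ℝ) f y := fun y hy =>
    (hf.contMDiffAt (W.2.mem_nhds hy)).mdifferentiableAt (by simp)
  have h1 : DifferentiableOn ℝ (f ∘ φ.symm) s := fun z hz =>
    ((hf' _ hz.2).comp z (hφ z hz)).differentiableAt.differentiableWithinAt
  have h2 : s.EqOn (fderiv ℝ (f ∘ φ.symm)) 0 := fun z hz => by
    have h3 := mfderiv_comp z (hf' _ hz.2) (hφ z hz)
    have h4 : mfderiv 𝓘(ℝ, E) 𝓘(ℝ, ℝ) f (φ.symm z) = 0 := h _ hz.2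
    rw [h4, ContinuousLinearMap.zero_comp, mfderiv_eq_fderiv] at h3
    exact h3
  have h5 := hs.isOpen_inter_preimage_of_fderiv_eq_zero h1 h2 {f x}
  have hxs : φ x ∈ s ∩ f ∘ φ.symm ⁻¹' {f x} := by
    have e : φ.symm (φ x) = x := extChartAt_to_inv x
    refine ⟨⟨mem_extChartAt_target x, ?_⟩, ?_⟩
    · change φ.symm (φ x) ∈ (W : Set M)
      rw [e]
      exact hx
    · change f (φ.symm (φ x)) = f x
      rw [e]
  filter_upwards [(continuousAt_extChartAt x).preimage_mem_nhds (h5.mem_nhds hxs),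
    extChartAt_source_mem_nhds (I := 𝓘(ℝ, E)) x] with y hy hy'
  have h6 : f (φ.symm (φ y)) = f x := hy.2
  rwa [φ.left_inv hy'] at h6

end LocallyConstant

section Invariance

variable {k l n : ℕ} {Δ : CliffordModule k l n}

/-- The matrix of the form `⟨ , ⟩ + G` on `ℝ^(k+l) + ℝⁿ`. -/
def blockForm (k l : ℕ) {n : ℕ} (G : Matrix (Fin n) (Fin n) ℝ) :
    Matrix (Idx k l n) (Idx k l n) ℝ :=
  Matrix.fromBlocks (Matrix.diagonal (sgn k l)) 0 0 G

theorem isUnit_blockForm {G : Matrix (Fin n) (Fin n) ℝ} (hG : G.det ≠ 0) :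
    IsUnit (blockForm k l G) := by
  rw [Matrix.isUnit_iff_isUnit_det, isUnit_iff_ne_zero, blockForm, Matrix.det_fromBlocks_zero₂₁,
    Matrix.det_diagonal]
  exact mul_ne_zero (Finset.prod_ne_zero_iff.2 fun i _ => sgn_ne_zero i) hG

theorem toMatrix'_transpose_mul_add {ι : Type*} [Fintype ι] [DecidableEq ι]
    (B : LinearMap.BilinForm ℝ (ι → ℝ)) (f : Module.End ℝ (ι → ℝ))
    (h : ∀ u w, B (f u) w = -B u (f w)) :
    (LinearMap.toMatrix' f).transpose * Matrix.of (fun i j => B (Pi.single i 1) (Pi.single j 1))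
      + Matrix.of (fun i j => B (Pi.single i 1) (Pi.single j 1)) * LinearMap.toMatrix' f = 0 := by
  ext i j
  have h1 := h (Pi.single i 1) (Pi.single j 1)
  have h2 : ∀ i, f (Pi.single i 1) = ∑ r, LinearMap.toMatrix' f r i • Pi.single r 1 := fun i => by
    conv_lhs => rw [pi_eq_sum_univ' (f (Pi.single i 1))]
    simp
  rw [h2, h2] at h1
  simp only [map_sum, map_smul, LinearMap.sum_apply, LinearMap.smul_apply, smul_eq_mul] at h1
  simp only [Matrix.add_apply, Matrix.mul_apply, Matrix.transpose_apply, Matrix.of_apply,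
    Matrix.zero_apply, h1]
  rw [neg_add_eq_zero]
  exact Finset.sum_congr rfl fun r _ => mul_comm _ _

theorem transpose_mul_blockForm_add {G : LinearMap.BilinForm ℝ (Fin n → ℝ)}
    (hG : IsSuitable Δ.ρ G) {Y : Matrix (Idx k l n) (Idx k l n) ℝ} (hY : Y ∈ spinMatrices Δ) :
    Y.transpose * blockForm k l (Matrix.of fun i j => G (Pi.single i 1) (Pi.single j 1))
      + blockForm k l (Matrix.of fun i j => G (Pi.single i 1) (Pi.single j 1)) * Y = 0 := by
  obtain ⟨A, hA, rfl⟩ := hY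
  have h0 : Matrix.diagonal (sgn k l)
      = Matrix.of fun i j => modelForm k l (Pi.single i 1) (Pi.single j 1) := by
    ext i j
    simp only [Matrix.diagonal_apply, Matrix.of_apply, modelForm_apply]
    rw [Finset.sum_eq_single i]
    · by_cases h : i = j <;> simp [h]
    · intro r _ hr
      simp [Pi.single_apply, hr]
    · simp
  have h1 := toMatrix'_transpose_mul_add _ A.1 (spinLie_skew modelForm_comm hA)
  have h2 := toMatrix'_transpose_mul_add _ A.2 (hG.spinLie_skew hA)
  rw [← h0] at h1
  rw [blockForm, Matrix.fromBlocks_transpose, Matrix.fromBlocks_multiply,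
    Matrix.fromBlocks_multiply, Matrix.fromBlocks_add]
  simp only [Matrix.transpose_zero, Matrix.zero_mul, Matrix.mul_zero, add_zero, zero_add, h1, h2,
    Matrix.fromBlocks_zero]

variable {E : Type*} [NormedAddCommGroup E] [NormedSpace ℝ E]
  {M : Type*} [TopologicalSpace M] [ChartedSpace E M]
  {U : Opens M} {h : M → Matrix (Idx k l n) (Idx k l n) ℝ}

theorem IsSpinMap.transpose_mul_mul (hh : IsSpinMap E Δ U h)
    {K : Matrix (Idx k l n) (Idx k l n) ℝ} (hK : IsUnit K)
    (hinv : ∀ Y ∈ spinMatrices Δ, Y.transpose * K + K * Y = 0) {x : M} (hx : x ∈ U) :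
    (h x).transpose * K * h x = K := by
  obtain ⟨W, hxW, -, L, hL, e⟩ := hh x hx
  rw [e x hxW]
  clear e
  induction L with
  | nil => simp
  | cons Y L ih =>
    have h1 := ih fun Y' hY' => hL Y' (List.mem_cons_of_mem _ hY')
    have h2 := exp_transpose_mul_mul_exp (hinv _ ((hL Y List.mem_cons_self).2 x hxW)) hK
    rw [List.map_cons, List.prod_cons, Matrix.transpose_mul]
    generalize (L.map fun Y => NormedSpace.exp (Y x)).prod = p at h1 ⊢
    calc p.transpose * (NormedSpace.exp (Y x)).transpose * K * (NormedSpace.exp (Y x) * p)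
        = p.transpose * ((NormedSpace.exp (Y x)).transpose * K * NormedSpace.exp (Y x)) * p := by
          simp only [mul_assoc]
      _ = K := by rw [h2, h1]

/-- Spin transformations are block diagonal. -/
theorem IsSpinMap.blockDiagonal (hh : IsSpinMap E Δ U h) {x : M} (hx : x ∈ U) :
    (∀ i j, h x (Sum.inl i) (Sum.inr j) = 0) ∧ ∀ i j, h x (Sum.inr i) (Sum.inl j) = 0 := by
  let D : Matrix (Idx k l n) (Idx k l n) ℝ := Matrix.fromBlocks 1 0 0 (-1)
  have h1 : Commute D (h x) := by
    obtain ⟨W, hxW, -, L, hL, e⟩ := hh x hx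
    rw [e x hxW]
    refine Commute.list_prod_right _ _ fun p hp => ?_
    obtain ⟨Y, hY, rfl⟩ := List.mem_map.1 hp
    obtain ⟨A, -, hA⟩ := (hL Y hY).2 x hxW
    refine Commute.exp_right ?_
    change D * Y x = Y x * D
    rw [hA, Matrix.fromBlocks_multiply, Matrix.fromBlocks_multiply]
    simp
  have h2 : D * h x = h x * D := h1
  rw [← Matrix.fromBlocks_toBlocks (h x), Matrix.fromBlocks_multiply, Matrix.fromBlocks_multiply,
    Matrix.fromBlocks_inj] at h2
  simp only [Matrix.one_mul, Matrix.zero_mul, add_zero, Matrix.mul_zero, zero_add, Matrix.mul_neg,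
    Matrix.mul_one, Matrix.neg_mul] at h2
  constructor
  · intro i j
    have h3 := congrFun₂ h2.2.1 i j
    simp only [Matrix.toBlocks₁₂, Matrix.of_apply, Matrix.neg_apply] at h3
    linarith
  · intro i j
    have h3 := congrFun₂ h2.2.2.1 i j
    simp only [Matrix.toBlocks₂₁, Matrix.of_apply, Matrix.neg_apply] at h3
    linarith

end Invariance

section Gram

variable {E : Type*} [NormedAddCommGroup E] [NormedSpace ℝ E] [FiniteDimensional ℝ E]
  {M : Type*} [TopologicalSpace M] [ChartedSpace E M] [IsManifold 𝓘(ℝ, E) ∞ M]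
  {F : Type*} [NormedAddCommGroup F] [NormedSpace ℝ F]
  {S : M → Type*} [TopologicalSpace (TotalSpace F S)] [∀ x, AddCommGroup (S x)]
  [∀ x, Module ℝ (S x)] [∀ x, TopologicalSpace (S x)] [FiberBundle F S]
  {k l n : ℕ} {g : PseudoMetric E M} {Δ : CliffordModule k l n}
  {ρ : ∀ x : M, TangentSpace 𝓘(ℝ, E) x →ₗ[ℝ] Module.End ℝ (S x)} {b c : LocalTuple E k l n S}

/-- In a spin frame, `∇ θ^j` is given by the coefficients of the Levi-Civita connection alone. -/
theorem LocalTuple.IsAdapted.nabla_θ (hc : c.IsAdapted F g Δ ρ) {x : M} (hx : x ∈ c.dom)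
    (v : TangentSpace 𝓘(ℝ, E) x) (j : Fin n) :
    hc.nabla (c.θ j) x v = (4⁻¹ : ℝ) • ∑ i, sgn k l i •
      ρ x (c.e i x) (ρ x (leviCivita g (c.e i) x v) (c.θ j x)) := by
  rw [LocalTuple.IsAdapted.nabla, Finset.sum_eq_zero, zero_add]
  intro r _
  have h1 : (fun y => hc.frame_θ.coeff r y (c.θ j y)) =ᶠ[nhds x] fun _ => if j = r then 1 else 0 :=
    Filter.eventually_of_mem (c.dom.2.mem_nhds hx) fun y hy => hc.coeff_θ hy j r
  rw [mvfderiv_congr h1, mvfderiv_const]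
  simp

/-- `∇ θ^j` is skew with respect to a suitable form. -/
theorem LocalTuple.IsAdapted.nabla_θ_skew (hc : c.IsAdapted F g Δ ρ) {x : M} (hx : x ∈ c.dom)
    {β : LinearMap.BilinForm ℝ (S x)} (hβ : IsSuitable (ρ x) β)
    (v : TangentSpace 𝓘(ℝ, E) x) (i j : Fin n) :
    β (hc.nabla (c.θ i) x v) (c.θ j x) + β (c.θ i x) (hc.nabla (c.θ j) x v) = 0 := by
  have hcl := (hc.isAdaptedBasis hx).isClifford
  have h0 : ∀ r, g.form x (c.e r x) (leviCivita g (c.e r) x v) = 0 := fun r => by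
    have h1 := leviCivita_metric g (hc.mdiffVec hx r) (hc.mdiffVec hx r) v
    have h2 : (fun y => g.form y (c.e r y) (c.e r y)) =ᶠ[nhds x] fun _ => sgn k l r :=
      Filter.eventually_of_mem (c.dom.2.mem_nhds hx) fun y hy => by
        simpa using hc.orthonormal y hy r r
    rw [mvfderiv_congr h2, mvfderiv_const, g.symm x (leviCivita g (c.e r) x v)] at h1
    have h3 : (0 : TangentSpace 𝓘(ℝ, E) x →L[ℝ] ℝ) v = 0 := rfl
    rw [h3] at h1
    linarith
  have h4 : ∀ r s t, β (ρ x (c.e r x) (ρ x (leviCivita g (c.e r) x v) s)) t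
      = -β s (ρ x (c.e r x) (ρ x (leviCivita g (c.e r) x v) t)) := fun r s t => by
    have h5 := hcl.mul_add_mul (g.symm x) (c.e r x) (leviCivita g (c.e r) x v)
    rw [h0] at h5
    have h6 := congrArg (fun L : Module.End ℝ (S x) => β s (L t)) h5
    simp only [LinearMap.add_apply, Module.End.mul_apply, map_add, mul_zero, neg_zero, zero_smul,
      LinearMap.zero_apply, map_zero] at h6
    rw [hβ.mul_apply]
    linarith
  rw [hc.nabla_θ hx, hc.nabla_θ hx]
  simp only [map_smul, map_sum, LinearMap.smul_apply, LinearMap.sum_apply, h4, smul_eq_mul]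
  rw [← mul_add, ← Finset.sum_add_distrib, Finset.sum_eq_zero, mul_zero]
  intro r _
  ring

variable [VectorBundle ℝ F S] [ContMDiffVectorBundle ∞ F S 𝓘(ℝ, E)]

namespace SpinStructure

variable (P : SpinStructure F g Δ S)

theorem nabla_eq (hc : c ∈ P.spinFrames) {x : M} (hx : x ∈ c.dom) {t : Π y, S y}
    (ht : SmoothAt E F t x) (v : TangentSpace 𝓘(ℝ, E) x) :
    P.nabla t x v = hc.1.nabla t x v := by
  obtain ⟨b, hb, W, hxW, hW, h, hh, hr⟩ := hc.2 x hx
  obtain ⟨h', hh', hr'⟩ := P.transition _ (P.frameAt_mem x) b hb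
  have hx' : x ∈ (P.frameAt x).dom := (P.cover x).choose_spec.2
  have e1 := (P.adapted _ (P.frameAt_mem x)).nabla_eq_of_relatedBy (P.adapted b hb) le_rfl hh' hr'
    ⟨hx', (hW hxW).1⟩ ht v
  have e2 := (P.adapted b hb).nabla_eq_of_relatedBy hc.1 hW hh hr hxW ht v
  exact e1.trans e2

theorem mem_spinFrames_of_mem_atlas (hb : b ∈ P.atlas) : b ∈ P.spinFrames := by
  obtain ⟨h, hh, hr⟩ := P.transition b hb b hb
  exact ⟨P.adapted b hb, fun x hx => ⟨b, hb, b.dom ⊓ b.dom, ⟨hx, hx⟩, le_rfl, h, hh, hr⟩⟩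

theorem isClifford (x : M) : IsClifford (g.form x) (P.ρ x) := by
  obtain ⟨b, hb, hx⟩ := P.cover x
  exact ((P.adapted b hb).isAdaptedBasis hx).isClifford

variable {P} {g₁ : FormField E F S}

/-- The matrix of `g₁` in a spin frame is locally constant, since its derivative is given by the
action of `spin(k, l)`. -/
theorem gram_eventually_eq (hsuit : ∀ x, IsSuitable (P.ρ x) (g₁.form x)) (hpar : P.IsParallel g₁)
    (hc : c ∈ P.spinFrames) {x : M} (hx : x ∈ c.dom) (i j : Fin n) :
    ∀ᶠ y in nhds x, g₁.form y (c.θ i y) (c.θ j y) = g₁.form x (c.θ i x) (c.θ j x) := by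
  have hs : ∀ i, SmoothOn E F (c.θ i) c.dom := fun i => hc.1.frame_θ.contMDiffOn i
  refine eventually_eq_of_mvfderiv_eq_zero (f := fun y => g₁.form y (c.θ i y) (c.θ j y))
    (g₁.smooth c.dom _ _ (hs i) (hs j)) (fun y hy => ?_) hx
  ext v
  rw [hpar c.dom _ _ (hs i) (hs j) y hy, P.nabla_eq hc hy ((hs i).smoothAt hy),
    P.nabla_eq hc hy ((hs j).smoothAt hy)]
  exact hc.1.nabla_θ_skew hy (hsuit y) v i j

theorem formInBasis_single (hc : c.IsAdapted F g Δ P.ρ) {x : M} (hx : x ∈ c.dom) (i j : Fin n) :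
    formInBasis (g₁.form x) (hc.frame_θ.toBasisAt hx) (Pi.single i 1) (Pi.single j 1)
      = g₁.form x (c.θ i x) (c.θ j x) := by
  have h1 : ∀ i, (hc.frame_θ.toBasisAt hx).equivFun.symm (Pi.single i 1) = c.θ i x := fun i => by
    rw [← basis_equivFun_self (hc.frame_θ.toBasisAt hx), LinearEquiv.symm_apply_apply,
      IsLocalFrameOn.toBasisAt_coe]
  rw [formInBasis_apply, h1, h1]

theorem gram_eq_of_relatedBy (hnondeg : ∀ x, (g₁.form x).Nondegenerate)
    (hsuit : ∀ x, IsSuitable (P.ρ x) (g₁.form x)) (hb : b.IsAdapted F g Δ P.ρ) {W : Opens M}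
    (hW : W ≤ b.dom) {h : M → Matrix (Idx k l n) (Idx k l n) ℝ}
    (hh : IsSpinMap E Δ W h) (hbc : b.RelatedBy c h W) {x : M} (hx : x ∈ W) (i j : Fin n) :
    g₁.form x (c.θ i x) (c.θ j x) = g₁.form x (b.θ i x) (b.θ j x) := by
  have hxb := hW hx
  let G := formInBasis (g₁.form x) (hb.frame_θ.toBasisAt hxb)
  let Gm : Matrix (Fin n) (Fin n) ℝ := Matrix.of fun i j => G (Pi.single i 1) (Pi.single j 1)
  have hGm : ∀ i j, Gm i j = g₁.form x (b.θ i x) (b.θ j x) := fun i j =>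
    formInBasis_single hb hxb i j
  have hdet : Gm.det ≠ 0 := by
    have h1 : Gm = LinearMap.BilinForm.toMatrix (hb.frame_θ.toBasisAt hxb) (g₁.form x) := by
      ext i j
      rw [LinearMap.BilinForm.toMatrix_apply, hGm, IsLocalFrameOn.toBasisAt_coe,
        IsLocalFrameOn.toBasisAt_coe]
    rw [h1]
    exact (LinearMap.BilinForm.nondegenerate_iff_det_ne_zero _).1 (hnondeg x)
  have hG : IsSuitable Δ.ρ G := (hb.isAdaptedBasis hxb).isSuitable_formInBasis (hsuit x)
  have h2 := hh.transpose_mul_mul (isUnit_blockForm (k := k) (l := l) hdet)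
    (fun Y hY => transpose_mul_blockForm_add hG hY) hx
  have h3 := congrFun₂ h2 (Sum.inr i) (Sum.inr j)
  have h4 := (hh.blockDiagonal hx).1
  have h5 : blockForm k l Gm (Sum.inr i) (Sum.inr j) = Gm i j := rfl
  rw [h5, hGm] at h3
  rw [← h3, (hbc x hx).2, (hbc x hx).2]
  simp only [Matrix.mul_apply, Fintype.sum_sum_type, Matrix.transpose_apply, h4, blockForm,
    Matrix.fromBlocks_apply₂₂, Matrix.fromBlocks_apply₂₁, hGm,
    Matrix.zero_apply, mul_zero, zero_mul, Finset.sum_const_zero, zero_add, map_sum, map_smul,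
    LinearMap.sum_apply, LinearMap.smul_apply, smul_eq_mul, Finset.sum_mul, Finset.mul_sum]
  refine Finset.sum_congr rfl fun r _ => Finset.sum_congr rfl fun q _ => ?_
  ring

theorem gram_eq_of_mem (hnondeg : ∀ x, (g₁.form x).Nondegenerate)
    (hsuit : ∀ x, IsSuitable (P.ρ x) (g₁.form x)) (hb : b ∈ P.spinFrames) (hc : c ∈ P.spinFrames)
    {x : M} (hxb : x ∈ b.dom) (hxc : x ∈ c.dom) (i j : Fin n) :
    g₁.form x (c.θ i x) (c.θ j x) = g₁.form x (b.θ i x) (b.θ j x) := by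
  obtain ⟨b', hb', W, hxW, hW, h, hh, hr⟩ := hb.2 x hxb
  obtain ⟨c', hc', W', hxW', hW', h', hh', hr'⟩ := hc.2 x hxc
  obtain ⟨h'', hh'', hr''⟩ := P.transition b' hb' c' hc'
  rw [gram_eq_of_relatedBy hnondeg hsuit (P.adapted c' hc') (hW'.trans inf_le_left) hh' hr' hxW',
    gram_eq_of_relatedBy hnondeg hsuit (P.adapted b' hb') (hW.trans inf_le_left) hh hr hxW,
    gram_eq_of_relatedBy hnondeg hsuit (P.adapted b' hb') inf_le_left hh'' hr''
      ⟨(hW hxW).1, (hW' hxW').1⟩]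

/-- The matrix of `g₁` is the same in all spin frames at all points of the connected manifold. -/
theorem gram_eq [ConnectedSpace M] (hnondeg : ∀ x, (g₁.form x).Nondegenerate)
    (hsuit : ∀ x, IsSuitable (P.ρ x) (g₁.form x)) (hpar : P.IsParallel g₁)
    (hb : b ∈ P.spinFrames) (hc : c ∈ P.spinFrames)
    {x y : M} (hx : x ∈ b.dom) (hy : y ∈ c.dom) (i j : Fin n) :
    g₁.form y (c.θ i y) (c.θ j y) = g₁.form x (b.θ i x) (b.θ j x) := by
  have hf : ∀ x, P.frameAt x ∈ P.spinFrames := fun x =>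
    P.mem_spinFrames_of_mem_atlas (P.frameAt_mem x)
  have hx' : ∀ x, x ∈ (P.frameAt x).dom := fun x => (P.cover x).choose_spec.2
  have h1 : IsLocallyConstant fun x => g₁.form x ((P.frameAt x).θ i x) ((P.frameAt x).θ j x) := by
    rw [IsLocallyConstant.iff_eventually_eq]
    intro x
    filter_upwards [gram_eventually_eq hsuit hpar (hf x) (hx' x) i j,
      (P.frameAt x).dom.2.mem_nhds (hx' x)] with y hy hy'
    rw [← hy]
    exact gram_eq_of_mem hnondeg hsuit (hf x) (hf y) hy' (hx' y) i j
  have h2 := h1.apply_eq_of_preconnectedSpace y x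
  rw [gram_eq_of_mem hnondeg hsuit (hf y) hc (hx' y) hy,
    gram_eq_of_mem hnondeg hsuit (hf x) hb (hx' x) hx]
  exact h2

theorem formInBasis_eq [ConnectedSpace M] (hnondeg : ∀ x, (g₁.form x).Nondegenerate)
    (hsuit : ∀ x, IsSuitable (P.ρ x) (g₁.form x)) (hpar : P.IsParallel g₁)
    (hb : b ∈ P.spinFrames) (hc : c ∈ P.spinFrames)
    {x y : M} (hx : x ∈ b.dom) (hy : y ∈ c.dom) :
    formInBasis (g₁.form y) (hc.1.frame_θ.toBasisAt hy)
      = formInBasis (g₁.form x) (hb.1.frame_θ.toBasisAt hx) := by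
  refine LinearMap.ext_basis (Pi.basisFun ℝ (Fin n)) (Pi.basisFun ℝ (Fin n)) fun i j => ?_
  rw [Pi.basisFun_apply, Pi.basisFun_apply, formInBasis_single (P := P) hc.1 hy,
    formInBasis_single (P := P) hb.1 hx]
  exact gram_eq hnondeg hsuit hpar hb hc hx hy i j

end SpinStructure

end Gram

/-! ### Smooth maps to finite-dimensional vector spaces in terms of linear functionals -/

section CoordSmooth

variable {E : Type*} [NormedAddCommGroup E] [NormedSpace ℝ E]
  {M : Type*} [TopologicalSpace M] [ChartedSpace E M]
  {Λ Λ' : Type*} [AddCommGroup Λ] [Module ℝ Λ] [AddCommGroup Λ'] [Module ℝ Λ']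

/-- Smoothness at a point of a map to a finite-dimensional vector space without a norm. -/
def CoordSmoothAt (E : Type*) [NormedAddCommGroup E] [NormedSpace ℝ E]
    {M : Type*} [TopologicalSpace M] [ChartedSpace E M]
    {Λ : Type*} [AddCommGroup Λ] [Module ℝ Λ] (f : M → Λ) (x : M) : Prop :=
  ∀ ℓ : Module.Dual ℝ Λ, ContMDiffAt 𝓘(ℝ, E) 𝓘(ℝ, ℝ) ∞ (fun y => ℓ (f y)) x

variable {f f' : M → Λ} {x : M}

theorem CoordSmoothAt.mdiff (hf : CoordSmoothAt E f x) (ℓ : Module.Dual ℝ Λ) :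
    MDifferentiableAt 𝓘(ℝ, E) 𝓘(ℝ, ℝ) (fun y => ℓ (f y)) x :=
  (hf ℓ).mdifferentiableAt (by simp)

theorem CoordSmoothAt.map (hf : CoordSmoothAt E f x) (T : Λ →ₗ[ℝ] Λ') :
    CoordSmoothAt E (fun y => T (f y)) x := fun ℓ => hf (ℓ ∘ₗ T)

theorem CoordSmoothAt.congr (hf : CoordSmoothAt E f x) (h : ∀ᶠ y in nhds x, f' y = f y) :
    CoordSmoothAt E f' x := fun ℓ =>
  (hf ℓ).congr_of_eventuallyEq (h.mono fun y hy => by simp only [hy])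

theorem CoordSmoothAt.add (hf : CoordSmoothAt E f x) (hf' : CoordSmoothAt E f' x) :
    CoordSmoothAt E (fun y => f y + f' y) x := fun ℓ => by
  simp only [map_add]
  exact (hf ℓ).add (hf' ℓ)

theorem CoordSmoothAt.smul {a : M → ℝ} (ha : ContMDiffAt 𝓘(ℝ, E) 𝓘(ℝ, ℝ) ∞ a x)
    (hf : CoordSmoothAt E f x) : CoordSmoothAt E (fun y => a y • f y) x := fun ℓ => by
  simp only [map_smul, smul_eq_mul]
  exact ha.mul (hf ℓ)

theorem coordSmoothAt_const (a : Λ) : CoordSmoothAt E (fun _ : M => a) x :=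
  fun _ => contMDiffAt_const

theorem CoordSmoothAt.sum {ι : Type*} (s : Finset ι) {f : ι → M → Λ}
    (hf : ∀ i ∈ s, CoordSmoothAt E (f i) x) : CoordSmoothAt E (fun y => ∑ i ∈ s, f i y) x :=
  fun ℓ => by
    simp only [map_sum]
    exact contMDiffAt_finsetSum fun i hi => hf i hi ℓ

variable [FiniteDimensional ℝ Λ]

theorem sum_finBasis_coord (a : Λ) : a = ∑ i, (Module.finBasis ℝ Λ).coord i a
    • Module.finBasis ℝ Λ i := ((Module.finBasis ℝ Λ).sum_repr a).symm

theorem CoordSmoothAt.mul {Λ : Type*} [Ring Λ] [Algebra ℝ Λ] [FiniteDimensional ℝ Λ]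
    {f f' : M → Λ} (hf : CoordSmoothAt E f x) (hf' : CoordSmoothAt E f' x) :
    CoordSmoothAt E (fun y => f y * f' y) x := by
  have h1 : (fun y => f y * f' y) = fun y => ∑ i, (Module.finBasis ℝ Λ).coord i (f y)
      • LinearMap.mulLeft ℝ (Module.finBasis ℝ Λ i) (f' y) := by
    funext y
    conv_lhs => rw [sum_finBasis_coord (f y)]
    rw [Finset.sum_mul]
    simp only [smul_mul_assoc, LinearMap.mulLeft_apply]
  rw [h1]
  exact CoordSmoothAt.sum _ fun i _ => CoordSmoothAt.smul (hf _) (hf'.map _)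

/-- The derivative of a map to a finite-dimensional vector space without a norm. -/
def coordDeriv (f : M → Λ) (x : M) (v : TangentSpace 𝓘(ℝ, E) x) : Λ :=
  ∑ i, mvfderiv 𝓘(ℝ, E) (fun y => (Module.finBasis ℝ Λ).coord i (f y)) x v
    • Module.finBasis ℝ Λ i

theorem dual_coordDeriv (hf : CoordSmoothAt E f x) (v : TangentSpace 𝓘(ℝ, E) x)
    (ℓ : Module.Dual ℝ Λ) :
    ℓ (coordDeriv f x v) = mvfderiv 𝓘(ℝ, E) (fun y => ℓ (f y)) x v := by
  have h1 : (fun y => ℓ (f y)) = fun y => ∑ i, (Module.finBasis ℝ Λ).coord i (f y)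
      * ℓ (Module.finBasis ℝ Λ i) := by
    funext y
    conv_lhs => rw [sum_finBasis_coord (f y)]
    simp only [map_sum, map_smul, smul_eq_mul]
  have h2 := mvfderiv_sum (f := fun i y => (Module.finBasis ℝ Λ).coord i (f y)
      * ℓ (Module.finBasis ℝ Λ i)) fun i => (hf.mdiff _).mul mdifferentiableAt_const
  rw [h1, h2, coordDeriv, sum_apply, map_sum]
  refine Finset.sum_congr rfl fun i _ => ?_
  rw [mvfderiv_fun_mul (hf.mdiff _) mdifferentiableAt_const, mvfderiv_const]
  simp [mul_comm]

theorem eq_of_forall_dual_eq {a b : Λ} (h : ∀ ℓ : Module.Dual ℝ Λ, ℓ a = ℓ b) : a = b := by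
  rw [← sub_eq_zero, ← Module.forall_dual_apply_eq_zero_iff ℝ]
  intro ℓ
  rw [map_sub, h, sub_self]

theorem coordDeriv_congr (h : ∀ᶠ y in nhds x, f y = f' y) (v : TangentSpace 𝓘(ℝ, E) x) :
    coordDeriv f x v = coordDeriv f' x v := by
  refine Finset.sum_congr rfl fun i _ => ?_
  have h1 : (fun y => (Module.finBasis ℝ Λ).coord i (f y))
      =ᶠ[nhds x] fun y => (Module.finBasis ℝ Λ).coord i (f' y) :=
    h.mono fun y hy => by simp only [hy]
  rw [mvfderiv_congr h1]

theorem coordDeriv_map [FiniteDimensional ℝ Λ'] (hf : CoordSmoothAt E f x) (T : Λ →ₗ[ℝ] Λ')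
    (v : TangentSpace 𝓘(ℝ, E) x) :
    coordDeriv (fun y => T (f y)) x v = T (coordDeriv f x v) :=
  eq_of_forall_dual_eq fun ℓ => by
    rw [dual_coordDeriv (hf.map T)]
    exact (dual_coordDeriv hf v (ℓ ∘ₗ T)).symm

theorem coordDeriv_add (hf : CoordSmoothAt E f x) (hf' : CoordSmoothAt E f' x)
    (v : TangentSpace 𝓘(ℝ, E) x) :
    coordDeriv (fun y => f y + f' y) x v = coordDeriv f x v + coordDeriv f' x v :=
  eq_of_forall_dual_eq fun ℓ => by
    rw [dual_coordDeriv (hf.add hf'), map_add, dual_coordDeriv hf, dual_coordDeriv hf']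
    simp only [map_add]
    rw [mvfderiv_fun_add (hf.mdiff ℓ) (hf'.mdiff ℓ)]
    rfl

theorem coordDeriv_smul {a : M → ℝ} (ha : ContMDiffAt 𝓘(ℝ, E) 𝓘(ℝ, ℝ) ∞ a x) (b : Λ)
    (v : TangentSpace 𝓘(ℝ, E) x) :
    coordDeriv (fun y => a y • b) x v = mvfderiv 𝓘(ℝ, E) a x v • b :=
  eq_of_forall_dual_eq fun ℓ => by
    rw [dual_coordDeriv (CoordSmoothAt.smul ha (coordSmoothAt_const b))]
    simp only [map_smul, smul_eq_mul]
    rw [mvfderiv_fun_mul (ha.mdifferentiableAt (by simp)) mdifferentiableAt_const, mvfderiv_const]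
    simp [mul_comm]

theorem coordDeriv_mul {Λ : Type*} [Ring Λ] [Algebra ℝ Λ] [FiniteDimensional ℝ Λ]
    {f f' : M → Λ} (hf : CoordSmoothAt E f x) (hf' : CoordSmoothAt E f' x)
    (v : TangentSpace 𝓘(ℝ, E) x) :
    coordDeriv (fun y => f y * f' y) x v
      = coordDeriv f x v * f' x + f x * coordDeriv f' x v :=
  eq_of_forall_dual_eq fun ℓ => by
    let b := Module.finBasis ℝ Λ
    have h1 : (fun y => ℓ (f y * f' y))
        = fun y => ∑ i, b.coord i (f y) * (ℓ ∘ₗ LinearMap.mulLeft ℝ (b i)) (f' y) := by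
      funext y
      conv_lhs => rw [sum_finBasis_coord (f y)]
      rw [Finset.sum_mul]
      simp [b]
    have h2 := mvfderiv_sum (f := fun i y => b.coord i (f y)
      * (ℓ ∘ₗ LinearMap.mulLeft ℝ (b i)) (f' y)) fun i => (hf.mdiff _).mul (hf'.mdiff _)
    rw [dual_coordDeriv (hf.mul hf'), h1, h2, sum_apply]
    have h3 : ℓ (coordDeriv f x v * f' x)
        = ∑ i, mvfderiv 𝓘(ℝ, E) (fun y => b.coord i (f y)) x v * ℓ (b i * f' x) := by
      rw [coordDeriv, Finset.sum_mul]
      simp [b]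
    have h4 : ℓ (f x * coordDeriv f' x v)
        = ∑ i, b.coord i (f x) * ℓ (b i * coordDeriv f' x v) := by
      conv_lhs => rw [sum_finBasis_coord (f x)]
      rw [Finset.sum_mul]
      simp [b]
    rw [map_add, h3, h4, ← Finset.sum_add_distrib]
    refine Finset.sum_congr rfl fun i _ => ?_
    rw [mvfderiv_fun_mul (hf.mdiff _) (hf'.mdiff _)]
    have h5 : ℓ (b i * coordDeriv f' x v) = mvfderiv 𝓘(ℝ, E) (fun y => ℓ (b i * f' y)) x v :=
      dual_coordDeriv hf' v (ℓ ∘ₗ LinearMap.mulLeft ℝ (b i))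
    simp only [add_apply, smul_apply, smul_eq_mul, h5,
      LinearMap.comp_apply, LinearMap.mulLeft_apply]
    ring

theorem coordSmoothAt_coordDeriv [FiniteDimensional ℝ E] [IsManifold 𝓘(ℝ, E) ∞ M] {W : Opens M}
    (hf : ∀ y ∈ W, CoordSmoothAt E f y) {X : Π x : M, TangentSpace 𝓘(ℝ, E) x}
    (hX : SmoothOn E E X W) (hx : x ∈ W) : CoordSmoothAt E (fun y => coordDeriv f y (X y)) x :=
  CoordSmoothAt.sum _ fun i _ => CoordSmoothAt.smul
    ((contMDiffOn_mvfderiv (f := fun y => (Module.finBasis ℝ Λ).coord i (f y))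
      (fun y hy => (hf y hy _).contMDiffWithinAt) hX).contMDiffAt (W.2.mem_nhds hx))
    (coordSmoothAt_const _)

end CoordSmooth

/-! ### Sheaf endomorphisms in a spin frame -/

section ConnectionCoefficients

variable {E : Type*} [NormedAddCommGroup E] [NormedSpace ℝ E] [FiniteDimensional ℝ E]
  {M : Type*} [TopologicalSpace M] [ChartedSpace E M] [IsManifold 𝓘(ℝ, E) ∞ M]
  {F : Type*} [NormedAddCommGroup F] [NormedSpace ℝ F]
  {S : M → Type*} [TopologicalSpace (TotalSpace F S)] [∀ x, AddCommGroup (S x)]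
  [∀ x, Module ℝ (S x)] [∀ x, TopologicalSpace (S x)] [FiberBundle F S]
  {k l n : ℕ} {g : PseudoMetric E M} {Δ : CliffordModule k l n}
  {ρ : ∀ x : M, TangentSpace 𝓘(ℝ, E) x →ₗ[ℝ] Module.End ℝ (S x)} {c : LocalTuple E k l n S}

namespace LocalTuple.IsAdapted

/-- The coefficients of the connection on the spinor bundle in a spin frame. -/
def connectionCoeff (g : PseudoMetric E M) (Δ : CliffordModule k l n) (c : LocalTuple E k l n S)
    (X : Π x : M, TangentSpace 𝓘(ℝ, E) x) (j m : Fin n) (y : M) : ℝ :=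
  ∑ a, ∑ b, koszul g X (c.e a) (c.e b) y * (8⁻¹ * sgn k l a * sgn k l b
    * (LinearMap.toMatrix' (Δ.ρ (Pi.single a 1)) * LinearMap.toMatrix' (Δ.ρ (Pi.single b 1))) m j)

theorem smoothOn_e (hc : c.IsAdapted F g Δ ρ) (i : EvenIdx k l) : SmoothOn E E (c.e i) c.dom :=
  hc.frame_e.contMDiffOn i

theorem smoothOn_θ (hc : c.IsAdapted F g Δ ρ) (j : Fin n) : SmoothOn E F (c.θ j) c.dom :=
  hc.frame_θ.contMDiffOn j

theorem contMDiffOn_connectionCoeff (hc : c.IsAdapted F g Δ ρ) {X : Π x : M, TangentSpace 𝓘(ℝ, E) x}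
    {W : Opens M} (hW : W ≤ c.dom) (hX : SmoothOn E E X W) (j m : Fin n) :
    ContMDiffOn 𝓘(ℝ, E) 𝓘(ℝ, ℝ) ∞ (connectionCoeff g Δ c X j m) W :=
  contMDiffOn_finsetSum fun a _ => contMDiffOn_finsetSum fun b _ =>
    (contMDiffOn_koszul g hX (ContMDiffOn.mono (hc.smoothOn_e a) hW)
      (ContMDiffOn.mono (hc.smoothOn_e b) hW)).mul contMDiffOn_const

theorem nabla_θ_eq_sum (hc : c.IsAdapted F g Δ ρ) {X : Π x : M, TangentSpace 𝓘(ℝ, E) x}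
    {W : Opens M} (hW : W ≤ c.dom) (hX : SmoothOn E E X W) {x : M} (hx : x ∈ W) (j : Fin n) :
    hc.nabla (c.θ j) x (X x) = ∑ m, connectionCoeff g Δ c X j m x • c.θ m x := by
  have hxc := hW hx
  have hρ : ∀ a b, ρ x (c.e a x) (ρ x (c.e b x) (c.θ j x)) = ∑ m,
      (LinearMap.toMatrix' (Δ.ρ (Pi.single a 1)) * LinearMap.toMatrix' (Δ.ρ (Pi.single b 1))) m j
        • c.θ m x := fun a b => by
    simp only [hc.clifford x hxc, map_sum, map_smul, Matrix.mul_apply, Finset.sum_smul,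
      Finset.smul_sum, smul_smul]
    rw [Finset.sum_comm]
    exact Finset.sum_congr rfl fun m _ => Finset.sum_congr rfl fun r _ => by rw [mul_comm]
  have hLC : ∀ a, leviCivita g (c.e a) x (X x)
      = ∑ b, (sgn k l b * (2⁻¹ * koszul g X (c.e a) (c.e b) x)) • c.e b x := fun a => by
    have h1 := (hc.isAdaptedBasis hxc).eq_sum (leviCivita g (c.e a) x (X x))
    simp only [IsLocalFrameOn.toBasisAt_coe] at h1
    rw [h1]
    refine Finset.sum_congr rfl fun b _ => ?_
    rw [smul_smul, ← two_mul_leviCivita g hx hX (hc.mdiffVec hxc a)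
      (ContMDiffOn.mono (hc.smoothOn_e b) hW), inv_mul_cancel_left₀ two_ne_zero]
  rw [hc.nabla_θ hxc]
  simp only [hLC, map_sum, map_smul, LinearMap.sum_apply, LinearMap.smul_apply, hρ, Finset.smul_sum,
    smul_smul, connectionCoeff, Finset.sum_smul]
  symm
  rw [Finset.sum_comm]
  refine Finset.sum_congr rfl fun a _ => ?_
  rw [Finset.sum_comm]
  refine Finset.sum_congr rfl fun b _ => Finset.sum_congr rfl fun m _ => ?_
  congr 1
  ring

theorem nabla_eq_sum (hc : c.IsAdapted F g Δ ρ) {x : M} (hx : x ∈ c.dom) (t : Π y, S y)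
    (v : TangentSpace 𝓘(ℝ, E) x) :
    hc.nabla t x v = (∑ j, mvfderiv 𝓘(ℝ, E) (fun y => hc.frame_θ.coeff j y (t y)) x v • c.θ j x)
      + ∑ j, hc.frame_θ.coeff j x (t x) • hc.nabla (c.θ j) x v := by
  rw [nabla]
  congr 1
  simp only [hc.nabla_θ hx]
  conv_lhs => rw [hc.frame_θ.coeff_sum_eq t hx]
  simp only [map_sum, map_smul, Finset.smul_sum]
  rw [Finset.sum_comm]
  refine Finset.sum_congr rfl fun j _ => Finset.sum_congr rfl fun a _ => ?_
  simp only [smul_smul]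
  congr 1
  ring

variable [VectorBundle ℝ F S] [ContMDiffVectorBundle ∞ F S 𝓘(ℝ, E)]

/-- Covariant derivatives of smooth sections of `S` are smooth. -/
theorem smoothOn_nabla (hc : c.IsAdapted F g Δ ρ) {X : Π x : M, TangentSpace 𝓘(ℝ, E) x}
    {W : Opens M} (hW : W ≤ c.dom) (hX : SmoothOn E E X W) {t : Π y, S y}
    (ht : SmoothOn E F t W) : SmoothOn E F (fun y => hc.nabla t y (X y)) W := by
  have hcoef : ∀ j, ContMDiffOn 𝓘(ℝ, E) 𝓘(ℝ, ℝ) ∞ (fun y => hc.frame_θ.coeff j y (t y)) W :=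
    fun j y hy =>
      (hc.frame_θ.contMDiffAt_coeff c.dom.2 (hW hy) (ht.smoothAt hy) j).contMDiffWithinAt
  have hθ : ∀ j, SmoothOn E F (c.θ j) W := fun j => ContMDiffOn.mono (hc.smoothOn_θ j) hW
  have h1 : SmoothOn E F (fun y =>
      (∑ j, mvfderiv 𝓘(ℝ, E) (fun y => hc.frame_θ.coeff j y (t y)) y (X y) • c.θ j y)
      + ∑ j, hc.frame_θ.coeff j y (t y) • ∑ m, connectionCoeff g Δ c X j m y • c.θ m y) W :=
    ContMDiffOn.add_section
      (ContMDiffOn.sum_section fun j _ => (contMDiffOn_mvfderiv (hcoef j) hX).smul_section (hθ j))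
      (ContMDiffOn.sum_section fun j _ => (hcoef j).smul_section
        (ContMDiffOn.sum_section fun m _ =>
          (hc.contMDiffOn_connectionCoeff hW hX j m).smul_section (hθ m)))
  refine ContMDiffOn.congr h1 fun y hy => ?_
  simp only [hc.nabla_eq_sum (hW hy) t, hc.nabla_θ_eq_sum hW hX hy]

end LocalTuple.IsAdapted

end ConnectionCoefficients

section FrameTransport

variable {E : Type*} [NormedAddCommGroup E] [NormedSpace ℝ E] [FiniteDimensional ℝ E]
  {M : Type*} [TopologicalSpace M] [ChartedSpace E M] [IsManifold 𝓘(ℝ, E) ∞ M]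
  {F : Type*} [NormedAddCommGroup F] [NormedSpace ℝ F]
  {S : M → Type*} [TopologicalSpace (TotalSpace F S)] [∀ x, AddCommGroup (S x)]
  [∀ x, Module ℝ (S x)] [∀ x, TopologicalSpace (S x)] [FiberBundle F S]
  {k l n : ℕ} {g : PseudoMetric E M} {Δ : CliffordModule k l n}
  {ρ : ∀ x : M, TangentSpace 𝓘(ℝ, E) x →ₗ[ℝ] Module.End ℝ (S x)} {c : LocalTuple E k l n S}

theorem map_involute {V V' : Type*} [AddCommGroup V] [Module ℝ V] [AddCommGroup V'] [Module ℝ V']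
    (f : V →ₗ[ℝ] V') (a : ExteriorAlgebra ℝ V) :
    ExteriorAlgebra.map f (CliffordAlgebra.involute a)
      = CliffordAlgebra.involute (ExteriorAlgebra.map f a) := by
  have h : (ExteriorAlgebra.map f).comp CliffordAlgebra.involute
      = (CliffordAlgebra.involute : ExteriorAlgebra ℝ V' →ₐ[ℝ] _).comp (ExteriorAlgebra.map f) := by
    refine ExteriorAlgebra.hom_ext (LinearMap.ext fun v => ?_)
    have h1 : CliffordAlgebra.involute (ExteriorAlgebra.ι ℝ v) = -ExteriorAlgebra.ι ℝ v :=
      CliffordAlgebra.involute_ι v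
    have h2 : CliffordAlgebra.involute (ExteriorAlgebra.ι ℝ (f v)) = -ExteriorAlgebra.ι ℝ (f v) :=
      CliffordAlgebra.involute_ι (f v)
    simp only [LinearMap.comp_apply, AlgHom.toLinearMap_apply, AlgHom.comp_apply, h1, map_neg,
      ExteriorAlgebra.map_apply_ι, h2]
  exact DFunLike.congr_fun h a

theorem map_contractLeft {V V' : Type*} [AddCommGroup V] [Module ℝ V] [AddCommGroup V']
    [Module ℝ V'] (f : V →ₗ[ℝ] V') (d : Module.Dual ℝ V') (a : ExteriorAlgebra ℝ V) :
    ExteriorAlgebra.map f (CliffordAlgebra.contractLeft (d ∘ₗ f) a)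
      = CliffordAlgebra.contractLeft d (ExteriorAlgebra.map f a) := by
  induction a using CliffordAlgebra.left_induction with
  | algebraMap r =>
    rw [CliffordAlgebra.contractLeft_algebraMap, map_zero, AlgHom.commutes,
      CliffordAlgebra.contractLeft_algebraMap]
  | add a b ha hb => simp only [map_add, ha, hb]
  | ι_mul a v ha =>
    have h1 : ExteriorAlgebra.map f (CliffordAlgebra.ι (0 : QuadraticForm ℝ V) v)
        = CliffordAlgebra.ι (0 : QuadraticForm ℝ V') (f v) := ExteriorAlgebra.map_apply_ι f v
    rw [CliffordAlgebra.contractLeft_ι_mul, map_mul, h1, CliffordAlgebra.contractLeft_ι_mul,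
      map_sub, map_mul, h1, ha, map_smul, LinearMap.comp_apply]

/-- The linear combination of the sections `θ^j` with given coefficients. -/
def frameMap (c : LocalTuple E k l n S) (y : M) : (Fin n → ℝ) →ₗ[ℝ] S y :=
  Fintype.linearCombination ℝ fun j => c.θ j y

/-- The algebra homomorphism `∧ℝⁿ → ∧S_y` defined by a spin frame. -/
def ofModel (c : LocalTuple E k l n S) (y : M) :
    ExteriorAlgebra ℝ (Fin n → ℝ) →ₐ[ℝ] ExteriorAlgebra ℝ (S y) :=
  ExteriorAlgebra.map (frameMap c y)

theorem ofModel_ι (y : M) (a : Fin n → ℝ) :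
    ofModel c y (ExteriorAlgebra.ι ℝ a) = ExteriorAlgebra.ι ℝ (frameMap c y a) :=
  ExteriorAlgebra.map_apply_ι _ _

theorem frameMap_apply (y : M) (a : Fin n → ℝ) : frameMap c y a = ∑ j, a j • c.θ j y :=
  Fintype.linearCombination_apply ℝ _ a

/-- The coefficients of elements of `S_y` in a spin frame. -/
def coeffMap (hc : c.IsAdapted F g Δ ρ) (y : M) : S y →ₗ[ℝ] (Fin n → ℝ) :=
  LinearMap.pi fun j => hc.frame_θ.coeff j y

theorem frameMap_coeffMap (hc : c.IsAdapted F g Δ ρ) {y : M} (hy : y ∈ c.dom) (t : Π y, S y) :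
    frameMap c y (coeffMap hc y (t y)) = t y :=
  (frameMap_apply y _).trans (hc.frame_θ.coeff_sum_eq t hy).symm

/-- The algebra homomorphism `∧S_y → ∧ℝⁿ` defined by a spin frame. -/
def toModel (hc : c.IsAdapted F g Δ ρ) (y : M) :
    ExteriorAlgebra ℝ (S y) →ₐ[ℝ] ExteriorAlgebra ℝ (Fin n → ℝ) :=
  ExteriorAlgebra.map (coeffMap hc y)

theorem ofModel_toModel (hc : c.IsAdapted F g Δ ρ) {y : M} (hy : y ∈ c.dom)
    (a : ExteriorAlgebra ℝ (S y)) : ofModel c y (toModel hc y a) = a := by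
  have h1 : frameMap c y ∘ₗ coeffMap hc y = LinearMap.id := LinearMap.ext fun t => by
    classical
    have h2 := frameMap_coeffMap hc hy (Function.update (fun z => (0 : S z)) y t)
    rwa [Function.update_self] at h2
  have h3 := DFunLike.congr_fun (ExteriorAlgebra.map_comp_map (coeffMap hc y) (frameMap c y)) a
  rw [h1, ExteriorAlgebra.map_id] at h3
  exact h3

/-- A section of `∧S`, expressed in a spin frame. -/
def localRep (hc : c.IsAdapted F g Δ ρ) {W : Opens M} (f : ExtSec S W) (y : M) :
    ExteriorAlgebra ℝ (Fin n → ℝ) :=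
  open scoped Classical in if h : y ∈ W then toModel hc y (f ⟨y, h⟩) else 0

section LocalRep

variable (hc : c.IsAdapted F g Δ ρ) {W : Opens M}

theorem localRep_of_mem (f : ExtSec S W) {y : M} (h : y ∈ W) :
    localRep hc f y = toModel hc y (f ⟨y, h⟩) := dif_pos h

theorem localRep_restrictExt {W' : Opens M} (h : W' ≤ W) (f : ExtSec S W) {y : M} (hy : y ∈ W') :
    localRep hc (restrictExt S h f) y = localRep hc f y := by
  rw [localRep_of_mem hc _ hy, localRep_of_mem hc _ (h hy)]
  rfl

theorem localRep_add (f f' : ExtSec S W) :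
    localRep hc (f + f') = fun y => localRep hc f y + localRep hc f' y := by
  funext y
  by_cases h : y ∈ W
  · rw [localRep_of_mem hc _ h, localRep_of_mem hc _ h, localRep_of_mem hc _ h, Pi.add_apply,
      map_add]
  · simp [localRep, h]

theorem localRep_mul (f f' : ExtSec S W) :
    localRep hc (f * f') = fun y => localRep hc f y * localRep hc f' y := by
  funext y
  by_cases h : y ∈ W
  · rw [localRep_of_mem hc _ h, localRep_of_mem hc _ h, localRep_of_mem hc _ h, Pi.mul_apply,
      map_mul]
  · simp [localRep, h]

theorem localRep_smul (r : ℝ) (f : ExtSec S W) :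
    localRep hc (r • f) = fun y => r • localRep hc f y := by
  funext y
  by_cases h : y ∈ W
  · rw [localRep_of_mem hc _ h, localRep_of_mem hc _ h, Pi.smul_apply, map_smul]
  · simp [localRep, h]

theorem localRep_involute (f : ExtSec S W) :
    localRep hc (fun y : W => CliffordAlgebra.involute (f y))
      = fun y => CliffordAlgebra.involute (localRep hc f y) := by
  funext y
  by_cases h : y ∈ W
  · rw [localRep_of_mem hc _ h, localRep_of_mem hc _ h]
    exact map_involute _ _
  · simp [localRep, h]

variable [VectorBundle ℝ F S] [ContMDiffVectorBundle ∞ F S 𝓘(ℝ, E)]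

/-- Elements of `𝒜(W)` have smooth components in a spin frame. -/
theorem coordSmoothAt_localRep (hW : W ≤ c.dom) {f : ExtSec S W} (hf : f ∈ superFunctions E F S W)
    {x : M} (hx : x ∈ W) : CoordSmoothAt E (localRep hc f) x := by
  obtain ⟨W', h, hxW', hmem⟩ := hf x hx
  refine CoordSmoothAt.congr (f := localRep hc (restrictExt S h f)) ?_
    (Filter.eventually_of_mem (W'.2.mem_nhds hxW') fun y hy =>
      (localRep_restrictExt hc h f hy).symm)
  have hnhds := W'.2.mem_nhds hxW'
  generalize restrictExt S h f = f' at hmem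
  clear hf f
  induction hmem using Algebra.adjoin_induction with
  | mem f hf =>
    obtain ⟨φ, hφ, rfl⟩ | ⟨t, ht, rfl⟩ := hf
    · refine CoordSmoothAt.congr (f := fun y => φ y • (1 : ExteriorAlgebra ℝ (Fin n → ℝ)))
        (CoordSmoothAt.smul (hφ.contMDiffAt hnhds) (coordSmoothAt_const _))
        (Filter.eventually_of_mem hnhds fun y hy => ?_)
      rw [localRep_of_mem hc _ hy, AlgHom.commutes, Algebra.algebraMap_eq_smul_one]
    · refine CoordSmoothAt.congr (f := fun y => ∑ j, hc.frame_θ.coeff j y (t y)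
          • ExteriorAlgebra.ι ℝ (Pi.single j 1 : Fin n → ℝ))
        (CoordSmoothAt.sum _ fun j _ => CoordSmoothAt.smul
          (hc.frame_θ.contMDiffAt_coeff c.dom.2 (hW hx) (ht.smoothAt hxW') j)
          (coordSmoothAt_const _))
        (Filter.eventually_of_mem hnhds fun y hy => ?_)
      rw [localRep_of_mem hc _ hy]
      refine (ExteriorAlgebra.map_apply_ι _ _).trans ?_
      conv_lhs => rw [pi_eq_sum_univ' (coeffMap hc y (t y))]
      simp only [map_sum, map_smul]
      rfl
  | algebraMap r =>
    refine CoordSmoothAt.congr (coordSmoothAt_const (algebraMap ℝ _ r))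
      (Filter.eventually_of_mem hnhds fun y hy => ?_)
    rw [localRep_of_mem hc _ hy]
    exact AlgHom.commutes _ _
  | add f f' _ _ ha hb =>
    rw [localRep_add]
    exact ha.add hb
  | mul f f' _ _ ha hb =>
    rw [localRep_mul]
    exact ha.mul hb

/-- Sections of `∧S` with smooth components in a spin frame belong to `𝒜(W)`. -/
theorem ofModel_mem (hc : c.IsAdapted F g Δ ρ) (hW : W ≤ c.dom)
    {f : M → ExteriorAlgebra ℝ (Fin n → ℝ)}
    (hf : ∀ x ∈ W, CoordSmoothAt E f x) :
    (fun y : W => ofModel c y (f y)) ∈ superFunctions E F S W := by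
  have hconst : ∀ a : ExteriorAlgebra ℝ (Fin n → ℝ),
      (fun y : W => ofModel c y a) ∈ Algebra.adjoin ℝ (generators E F S W) := by
    intro a
    induction a using ExteriorAlgebra.induction with
    | algebraMap r =>
      refine Algebra.subset_adjoin (Or.inl ⟨fun _ => r, contMDiffOn_const, ?_⟩)
      funext y
      exact AlgHom.commutes _ _
    | ι v =>
      refine Algebra.subset_adjoin (Or.inr ⟨fun y => frameMap c y v, ?_, ?_⟩)
      · simp only [frameMap_apply]
        exact ContMDiffOn.sum_section fun j _ =>
          contMDiffOn_const.smul_section (ContMDiffOn.mono (hc.smoothOn_θ j) hW)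
      · funext y
        exact ofModel_ι _ _
    | mul a b ha hb =>
      simp only [map_mul]
      exact mul_mem ha hb
    | add a b ha hb =>
      simp only [map_add]
      exact add_mem ha hb
  intro x hx
  refine ⟨W, le_rfl, hx, ?_⟩
  have h1 : restrictExt S le_rfl (fun y : W => ofModel c y (f y))
      = ∑ i, (fun y : W => algebraMap ℝ (ExteriorAlgebra ℝ (S y))
          ((Module.finBasis ℝ (ExteriorAlgebra ℝ (Fin n → ℝ))).coord i (f y)))
        * fun y : W => ofModel c y (Module.finBasis ℝ (ExteriorAlgebra ℝ (Fin n → ℝ)) i) := by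
    funext y
    rw [Finset.sum_apply]
    refine (congrArg (ofModel c (y : M)) (sum_finBasis_coord (f y))).trans ?_
    rw [map_sum]
    refine Finset.sum_congr rfl fun i _ => ?_
    rw [map_smul, Algebra.smul_def]
    rfl
  rw [h1]
  exact sum_mem fun i _ => mul_mem (Algebra.subset_adjoin
    (Or.inl ⟨fun y => _, fun y hy => (hf y hy _).contMDiffWithinAt, rfl⟩)) (hconst _)

end LocalRep

/-- A sheaf endomorphism of the smooth maps to `∧ℝⁿ`. -/
structure IsLocalOperator (U : Opens M)
    (T : (M → ExteriorAlgebra ℝ (Fin n → ℝ)) → M → ExteriorAlgebra ℝ (Fin n → ℝ)) : Prop where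
  map_add : ∀ x ∈ U, ∀ f f', CoordSmoothAt E f x → CoordSmoothAt E f' x →
    T (fun y => f y + f' y) x = T f x + T f' x
  map_smul : ∀ x ∈ U, ∀ (r : ℝ) f, CoordSmoothAt E f x → T (fun y => r • f y) x = r • T f x
  congr : ∀ x ∈ U, ∀ f f', (∀ᶠ y in nhds x, f y = f' y) → T f x = T f' x
  smooth : ∀ W ≤ U, ∀ f, (∀ y ∈ W, CoordSmoothAt E f y) → ∀ y ∈ W, CoordSmoothAt E (T f) y

variable [VectorBundle ℝ F S] [ContMDiffVectorBundle ∞ F S 𝓘(ℝ, E)]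
  (hc : c.IsAdapted F g Δ ρ)
  {T : (M → ExteriorAlgebra ℝ (Fin n → ℝ)) → M → ExteriorAlgebra ℝ (Fin n → ℝ)}

/-- The endomorphism of the sheaf `𝒜` that is given in a spin frame by an operator on the smooth
maps to `∧ℝⁿ`. -/
def frameEnd (hT : IsLocalOperator (E := E) c.dom T) : SheafEnd E F S c.dom :=
  ⟨fun W =>
    { toFun := fun f => ⟨fun y : W.1 => ofModel c y (T (localRep hc f.1) y),
        ofModel_mem hc W.2 (hT.smooth W.1 W.2 _ fun _ hy => coordSmoothAt_localRep hc W.2 f.2 hy)⟩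
      map_add' := fun f f' => superFunctions_ext fun y => by
        have h1 := hT.map_add y (W.2 y.2) _ _ (coordSmoothAt_localRep hc W.2 f.2 y.2)
          (coordSmoothAt_localRep hc W.2 f'.2 y.2)
        rw [← localRep_add] at h1
        exact (congrArg (ofModel c (y : M)) h1).trans (map_add _ _ _)
      map_smul' := fun r f => superFunctions_ext fun y => by
        have h1 := hT.map_smul y (W.2 y.2) r _ (coordSmoothAt_localRep hc W.2 f.2 y.2)
        rw [← localRep_smul] at h1
        exact (congrArg (ofModel c (y : M)) h1).trans (map_smul _ _ _) },
    fun W W' h f => superFunctions_ext fun y =>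
      congrArg (ofModel c (y : M)) (hT.congr y (W'.2 y.2) _ _
        (Filter.eventually_of_mem (W'.1.2.mem_nhds y.2) fun z hz =>
          (localRep_restrictExt hc h f.1 hz).symm))⟩

theorem frameEnd_apply (hT : IsLocalOperator (E := E) c.dom T) (W : {W : Opens M // W ≤ c.dom})
    (f : superFunctions E F S W.1) (x : W.1) :
    ((frameEnd hc hT).1 W f).1 x = ofModel c x (T (localRep hc f.1) x) := rfl

end FrameTransport

/-! ### Covariant derivatives and frame fields of the supermanifold -/

section CovariantDerivative

variable {E : Type*} [NormedAddCommGroup E] [NormedSpace ℝ E] [FiniteDimensional ℝ E]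
  {M : Type*} [TopologicalSpace M] [ChartedSpace E M] [IsManifold 𝓘(ℝ, E) ∞ M]

/-- The operator `r (X + ∑ ω(X) θ^j ∧ ι(θ_j))` on the smooth maps to `∧ℝⁿ`, where the
endomorphism `ω(X)` of `ℝⁿ` has the columns `w j`. -/
def covariantOp {n : ℕ} (r : ℝ) (X : Π x : M, TangentSpace 𝓘(ℝ, E) x)
    (w : Fin n → M → Fin n → ℝ) (f : M → ExteriorAlgebra ℝ (Fin n → ℝ)) (x : M) :
    ExteriorAlgebra ℝ (Fin n → ℝ) :=
  r • (coordDeriv f x (X x) + ∑ j, ExteriorAlgebra.ι ℝ (w j x)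
    * CliffordAlgebra.contractLeft (LinearMap.proj j : Module.Dual ℝ (Fin n → ℝ)) (f x))

variable {n : ℕ} {r : ℝ} {X : Π x : M, TangentSpace 𝓘(ℝ, E) x} {w : Fin n → M → Fin n → ℝ}

theorem coordSmoothAt_ι {x : M} {a : M → Fin n → ℝ}
    (ha : ∀ m, ContMDiffAt 𝓘(ℝ, E) 𝓘(ℝ, ℝ) ∞ (fun y => a y m) x) :
    CoordSmoothAt E a x := by
  have h1 : a = fun y => ∑ m, a y m • (Pi.single m 1 : Fin n → ℝ) :=
    funext fun y => pi_eq_sum_univ' (a y)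
  rw [h1]
  exact CoordSmoothAt.sum _ fun m _ => CoordSmoothAt.smul (ha m) (coordSmoothAt_const _)

theorem isLocalOperator_covariantOp {U : Opens M} (hX : SmoothOn E E X U)
    (hw : ∀ j m, ContMDiffOn 𝓘(ℝ, E) 𝓘(ℝ, ℝ) ∞ (fun y => w j y m) U) :
    IsLocalOperator (E := E) U (covariantOp r X w) where
  map_add x _ f f' hf hf' := by
    simp only [covariantOp, coordDeriv_add hf hf', map_add, mul_add, Finset.sum_add_distrib,
      smul_add]
    abel
  map_smul x _ a f hf := by
    have h1 := coordDeriv_map hf (LinearMap.lsmul ℝ _ a) (X x)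
    simp only [LinearMap.lsmul_apply] at h1
    simp only [covariantOp, h1, map_smul, mul_smul_comm, ← Finset.smul_sum, ← smul_add]
    rw [smul_comm]
  congr x _ f f' h := by
    rw [covariantOp, covariantOp, coordDeriv_congr h, h.self_of_nhds]
  smooth W hW f hf y hy := by
    refine CoordSmoothAt.smul contMDiffAt_const (CoordSmoothAt.add
      (coordSmoothAt_coordDeriv hf (ContMDiffOn.mono hX hW) hy)
      (CoordSmoothAt.sum _ fun j _ => CoordSmoothAt.mul
        (CoordSmoothAt.map (coordSmoothAt_ι fun m => ?_) (ExteriorAlgebra.ι ℝ))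
        ((hf y hy).map (CliffordAlgebra.contractLeft (LinearMap.proj j)))))
    exact (hw j m).contMDiffAt (U.2.mem_nhds (hW hy))

theorem covariantOp_mul {x : M} {f f' : M → ExteriorAlgebra ℝ (Fin n → ℝ)}
    (hf : CoordSmoothAt E f x) (hf' : CoordSmoothAt E f' x) :
    covariantOp r X w (fun y => f y * f' y) x
      = covariantOp r X w f x * f' x + f x * covariantOp r X w f' x := by
  have h1 : ∀ j, ExteriorAlgebra.ι ℝ (w j x) * CliffordAlgebra.contractLeft
      (LinearMap.proj j : Module.Dual ℝ (Fin n → ℝ)) (f x * f' x)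
      = ExteriorAlgebra.ι ℝ (w j x) * CliffordAlgebra.contractLeft
          (LinearMap.proj j : Module.Dual ℝ (Fin n → ℝ)) (f x) * f' x
        + f x * (ExteriorAlgebra.ι ℝ (w j x) * CliffordAlgebra.contractLeft
          (LinearMap.proj j : Module.Dual ℝ (Fin n → ℝ)) (f' x)) := fun j => by
    have h2 := ι_mul_eq_involute_mul (w j x) (CliffordAlgebra.involute (f x))
    rw [CliffordAlgebra.involute_involute] at h2
    rw [contractLeft_mul, mul_add, ← mul_assoc, ← mul_assoc, ← mul_assoc, h2]
  simp only [covariantOp, coordDeriv_mul hf hf', h1, Finset.sum_add_distrib, ← Finset.sum_mul,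
    ← Finset.mul_sum, smul_mul_assoc, mul_smul_comm, add_mul, mul_add, ← smul_add]
  congr 1
  abel

theorem covariantOp_involute {x : M} {f : M → ExteriorAlgebra ℝ (Fin n → ℝ)}
    (hf : CoordSmoothAt E f x) :
    covariantOp r X w (fun y => CliffordAlgebra.involute (f y)) x
      = CliffordAlgebra.involute (covariantOp r X w f x) := by
  have h1 := coordDeriv_map hf
    (CliffordAlgebra.involute : ExteriorAlgebra ℝ (Fin n → ℝ) →ₐ[ℝ] _).toLinearMap (X x)
  simp only [AlgHom.toLinearMap_apply] at h1
  have h2 : ∀ a : Fin n → ℝ, CliffordAlgebra.involute (ExteriorAlgebra.ι ℝ a)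
      = -ExteriorAlgebra.ι ℝ a := fun a => CliffordAlgebra.involute_ι a
  simp only [covariantOp, h1, map_smul, map_add, map_sum, map_mul, contractLeft_involute, h2,
    mul_neg, neg_mul]

theorem covariantOp_smul_one {x : M} {φ : M → ℝ} (hφ : ContMDiffAt 𝓘(ℝ, E) 𝓘(ℝ, ℝ) ∞ φ x) :
    covariantOp r X w (fun y => φ y • (1 : ExteriorAlgebra ℝ (Fin n → ℝ))) x
      = algebraMap ℝ _ (r * mvfderiv 𝓘(ℝ, E) φ x (X x)) := by
  simp only [covariantOp, coordDeriv_smul hφ, map_smul, CliffordAlgebra.contractLeft_one, smul_zero,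
    mul_zero, Finset.sum_const_zero, add_zero, smul_smul, Algebra.algebraMap_eq_smul_one]

theorem covariantOp_ι {x : M} {a : M → Fin n → ℝ}
    (ha : ∀ m, ContMDiffAt 𝓘(ℝ, E) 𝓘(ℝ, ℝ) ∞ (fun y => a y m) x) :
    covariantOp r X w (fun y => ExteriorAlgebra.ι ℝ (a y)) x
      = ExteriorAlgebra.ι ℝ (r • ((fun m => mvfderiv 𝓘(ℝ, E) (fun y => a y m) x (X x))
        + ∑ j, a x j • w j x)) := by
  have h1 := coordDeriv_map (coordSmoothAt_ι ha) (ExteriorAlgebra.ι ℝ) (X x)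
  have h2 : coordDeriv a x (X x) = fun m => mvfderiv 𝓘(ℝ, E) (fun y => a y m) x (X x) := by
    funext m
    exact dual_coordDeriv (coordSmoothAt_ι ha) (X x) (LinearMap.proj m)
  have h3 : ∀ j, ExteriorAlgebra.ι ℝ (w j x) * CliffordAlgebra.contractLeft
      (LinearMap.proj j : Module.Dual ℝ (Fin n → ℝ)) (ExteriorAlgebra.ι ℝ (a x))
      = a x j • ExteriorAlgebra.ι ℝ (w j x) := fun j => by
    have h4 : CliffordAlgebra.contractLeft (LinearMap.proj j : Module.Dual ℝ (Fin n → ℝ))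
        (ExteriorAlgebra.ι ℝ (a x)) = algebraMap ℝ _ (a x j) :=
      CliffordAlgebra.contractLeft_ι (0 : QuadraticForm ℝ (Fin n → ℝ)) _ (a x)
    rw [h4, ← Algebra.commutes, Algebra.smul_def]
  simp only [covariantOp, h1, h2, h3, map_smul, map_add, map_sum]

end CovariantDerivative

section FrameFields

variable {E : Type*} [NormedAddCommGroup E] [NormedSpace ℝ E] [FiniteDimensional ℝ E]
  {M : Type*} [TopologicalSpace M] [ChartedSpace E M] [IsManifold 𝓘(ℝ, E) ∞ M]
  {F : Type*} [NormedAddCommGroup F] [NormedSpace ℝ F]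
  {S : M → Type*} [TopologicalSpace (TotalSpace F S)] [∀ x, AddCommGroup (S x)]
  [∀ x, Module ℝ (S x)] [∀ x, TopologicalSpace (S x)] [FiberBundle F S]
  {k l n : ℕ} {g : PseudoMetric E M} {Δ : CliffordModule k l n} {c : LocalTuple E k l n S}

namespace SpinStructure

variable (P : SpinStructure F g Δ S)

theorem IsCovariantDerivative.unique {U : Opens M} {r : ℝ} {X : Π x : M, TangentSpace 𝓘(ℝ, E) x}
    {P : SpinStructure F g Δ S} {D D' : SheafEnd E F S U} (hD : P.IsCovariantDerivative r X D)
    (hD' : P.IsCovariantDerivative r X D') : D = D' :=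
  eq_of_eq_on_generators (fun _ a => a) hD.1.2 hD'.1.2
    (fun W f φ hφ hf x => by rw [(hD.2 W f).1 φ hφ hf, (hD'.2 W f).1 φ hφ hf])
    (fun W f t ht hf x => by rw [(hD.2 W f).2 t ht hf, (hD'.2 W f).2 t ht hf])

variable [VectorBundle ℝ F S] [ContMDiffVectorBundle ∞ F S 𝓘(ℝ, E)]

/-- In a spin frame, `r ∇_X` on `∧S` is the operator `covariantOp`. -/
theorem exists_isCovariantDerivative (hc : c ∈ P.spinFrames) (r : ℝ)
    {X : Π x : M, TangentSpace 𝓘(ℝ, E) x} (hX : SmoothOn E E X c.dom) :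
    ∃ D : SheafEnd E F S c.dom, P.IsCovariantDerivative r X D := by
  let w : Fin n → M → Fin n → ℝ := fun j y m =>
    LocalTuple.IsAdapted.connectionCoeff g Δ c X j m y
  have hT : IsLocalOperator (E := E) c.dom (covariantOp r X w) :=
    isLocalOperator_covariantOp hX fun j m => hc.1.contMDiffOn_connectionCoeff le_rfl hX j m
  refine ⟨frameEnd hc.1 hT, ⟨?_, fun W a b => superFunctions_ext fun x => ?_⟩,
    fun W f => ⟨fun φ hφ hf x => ?_, fun t ht hf x => ?_⟩⟩
  · refine sheafEnd_ext fun W f x => ?_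
    have h1 := covariantOp_involute (r := r) (X := X) (w := w)
      (coordSmoothAt_localRep hc.1 W.2 f.2 x.2)
    rw [← localRep_involute] at h1
    exact (congrArg (ofModel c (x : M)) h1).trans (map_involute _ _)
  · have h1 := covariantOp_mul (r := r) (X := X) (w := w)
      (coordSmoothAt_localRep hc.1 W.2 a.2 x.2) (coordSmoothAt_localRep hc.1 W.2 b.2 x.2)
    rw [← localRep_mul] at h1
    refine (congrArg (ofModel c (x : M)) h1).trans ?_
    rw [map_add, map_mul, map_mul, localRep_of_mem hc.1 a.1 x.2, localRep_of_mem hc.1 b.1 x.2,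
      ofModel_toModel hc.1 (W.2 x.2), ofModel_toModel hc.1 (W.2 x.2)]
    rfl
  · have h1 : ∀ᶠ y in nhds (x : M), localRep hc.1 f.1 y = φ y • 1 :=
      Filter.eventually_of_mem (W.1.2.mem_nhds x.2) fun y hy => by
        rw [localRep_of_mem hc.1 _ hy, hf ⟨y, hy⟩, AlgHom.commutes, Algebra.algebraMap_eq_smul_one]
    rw [frameEnd_apply, hT.congr x (W.2 x.2) _ _ h1,
      covariantOp_smul_one (hφ.contMDiffAt (W.1.2.mem_nhds x.2)), AlgHom.commutes]
  · have hxc := W.2 x.2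
    have h1 : ∀ᶠ y in nhds (x : M), localRep hc.1 f.1 y
        = ExteriorAlgebra.ι ℝ (coeffMap hc.1 y (t y)) :=
      Filter.eventually_of_mem (W.1.2.mem_nhds x.2) fun y hy => by
        rw [localRep_of_mem hc.1 _ hy, hf ⟨y, hy⟩]
        exact ExteriorAlgebra.map_apply_ι _ _
    rw [frameEnd_apply, hT.congr x hxc _ _ h1, covariantOp_ι (a := fun y => coeffMap hc.1 y (t y))
      fun m => hc.1.frame_θ.contMDiffAt_coeff c.dom.2 hxc (ht.smoothAt x.2) m, ofModel_ι,
      map_smul, map_add, map_sum]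
    congr 2
    rw [P.nabla_eq hc hxc (ht.smoothAt x.2), hc.1.nabla_eq_sum hxc]
    refine congrArg₂ _ (frameMap_apply _ _) ?_
    · refine Finset.sum_congr rfl fun j _ => ?_
      have h2 : frameMap c (x : M) (w j x) = hc.1.nabla (c.θ j) x (X x) :=
        (frameMap_apply _ _).trans (hc.1.nabla_θ_eq_sum le_rfl hX hxc j).symm
      exact (map_smul (frameMap c (x : M)) _ _).trans (congrArg _ h2)

theorem exists_isInterior {ρ : ∀ x : M, TangentSpace 𝓘(ℝ, E) x →ₗ[ℝ] Module.End ℝ (S x)}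
    (hc : c.IsAdapted F g Δ ρ) (j : Fin n) :
    ∃ D : SheafEnd E F S c.dom, IsInterior (hc.frame_θ.coeff j) D := by
  have hT : IsLocalOperator (E := E) c.dom fun f (x : M) =>
      CliffordAlgebra.contractLeft (LinearMap.proj j : Module.Dual ℝ (Fin n → ℝ)) (f x) :=
    { map_add := fun x _ f f' _ _ => map_add _ _ _
      map_smul := fun x _ r f _ => map_smul _ _ _
      congr := fun x _ f f' h => by rw [h.self_of_nhds]
      smooth := fun W _ f hf y hy => (hf y hy).map _ }
  refine ⟨frameEnd hc hT, fun W f x => ?_⟩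
  rw [frameEnd_apply, localRep_of_mem hc _ x.2, toModel, ← map_contractLeft]
  exact ofModel_toModel hc (W.2 x.2) _

theorem exists_isFrameField (hc : c ∈ P.spinFrames) :
    ∃ X : Idx k l n → SheafEnd E F S c.dom, P.IsFrameField c hc.1 X := by
  choose D hD using fun i => P.exists_isCovariantDerivative hc (sgn k l i) (hc.1.smoothOn_e i)
  choose D' hD' using fun j => exists_isInterior hc.1 j
  exact ⟨Sum.elim D D', hD, hD'⟩

end SpinStructure

end FrameFields

/-! ### Linear independence of the frame fields -/

namespace SuperAction

variable {R Λ : Type*} [Ring R] [Algebra ℝ R] [Ring Λ] [Algebra ℝ Λ] {A : SuperAction R Λ} {X : R}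

theorem IsEven.smulRight_eq (h : A.IsEven X) (a : Λ) : A.smulRight X a = A.l a * X := by
  rw [smulRight, h.even_eq, h.odd_eq, mul_zero, add_zero]

theorem IsOdd.smulRight_eq (h : A.IsOdd X) (a : Λ) : A.smulRight X a = A.l (A.p a) * X := by
  rw [smulRight, h.even_eq, h.odd_eq, mul_zero, zero_add]

theorem map_tuple {B : Type*} [AddCommGroup B] (f : R →+ B) {J₀ J₁ : Type*} [Fintype J₀]
    [Fintype J₁] {X : J₀ ⊕ J₁ → R} (h₀ : ∀ i, A.IsEven (X (Sum.inl i)))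
    (h₁ : ∀ i, A.IsOdd (X (Sum.inr i))) (Z : Matrix (J₀ ⊕ J₁) (J₀ ⊕ J₁) Λ) (j : J₀ ⊕ J₁) :
    f (∑ i, A.smulRight (X i) (Z i j))
      = (∑ i, f (A.l (Z (Sum.inl i) j) * X (Sum.inl i)))
        + ∑ i, f (A.l (A.p (Z (Sum.inr i) j)) * X (Sum.inr i)) := by
  simp only [Fintype.sum_sum_type, map_add, map_sum, (h₀ _).smulRight_eq, (h₁ _).smulRight_eq]

end SuperAction

section SuperEnd

variable {E : Type*} [NormedAddCommGroup E] [NormedSpace ℝ E]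
  {M : Type*} [TopologicalSpace M] [ChartedSpace E M]
  {F : Type*} [NormedAddCommGroup F] [NormedSpace ℝ F]
  {S : M → Type*} [TopologicalSpace (TotalSpace F S)] [∀ x, AddCommGroup (S x)]
  [∀ x, Module ℝ (S x)] [∀ x, TopologicalSpace (S x)] [FiberBundle F S] {U : Opens M}

/-- A smooth function as an element of `𝒜(W)`. -/
def scalarFunction (F S) [NormedAddCommGroup F] [NormedSpace ℝ F]
    [TopologicalSpace (TotalSpace F S)] [∀ x, AddCommGroup (S x)]
    [∀ x, Module ℝ (S x)] [∀ x, TopologicalSpace (S x)] [FiberBundle F S] {W : Opens M} (φ : M → ℝ)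
    (hφ : ContMDiffOn 𝓘(ℝ, E) 𝓘(ℝ, ℝ) ∞ φ W) : superFunctions E F S W :=
  ⟨fun x => algebraMap ℝ _ (φ x), fun _ hx =>
    ⟨W, le_rfl, hx, Algebra.subset_adjoin (Or.inl ⟨φ, hφ, rfl⟩)⟩⟩

/-- A smooth section of `S` as an element of `𝒜(W)`. -/
def sectionFunction {W : Opens M} (t : Π x, S x) (ht : SmoothOn E F t W) :
    superFunctions E F S W :=
  ⟨fun x => ExteriorAlgebra.ι ℝ (t x), fun _ hx =>
    ⟨W, le_rfl, hx, Algebra.subset_adjoin (Or.inr ⟨t, ht, rfl⟩)⟩⟩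

/-- The value `(X f)(x)`, as an additive function of the sheaf endomorphism `X`. -/
def evalEnd (W : {W : Opens M // W ≤ U}) (f : superFunctions E F S W.1) (x : W.1) :
    SheafEnd E F S U →+ ExteriorAlgebra ℝ (S x) where
  toFun X := (X.1 W f).1 x
  map_zero' := rfl
  map_add' _ _ := rfl

theorem IsInterior.isOdd {η : Π x : M, Module.Dual ℝ (S x)} {D : SheafEnd E F S U}
    (hD : IsInterior η D) : (sheafAction E F S U).IsOdd D := by
  refine sheafEnd_ext fun W f x => ?_
  refine (hD W (parity E F S W.1 f) x).trans ((contractLeft_involute _ _).trans ?_)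
  exact congrArg (fun a => -CliffordAlgebra.involute a) (hD W f x).symm

theorem IsInterior.restrict {η : Π x : M, Module.Dual ℝ (S x)} {D : SheafEnd E F S U}
    (hD : IsInterior η D) {U' : Opens M} (h : U' ≤ U) : IsInterior η (restrictEnd h D) :=
  fun W f x => hD ⟨W.1, W.2.trans h⟩ f x

variable {J₀ J₁ : Type*} [Fintype J₀] [Fintype J₁] [DecidableEq J₀] [DecidableEq J₁]

theorem evalEnd_tupleMul {X : J₀ ⊕ J₁ → SheafEnd E F S U}
    (h₀ : ∀ i, (sheafAction E F S U).IsEven (X (Sum.inl i)))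
    (h₁ : ∀ i, (sheafAction E F S U).IsOdd (X (Sum.inr i)))
    (Z : Matrix (J₀ ⊕ J₁) (J₀ ⊕ J₁) (superFunctions E F S U)) (j : J₀ ⊕ J₁)
    (W : {W : Opens M // W ≤ U}) (f : superFunctions E F S W.1) (x : W.1) :
    evalEnd W f x (tupleMul X Z j)
      = (∑ i, (Z (Sum.inl i) j).1 ⟨x, W.2 x.2⟩ * evalEnd W f x (X (Sum.inl i)))
        + ∑ i, CliffordAlgebra.involute ((Z (Sum.inr i) j).1 ⟨x, W.2 x.2⟩)
            * evalEnd W f x (X (Sum.inr i)) :=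
  SuperAction.map_tuple (A := sheafAction E F S U) (evalEnd W f x) h₀ h₁ Z j

end SuperEnd

theorem _root_.IsLocalFrameOn.coeff_self {𝕜 E H M F ι : Type*} [NontriviallyNormedField 𝕜]
    [NormedAddCommGroup E] [NormedSpace 𝕜 E] [TopologicalSpace H] {I : ModelWithCorners 𝕜 E H}
    [TopologicalSpace M] [ChartedSpace H M] [NormedAddCommGroup F] [NormedSpace 𝕜 F]
    {V : M → Type*} [TopologicalSpace (TotalSpace F V)] [∀ x, AddCommGroup (V x)]
    [∀ x, Module 𝕜 (V x)] [∀ x, TopologicalSpace (V x)] [FiberBundle F V] {m : WithTop ℕ∞}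
    {s : ι → Π x, V x} {u : Set M} (hs : IsLocalFrameOn I F m s u) [DecidableEq ι] {x : M}
    (hx : x ∈ u) (i j : ι) : hs.coeff j x (s i x) = if i = j then 1 else 0 := by
  rw [IsLocalFrameOn.coeff_apply_of_mem _ hx]
  conv_lhs => rw [← hs.toBasisAt_coe hx i, Module.Basis.repr_self]
  simp [Finsupp.single_apply]

theorem mul_algebraMap_cancel {A : Type*} [Ring A] [Algebra ℝ A] {r : ℝ} (hr : r ≠ 0) {a b : A}
    (h : a * algebraMap ℝ A r = b * algebraMap ℝ A r) : a = b := by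
  simpa [mul_assoc, ← map_mul, mul_inv_cancel₀ hr] using congrArg (· * algebraMap ℝ A r⁻¹) h

section Independence

variable {E : Type*} [NormedAddCommGroup E] [NormedSpace ℝ E] [FiniteDimensional ℝ E]
  {M : Type*} [TopologicalSpace M] [ChartedSpace E M] [IsManifold 𝓘(ℝ, E) ∞ M]

/-- Every covector is the differential of a smooth function. -/
theorem exists_mvfderiv_eq (x : M) (ℓ : Module.Dual ℝ (TangentSpace 𝓘(ℝ, E) x)) :
    ∃ (W : Opens M) (φ : M → ℝ), x ∈ W ∧ ContMDiffOn 𝓘(ℝ, E) 𝓘(ℝ, ℝ) ∞ φ W ∧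
      ∀ v, mvfderiv 𝓘(ℝ, E) φ x v = ℓ v := by
  obtain ⟨e, he⟩ := isInvertible_mfderiv_extChartAt (I := 𝓘(ℝ, E))
    (mem_extChartAt_source (I := 𝓘(ℝ, E)) x)
  let ℓ' : E →L[ℝ] ℝ := LinearMap.toContinuousLinearMap
    (ℓ ∘ₗ (e.symm.toLinearEquiv.toLinearMap : E →ₗ[ℝ] TangentSpace 𝓘(ℝ, E) x))
  have h1 : ContMDiffOn 𝓘(ℝ, E) 𝓘(ℝ, E) ∞ (extChartAt 𝓘(ℝ, E) x) (chartAt E x).source :=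
    contMDiffOn_extChartAt
  refine ⟨⟨(chartAt E x).source, (chartAt E x).open_source⟩, fun y => ℓ' (extChartAt 𝓘(ℝ, E) x y),
    mem_chart_source E x, ℓ'.contMDiff.comp_contMDiffOn h1, fun v => ?_⟩
  have h2 : MDifferentiableAt 𝓘(ℝ, E) 𝓘(ℝ, E) (extChartAt 𝓘(ℝ, E) x) x :=
    (contMDiffAt_extChartAt (n := ∞)).mdifferentiableAt (by simp)
  rw [mvfderiv_comp_fderiv ℓ'.differentiableAt h2, ℓ'.fderiv]
  have h3 : mvfderiv 𝓘(ℝ, E) (extChartAt 𝓘(ℝ, E) x) x v = e v :=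
    congrArg (fun f : TangentSpace 𝓘(ℝ, E) x →L[ℝ] E => f v) he.symm
  rw [h3]
  exact congrArg ℓ (e.symm_apply_apply v)

variable {F : Type*} [NormedAddCommGroup F] [NormedSpace ℝ F]
  {S : M → Type*} [TopologicalSpace (TotalSpace F S)] [∀ x, AddCommGroup (S x)]
  [∀ x, Module ℝ (S x)] [∀ x, TopologicalSpace (S x)] [FiberBundle F S]
  {k l n : ℕ} {g : PseudoMetric E M} {Δ : CliffordModule k l n} {c : LocalTuple E k l n S}
  {P : SpinStructure F g Δ S}

namespace SpinStructure

theorem IsCovariantDerivative.restrict {U U' : Opens M} {r : ℝ}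
    {X : Π x : M, TangentSpace 𝓘(ℝ, E) x} {D : SheafEnd E F S U}
    (hD : P.IsCovariantDerivative r X D) (h : U' ≤ U) :
    P.IsCovariantDerivative r X (restrictEnd h D) :=
  ⟨⟨congrArg (restrictEnd h) hD.1.1, fun W a b => hD.1.2 ⟨W.1, W.2.trans h⟩ a b⟩,
    fun W f => hD.2 ⟨W.1, W.2.trans h⟩ f⟩

variable {hc : c.IsAdapted F g Δ P.ρ} {X : Idx k l n → SheafEnd E F S c.dom}

theorem IsFrameField.isEven (hX : P.IsFrameField c hc X) {U : Opens M} (h : U ≤ c.dom)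
    (i : EvenIdx k l) : (sheafAction E F S U).IsEven (restrictEnd h (X (Sum.inl i))) :=
  ((hX.1 i).restrict h).1.1

theorem IsFrameField.isOdd (hX : P.IsFrameField c hc X) {U : Opens M} (h : U ≤ c.dom)
    (i : Fin n) : (sheafAction E F S U).IsOdd (restrictEnd h (X (Sum.inr i))) :=
  ((hX.2 i).restrict h).isOdd

/-- The vector fields of a frame field are linearly independent: the `ι(e^i)` are separated by the
differentials of functions, and the `ι(θ_j)` vanish on functions and are separated by the sections
`θ^j`. -/
theorem IsFrameField.isIndependent (hX : P.IsFrameField c hc X) : IsIndependent X := by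
  intro W h Z Z' e
  have key : ∀ (j : Idx k l n) (W' : {W' : Opens M // W' ≤ W}) (f : superFunctions E F S W'.1)
      (x : W'.1), _ := fun j W' f x =>
    (evalEnd_tupleMul (hX.isEven h) (hX.isOdd h) Z j W' f x).symm.trans
      ((congrArg (fun Y => evalEnd W' f x (Y j)) e).trans
        (evalEnd_tupleMul (hX.isEven h) (hX.isOdd h) Z' j W' f x))
  have h0 : ∀ i j, Z (Sum.inl i) j = Z' (Sum.inl i) j := fun i j => superFunctions_ext fun x => by
    have hxc := h x.2
    obtain ⟨W', φ, hx', hφ, hd⟩ := exists_mvfderiv_eq (x : M) (hc.frame_e.coeff i (x : M))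
    have hφ' : ContMDiffOn 𝓘(ℝ, E) 𝓘(ℝ, ℝ) ∞ φ (W ⊓ W' : Opens M) := hφ.mono Set.inter_subset_right
    let f := scalarFunction F S φ hφ'
    have h1 := key j ⟨W ⊓ W', inf_le_left⟩ f ⟨x, x.2, hx'⟩
    have h2 : ∀ m, evalEnd ⟨W ⊓ W', inf_le_left⟩ f ⟨(x : M), x.2, hx'⟩
        (restrictEnd h (X (Sum.inl m)))
        = algebraMap ℝ _ (if m = i then sgn k l i else 0) := fun m => by
      refine ((((hX.1 m).restrict h).2 ⟨W ⊓ W', inf_le_left⟩ f).1 φ hφ' (fun _ => rfl)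
        ⟨(x : M), x.2, hx'⟩).trans ?_
      rw [hd, hc.frame_e.coeff_self hxc]
      split_ifs with hm
      · rw [hm, mul_one]
      · rw [mul_zero]
    have h3 : ∀ m, evalEnd ⟨W ⊓ W', inf_le_left⟩ f ⟨(x : M), x.2, hx'⟩
        (restrictEnd h (X (Sum.inr m)))
        = 0 := fun m =>
      ((hX.2 m).restrict h ⟨W ⊓ W', inf_le_left⟩ f ⟨(x : M), x.2, hx'⟩).trans
        (CliffordAlgebra.contractLeft_algebraMap (0 : QuadraticForm ℝ (S x)) _ _)
    simp only [h2, h3, mul_zero, Finset.sum_const_zero, add_zero, apply_ite (algebraMap ℝ _),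
      map_zero, mul_ite, Finset.sum_ite_eq', Finset.mem_univ, if_true] at h1
    exact mul_algebraMap_cancel (sgn_ne_zero i) h1
  refine matrix_ext fun x => ?_
  ext (i | i) j
  · rw [evalMatrix_apply, evalMatrix_apply, h0]
  · have hxc := h x.2
    have hθ : SmoothOn E F (c.θ i) W := ContMDiffOn.mono (hc.smoothOn_θ i) h
    have h1 := key j ⟨W, le_rfl⟩ (sectionFunction (c.θ i) hθ) x
    have h2 : ∀ m, evalEnd ⟨W, le_rfl⟩ (sectionFunction (c.θ i) hθ) x
        (restrictEnd h (X (Sum.inr m)))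
        = algebraMap ℝ _ (if i = m then 1 else 0) := fun m => by
      rw [← hc.coeff_θ hxc]
      exact ((hX.2 m).restrict h ⟨W, le_rfl⟩ (sectionFunction (c.θ i) hθ) x).trans
        (CliffordAlgebra.contractLeft_ι (0 : QuadraticForm ℝ (S x)) _ _)
    simp only [h2, h0] at h1
    have h3 := add_left_cancel h1
    simp only [apply_ite (algebraMap ℝ _), map_zero, map_one, mul_ite, mul_zero, mul_one,
      Finset.sum_ite_eq, Finset.mem_univ, if_true] at h3
    have h4 := congrArg CliffordAlgebra.involute h3
    rwa [CliffordAlgebra.involute_involute, CliffordAlgebra.involute_involute] at h4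

end SpinStructure

end Independence

/-! ### Real supermatrices in the supergroup -/

section RealMatrices

theorem hasSum_exp_entry {ι : Type*} [Fintype ι] [DecidableEq ι] (Y : Matrix ι ι ℝ) (i j : ι) :
    HasSum (fun r : ℕ => ((r.factorial : ℝ)⁻¹) * (Y ^ r) i j) (NormedSpace.exp Y i j) := by
  have h1 := NormedSpace.exp_series_hasSum_exp' (𝕂 := ℝ) ((endEquivMatrix ι).symm Y)
  rw [exp_endEquivMatrix_symm] at h1
  have h2 := (entryCLM i j).hasSum h1
  simpa only [Function.comp_def, map_smul, ← map_pow, entryCLM_symm, smul_eq_mul] using h2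

theorem exp_mul_exp_neg_matrix {ι : Type*} [Fintype ι] [DecidableEq ι] (Y : Matrix ι ι ℝ) :
    NormedSpace.exp Y * NormedSpace.exp (-Y) = 1 := by
  rw [Matrix.exp_neg]
  exact Matrix.mul_nonsing_inv _ ((Matrix.isUnit_iff_isUnit_det _).1 (Matrix.isUnit_exp _))

theorem exp_neg_transpose {ι : Type*} [Fintype ι] [DecidableEq ι] (Y : Matrix ι ι ℝ) :
    (NormedSpace.exp Y).transpose * NormedSpace.exp (-Y.transpose) = 1 := by
  rw [← Matrix.exp_transpose]
  exact exp_mul_exp_neg_matrix _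

variable {E : Type*} [NormedAddCommGroup E] [NormedSpace ℝ E]
  {M : Type*} [TopologicalSpace M] [ChartedSpace E M]
  {F : Type*} [NormedAddCommGroup F] [NormedSpace ℝ F]
  {S : M → Type*} [TopologicalSpace (TotalSpace F S)] [∀ x, AddCommGroup (S x)]
  [∀ x, Module ℝ (S x)] [∀ x, TopologicalSpace (S x)] [FiberBundle F S] {W : Opens M}
  {J₀ J₁ : Type*} [Fintype J₀] [Fintype J₁] [DecidableEq J₀] [DecidableEq J₁]

/-- The groups `G(𝒜(U))` form a presheaf. -/
theorem resUnits_mem_expGroup {𝔤 : Submodule ℝ (Matrix (J₀ ⊕ J₁) (J₀ ⊕ J₁) ℝ)} {U : Opens M}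
    (h : W ≤ U) {u : (Matrix (J₀ ⊕ J₁) (J₀ ⊕ J₁) (superFunctions E F S U))ˣ}
    (hu : u ∈ expGroup 𝔤 U) : resUnits h u ∈ expGroup 𝔤 W := by
  suffices h1 : expGroup 𝔤 U ≤ (expGroup 𝔤 W).comap (resUnits h) from h1 hu
  refine (Subgroup.closure_le _).2 ?_
  rintro u ⟨Y, hY, hev, hexp⟩
  refine Subgroup.subset_closure ⟨resMatrix h Y, mem_tensorSub_iff.2 fun x => ?_,
    ⟨fun i j => congrArg (res E F S h) (hev.1 i j), fun i j => congrArg (res E F S h) (hev.2.1 i j),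
      fun i j => congrArg (res E F S h) (hev.2.2.1 i j),
      fun i j => congrArg (res E F S h) (hev.2.2.2 i j)⟩, fun x i j φ => ?_⟩
  · exact mem_tensorSub_iff.1 hY ⟨x, h x.2⟩
  · have h1 : ∀ r : ℕ, ((resMatrix h Y ^ r) i j).1 x = ((Y ^ r) i j).1 ⟨x, h x.2⟩ := fun r => by
      rw [← map_pow]
      rfl
    simp only [h1]
    exact hexp ⟨x, h x.2⟩ i j φ

theorem resUnits_val {J : Type*} [Fintype J] [DecidableEq J] {U : Opens M} (h : W ≤ U)
    (u : (Matrix J J (superFunctions E F S U))ˣ) : (resUnits h u).1 = resMatrix h u.1 := rfl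

variable (F S) in
/-- A smooth field of real matrices as a matrix over `𝒜(W)`. -/
def scalarMatrix {J : Type*} (N : M → Matrix J J ℝ)
    (hN : ∀ i j, ContMDiffOn 𝓘(ℝ, E) 𝓘(ℝ, ℝ) ∞ (fun y => N y i j) W) :
    Matrix J J (superFunctions E F S W) :=
  Matrix.of fun i j => scalarFunction F S (fun y => N y i j) (hN i j)

theorem evalMatrix_scalarMatrix {N : M → Matrix (J₀ ⊕ J₁) (J₀ ⊕ J₁) ℝ}
    (hN : ∀ i j, ContMDiffOn 𝓘(ℝ, E) 𝓘(ℝ, ℝ) ∞ (fun y => N y i j) W) (x : W) :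
    evalMatrix x (scalarMatrix F S N hN) = realMatrix (N x) := rfl

theorem realMatrix_eq_superScale {V : Type*} [AddCommGroup V] [Module ℝ V]
    (N : Matrix (J₀ ⊕ J₁) (J₀ ⊕ J₁) ℝ) :
    (realMatrix N : Matrix _ _ (ExteriorAlgebra ℝ V)) = superScale (extParity V) 1 N := by
  ext (i | i) j : 2
  · exact Algebra.algebraMap_eq_smul_one (A := ExteriorAlgebra ℝ V) (N (Sum.inl i) j)
  · refine (Algebra.algebraMap_eq_smul_one (A := ExteriorAlgebra ℝ V) (N (Sum.inr i) j)).trans ?_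
    exact congrArg (N (Sum.inr i) j • ·)
      (map_one (CliffordAlgebra.involute (Q := (0 : QuadraticForm ℝ V)))).symm

theorem realMatrix_mem {V : Type*} [AddCommGroup V] [Module ℝ V]
    {𝔤 : Submodule ℝ (Matrix (J₀ ⊕ J₁) (J₀ ⊕ J₁) ℝ)} {N : Matrix (J₀ ⊕ J₁) (J₀ ⊕ J₁) ℝ}
    (hN : N ∈ 𝔤) : (realMatrix N : Matrix _ _ (ExteriorAlgebra ℝ V))
      ∈ tensorSpace (extParity V) 𝔤 := by
  rw [realMatrix_eq_superScale]
  exact superScale_mem _ _ hN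

/-- Exponentials of smooth maps to the even part of `𝔤` belong to `G(𝒜(W))`. -/
theorem exists_expGroup_exp {𝔤 : Submodule ℝ (Matrix (J₀ ⊕ J₁) (J₀ ⊕ J₁) ℝ)}
    {N : M → Matrix (J₀ ⊕ J₁) (J₀ ⊕ J₁) ℝ}
    (hN : ∀ i j, ContMDiffOn 𝓘(ℝ, E) 𝓘(ℝ, ℝ) ∞ (fun y => N y i j) W)
    (hmem : ∀ y ∈ W, N y ∈ 𝔤) (hdiag : ∀ y ∈ W, IsBlockDiagonal (N y)) :
    ∃ u : (Matrix (J₀ ⊕ J₁) (J₀ ⊕ J₁) (superFunctions E F S W))ˣ, u ∈ expGroup 𝔤 W ∧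
      ∀ x : W, evalMatrix x u.1 = realMatrix (NormedSpace.exp (N x)) := by
  have hexp : ∀ i j, ContMDiffOn 𝓘(ℝ, E) 𝓘(ℝ, ℝ) ∞ (fun y => NormedSpace.exp (N y) i j) W :=
    fun i j y hy => (contMDiffAt_exp_entry
      (fun i j => (hN i j).contMDiffAt (W.2.mem_nhds hy)) i j).contMDiffWithinAt
  have hexp' : ∀ i j, ContMDiffOn 𝓘(ℝ, E) 𝓘(ℝ, ℝ) ∞ (fun y => NormedSpace.exp (-N y) i j) W :=
    fun i j y hy => (contMDiffAt_exp_entry (Y := fun y => -N y)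
      (fun i j => ((hN i j).contMDiffAt (W.2.mem_nhds hy)).neg) i j).contMDiffWithinAt
  refine ⟨⟨scalarMatrix F S _ hexp, scalarMatrix F S _ hexp', matrix_ext fun x => ?_,
    matrix_ext fun x => ?_⟩, Subgroup.subset_closure ⟨scalarMatrix F S N hN,
      mem_tensorSub_iff.2 fun x => realMatrix_mem (hmem x x.2), ⟨fun i j => ?_, fun i j => ?_,
        fun i j => ?_, fun i j => ?_⟩, fun x i j φ => ?_⟩, fun x => rfl⟩
  · rw [map_mul, map_one, evalMatrix_scalarMatrix, evalMatrix_scalarMatrix, ← map_mul,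
      exp_mul_exp_neg_matrix, map_one]
  · rw [map_mul, map_one, evalMatrix_scalarMatrix, evalMatrix_scalarMatrix, ← map_mul]
    have h1 := exp_mul_exp_neg_matrix (-N x)
    rw [neg_neg] at h1
    rw [h1, map_one]
  · exact superFunctions_ext fun x => AlgHom.commutes _ _
  · exact superFunctions_ext fun x => AlgHom.commutes _ _
  · refine superFunctions_ext fun x => ?_
    have h1 : (scalarMatrix F S N hN (Sum.inl i) (Sum.inr j)).1 x = 0 := by
      refine (congrArg (algebraMap ℝ _) ((hdiag x x.2).1 i j)).trans (map_zero _)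
    refine (congrArg CliffordAlgebra.involute h1).trans ?_
    rw [map_zero]
    exact (neg_eq_zero.2 h1).symm
  · refine superFunctions_ext fun x => ?_
    have h1 : (scalarMatrix F S N hN (Sum.inr i) (Sum.inl j)).1 x = 0 := by
      refine (congrArg (algebraMap ℝ _) ((hdiag x x.2).2 i j)).trans (map_zero _)
    refine (congrArg CliffordAlgebra.involute h1).trans ?_
    rw [map_zero]
    exact (neg_eq_zero.2 h1).symm
  · have h1 : ∀ r : ℝ, φ (algebraMap ℝ _ r) = r * φ 1 := fun r => by
      rw [Algebra.algebraMap_eq_smul_one, map_smul, smul_eq_mul]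
    have h2 : ∀ r : ℕ, (((scalarMatrix F S N hN) ^ r) i j).1 x = algebraMap ℝ _ ((N x ^ r) i j) :=
      fun r => by
        rw [← evalMatrix_apply, map_pow, evalMatrix_scalarMatrix, ← map_pow]
        rfl
    have h3 : (fun r : ℕ => ((r.factorial : ℝ)⁻¹) * φ ((((scalarMatrix F S N hN) ^ r) i j).1 x))
        = fun r : ℕ => ((r.factorial : ℝ)⁻¹) * (N x ^ r) i j * φ 1 :=
      funext fun r => by rw [h2, h1, mul_assoc]
    rw [h3]
    exact (congrArg (HasSum _) (h1 (NormedSpace.exp (N x) i j))).mpr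
      ((hasSum_exp_entry (N x) i j).mul_right (φ 1))

end RealMatrices

section GaugeMaps

variable {E : Type*} [NormedAddCommGroup E] [NormedSpace ℝ E]
  {M : Type*} [TopologicalSpace M] [ChartedSpace E M]
  {F : Type*} [NormedAddCommGroup F] [NormedSpace ℝ F]
  {S : M → Type*} [TopologicalSpace (TotalSpace F S)] [∀ x, AddCommGroup (S x)]
  [∀ x, Module ℝ (S x)] [∀ x, TopologicalSpace (S x)] [FiberBundle F S]
  {k l n : ℕ} {Δ : CliffordModule k l n} {U : Opens M}

/-- The inverse transpose of a smooth map to the spin group belongs to `G`. -/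
theorem IsSpinMap.exists_expGroup (G : LinearMap.BilinForm ℝ (Fin n → ℝ))
    {h : M → Matrix (Idx k l n) (Idx k l n) ℝ} (hh : IsSpinMap E Δ U h) {x : M} (hx : x ∈ U) :
    ∃ W : Opens M, x ∈ W ∧ W ≤ U ∧
      ∃ u : (Matrix (Idx k l n) (Idx k l n) (superFunctions E F S W))ˣ,
        u ∈ expGroup (modelLie Δ G) W ∧ ∃ v : M → Matrix (Idx k l n) (Idx k l n) ℝ,
          ∀ y : W, evalMatrix y u.1 = realMatrix (v y) ∧ (h y).transpose * v y = 1 := by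
  obtain ⟨W, hxW, hW, L, hL, e⟩ := hh x hx
  refine ⟨W, hxW, hW, ?_⟩
  suffices h1 : ∃ u : (Matrix (Idx k l n) (Idx k l n) (superFunctions E F S W))ˣ,
      u ∈ expGroup (modelLie Δ G) W ∧ ∃ v : M → Matrix (Idx k l n) (Idx k l n) ℝ,
        ∀ y : W, evalMatrix y u.1 = realMatrix (v y) ∧
          ((L.map fun Y : M → Matrix (Idx k l n) (Idx k l n) ℝ =>
            NormedSpace.exp (Y y)).prod).transpose * v y = 1 by
    obtain ⟨u, hu, v, hv⟩ := h1
    exact ⟨u, hu, v, fun y => ⟨(hv y).1, by rw [e y y.2, (hv y).2]⟩⟩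
  clear e
  induction L with
  | nil => exact ⟨1, one_mem _, fun _ => 1, fun y => ⟨by simp, by simp⟩⟩
  | cons Y L ih =>
    obtain ⟨u, hu, v, hv⟩ := ih fun Y' hY' => hL Y' (List.mem_cons_of_mem _ hY')
    obtain ⟨h1, h2⟩ := hL Y List.mem_cons_self
    have h3 : ∀ y ∈ W, -(Y y).transpose ∈ modelLie Δ G ∧ IsBlockDiagonal (-(Y y).transpose) := by
      intro y hy
      obtain ⟨A, hA, e⟩ := h2 y hy
      have h4 : -(Y y).transpose = rotationMatrix A := by
        rw [e, Matrix.fromBlocks_transpose, Matrix.fromBlocks_neg]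
        simp [rotationMatrix]
      rw [h4]
      exact ⟨rotationMatrix_mem hA, fun i j => rfl, fun i j => rfl⟩
    obtain ⟨u', hu', hv'⟩ := exists_expGroup_exp (F := F) (S := S)
      (N := fun y => -(Y y).transpose) (fun i j => (h1 j i).neg) (fun y hy => (h3 y hy).1)
      fun y hy => (h3 y hy).2
    refine ⟨u' * u, mul_mem hu' hu, fun y => NormedSpace.exp (-(Y y).transpose) * v y,
      fun y => ⟨?_, ?_⟩⟩
    · rw [Units.val_mul, map_mul, hv', (hv y).1, ← map_mul]
    · rw [List.map_cons, List.prod_cons, Matrix.transpose_mul, mul_assoc, ← mul_assoc _ _ (v y),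
        exp_neg_transpose, one_mul, (hv y).2]

end GaugeMaps

/-! ### Change of spin frame -/

section InverseTranspose

variable {k l n : ℕ}

/-- The blocks of the inverse transpose `v` of a block diagonal matrix `h` with orthogonal upper
left block. -/
theorem inverseTranspose_apply {h v : Matrix (Idx k l n) (Idx k l n) ℝ} (hv : h.transpose * v = 1)
    (h₁ : ∀ i j, h (Sum.inl i) (Sum.inr j) = 0) (h₂ : ∀ i j, h (Sum.inr i) (Sum.inl j) = 0)
    (horth : ∀ i m, ∑ j, h (Sum.inl j) (Sum.inl i) * (sgn k l j * h (Sum.inl j) (Sum.inl m))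
      = if i = m then sgn k l i else 0) :
    (∀ i j, v (Sum.inl j) (Sum.inl i) = sgn k l i * (sgn k l j * h (Sum.inl j) (Sum.inl i))) ∧
    (∀ i j, v (Sum.inr j) (Sum.inl i) = 0) ∧ (∀ i j, v (Sum.inl j) (Sum.inr i) = 0) ∧
    ∀ i m, ∑ j, h (Sum.inr j) (Sum.inr m) * v (Sum.inr j) (Sum.inr i) = if m = i then 1 else 0 := by
  have hv' : v * h.transpose = 1 := mul_eq_one_comm.1 hv
  have hcol : ∀ (w : Idx k l n → ℝ) (i : Idx k l n),
      h.transpose.mulVec w = Pi.single i 1 → ∀ j, w j = v j i := fun w i hw j => by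
    have h3 := congrArg v.mulVec hw
    rw [Matrix.mulVec_mulVec, hv', Matrix.one_mulVec] at h3
    rw [h3, Matrix.mulVec_single_one]
    rfl
  have h4 : ∀ i m, ∑ j, h (Sum.inr j) (Sum.inr m) * v (Sum.inr j) (Sum.inr i)
      = if m = i then 1 else 0 := fun i m => by
    have h5 := congrFun (congrFun hv (Sum.inr m)) (Sum.inr i)
    simpa [Matrix.mul_apply, h₁, Matrix.one_apply] using h5
  have h5 : ∀ i, _ := fun i => hcol (Sum.elim
    (fun j => sgn k l i * (sgn k l j * h (Sum.inl j) (Sum.inl i))) fun _ => 0) (Sum.inl i) (by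
      funext q
      rcases q with m | m
      · have h6 := horth m i
        simp only [Matrix.mulVec, dotProduct, Matrix.transpose_apply, Fintype.sum_sum_type,
          Sum.elim_inl, Sum.elim_inr, mul_zero, Finset.sum_const_zero, add_zero,
          mul_left_comm _ (sgn k l i), ← Finset.mul_sum, h6, Pi.single_apply, Sum.inl.injEq]
        split_ifs with h7
        · rw [h7, sgn_mul_self]
        · rw [mul_zero]
      · simp [Matrix.mulVec, dotProduct, h₁])
  have h6 : ∀ i, _ := fun i => hcol (Sum.elim (fun _ => 0) fun j => v (Sum.inr j) (Sum.inr i))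
    (Sum.inr i) (by
      funext q
      rcases q with m | m
      · simp [Matrix.mulVec, dotProduct, h₂]
      · simp [Matrix.mulVec, dotProduct, h4, Pi.single_apply])
  exact ⟨fun i j => (h5 i (Sum.inl j)).symm, fun i j => (h5 i (Sum.inr j)).symm,
    fun i j => (h6 i (Sum.inl j)).symm, h4⟩

end InverseTranspose

section ChangeOfFrame

variable {E : Type*} [NormedAddCommGroup E] [NormedSpace ℝ E] [FiniteDimensional ℝ E]
  {M : Type*} [TopologicalSpace M] [ChartedSpace E M] [IsManifold 𝓘(ℝ, E) ∞ M]
  {F : Type*} [NormedAddCommGroup F] [NormedSpace ℝ F]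
  {S : M → Type*} [TopologicalSpace (TotalSpace F S)] [∀ x, AddCommGroup (S x)]
  [∀ x, Module ℝ (S x)] [∀ x, TopologicalSpace (S x)] [FiberBundle F S]
  {k l n : ℕ} {g : PseudoMetric E M} {Δ : CliffordModule k l n} {b c : LocalTuple E k l n S}

theorem LocalTuple.IsAdapted.orthogonal_of_relatedBy
    {ρ : ∀ x : M, TangentSpace 𝓘(ℝ, E) x →ₗ[ℝ] Module.End ℝ (S x)} (hb : b.IsAdapted F g Δ ρ)
    (hc : c.IsAdapted F g Δ ρ) {W : Opens M} (hWb : W ≤ b.dom) (hWc : W ≤ c.dom)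
    {h : M → Matrix (Idx k l n) (Idx k l n) ℝ} (hbc : b.RelatedBy c h W) {x : M} (hx : x ∈ W)
    (i m : EvenIdx k l) :
    ∑ j, h x (Sum.inl j) (Sum.inl i) * (sgn k l j * h x (Sum.inl j) (Sum.inl m))
      = if i = m then sgn k l i else 0 := by
  rw [← hc.orthonormal x (hWc hx), (hbc x hx).1 i, (hbc x hx).1 m]
  simp only [map_sum, map_smul, LinearMap.sum_apply, LinearMap.smul_apply,
    hb.orthonormal x (hWb hx), smul_eq_mul, mul_ite, mul_zero, Finset.sum_ite_eq',
    Finset.mem_univ, if_true]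
  refine Finset.sum_congr rfl fun j _ => ?_
  ring

/-- The transformation of the dual frame of `S`. -/
theorem LocalTuple.IsAdapted.coeff_eq_sum
    {ρ : ∀ x : M, TangentSpace 𝓘(ℝ, E) x →ₗ[ℝ] Module.End ℝ (S x)} (hb : b.IsAdapted F g Δ ρ)
    (hc : c.IsAdapted F g Δ ρ) {W : Opens M} (hWb : W ≤ b.dom) (hWc : W ≤ c.dom)
    {h : M → Matrix (Idx k l n) (Idx k l n) ℝ} (hbc : b.RelatedBy c h W) {x : M} (hx : x ∈ W)
    {v : Matrix (Fin n) (Fin n) ℝ}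
    (hv : ∀ i m, ∑ j, h x (Sum.inr j) (Sum.inr m) * v j i = if m = i then 1 else 0) (i : Fin n) :
    hc.frame_θ.coeff i x = ∑ j, v j i • hb.frame_θ.coeff j x := by
  refine (hc.frame_θ.toBasisAt (hWc hx)).ext fun m => ?_
  rw [hc.frame_θ.toBasisAt_coe, hc.frame_θ.coeff_self (hWc hx), (hbc x hx).2 m]
  simp only [map_sum, map_smul, LinearMap.sum_apply, LinearMap.smul_apply,
    hb.frame_θ.coeff_self (hWb hx), smul_eq_mul, mul_ite, mul_one, mul_zero, Finset.sum_ite_eq,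
    Finset.mem_univ, if_true, ← hv i m]

variable {P : SpinStructure F g Δ S}

section

variable [VectorBundle ℝ F S] [ContMDiffVectorBundle ∞ F S 𝓘(ℝ, E)]

/-- `v ↦ ∇_v t` is linear. -/
theorem SpinStructure.exists_nabla_eq (hc : c ∈ P.spinFrames) {x : M} (hx : x ∈ c.dom)
    {t : Π y, S y} (ht : SmoothAt E F t x) :
    ∃ N : TangentSpace 𝓘(ℝ, E) x →ₗ[ℝ] S x, ∀ v, P.nabla t x v = N v := by
  choose N hN _ using fun i => exists_leviCivita_eq g (hc.1.mdiffVec hx i)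
  refine ⟨(∑ j, (mvfderiv 𝓘(ℝ, E) (fun y => hc.1.frame_θ.coeff j y (t y)) x).toLinearMap.smulRight
      (c.θ j x)) + (4⁻¹ : ℝ) • ∑ i, sgn k l i •
        (P.ρ x (c.e i x) ∘ₗ ((P.ρ x).flip (t x)) ∘ₗ N i), fun v => ?_⟩
  rw [P.nabla_eq hc hx ht, LocalTuple.IsAdapted.nabla]
  simp [hN]

end

variable [VectorBundle ℝ F S] [ContMDiffVectorBundle ∞ F S 𝓘(ℝ, E)]

/-- If `c = b h`, then `ι(c) = ι(b) v`, where `v` is the inverse transpose of `h`. -/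
theorem SpinStructure.IsFrameField.eq_tupleMul (hb : b ∈ P.spinFrames) (hc : c ∈ P.spinFrames)
    {X : Idx k l n → SheafEnd E F S b.dom} {X' : Idx k l n → SheafEnd E F S c.dom}
    (hX : P.IsFrameField b hb.1 X) (hX' : P.IsFrameField c hc.1 X') {W : Opens M}
    (hWb : W ≤ b.dom) (hWc : W ≤ c.dom) {h v : M → Matrix (Idx k l n) (Idx k l n) ℝ}
    (hh : IsSpinMap E Δ W h) (hbc : b.RelatedBy c h W)
    {u : Matrix (Idx k l n) (Idx k l n) (superFunctions E F S W)}
    (hu : ∀ y : W, evalMatrix y u = realMatrix (v y) ∧ (h y).transpose * v y = 1) :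
    (fun j => restrictEnd hWc (X' j)) = tupleMul (fun j => restrictEnd hWb (X j)) u := by
  have hu' : ∀ (y : W) p q, (u p q).1 y = algebraMap ℝ _ (v y p q) := fun y p q =>
    congrFun (congrFun (hu y).1 p) q
  have hblock : ∀ y : W, _ := fun y => inverseTranspose_apply (hu y).2 (hh.blockDiagonal y.2).1
    (hh.blockDiagonal y.2).2 (hb.1.orthogonal_of_relatedBy hc.1 hWb hWc hbc y.2)
  funext j
  rcases j with i | i
  · have hD : ∀ (W' : {W' : Opens M // W' ≤ W}) (f : superFunctions E F S W'.1) (x : W'.1),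
        ((tupleMul (fun j => restrictEnd hWb (X j)) u (Sum.inl i)).1 W' f).1 x
        = ∑ m, v x (Sum.inl m) (Sum.inl i) • ((restrictEnd hWb (X (Sum.inl m))).1 W' f).1 x := by
      intro W' f x
      refine (evalEnd_tupleMul (hX.isEven hWb) (hX.isOdd hWb) u _ W' f x).trans ?_
      simp only [hu', (hblock ⟨x, W'.2 x.2⟩).2.1, map_zero, zero_mul, Finset.sum_const_zero,
        add_zero, ← Algebra.smul_def]
      rfl
    have hX₀ := fun m => (hX.1 m).restrict hWb
    refine ((hX'.1 i).restrict hWc).unique ⟨⟨?_, fun W' a a' => superFunctions_ext fun x => ?_⟩,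
      fun W' f => ⟨fun φ hφ hf x => ?_, fun t ht hf x => ?_⟩⟩
    · refine sheafEnd_ext fun W' f x => ?_
      refine (hD W' (parity E F S W'.1 f) x).trans ?_
      refine Eq.trans ?_ (congrArg CliffordAlgebra.involute (hD W' f x)).symm
      rw [map_sum]
      refine Finset.sum_congr rfl fun m _ => ?_
      rw [map_smul]
      exact congrArg (fun D => v x (Sum.inl m) (Sum.inl i) • evalEnd W' f x D) (hX₀ m).1.1
    · refine (hD W' (a * a') x).trans ?_
      refine Eq.trans ?_ (congrArg₂ (fun A A' => A * a'.1 x + a.1 x * A') (hD W' a x)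
        (hD W' a' x)).symm
      simp only [Finset.sum_mul, Finset.mul_sum, smul_mul_assoc, mul_smul_comm,
        ← Finset.sum_add_distrib, ← smul_add]
      exact Finset.sum_congr rfl fun m _ => congrArg _
        (congrArg (fun A : superFunctions E F S W'.1 => A.1 x) ((hX₀ m).1.2 W' a a'))
    · rw [hD]
      simp only [((hX₀ _).2 W' f).1 φ hφ hf]
      rw [(hbc x (W'.2 x.2)).1 i]
      simp only [(hblock ⟨x, W'.2 x.2⟩).1, map_sum, map_smul, Finset.mul_sum, smul_eq_mul,
        Algebra.smul_def, ← map_mul]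
      refine Finset.sum_congr rfl fun m _ => congrArg _ ?_
      linear_combination (sgn k l i * h x (Sum.inl m) (Sum.inl i) *
        mvfderiv 𝓘(ℝ, E) φ x (b.e m x)) * sgn_mul_self m
    · rw [hD]
      simp only [((hX₀ _).2 W' f).2 t ht hf]
      obtain ⟨N, hN⟩ := P.exists_nabla_eq hb (hWb (W'.2 x.2)) (ht.smoothAt x.2)
      rw [(hbc x (W'.2 x.2)).1 i]
      simp only [(hblock ⟨x, W'.2 x.2⟩).1, hN, ← map_smul, ← map_sum, Finset.smul_sum, smul_smul]
      congr 2
      refine Finset.sum_congr rfl fun m _ => congrArg (· • b.e m x) ?_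
      linear_combination (sgn k l i * h x (Sum.inl m) (Sum.inl i)) * sgn_mul_self m
  · refine sheafEnd_ext fun W' f x => ?_
    refine ((hX'.2 i).restrict hWc W' f x).trans (Eq.symm ?_)
    refine (evalEnd_tupleMul (hX.isEven hWb) (hX.isOdd hWb) u _ W' f x).trans ?_
    rw [hb.1.coeff_eq_sum hc.1 hWb hWc hbc (W'.2 x.2) (hblock ⟨x, W'.2 x.2⟩).2.2.2]
    simp only [hu', (hblock ⟨x, W'.2 x.2⟩).2.2.1, map_zero, zero_mul, Finset.sum_const_zero,
        zero_add, AlgHom.commutes, ← Algebra.smul_def, map_sum, map_smul, LinearMap.sum_apply,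
        LinearMap.smul_apply]
    exact Finset.sum_congr rfl fun m _ => congrArg _ ((hX.2 m).restrict hWb W' f x)

end ChangeOfFrame

/-! ### All open sets are small -/

section GaugeRelated

variable {E : Type*} [NormedAddCommGroup E] [NormedSpace ℝ E]
  {M : Type*} [TopologicalSpace M] [ChartedSpace E M]
  {F : Type*} [NormedAddCommGroup F] [NormedSpace ℝ F]
  {S : M → Type*} [TopologicalSpace (TotalSpace F S)] [∀ x, AddCommGroup (S x)]
  [∀ x, Module ℝ (S x)] [∀ x, TopologicalSpace (S x)] [FiberBundle F S]
  {J₀ J₁ : Type*} [Fintype J₀] [Fintype J₁] [DecidableEq J₀] [DecidableEq J₁]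
  {𝔤 : Submodule ℝ (Matrix (J₀ ⊕ J₁) (J₀ ⊕ J₁) ℝ)} {x : M} {U U' U'' : Opens M}

/-- Near `x`, the tuples `X` and `X'` differ by an element of `G`. -/
def GaugeRelated (𝔤 : Submodule ℝ (Matrix (J₀ ⊕ J₁) (J₀ ⊕ J₁) ℝ)) (x : M)
    (X : J₀ ⊕ J₁ → SheafEnd E F S U) (X' : J₀ ⊕ J₁ → SheafEnd E F S U') : Prop :=
  ∃ (W : Opens M) (h : W ≤ U) (h' : W ≤ U'), x ∈ W ∧ ∃ u ∈ expGroup 𝔤 W,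
    (fun j => restrictEnd h' (X' j)) = tupleMul (fun j => restrictEnd h (X j)) u.1

variable {X : J₀ ⊕ J₁ → SheafEnd E F S U} {X' : J₀ ⊕ J₁ → SheafEnd E F S U'}
  {X'' : J₀ ⊕ J₁ → SheafEnd E F S U''}

theorem GaugeRelated.symm (h : GaugeRelated 𝔤 x X X') : GaugeRelated 𝔤 x X' X := by
  obtain ⟨W, h, h', hx, u, hu, e⟩ := h
  refine ⟨W, h', h, hx, u⁻¹, inv_mem hu, ?_⟩
  rw [e, tupleMul_tupleMul, Units.mul_inv, tupleMul_one]

theorem GaugeRelated.trans (h₁ : GaugeRelated 𝔤 x X X') (h₂ : GaugeRelated 𝔤 x X' X'') :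
    GaugeRelated 𝔤 x X X'' := by
  obtain ⟨W, h, h', hx, u, hu, e⟩ := h₁
  obtain ⟨W', k, k', hx', u', hu', e'⟩ := h₂
  have i : W ⊓ W' ≤ W := inf_le_left
  have i' : W ⊓ W' ≤ W' := inf_le_right
  refine ⟨W ⊓ W', i.trans h, i'.trans k', ⟨hx, hx'⟩, resUnits i u * resUnits i' u',
    mul_mem (resUnits_mem_expGroup i hu) (resUnits_mem_expGroup i' hu'), ?_⟩
  have e₁ : (fun j => restrictEnd (i.trans h') (X' j))
      = tupleMul (fun j => restrictEnd (i.trans h) (X j)) (resMatrix i u.1) :=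
    (congrArg (fun (Y : J₀ ⊕ J₁ → SheafEnd E F S W) j => restrictEnd i (Y j)) e).trans
      (restrictEnd_tupleMul i _ _)
  have e₂ : (fun j => restrictEnd (i'.trans k') (X'' j))
      = tupleMul (fun j => restrictEnd (i'.trans k) (X' j)) (resMatrix i' u'.1) :=
    (congrArg (fun (Y : J₀ ⊕ J₁ → SheafEnd E F S W') j => restrictEnd i' (Y j)) e').trans
      (restrictEnd_tupleMul i' _ _)
  rw [Units.val_mul, ← tupleMul_tupleMul, resUnits_val, resUnits_val, ← e₁]
  exact e₂

/-- A family of frame fields that differ locally by elements of `G` makes all open sets small. -/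
theorem isSmall_of_gaugeRelated {ℱ : ∀ U : Opens M, Set (J₀ ⊕ J₁ → SheafEnd E F S U)}
    (hind : ∀ X ∈ ℱ U, IsIndependent X)
    (hrel : ∀ X ∈ ℱ U, ∀ Y ∈ ℱ U, ∀ x ∈ U, GaugeRelated 𝔤 x X Y) : IsSmall 𝔤 ℱ U := by
  intro X hX Y hY
  have hres : ∀ T : J₀ ⊕ J₁ → SheafEnd E F S U, (fun j => restrictEnd le_rfl (T j)) = T :=
    fun T => rfl
  have hglue : ∀ X ∈ ℱ U, ∀ Y ∈ ℱ U, _ := fun X hX Y hY => (hind X hX).glue Y fun x hx => by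
    obtain ⟨W, h, _, hxW, u, -, e⟩ := hrel X hX Y hY x hx
    exact ⟨W, h, hxW, u.1, e⟩
  obtain ⟨Z, hZ, hZ'⟩ := hglue X hX Y hY
  obtain ⟨Z₁, hZ₁, -⟩ := hglue Y hY X hX
  have h1 : Z * Z₁ = 1 := hind X hX U le_rfl _ _ (by
    rw [hres, tupleMul_one, ← tupleMul_tupleMul, ← hZ, ← hZ₁])
  have h2 : Z₁ * Z = 1 := hind Y hY U le_rfl _ _ (by
    rw [hres, tupleMul_one, ← tupleMul_tupleMul, ← hZ₁, ← hZ])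
  refine ⟨⟨Z, Z₁, h1, h2⟩, ⟨fun x hx => ?_, hZ.symm⟩, fun u hu => Units.ext ?_⟩
  · obtain ⟨W, h, _, hxW, u, hu, e⟩ := hrel X hX Y hY x hx
    refine ⟨W, h, hxW, ?_⟩
    have h3 : resUnits h ⟨Z, Z₁, h1, h2⟩ = u := Units.ext (hZ' W h u.1 e)
    rwa [h3]
  · exact hind X hX U le_rfl _ _ (by rw [hres, hu.2]; exact hZ)

end GaugeRelated

theorem IsSpinMap.mono {E : Type*} [NormedAddCommGroup E] [NormedSpace ℝ E]
    {M : Type*} [TopologicalSpace M] [ChartedSpace E M] {k l n : ℕ} {Δ : CliffordModule k l n}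
    {U W : Opens M} {h : M → Matrix (Idx k l n) (Idx k l n) ℝ} (hh : IsSpinMap E Δ U h)
    (hW : W ≤ U) : IsSpinMap E Δ W h := by
  intro x hx
  obtain ⟨W', hxW', -, L, hL, e⟩ := hh x (hW hx)
  exact ⟨W' ⊓ W, ⟨hxW', hx⟩, inf_le_right, L,
    fun Y hY => ⟨fun i j => ((hL Y hY).1 i j).mono Set.inter_subset_left,
      fun y hy => (hL Y hY).2 y hy.1⟩, fun y hy => e y hy.1⟩

section SpinFrames

variable {E : Type*} [NormedAddCommGroup E] [NormedSpace ℝ E] [FiniteDimensional ℝ E]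
  {M : Type*} [TopologicalSpace M] [ChartedSpace E M] [IsManifold 𝓘(ℝ, E) ∞ M]
  {F : Type*} [NormedAddCommGroup F] [NormedSpace ℝ F]
  {S : M → Type*} [TopologicalSpace (TotalSpace F S)] [∀ x, AddCommGroup (S x)]
  [∀ x, Module ℝ (S x)] [∀ x, TopologicalSpace (S x)] [FiberBundle F S]
  [VectorBundle ℝ F S] [ContMDiffVectorBundle ∞ F S 𝓘(ℝ, E)]
  {k l n : ℕ} {g : PseudoMetric E M} {Δ : CliffordModule k l n} {b c : LocalTuple E k l n S}
  {P : SpinStructure F g Δ S} (G : LinearMap.BilinForm ℝ (Fin n → ℝ)) {U : Opens M} {x : M}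

namespace SpinStructure

theorem IsFrameField.gaugeRelated_of_relatedBy (hb : b ∈ P.spinFrames) (hc : c ∈ P.spinFrames)
    {X : Idx k l n → SheafEnd E F S b.dom} {X' : Idx k l n → SheafEnd E F S c.dom}
    (hX : P.IsFrameField b hb.1 X) (hX' : P.IsFrameField c hc.1 X')
    (hU : U ≤ b.dom ⊓ c.dom) {h : M → Matrix (Idx k l n) (Idx k l n) ℝ}
    (hh : IsSpinMap E Δ U h) (hbc : b.RelatedBy c h U) (hx : x ∈ U) :
    GaugeRelated (modelLie Δ G) x X X' := by
  obtain ⟨W, hxW, hW, u, hu, v, hv⟩ := hh.exists_expGroup (F := F) (S := S) G hx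
  refine ⟨W, hW.trans (hU.trans inf_le_left), hW.trans (hU.trans inf_le_right), hxW, u, hu,
    hX.eq_tupleMul hb hc hX' _ _ (hh.mono hW)
      (fun y hy => hbc y (hW hy)) hv⟩

/-- Any two spin frames are related, near a common point, by transition maps of the atlas and by the
spin transformations that relate them to the atlas. -/
theorem IsFrameField.gaugeRelated (hb : b ∈ P.spinFrames) (hc : c ∈ P.spinFrames)
    {X : Idx k l n → SheafEnd E F S b.dom} {X' : Idx k l n → SheafEnd E F S c.dom}
    (hX : P.IsFrameField b hb.1 X) (hX' : P.IsFrameField c hc.1 X')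
    (hxb : x ∈ b.dom) (hxc : x ∈ c.dom) : GaugeRelated (modelLie Δ G) x X X' := by
  obtain ⟨b', hb', W, hxW, hW, h, hh, hrel⟩ := hb.2 x hxb
  obtain ⟨c', hc', W', hxW', hW', h', hh', hrel'⟩ := hc.2 x hxc
  obtain ⟨k, hk, hrelk⟩ := P.transition b' hb' c' hc'
  have hb₁ := P.mem_spinFrames_of_mem_atlas hb'
  have hc₁ := P.mem_spinFrames_of_mem_atlas hc'
  obtain ⟨Y, hY⟩ := P.exists_isFrameField hb₁
  obtain ⟨Y', hY'⟩ := P.exists_isFrameField hc₁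
  refine (GaugeRelated.symm ?_).trans (GaugeRelated.trans (X' := Y') ?_ ?_) (X' := Y)
  · exact hY.gaugeRelated_of_relatedBy G hb₁ hb hX hW hh hrel hxW
  · exact hY.gaugeRelated_of_relatedBy G hb₁ hc₁ hY' le_rfl hk hrelk
      ⟨(hW hxW).1, (hW' hxW').1⟩
  · exact hY'.gaugeRelated_of_relatedBy G hc₁ hc hX' hW' hh' hrel' hxW'

theorem isIndependent_of_mem_sheafF {𝔤 : Submodule ℝ (Matrix (Idx k l n) (Idx k l n) ℝ)}
    {Y : Idx k l n → SheafEnd E F S U} (hY : Y ∈ P.sheafF 𝔤 U) : IsIndependent Y :=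
  IsIndependent.of_local fun x hx => by
    obtain ⟨c, hc, h, hxc, X, hX, u, -, e⟩ := hY x hx
    refine ⟨c.dom, h, hxc, ?_⟩
    rw [e]
    exact hX.isIndependent.tupleMul_units u

/-- All open sets are small: any two elements of `ℱ_G(U)` differ locally by elements of `G`,
which are unique and hence can be glued, because frame fields are linearly independent. -/
theorem isSmall (U : Opens M) : IsSmall (modelLie Δ G) (P.sheafF (modelLie Δ G)) U := by
  refine isSmall_of_gaugeRelated (fun Y hY => isIndependent_of_mem_sheafF hY)
    fun Y hY Y' hY' x hx => ?_
  obtain ⟨b, hb, h, hxb, X, hX, u, hu, e⟩ := hY x hx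
  obtain ⟨c, hc, h', hxc, X', hX', u', hu', e'⟩ := hY' x hx
  have h1 : GaugeRelated (modelLie Δ G) x X Y := ⟨b.dom, le_rfl, h, hxb, u, hu, e⟩
  have h2 : GaugeRelated (modelLie Δ G) x X' Y' := ⟨c.dom, le_rfl, h', hxc, u', hu', e'⟩
  exact h1.symm.trans ((hX.gaugeRelated G hb hc hX' hxb hxc).trans h2)

theorem IsFrameField.mem_sheafF {𝔤 : Submodule ℝ (Matrix (Idx k l n) (Idx k l n) ℝ)}
    (hc : c ∈ P.spinFrames) {X : Idx k l n → SheafEnd E F S c.dom}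
    (hX : P.IsFrameField c hc.1 X) : X ∈ P.sheafF 𝔤 c.dom :=
  fun _ hx => ⟨c, hc, le_rfl, hx, X, hX, 1, one_mem _, (tupleMul_one X).symm⟩

end SpinStructure

end SpinFrames

/-! ### The brackets of `X_s` with the vector fields of a frame field -/

namespace SuperAction

variable {R Λ : Type*} [Ring R] [Algebra ℝ R] [Ring Λ] [Algebra ℝ Λ] {A : SuperAction R Λ}
  {X Y : R}

theorem IsOdd.bracket_even (hX : A.IsOdd X) (hY : A.IsEven Y) : A.bracket X Y = X * Y - Y * X := by
  rw [hX.bracket_eq, hY.even_eq, hY.odd_eq, mul_zero, zero_mul, add_zero, zero_add]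

theorem IsOdd.bracket_odd (hX : A.IsOdd X) (hY : A.IsOdd Y) : A.bracket X Y = X * Y + Y * X := by
  rw [hX.bracket_eq, hY.even_eq, hY.odd_eq, mul_zero, zero_mul, sub_zero, add_zero]

end SuperAction

theorem leibniz_commutator {A : Type*} [Ring A] [Algebra ℝ A] (D Y p : A →ₗ[ℝ] A)
    (hD : ∀ a b, D (a * b) = D a * b + p a * D b) (hY : ∀ a b, Y (a * b) = Y a * b + a * Y b)
    (hp : ∀ a, Y (p a) = p (Y a)) (a b : A) :
    D (Y (a * b)) - Y (D (a * b))
      = (D (Y a) - Y (D a)) * b + p a * (D (Y b) - Y (D b)) := by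
  rw [hY, hD, map_add, map_add, hD, hD, hY, hY, hp, sub_mul, mul_sub]
  abel

section Bracket

variable {E : Type*} [NormedAddCommGroup E] [NormedSpace ℝ E]
  {M : Type*} [TopologicalSpace M] [ChartedSpace E M]
  {F : Type*} [NormedAddCommGroup F] [NormedSpace ℝ F]
  {S : M → Type*} [TopologicalSpace (TotalSpace F S)] [∀ x, AddCommGroup (S x)]
  [∀ x, Module ℝ (S x)] [∀ x, TopologicalSpace (S x)] [FiberBundle F S] {U : Opens M}

theorem IsOddDer.restrict {U' : Opens M} {D : SheafEnd E F S U} (hD : IsOddDer D) (h : U' ≤ U) :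
    IsOddDer (restrictEnd h D) :=
  ⟨congrArg (restrictEnd h) hD.1, fun W a b => hD.2 ⟨W.1, W.2.trans h⟩ a b⟩

theorem IsOddDer.isOdd {D : SheafEnd E F S U} (hD : IsOddDer D) :
    (sheafAction E F S U).IsOdd D := hD.1

theorem IsOddDer.superBracket_isEven {D Y : SheafEnd E F S U} (hD : IsOddDer D)
    (hY : (sheafAction E F S U).IsEven Y) : superBracket D Y = D * Y - Y * D :=
  hD.isOdd.bracket_even hY

theorem IsOddDer.superBracket_isOdd {D Y : SheafEnd E F S U} (hD : IsOddDer D)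
    (hY : (sheafAction E F S U).IsOdd Y) : superBracket D Y = D * Y + Y * D :=
  hD.isOdd.bracket_odd hY

/-- The bracket of an odd and an even derivation is an odd derivation. -/
theorem IsOddDer.bracket_isEvenDer {D Y : SheafEnd E F S U} (hD : IsOddDer D) (hY : IsEvenDer Y)
    (W : {W : Opens M // W ≤ U}) (a b : superFunctions E F S W.1) :
    (D * Y - Y * D).1 W (a * b)
      = (D * Y - Y * D).1 W a * b + parity E F S W.1 a * (D * Y - Y * D).1 W b :=
  leibniz_commutator (D.1 W) (Y.1 W) (parity E F S W.1) (hD.2 W) (hY.2 W)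
    (fun a => congrArg (fun T : SheafEnd E F S U => T.1 W a) hY.1) a b

/-- Interior multiplications supercommute. -/
theorem IsInterior.superBracket {η η' : Π x : M, Module.Dual ℝ (S x)} {D D' : SheafEnd E F S U}
    (hDer : IsOddDer D) (hD : IsInterior η D) (hD' : IsInterior η' D') : superBracket D D' = 0 := by
  rw [hDer.superBracket_isOdd hD'.isOdd]
  refine sheafEnd_ext fun W f x => ?_
  refine (congrArg₂ (· + ·) ((hD W (D'.1 W f) x).trans (congrArg _ (hD' W f x)))
    ((hD' W (D.1 W f) x).trans (congrArg _ (hD W f x)))).trans ?_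
  rw [CliffordAlgebra.contractLeft_comm]
  exact neg_add_cancel _

end Bracket

section SpinorField

variable {E : Type*} [NormedAddCommGroup E] [NormedSpace ℝ E] [FiniteDimensional ℝ E]
  {M : Type*} [TopologicalSpace M] [ChartedSpace E M] [IsManifold 𝓘(ℝ, E) ∞ M]
  {F : Type*} [NormedAddCommGroup F] [NormedSpace ℝ F]
  {S : M → Type*} [TopologicalSpace (TotalSpace F S)] [∀ x, AddCommGroup (S x)]
  [∀ x, Module ℝ (S x)] [∀ x, TopologicalSpace (S x)] [FiberBundle F S]
  {k l n : ℕ} {g : PseudoMetric E M} {Δ : CliffordModule k l n} {c : LocalTuple E k l n S}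
  {P : SpinStructure F g Δ S} {g₁ : FormField E F S} {s : Π x, S x}

namespace SpinStructure

/-- The matrix with the entries `-ε_i g₁(∇_{e_i} s, θ^r)` in its lower left block. -/
def nablaMatrix (P : SpinStructure F g Δ S) (g₁ : FormField E F S) (c : LocalTuple E k l n S)
    (s : Π x, S x) (y : M) : Matrix (Idx k l n) (Idx k l n) ℝ :=
  Matrix.fromBlocks 0 0
    (Matrix.of fun r i => -(sgn k l i * g₁.form y (P.nabla s y (c.e i y)) (c.θ r y))) 0

variable [VectorBundle ℝ F S] [ContMDiffVectorBundle ∞ F S 𝓘(ℝ, E)]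

theorem smoothOn_nabla (hc : c ∈ P.spinFrames) (hs : SmoothOn E F s ⊤) (i : EvenIdx k l) :
    SmoothOn E F (fun y => P.nabla s y (c.e i y)) c.dom := by
  have hs' : SmoothOn E F s c.dom := ContMDiffOn.mono hs (Set.subset_univ _)
  refine ContMDiffOn.congr (hc.1.smoothOn_nabla le_rfl (hc.1.smoothOn_e i) hs') fun y hy => ?_
  exact congrArg (TotalSpace.mk' F y) (P.nabla_eq hc hy (hs'.smoothAt hy) _)

theorem contMDiffOn_nablaMatrix (hc : c ∈ P.spinFrames) (hs : SmoothOn E F s ⊤)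
    (p q : Idx k l n) :
    ContMDiffOn 𝓘(ℝ, E) 𝓘(ℝ, ℝ) ∞ (fun y => P.nablaMatrix g₁ c s y p q) c.dom := by
  rcases p with p | r
  · rcases q with q | q <;> exact contMDiffOn_const
  · rcases q with i | q
    · exact (contMDiffOn_const.mul
        (g₁.smooth _ _ _ (smoothOn_nabla hc hs i) (hc.1.smoothOn_θ r))).neg
    · exact contMDiffOn_const

/-- `ι(c) N` for the matrix `N` with the entries `-ε_i g₁(∇_{e_i} s, θ^r)`. -/
theorem IsFrameField.isInterior_tupleMul (hc : c ∈ P.spinFrames) (hs : SmoothOn E F s ⊤)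
    {X : Idx k l n → SheafEnd E F S c.dom} (hX : P.IsFrameField c hc.1 X) :
    (∀ i, IsInterior (fun x => -(sgn k l i • g₁.form x (P.nabla s x (c.e i x))))
      (tupleMul X (scalarMatrix F S (P.nablaMatrix g₁ c s) (contMDiffOn_nablaMatrix hc hs))
        (Sum.inl i))) ∧
    ∀ j, tupleMul X (scalarMatrix F S (P.nablaMatrix g₁ c s) (contMDiffOn_nablaMatrix hc hs))
        (Sum.inr j) = 0 := by
  have hZ : ∀ (j : Idx k l n) (W : {W : Opens M // W ≤ c.dom}) (f : superFunctions E F S W.1)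
      (x : W.1), ((tupleMul X (scalarMatrix F S (P.nablaMatrix g₁ c s)
        (contMDiffOn_nablaMatrix hc hs)) j).1 W f).1 x
      = (∑ m, P.nablaMatrix g₁ c s x (Sum.inl m) j • ((X (Sum.inl m)).1 W f).1 x)
      + ∑ r, P.nablaMatrix g₁ c s x (Sum.inr r) j • CliffordAlgebra.contractLeft
          (hc.1.frame_θ.coeff r x) (f.1 x) := by
    intro j W f x
    refine (evalEnd_tupleMul (hX.isEven le_rfl) (hX.isOdd le_rfl) _ j W f x).trans ?_
    refine congrArg₂ _ (Finset.sum_congr rfl fun m _ => (Algebra.smul_def _ _).symm)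
      (Finset.sum_congr rfl fun r _ => ?_)
    refine (congrArg (· * _) (AlgHom.commutes _ _)).trans ((Algebra.smul_def _ _).symm.trans ?_)
    exact congrArg _ (hX.2 r W f x)
  refine ⟨fun i W f x => ?_, fun j => sheafEnd_ext fun W f x => (hZ _ W f x).trans ?_⟩
  · have hx := W.2 x.2
    have h1 : ∑ r, P.nablaMatrix g₁ c s x (Sum.inr r) (Sum.inl i) • hc.1.frame_θ.coeff r x
        = -(sgn k l i • g₁.form x (P.nabla s x (c.e i x))) := by
      refine (hc.1.frame_θ.toBasisAt hx).ext fun m => ?_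
      rw [hc.1.frame_θ.toBasisAt_coe]
      simp [nablaMatrix, hc.1.frame_θ.coeff_self hx]
    refine (hZ _ W f x).trans (Eq.trans ?_
      (congrArg (fun η : Module.Dual ℝ (S x) => CliffordAlgebra.contractLeft η (f.1 x)) h1))
    simp [nablaMatrix]
  · simp [nablaMatrix]

/-- `[X_s, r ∇_Y] = -r ι(g₁(∇_Y s, ·))`. -/
theorem IsCovariantDerivative.bracket_eq (hpar : P.IsParallel g₁) (hs : SmoothOn E F s ⊤)
    {U : Opens M} {D Y R : SheafEnd E F S U} (hD : IsOddDer D)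
    (hD' : IsInterior (fun x => g₁.form x (s x)) D) {r : ℝ} {v : Π x : M, TangentSpace 𝓘(ℝ, E) x}
    (hY : P.IsCovariantDerivative r v Y)
    (hR : IsInterior (fun x => -(r • g₁.form x (P.nabla s x (v x)))) R) :
    D * Y - Y * D = R := by
  refine eq_of_eq_on_generators (fun W => parity E F S W.1)
    (hD.bracket_isEvenDer hY.1) (fun W a b => superFunctions_ext fun x => ?_)
    (fun W f φ hφ hf x => ?_) (fun W f t ht hf x => ?_)
  · refine (hR W (a * b) x).trans ((contractLeft_mul _ _ _).trans ?_)
    exact (congrArg₂ (fun A A' => A * b.1 x + CliffordAlgebra.involute (a.1 x) * A') (hR W a x)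
      (hR W b x)).symm
  · have h1 : ∀ (x : M) (η : Module.Dual ℝ (S x)) (r : ℝ),
        CliffordAlgebra.contractLeft η (algebraMap ℝ (ExteriorAlgebra ℝ (S x)) r) = 0 :=
      fun x η r => CliffordAlgebra.contractLeft_algebraMap (0 : QuadraticForm ℝ (S x)) _ _
    have h2 : D.1 W f = 0 := superFunctions_ext fun y => by
      rw [hD' W f y, hf y, h1]
      rfl
    have h3 : (D.1 W (Y.1 W f)).1 x = 0 := by
      rw [hD' W _ x, (hY.2 W f).1 φ hφ hf, h1]
    have h4 : (R.1 W f).1 x = 0 := by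
      rw [hR W f x, hf, h1]
    refine Eq.trans (b := (D.1 W (Y.1 W f)).1 x - (Y.1 W (D.1 W f)).1 x) rfl ?_
    rw [h2, h3, h4, map_zero]
    exact sub_self _
  · have h1 : ∀ (x : M) (η : Module.Dual ℝ (S x)) (r : S x),
        CliffordAlgebra.contractLeft η (ExteriorAlgebra.ι ℝ r) = algebraMap ℝ _ (η r) :=
      fun x η r => CliffordAlgebra.contractLeft_ι (0 : QuadraticForm ℝ (S x)) _ _
    have h2 : ∀ y : W.1, (D.1 W f).1 y = algebraMap ℝ _ (g₁.form y (s y) (t y)) := fun y => by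
      rw [hD' W f y, hf y, h1]
    have hs' : SmoothOn E F s W.1 := ContMDiffOn.mono hs (Set.subset_univ _)
    have h3 : (D.1 W (Y.1 W f)).1 x = algebraMap ℝ _ (g₁.form x (s x) (r • P.nabla t x (v x))) := by
      rw [hD' W _ x, (hY.2 W f).2 t ht hf, h1]
    have h4 : (R.1 W f).1 x = algebraMap ℝ _ (-(r * g₁.form x (P.nabla s x (v x)) (t x))) := by
      rw [hR W f x, hf, h1]
      rfl
    have h5 : (Y.1 W (D.1 W f)).1 x = algebraMap ℝ _ (r * (g₁.form x (P.nabla s x (v x)) (t x)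
        + g₁.form x (s x) (P.nabla t x (v x)))) := by
      rw [(hY.2 W (D.1 W f)).1 _ (g₁.smooth _ _ _ hs' ht) h2, hpar _ _ _ hs' ht _ x.2]
    refine Eq.trans (b := (D.1 W (Y.1 W f)).1 x - (Y.1 W (D.1 W f)).1 x) rfl ?_
    rw [h3, h4, h5, ← map_sub, map_smul, smul_eq_mul]
    congr 1
    ring

/-- `[X_s, ι(e^i)] = -ε_i ι(g₁(∇_{e_i} s, ·))` and `[X_s, ι(θ_j)] = 0`. -/
theorem superBracket_spinorField (hc : c ∈ P.spinFrames) (hpar : P.IsParallel g₁)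
    (hs : SmoothOn E F s ⊤) {X : Idx k l n → SheafEnd E F S c.dom}
    (hX : P.IsFrameField c hc.1 X) :
    (fun j => superBracket (restrictEnd (le_top : c.dom ≤ ⊤) (spinorField g₁ s hs :)) (X j))
      = tupleMul X (scalarMatrix F S (P.nablaMatrix g₁ c s) (contMDiffOn_nablaMatrix hc hs)) := by
  have hD := (spinorField_isOddDer g₁ s hs).restrict (le_top : c.dom ≤ ⊤)
  have hD' : IsInterior (fun x => g₁.form x (s x))
    (restrictEnd (le_top : c.dom ≤ ⊤) (spinorField g₁ s hs :)) := fun W f x => rfl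
  obtain ⟨h₀, h₁⟩ := hX.isInterior_tupleMul (g₁ := g₁) hc hs
  funext j
  rcases j with i | j
  · exact (hD.superBracket_isEven (hX.1 i).1.1).trans
      ((hX.1 i).bracket_eq hpar hs hD hD' (h₀ i))
  · exact (hD'.superBracket hD (hX.2 j)).trans (h₁ j).symm

end SpinStructure

end SpinorField

/-! ### Killing vector fields and twistor spinors -/

/-- A real matrix that belongs to `𝔤 ⊗ Λ` belongs to `𝔤`. -/
theorem mem_of_realMatrix_mem {V : Type*} [AddCommGroup V] [Module ℝ V] {J₀ J₁ : Type*}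
    [Fintype J₀] [Fintype J₁] [DecidableEq J₀] [DecidableEq J₁]
    {𝔤 : Submodule ℝ (Matrix (J₀ ⊕ J₁) (J₀ ⊕ J₁) ℝ)} {N : Matrix (J₀ ⊕ J₁) (J₀ ⊕ J₁) ℝ}
    (hN : (realMatrix N : Matrix _ _ (ExteriorAlgebra ℝ V)) ∈ tensorSpace (extParity V) 𝔤) :
    N ∈ 𝔤 := by
  obtain ⟨p, hp, hp'⟩ := exists_projection 𝔤
  have h1 := (mem_tensorSpace_iff _ extParity_extParity hp hp' _).1 hN
  rw [realMatrix_eq_superScale, superExtend_superScale _ extParity_extParity,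
    ← realMatrix_eq_superScale, ← realMatrix_eq_superScale] at h1
  have h2 : p N = N := by
    ext i j
    exact (algebraMap ℝ (ExteriorAlgebra ℝ V)).injective (congrFun (congrFun h1 i) j)
  rw [← h2]
  exact hp N

section VectorFields

variable {E : Type*} [NormedAddCommGroup E] [NormedSpace ℝ E]
  {M : Type*} [TopologicalSpace M] [ChartedSpace E M]
  {F : Type*} [NormedAddCommGroup F] [NormedSpace ℝ F]
  {S : M → Type*} [TopologicalSpace (TotalSpace F S)] [∀ x, AddCommGroup (S x)]
  [∀ x, Module ℝ (S x)] [∀ x, TopologicalSpace (S x)] [FiberBundle F S] {U : Opens M}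

theorem isEvenDer_zero : IsEvenDer (0 : SheafEnd E F S U) := by
  refine ⟨(zero_mul (parityEnd E F S U)).trans (mul_zero (parityEnd E F S U)).symm,
    fun W a b => superFunctions_ext fun x => ?_⟩
  refine Eq.trans (b := (0 : ExteriorAlgebra ℝ (S x))) rfl (Eq.symm ?_)
  refine Eq.trans (b := (0 : ExteriorAlgebra ℝ (S x)) * b.1 x + a.1 x * 0) rfl ?_
  rw [zero_mul, mul_zero, add_zero]

theorem IsOddDer.isVectorField {X : SheafEnd E F S U} (hX : IsOddDer X) : IsVectorField X :=
  ⟨0, X, isEvenDer_zero, hX, (zero_add X).symm⟩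

theorem tupleMul_tupleMul_inv {J : Type*} [Fintype J] [DecidableEq J] (X : J → SheafEnd E F S U)
    (u : (Matrix J J (superFunctions E F S U))ˣ) (Z : Matrix J J (superFunctions E F S U)) :
    tupleMul (tupleMul X u.1) (u⁻¹.1 * Z) = tupleMul X Z := by
  rw [tupleMul_tupleMul, Units.mul_inv_cancel_left]

/-- If `[D, Y] = Y N`, then `[D, Y u] = Y (N u + D u)`. -/
theorem IsOddDer.superBracket_tupleMul_of_eq {J₀ J₁ : Type*} [Fintype J₀] [Fintype J₁]
    [DecidableEq J₀] [DecidableEq J₁] {D : SheafEnd E F S U} (hD : IsOddDer D)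
    {Y : J₀ ⊕ J₁ → SheafEnd E F S U} (hY₀ : ∀ i, (sheafAction E F S U).IsEven (Y (Sum.inl i)))
    (hY₁ : ∀ i, (sheafAction E F S U).IsOdd (Y (Sum.inr i)))
    {N : Matrix (J₀ ⊕ J₁) (J₀ ⊕ J₁) (superFunctions E F S U)}
    (hN : (fun i => superBracket D (Y i)) = tupleMul Y N)
    (u : Matrix (J₀ ⊕ J₁) (J₀ ⊕ J₁) (superFunctions E F S U)) :
    (fun j => superBracket D (tupleMul Y u j))
      = tupleMul Y (N * u + matrixDerivation (D.1 ⟨U, le_rfl⟩) u) :=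
  (hD.superBracket_tupleMul hY₀ hY₁ u).trans
    ((congrArg (fun T => tupleMul T u + tupleMul Y (matrixDerivation (D.1 ⟨U, le_rfl⟩) u)) hN).trans
      ((congrArg (fun T => T + tupleMul Y (matrixDerivation (D.1 ⟨U, le_rfl⟩) u))
        (tupleMul_tupleMul Y N u)).trans (tupleMul_add Y _ _).symm))

end VectorFields

section Main

variable {E : Type*} [NormedAddCommGroup E] [NormedSpace ℝ E] [FiniteDimensional ℝ E]
  {M : Type*} [TopologicalSpace M] [ChartedSpace E M] [IsManifold 𝓘(ℝ, E) ∞ M]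
  {F : Type*} [NormedAddCommGroup F] [NormedSpace ℝ F]
  {S : M → Type*} [TopologicalSpace (TotalSpace F S)] [∀ x, AddCommGroup (S x)]
  [∀ x, Module ℝ (S x)] [∀ x, TopologicalSpace (S x)] [FiberBundle F S]
  {k l n : ℕ} {g : PseudoMetric E M} {Δ : CliffordModule k l n} {c : LocalTuple E k l n S}
  {P : SpinStructure F g Δ S} {g₁ : FormField E F S} {s : Π x, S x}

namespace SpinStructure

theorem finiteDimensional (P : SpinStructure F g Δ S) (x : M) : FiniteDimensional ℝ (S x) := by
  obtain ⟨b, hb, hx⟩ := P.cover x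
  exact Module.Finite.of_basis ((P.adapted b hb).frame_θ.toBasisAt hx)

theorem lieAlg_eq [ConnectedSpace M] [VectorBundle ℝ F S] [ContMDiffVectorBundle ∞ F S 𝓘(ℝ, E)]
    (hc : c ∈ P.spinFrames) {p : M} (hp : p ∈ c.dom) :
    P.lieAlg g₁ c hc p hp = modelLie Δ (formInBasis (g₁.form p) (hc.1.frame_θ.toBasisAt hp)) :=
  (hc.1.isAdaptedBasis hp).coadjointMatrices_eq (g.nondeg p) (g₁.form p)

/-- The entries `-ε_i g₁(∇_{e_i} s, θ^r)` and `-ε_i g₁(ρ(e_i) q, θ^r)` agree for all `r` if and only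
if `∇_{e_i} s = ρ(e_i) q`, since `g₁` is non-degenerate. -/
theorem nablaMatrix_apply_eq_iff (hc : c.IsAdapted F g Δ P.ρ) {x : M} (hx : x ∈ c.dom)
    (hnondeg : (g₁.form x).Nondegenerate) (q : S x) (i : EvenIdx k l) :
    P.nabla s x (c.e i x) = P.ρ x (c.e i x) q ↔
      ∀ r, P.nablaMatrix g₁ c s x (Sum.inr r) (Sum.inl i)
        = spinorMatrix Δ (formInBasis (g₁.form x) (hc.frame_θ.toBasisAt hx))
          ((hc.frame_θ.toBasisAt hx).equivFun q) (Sum.inr r) (Sum.inl i) := by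
  have hb := hc.isAdaptedBasis hx
  have h1 : ∀ r, spinorMatrix Δ (formInBasis (g₁.form x) (hc.frame_θ.toBasisAt hx))
      ((hc.frame_θ.toBasisAt hx).equivFun q) (Sum.inr r) (Sum.inl i)
      = -(sgn k l i * g₁.form x (P.ρ x (c.e i x) q) (c.θ r x)) := fun r => by
    have h4 : (hc.frame_e.toBasisAt hx).equivFun.symm (Pi.single i 1) = c.e i x := by
      rw [← basis_equivFun_self (hc.frame_e.toBasisAt hx), LinearEquiv.symm_apply_apply,
        hc.frame_e.toBasisAt_coe]
    have h2 := hb.clifford_eq (Pi.single i 1) ((hc.frame_θ.toBasisAt hx).equivFun q)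
    rw [LinearEquiv.symm_apply_apply, h4] at h2
    have h3 : (hc.frame_θ.toBasisAt hx).equivFun.symm (Pi.single r 1) = c.θ r x := by
      rw [← basis_equivFun_self (hc.frame_θ.toBasisAt hx), LinearEquiv.symm_apply_apply,
        hc.frame_θ.toBasisAt_coe]
    rw [h2, ← h3]
    rfl
  simp only [h1]
  refine ⟨fun h r => by rw [← h]; rfl, fun h => ?_⟩
  rw [← sub_eq_zero]
  refine hnondeg.1 _ fun t => ?_
  have h2 : g₁.form x (P.nabla s x (c.e i x) - P.ρ x (c.e i x) q) = 0 := by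
    refine (hc.frame_θ.toBasisAt hx).ext fun r => ?_
    rw [hc.frame_θ.toBasisAt_coe, map_sub]
    exact sub_eq_zero.2 (mul_left_cancel₀ (sgn_ne_zero i) (neg_injective (h r)))
  rw [h2]
  rfl

/-- The matrix of `[X_s, ι(c)]` at `x` belongs to `𝔤` if and only if `s` satisfies the twistor
equation at `x`: its only block is the lower left one, and such elements of `𝔤` are given by
spinors `q`. -/
theorem nablaMatrix_mem_iff (hc : c.IsAdapted F g Δ P.ρ) {x : M} (hx : x ∈ c.dom)
    (hnondeg : (g₁.form x).Nondegenerate) :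
    P.nablaMatrix g₁ c s x ∈ modelLie Δ (formInBasis (g₁.form x) (hc.frame_θ.toBasisAt hx)) ↔
      ∃ q, ∀ i, P.nabla s x (c.e i x) = P.ρ x (c.e i x) q := by
  constructor
  · rintro ⟨A, -, q, e⟩
    refine ⟨(hc.frame_θ.toBasisAt hx).equivFun.symm q, fun i =>
      (nablaMatrix_apply_eq_iff hc hx hnondeg _ i).2 fun r => ?_⟩
    have h1 := congrFun (congrFun e (Sum.inr r)) (Sum.inl i)
    rw [LinearEquiv.apply_symm_apply]
    exact h1.trans (zero_add _)
  · rintro ⟨q, hq⟩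
    have h1 : P.nablaMatrix g₁ c s x
        = spinorMatrix Δ (formInBasis (g₁.form x) (hc.frame_θ.toBasisAt hx))
          ((hc.frame_θ.toBasisAt hx).equivFun q) := by
      funext p p'
      rcases p with p | r
      · rcases p' with p' | p' <;> rfl
      · rcases p' with i | p'
        · exact (nablaMatrix_apply_eq_iff hc hx hnondeg q i).1 (hq i) r
        · rfl
    rw [h1]
    exact spinorMatrix_mem _

/-- The formula `(∑ t^j M_rj θ^r)` for Clifford multiplication in a spin frame shows that it
preserves smoothness. -/
theorem smoothOn_clifford [VectorBundle ℝ F S] [ContMDiffVectorBundle ∞ F S 𝓘(ℝ, E)]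
    (hc : c.IsAdapted F g Δ P.ρ) {t : Π x, S x}
    (ht : SmoothOn E F t c.dom) (i : EvenIdx k l) :
    SmoothOn E F (fun y => P.ρ y (c.e i y) (t y)) c.dom := by
  have h1 : SmoothOn E F (fun y => ∑ j, hc.frame_θ.coeff j y (t y) •
      ∑ r, LinearMap.toMatrix' (Δ.ρ (Pi.single i 1)) r j • c.θ r y) c.dom :=
    ContMDiffOn.sum_section fun j _ => ContMDiffOn.smul_section
      (fun y hy => (hc.frame_θ.contMDiffAt_coeff c.dom.2 hy (ht.smoothAt hy) j).contMDiffWithinAt)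
      (ContMDiffOn.sum_section fun r _ =>
        ContMDiffOn.smul_section contMDiffOn_const (hc.smoothOn_θ r))
  refine ContMDiffOn.congr h1 fun y hy => congrArg (TotalSpace.mk' F y) ?_
  refine (congrArg (P.ρ y (c.e i y)) (hc.frame_θ.coeff_sum_eq t hy)).trans ?_
  simp only [map_sum, map_smul, hc.clifford y hy]

variable [VectorBundle ℝ F S] [ContMDiffVectorBundle ∞ F S 𝓘(ℝ, E)]

theorem nabla_eq_of_frame (hc : c ∈ P.spinFrames) {x : M} (hx : x ∈ c.dom)
    (hs : SmoothAt E F s x) {q : S x} (hq : ∀ i, P.nabla s x (c.e i x) = P.ρ x (c.e i x) q)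
    (v : TangentSpace 𝓘(ℝ, E) x) : P.nabla s x v = P.ρ x v q := by
  obtain ⟨N, hN⟩ := P.exists_nabla_eq hc hx hs
  have h1 : N = (P.ρ x).flip q := by
    refine (hc.1.frame_e.toBasisAt hx).ext fun i => ?_
    rw [hc.1.frame_e.toBasisAt_coe, ← hN, hq]
    rfl
  rw [hN, h1]
  rfl

/-- A section that satisfies the twistor equation at each point is a twistor spinor: if
`⟨e, e⟩ = ε`, the section `s'` is `-ε ρ(e) ∇_e s`, which is smooth. -/
theorem isTwistorSpinor_of_pointwise (hs : SmoothOn E F s ⊤)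
    (h : ∀ x, ∃ q, ∀ v : TangentSpace 𝓘(ℝ, E) x, P.nabla s x v = P.ρ x v q) :
    P.IsTwistorSpinor s := by
  rcases isEmpty_or_nonempty (EvenIdx k l) with hkl | ⟨⟨i⟩⟩
  · -- the tangent spaces are trivial
    refine ⟨0, contMDiff_zeroSection ℝ S |>.contMDiffOn, fun x v => ?_⟩
    obtain ⟨q, hq⟩ := h x
    obtain ⟨b, hb, hx⟩ := P.cover x
    have h1 : v = 0 := ((P.adapted b hb).frame_e.toBasisAt hx).ext_elem fun i => hkl.elim i
    rw [hq, h1, map_zero]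
    rfl
  · choose q hq using h
    refine ⟨q, fun x _ => ?_, fun x v => hq x v⟩
    obtain ⟨b, hb, hx⟩ := P.cover x
    have hb' := P.mem_spinFrames_of_mem_atlas hb
    have h1 : SmoothOn E F (fun y => (-sgn k l i) • P.ρ y (b.e i y) (P.nabla s y (b.e i y)))
        b.dom :=
      ContMDiffOn.smul_section contMDiffOn_const
        (smoothOn_clifford hb'.1 (smoothOn_nabla hb' hs i) i)
    have h2 : SmoothOn E F q b.dom := ContMDiffOn.congr h1 fun y hy =>
      congrArg (TotalSpace.mk' F y) <| by
        have h3 := LinearMap.congr_fun (P.isClifford y (b.e i y)) (q y)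
        rw [hb'.1.orthonormal y hy, if_pos rfl] at h3
        beta_reduce
        rw [hq, ← Module.End.mul_apply, h3]
        simp [smul_smul, sgn_mul_self]
    exact (h2.smoothAt hx).contMDiffWithinAt

variable {G : LinearMap.BilinForm ℝ (Fin n → ℝ)}

/-- It suffices to evaluate the Killing condition on the frame fields `ι(b)`. -/
theorem isTwistorSpinor_of_isKillingVectorField (hnondeg : ∀ x, (g₁.form x).Nondegenerate)
    (hpar : P.IsParallel g₁) (hs : SmoothOn E F s ⊤)
    (hG : ∀ b (hb : b ∈ P.spinFrames) x (hx : x ∈ b.dom),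
      formInBasis (g₁.form x) (hb.1.frame_θ.toBasisAt hx) = G)
    (h : P.IsKillingVectorField (modelLie Δ G) (spinorField g₁ s hs :)) : P.IsTwistorSpinor s := by
  refine isTwistorSpinor_of_pointwise hs fun x => ?_
  obtain ⟨b, hb, hx⟩ := P.cover x
  have hb' := P.mem_spinFrames_of_mem_atlas hb
  obtain ⟨X, hX⟩ := P.exists_isFrameField hb'
  obtain ⟨Z, hZ, e⟩ := h.2 b.dom (P.isSmall G b.dom) X (hX.mem_sheafF hb')
  have h1 := hX.isIndependent b.dom le_rfl _ _
    (e.symm.trans (superBracket_spinorField hb' hpar hs hX))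
  rw [h1] at hZ
  have h2 : P.nablaMatrix g₁ b s x ∈ modelLie Δ G :=
    mem_of_realMatrix_mem (mem_tensorSub_iff.1 hZ ⟨x, hx⟩)
  rw [← hG b hb' x hx, nablaMatrix_mem_iff hb'.1 hx (hnondeg x)] at h2
  obtain ⟨q, hq⟩ := h2
  exact ⟨q, nabla_eq_of_frame hb' hx (hs.smoothAt trivial) hq⟩

/-- If `L` is the Lie derivative along `X_s`, then
`L(ι(c) u) = ι(c) (N u + L u) = ι(c) u (u⁻¹ N u + u⁻¹ L u)`. -/
theorem exists_superBracket_eq (hpar : P.IsParallel g₁) (hs : SmoothOn E F s ⊤)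
    (hGsuit : IsSuitable Δ.ρ G) (hc : c ∈ P.spinFrames)
    (hN : ∀ x ∈ c.dom, P.nablaMatrix g₁ c s x ∈ modelLie Δ G)
    {X : Idx k l n → SheafEnd E F S c.dom} (hX : P.IsFrameField c hc.1 X)
    {u : (Matrix (Idx k l n) (Idx k l n) (superFunctions E F S c.dom))ˣ}
    (hu : u ∈ expGroup (modelLie Δ G) c.dom) :
    ∃ Z ∈ tensorSub (modelLie Δ G) c.dom,
      (fun j => superBracket (restrictEnd (le_top : c.dom ≤ ⊤) (spinorField g₁ s hs :))
        (tupleMul X u.1 j)) = tupleMul (tupleMul X u.1) Z := by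
  have hfin := P.finiteDimensional
  let D : SheafEnd E F S c.dom := restrictEnd (le_top : c.dom ≤ ⊤) (spinorField g₁ s hs :)
  have hD : IsOddDer D := (spinorField_isOddDer g₁ s hs).restrict le_top
  let N := scalarMatrix F S (P.nablaMatrix g₁ c s) (contMDiffOn_nablaMatrix hc hs)
  refine ⟨u⁻¹.1 * (N * u.1 + matrixDerivation (D.1 ⟨c.dom, le_rfl⟩) u.1),
    mem_tensorSub_iff.2 fun x => ?_, ?_⟩
  · have hgauge := isGauge_of_mem_expGroup (isTriangularSuperLie_modelLie hGsuit) x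
      (X := CliffordAlgebra.contractLeft (g₁.form x (s x))) (contractLeft_mul _)
      (contractLeft_involute _) hu
    have h1 : evalMatrix x (matrixDerivation (D.1 ⟨c.dom, le_rfl⟩) u.1)
        = matrixDerivation (CliffordAlgebra.contractLeft (g₁.form x (s x)))
          (evalMatrix x u.1) := by
      ext (i | i) j <;> rfl
    rw [mul_add, map_add, ← mul_assoc, map_mul, map_mul, map_mul, h1]
    exact add_mem (hgauge.conj _ (realMatrix_mem (hN x x.2))) hgauge.deriv
  · exact (hD.superBracket_tupleMul_of_eq (fun i => hX.isEven le_rfl i)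
      (fun i => hX.isOdd le_rfl i) (superBracket_spinorField hc hpar hs hX) u.1).trans
      (tupleMul_tupleMul_inv X u _).symm

/-- The matrices that express `[X_s, Y]` locally in terms of `Y` can be glued, as `Y` is linearly
independent. -/
theorem isKillingVectorField_of_isTwistorSpinor (hnondeg : ∀ x, (g₁.form x).Nondegenerate)
    (hpar : P.IsParallel g₁) (hs : SmoothOn E F s ⊤) (hGsuit : IsSuitable Δ.ρ G)
    (hG : ∀ b (hb : b ∈ P.spinFrames) x (hx : x ∈ b.dom),
      formInBasis (g₁.form x) (hb.1.frame_θ.toBasisAt hx) = G)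
    (h : P.IsTwistorSpinor s) :
    P.IsKillingVectorField (modelLie Δ G) (spinorField g₁ s hs :) := by
  obtain ⟨s', -, hs'⟩ := h
  refine ⟨(spinorField_isOddDer g₁ s hs).isVectorField, fun U _ Y hY => ?_⟩
  have hloc : ∀ x ∈ U, ∃ (W : Opens M) (hW : W ≤ U), x ∈ W ∧ ∃ Z ∈ tensorSub (modelLie Δ G) W,
      (fun j => restrictEnd hW (superBracket (restrictEnd (le_top : U ≤ ⊤) (spinorField g₁ s hs :))
        (Y j))) = tupleMul (fun j => restrictEnd hW (Y j)) Z := by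
    intro x hx
    obtain ⟨c, hc, h, hxc, X, hX, u, hu, e⟩ := hY x hx
    obtain ⟨Z, hZ, e'⟩ := exists_superBracket_eq hpar hs hGsuit hc (fun y hy => by
      rw [← hG c hc y hy, nablaMatrix_mem_iff hc.1 hy (hnondeg y)]
      exact ⟨s' y, fun i => hs' y _⟩) hX hu
    refine ⟨c.dom, h, hxc, Z, hZ, ?_⟩
    rw [← e] at e'
    exact e'
  obtain ⟨Z, hZ, hZ'⟩ := (isIndependent_of_mem_sheafF hY).glue _ fun x hx => by
    obtain ⟨W, hW, hxW, Z, -, e⟩ := hloc x hx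
    exact ⟨W, hW, hxW, Z, e⟩
  refine ⟨Z, mem_tensorSub_iff.2 fun x => ?_, hZ⟩
  obtain ⟨W, hW, hxW, Z₁, hZ₁, e⟩ := hloc x x.2
  have h1 := mem_tensorSub_iff.1 hZ₁ ⟨x, hxW⟩
  rw [← hZ' W hW Z₁ e, evalMatrix_resMatrix] at h1
  exact h1

theorem IsKillingSpinor.isTwistorSpinor (hs : SmoothOn E F s ⊤) (h : P.IsKillingSpinor s) :
    P.IsTwistorSpinor s := by
  obtain ⟨r, hr⟩ := h
  exact ⟨fun x => r • s x, ContMDiffOn.smul_section contMDiffOn_const hs, hr⟩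

end SpinStructure

end Main

end SpinSuper

end

theorem theorem2 {k l n : ℕ}
    {E : Type*} [NormedAddCommGroup E] [NormedSpace ℝ E] [FiniteDimensional ℝ E]
    {M : Type*} [TopologicalSpace M] [ChartedSpace E M] [IsManifold 𝓘(ℝ, E) ∞ M]
    [T2Space M] [SecondCountableTopology M] [ConnectedSpace M]
    {F : Type*} [NormedAddCommGroup F] [NormedSpace ℝ F]
    {S : M → Type*} [TopologicalSpace (TotalSpace F S)] [∀ x, AddCommGroup (S x)]
    [∀ x, Module ℝ (S x)] [∀ x, TopologicalSpace (S x)] [FiberBundle F S] [VectorBundle ℝ F S]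
    [ContMDiffVectorBundle ∞ F S 𝓘(ℝ, E)]
    (g₀ : SpinSuper.PseudoMetric E M) (Δ : SpinSuper.CliffordModule k l n)
    (P : SpinSuper.SpinStructure F g₀ Δ S)
    (g₁ : SpinSuper.FormField E F S) (hnondeg : ∀ x, (g₁.form x).Nondegenerate)
    (hsuit : ∀ x, SpinSuper.IsSuitable (P.ρ x) (g₁.form x)) (hpar : P.IsParallel g₁)
    (c : SpinSuper.LocalTuple E k l n S) (hc : c ∈ P.spinFrames) (p : M) (hp : p ∈ c.dom)
    (s : Π x, S x) (hs : SpinSuper.SmoothOn E F s ⊤) :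
    (P.IsKillingVectorField (P.lieAlg g₁ c hc p hp) (SpinSuper.spinorField g₁ s hs) ↔
      P.IsTwistorSpinor s) ∧
    (P.IsKillingSpinor s →
      P.IsKillingVectorField (P.lieAlg g₁ c hc p hp) (SpinSuper.spinorField g₁ s hs)) := by
  have hG : ∀ b (hb : b ∈ P.spinFrames) x (hx : x ∈ b.dom),
      SpinSuper.formInBasis (g₁.form x) (hb.1.frame_θ.toBasisAt hx)
        = SpinSuper.formInBasis (g₁.form p) (hc.1.frame_θ.toBasisAt hp) :=
    fun b hb x hx => SpinSuper.SpinStructure.formInBasis_eq hnondeg hsuit hpar hc hb hp hx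
  have hGsuit := (hc.1.isAdaptedBasis hp).isSuitable_formInBasis (hsuit p)
  have key : P.IsTwistorSpinor s →
      P.IsKillingVectorField (P.lieAlg g₁ c hc p hp) (SpinSuper.spinorField g₁ s hs) := by
    rw [SpinSuper.SpinStructure.lieAlg_eq hc hp]
    exact SpinSuper.SpinStructure.isKillingVectorField_of_isTwistorSpinor hnondeg hpar hs hGsuit hG
  refine ⟨⟨fun h => ?_, key⟩, fun h => key (h.isTwistorSpinor hs)⟩
  rw [SpinSuper.SpinStructure.lieAlg_eq hc hp] at h
  exact SpinSuper.SpinStructure.isTwistorSpinor_of_isKillingVectorField hnondeg hpar hs hG h
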